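/- Let $n\ge 2$, $k\in\mathbb Z$, $\omega=e^{2\pi i/n}$, and let $L''\subset\mathbb C^n$ be the set of $z=(z_1,\dots,z_n)$ with $z_a-z_b\notin\mathbb Z$ for $a\ne b$. **Equations.** For $z\in L''$ let $H_z=\mathbb C[x]/\langle\prod_{a=1}^n(x-z_a)\rangle$ be the equivariant cohomology algebra of $P^{n-1}$ at $z$, with basis $g_i=\prod_{a>i}(x-z_a)$, $i=1,\dots,n$; define $\prod_{j=1}^{n-1}(u-y_j)\in H_z[u]$ by $(u-x)\prod_j(u-y_j)=\prod_a(u-z_a)$. Let $x*_{p,z}$ be the $\mathbb C$-linear operator on $H_z$ with $x*x^j=x^{j+1}$ for $j\le n-2$ and $x*x^{n-1}=p+x^n$. Let $R_{ab}(u)$ be given by $g_b\mapsto g_a$, $g_a\mapsto g_b+ug_a$, $g_i\mapsto g_i$ for $i\neq a,b$, let $E_ig_j=\delta_{ij}g_i$, and $$K_i=R_{i,i-1}(z_i-z_{i-1}-1)\cdots R_{i,1}(z_i-z_1-1)\,p^{-E_i}\,R_{i,n}(z_i-z_n)\cdots R_{i,i+1}(z_i-z_{i+1}).$$ Consider functions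 $I(p,z)\in H_z$ whose coordinates in $g_1,\dots,g_n$ are holomorphic in $(\log p,z)\in\mathbb C\times L''$ (differentiation in $p$ and shifts of $z$ are taken in these coordinates), and the joint system $$p\,\frac{dI}{dp}=x*_{p,z}I,\qquad I(p,z_1,\dots,z_i-1,\dots,z_n)=-K_i(p,z)\,I(p,z),\quad i=1,\dots,n.$$ A basis of solutions is a basis of the module of solutions over the ring of functions of $z$ holomorphic on $L''$ and $1$-periodic in each $z_i$, which is moreover linearly independent over $\mathbb C$ (as functions of $\log p$) for every fixed $z\in L''$. Let $$\Psi_J=-\sum_{r\ge0}\operatorname{Res}_{t=z_J+r}\,(e^{\pi i(2-n)}p)^t\prod_{a=1}^n\Gamma(z_a-t)\prod_{j=1}^{n-1}(y_j-t),\qquad \Psi^m=\sum_{J=1}^n e^{2\pi i(m-1)z_J}\,\Psi_J\quad(m\in\mathbb Z).$$ **Stokes bases.** Put $p=s^n$, $s=re^{-2\pi i\phi}$, $\log p=n(\log r-2\pi i\phi)$. A basis of solutions is a Stokes basis on an interval $(\alpha,\beta)$, with indices $k+1,\dots,k+n$, if it can be ordered as $I_{k+1},\dots,I_{k+n}$ so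 that for every $m\in\{k+1,\dots,k+n\}$, every $\phi\in(\alpha,\beta)$ with $n\phi\notin\mathbb Z$ and every $z\in L''$, $$I_m(s^n,z)=\frac{(2\pi)^{(n-1)/2}}{\sqrt n}\,e^{n\omega^ms}\,(-\omega^ms)^{\sum_az_a+(1-n)/2}\prod_{j=1}^{n-1}(y_j-\omega^ms)\,\bigl(1+O(1/s)\bigr)\qquad(r\to\infty),$$ where $O(1/s)$ is $H_z$-valued and $\arg(-\omega^ms)=2\pi m/n-\pi-2\pi\phi$. **Exceptional bases.** Let $s_j,m_j\in\mathbb C[Z_1^{\pm1},\dots,Z_n^{\pm1}]$ be the elementary and the complete homogeneous symmetric functions of $Z_1,\dots,Z_n$. Let $M_n$ be the free $\mathbb C[Z^{\pm1}]$-module with basis $e_1,\dots,e_n$, with the form $A$ that is $Z\mapsto Z^{-1}$-semilinear in the first and linear in the second argument and has $A(e_i,e_j)=m_{j-i}(Z)$ for $i\le j$, $A(e_i,e_j)=0$ for $i>j$. A basis $\{v_1,\dots,v_n\}$ of $M_n$ is exceptional if $A(v_i,v_i)=1$ and $A(v_i,v_j)=0$ for $i>j$. The braid group generators $\tau_1,\dots,\tau_{n-1}$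 act by $\tau_i\{v_1,\dots,v_n\}=\{\dots,v_{i-1},\,v_{i+1}-A(v_i,v_{i+1})v_i,\,v_i,\,v_{i+2},\dots\}$. Put $\gamma_n=\beta_\ell\beta_{\ell-2}\cdots\beta_2$ with $\beta_q=\tau_q\tau_{q+1}\cdots\tau_{n-1}$ and $\ell$ the even one of $n-1,n-2$ (so $\gamma_2=1$), and $\delta_{n,\rm odd}=\prod_{i\text{ odd},\,i<n}\tau_i$. Identify $M_n$ with $\mathbb C[X^{\pm1},Z^{\pm1}]/\langle\prod_a(X-Z_a)\rangle$ by $e_j\mapsto X^{j-1}$, and map it to solutions by $\sum_mf_m(Z)e_m\mapsto\sum_{m=1}^nf_m(e^{2\pi iz_1},\dots,e^{2\pi iz_n})\Psi^m$. Let $Q_k=\{v_1,\dots,v_n\}$ with $v_j=X^{k+j-1}$. With $v_m(l)=\sum_{i=0}^{m-l}(-1)^is_i(Z)v_{m-i}$, let $Q_k'$ be the first $n$ terms of $v_1,v_n(2),v_2,v_{n-1}(3),v_3,\dots$ and $Q_k''$ the first $n$ terms of $v_n(1),v_1,v_{n-1}(2),v_2,\dots$. **Theorem.** The basis $Q_k$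 is mapped to $\{\Psi^{k+1},\dots,\Psi^{k+n}\}$ (for $z\in L''$); $Q_k,Q_k',Q_k''$ are exceptional bases, $\gamma_nQ_k=Q_k'$ and $\delta_{n,\rm odd}Q_k'=Q_k''$. Moreover, for all real $a$ and $\varepsilon>0$ such that neither $(a,a+\varepsilon)$ nor $(a-\tfrac12-\varepsilon,a-\tfrac12)$ contains a point $r/2n$ with $r\in\mathbb Z$: 1. if $a\in\bigl(\tfrac{2k+1}{2n},\tfrac{k+1}n\bigr)$, then the image of $Q_k'$ is a Stokes basis on $(a-\tfrac12-\varepsilon,a+\varepsilon)$ with indices $k+1,\dots,k+n$; 2. if $a\in\bigl(\tfrac kn,\tfrac{2k+1}{2n}\bigr)$, then the image of $Q_k''$ is a Stokes basis on $(a-\tfrac12-\varepsilon,a+\varepsilon)$ with indices $k+1,\dots,k+n$. -/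

import Mathlib

open Filter Topology Asymptotics Polynomial

namespace EquivQDE

/-! ### The equivariant cohomology algebra of projective space at a parameter `z`

A parameter is `z : Fin n → ℂ`; the indices `0, …, n - 1` of `Fin n` stand for `1, …, n`. -/

/-- The relation `∏ₐ (x - zₐ)`. -/
noncomputable def relPoly {n : ℕ} (z : Fin n → ℂ) : ℂ[X] := ∏ a, (X - C (z a))

theorem relPoly_monic {n : ℕ} (z : Fin n → ℂ) : (relPoly z).Monic :=
  monic_prod_of_monic _ _ fun a _ => monic_X_sub_C (z a)

theorem relPoly_natDegree {n : ℕ} (z : Fin n → ℂ) : (relPoly z).natDegree = n := by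
  rw [relPoly, natDegree_prod_of_monic _ _ fun a _ => monic_X_sub_C (z a)]
  simp

/-- The equivariant cohomology algebra `ℂ[x, z] / ∏ₐ (x - zₐ)` specialized at the value `z` of the
equivariant parameters. -/
abbrev HT {n : ℕ} (z : Fin n → ℂ) : Type := AdjoinRoot (relPoly z)

/-- The generator `x`, the first Chern class of the tautological line bundle. -/
noncomputable def xi {n : ℕ} (z : Fin n → ℂ) : HT z := AdjoinRoot.root (relPoly z)

/-- `g_i = ∏_{a > i} (x - zₐ)`; in particular the last one is `1`. -/
noncomputable def gElem {n : ℕ} (z : Fin n → ℂ) (i : Fin n) : HT z :=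
  ∏ a ∈ Finset.Ioi i, (xi z - algebraMap ℂ (HT z) (z a))

theorem xi_mul_gElem_mem {n : ℕ} (z : Fin n → ℂ) (i : Fin n) :
    xi z * gElem z i ∈ Submodule.span ℂ (Set.range (gElem z)) := by
  have h1 : xi z * gElem z i = z i • gElem z i +
      ∏ a ∈ Finset.Ici i, (xi z - algebraMap ℂ (HT z) (z a)) := by
    have h : Finset.Ici i = insert i (Finset.Ioi i) := by
      ext a; simp [le_iff_eq_or_lt]
    rw [h, Finset.prod_insert (by simp), Algebra.smul_def]
    change _ = _ + (xi z - _) * gElem z i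
    ring
  rw [h1]
  refine add_mem (Submodule.smul_mem _ _ (Submodule.subset_span ⟨i, rfl⟩)) ?_
  by_cases hi : i.val = 0
  · have h : Finset.Ici i = Finset.univ := by
      ext a
      simp [Fin.le_def, hi]
    have h0 : ∏ a ∈ Finset.Ici i, (xi z - algebraMap ℂ (HT z) (z a)) = 0 := by
      rw [h]
      have h2 : AdjoinRoot.mk (relPoly z) (∏ a, (X - C (z a))) = 0 := AdjoinRoot.mk_self
      rw [map_prod] at h2
      simpa [xi, AdjoinRoot.algebraMap_eq] using h2
    rw [h0]
    exact zero_mem _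
  · have hlt : i.val - 1 < n := by omega
    have h : Finset.Ici i = Finset.Ioi (⟨i.val - 1, hlt⟩ : Fin n) := by
      ext a
      simp only [Finset.mem_Ici, Finset.mem_Ioi, Fin.le_def, Fin.lt_def]
      omega
    rw [h]
    exact Submodule.subset_span ⟨⟨i.val - 1, hlt⟩, rfl⟩

theorem top_le_span_gElem {n : ℕ} (z : Fin n → ℂ) :
    ⊤ ≤ Submodule.span ℂ (Set.range (gElem z)) := by
  rcases Nat.eq_zero_or_pos n with rfl | hn
  · have h : (1 : HT z) = 0 := by
      have h2 : AdjoinRoot.mk (relPoly z) (∏ a, (X - C (z a))) = 0 := AdjoinRoot.mk_self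
      rwa [Finset.univ_eq_empty, Finset.prod_empty, map_one] at h2
    intro v _
    rw [← mul_one v, h, mul_zero]
    exact zero_mem _
  · have hone : (1 : HT z) ∈ Submodule.span ℂ (Set.range (gElem z)) := by
      refine Submodule.subset_span ⟨⟨n - 1, by omega⟩, ?_⟩
      have h : Finset.Ioi (⟨n - 1, by omega⟩ : Fin n) = ∅ := by
        ext a
        simp only [Finset.mem_Ioi, Fin.lt_def, Finset.notMem_empty, iff_false]
        omega
      rw [gElem, h, Finset.prod_empty]
    have hmul : ∀ v ∈ Submodule.span ℂ (Set.range (gElem z)),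
        xi z * v ∈ Submodule.span ℂ (Set.range (gElem z)) := by
      intro v hv
      induction hv using Submodule.span_induction with
      | mem v hv => obtain ⟨i, rfl⟩ := hv; exact xi_mul_gElem_mem z i
      | zero => rw [mul_zero]; exact zero_mem _
      | add v w _ _ h1 h2 => rw [mul_add]; exact add_mem h1 h2
      | smul c v _ h1 => rw [mul_smul_comm]; exact Submodule.smul_mem _ _ h1
    have hpow : ∀ j : ℕ, xi z ^ j ∈ Submodule.span ℂ (Set.range (gElem z)) := by
      intro j
      induction j with
      | zero => rw [pow_zero]; exact hone
      | succ j ih => rw [pow_succ']; exact hmul _ ih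
    intro v _
    obtain ⟨f, rfl⟩ := AdjoinRoot.mk_surjective v
    have hf : AdjoinRoot.mk (relPoly z) f = f.sum fun j c => c • xi z ^ j := by
      conv_lhs => rw [← AdjoinRoot.aeval_eq]
      rw [aeval_eq_sum_range, Polynomial.sum_over_range _ (by simp)]
      rfl
    rw [hf, Polynomial.sum]
    exact sum_mem fun j _ => Submodule.smul_mem _ _ (hpow j)

/-- The basis `g_1, …, g_n` of the cohomology algebra. -/
noncomputable def gBasis {n : ℕ} (z : Fin n → ℂ) : Module.Basis (Fin n) ℂ (HT z) :=
  basisOfTopLeSpanOfCardEqFinrank (gElem z) (top_le_span_gElem z) (by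
    rw [(AdjoinRoot.powerBasis' (relPoly_monic z)).finrank, AdjoinRoot.powerBasis'_dim,
      relPoly_natDegree, Fintype.card_fin])

/-- The coordinates of a cohomology class in the basis `g_1, …, g_n`. -/
noncomputable def coord {n : ℕ} (z : Fin n → ℂ) (v : HT z) (i : Fin n) : ℂ :=
  (gBasis z).equivFun v i

/-- The quantum multiplication `x *_{p,z}`: in the basis `1, x, …, x^{n-1}` it is
`x * x^j = x^{j+1}` for `j < n - 1` and `x * x^{n-1} = p + x^n`, that is,
`x * f = x f + p · (coefficient of x^{n-1} in f)`. -/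
noncomputable def quantumMul {n : ℕ} (p : ℂ) (z : Fin n → ℂ) : HT z →ₗ[ℂ] HT z :=
  LinearMap.mulLeft ℂ (xi z) +
    ((Polynomial.lcoeff ℂ (n - 1)).comp
      (AdjoinRoot.modByMonicHom (relPoly_monic z))).smulRight (algebraMap ℂ (HT z) p)

/-! ### The equivariant quantum differential equation and the qKZ difference equations -/

/-- The R-matrix `R_{ab}(u)`: `g_b ↦ g_a`, `g_a ↦ g_b + u g_a`, `g_i ↦ g_i` otherwise. -/
noncomputable def rMatrix {n : ℕ} (z : Fin n → ℂ) (a b : Fin n) (u : ℂ) : Module.End ℂ (HT z) :=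
  (gBasis z).constr ℂ fun i =>
    if i = b then gElem z a else if i = a then gElem z b + u • gElem z a else gElem z i

/-- `p^{-E_i}`, where `E_i g_j = δ_{ij} g_i`. -/
noncomputable def pPowNegE {n : ℕ} (p : ℂ) (z : Fin n → ℂ) (i : Fin n) : Module.End ℂ (HT z) :=
  (gBasis z).constr ℂ fun j => if j = i then p⁻¹ • gElem z j else gElem z j

/-- The qKZ operator
`K_i = R_{i,i-1}(z_i-z_{i-1}-1) ⋯ R_{i,1}(z_i-z_1-1) p^{-E_i} R_{i,n}(z_i-z_n) ⋯ R_{i,i+1}(z_i-z_{i+1})`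
(a product in the ring of endomorphisms). -/
noncomputable def qkzOp {n : ℕ} (p : ℂ) (z : Fin n → ℂ) (i : Fin n) : Module.End ℂ (HT z) :=
  ((((List.finRange n).filter (· < i)).reverse.map fun b => rMatrix z i b (z i - z b - 1)).prod) *
    pPowNegE p z i *
    ((((List.finRange n).filter (i < ·)).reverse.map fun b => rMatrix z i b (z i - z b)).prod)

/-- The complement of the hyperplanes `zₐ - z_b = m`, `a ≠ b`, `m ∈ ℤ`. -/
def generic (n : ℕ) : Set (Fin n → ℂ) := {z | ∀ a b, a ≠ b → ∀ m : ℤ, z a - z b ≠ m}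

/-- Functions of `(p, z)` with values in the cohomology algebra. The variable `p ≠ 0` together with a
choice of its argument is written as `p = exp τ`, with `τ = log p ∈ ℂ`; thus fixing the argument of
`p` and analytic continuation in `p` both refer to functions of `τ`. -/
abbrev Fam (n : ℕ) : Type := ℂ → (z : Fin n → ℂ) → HT z

/-- Solutions of the joint system: functions holomorphic in `(log p, z)` for generic `z` such that
`p dI/dp = x *_{p,z} I` (here `p d/dp = d/dτ`) and `I(p, …, z_i - 1, …) = -K_i I(p, z)`; both
derivatives in `p` and shifts of `z` are taken in the coordinates with respect to `g_1, …, g_n`.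

The sign in the difference equation is the one for which the hypergeometric functions `PsiJ` below are
solutions: e.g. for `n = 2` one has `PsiJ = (-∫Φ) g_1 + (∫(z_1-t)Φ) g_2`, and replacing `z_1` by
`z_1 - 1` turns the second coordinate into `∫Φ`, while the second coordinate of `K_1 PsiJ` is
`-∫Φ`. -/
structure IsSolution {n : ℕ} (I : Fam n) : Prop where
  holomorphic : ∀ i : Fin n,
    DifferentiableOn ℂ (fun q : ℂ × (Fin n → ℂ) => coord q.2 (I q.1 q.2) i)
      (Set.univ ×ˢ generic n)
  qde : ∀ τ : ℂ, ∀ z ∈ generic n, ∀ i : Fin n,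
    HasDerivAt (fun τ' => coord z (I τ' z) i) (coord z (quantumMul (Complex.exp τ) z (I τ z)) i) τ
  qkz : ∀ τ : ℂ, ∀ z ∈ generic n, ∀ i j : Fin n,
    coord (z - Pi.single i 1) (I τ (z - Pi.single i 1)) j =
      -coord z (qkzOp (Complex.exp τ) z i (I τ z)) j

/-- The scalar ring over which the solutions form a module: holomorphic functions of generic `z`,
1-periodic in each `z_i`. -/
structure IsPeriodicScalar {n : ℕ} (c : (Fin n → ℂ) → ℂ) : Prop where
  holomorphic : DifferentiableOn ℂ c (generic n)
  periodic : ∀ z ∈ generic n, ∀ i : Fin n, c (z + Pi.single i 1) = c z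

/-- A basis of the module of solutions. The independence is required at every generic `z`, which is
independence over arbitrary functions of `z` that do not depend on `p`. -/
structure IsSolutionBasis {n : ℕ} (I : Fin n → Fam n) : Prop where
  isSolution : ∀ j, IsSolution (I j)
  generates : ∀ F : Fam n, IsSolution F → ∃ c : Fin n → (Fin n → ℂ) → ℂ,
    (∀ j, IsPeriodicScalar (c j)) ∧ ∀ τ, ∀ z ∈ generic n, F τ z = ∑ j, c j z • I j τ z
  independent : ∀ z ∈ generic n, LinearIndependent ℂ fun j => fun τ : ℂ => I j τ z

/-! ### The q-hypergeometric solutions -/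

/-- The master function `Φ(t, p, z) = (e^{πi(2-n)} p)^t ∏ₐ Γ(zₐ - t)`, with `p = exp τ`. -/
noncomputable def masterFun {n : ℕ} (t τ : ℂ) (z : Fin n → ℂ) : ℂ :=
  Complex.exp ((Real.pi * Complex.I * (2 - n) + τ) * t) * ∏ a, Complex.Gamma (z a - t)

/-- The polynomial `∏_j (u - y_j)` in a variable `u`, where `y_1, …, y_{n-1}` are the Chern roots of
the quotient bundle. It is determined by `(u - x) ∏_j (u - y_j) = ∏ₐ (u - zₐ)`. -/
noncomputable def yPoly {n : ℕ} (z : Fin n → ℂ) : (HT z)[X] :=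
  (relPoly z).map (algebraMap ℂ (HT z)) /ₘ (X - C (xi z))

/-- The class `∏_{j=1}^{n-1} (y_j - t)`. -/
noncomputable def weight {n : ℕ} (t : ℂ) (z : Fin n → ℂ) : HT z :=
  (-1) ^ (n - 1) * (yPoly z).eval (algebraMap ℂ (HT z) t)

/-- The residue of `f` at an isolated singularity `c`. -/
noncomputable def residue (f : ℂ → ℂ) (c : ℂ) : ℂ :=
  limUnder (𝓝[>] (0 : ℝ)) fun ρ =>
    (2 * Real.pi * Complex.I : ℂ)⁻¹ * circleIntegral f c ρ

/-- The Jackson integrals `Ψ_J = -∑_{r ≥ 0} Res_{t = z_J + r} Φ(t, p, z) ∏_j (y_j - t)`. -/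
noncomputable def PsiJ {n : ℕ} (J : Fin n) : Fam n := fun τ z =>
  (gBasis z).equivFun.symm fun i =>
    -∑' r : ℕ, residue (fun t => masterFun t τ z * coord z (weight t z) i) (z J + r)

/-- `Ψ^m`, the solution corresponding to the Laurent polynomial `X^{m-1}`:
`Ψ^m = ∑_J (e^{2πi z_J})^{m-1} Ψ_J`. -/
noncomputable def Psi {n : ℕ} (m : ℤ) : Fam n := fun τ z =>
  ∑ J, Complex.exp (2 * Real.pi * Complex.I * z J) ^ (m - 1) • PsiJ J τ z

/-! ### K-theory, the sesquilinear form, exceptional bases and the braid group action -/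

/-- Laurent polynomials `ℂ[Z_1^{±1}, …, Z_n^{±1}]`. -/
abbrev Laurent (n : ℕ) : Type := AddMonoidAlgebra ℂ (Fin n → ℤ)

/-- The variable `Zₐ`. -/
noncomputable def Zvar {n : ℕ} (a : Fin n) : Laurent n :=
  AddMonoidAlgebra.single (Pi.single a 1) 1

/-- The elementary symmetric function `s_k(Z)`. -/
noncomputable def sSym (n k : ℕ) : Laurent n := MvPolynomial.aeval Zvar (MvPolynomial.esymm (Fin n) ℂ k)

/-- The complete homogeneous symmetric function `m_k(Z)`. -/
noncomputable def mSym (n k : ℕ) : Laurent n := MvPolynomial.aeval Zvar (MvPolynomial.hsymm (Fin n) ℂ k)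

/-- The involution `f(Z) ↦ f(Z^{-1})`. -/
noncomputable def bar {n : ℕ} : Laurent n →ₐ[ℂ] Laurent n :=
  AddMonoidAlgebra.mapDomainAlgHom ℂ ℂ (negAddMonoidHom : (Fin n → ℤ) →+ (Fin n → ℤ))

/-- The free module `M_n` with basis `e_1, …, e_n`. It is identified with the equivariant K-theory
algebra `ℂ[X^{±1}, Z^{±1}] / ∏ₐ (X - Zₐ)` by `e_j ↦ X^{j-1}`. -/
abbrev M (n : ℕ) : Type := Fin n → Laurent n

/-- The sesquilinear form `A` on `M_n`: `A(e_i, e_j) = m_{j-i}(Z)` for `i ≤ j` and `0` for `i > j`. -/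
noncomputable def formA {n : ℕ} (v w : M n) : Laurent n :=
  ∑ i, ∑ j, bar (v i) * w j * (if i ≤ j then mSym n (j.val - i.val) else 0)

/-- Exceptional bases of `M_n`. -/
structure IsExceptional {n : ℕ} (Q : Fin n → M n) : Prop where
  linearIndependent : LinearIndependent (Laurent n) Q
  span_eq_top : Submodule.span (Laurent n) (Set.range Q) = ⊤
  form_self : ∀ i, formA (Q i) (Q i) = 1
  form_eq_zero : ∀ i j, j < i → formA (Q i) (Q j) = 0

/-- The action of the braid group generator `τ_i`, `1 ≤ i ≤ n - 1`:
`{v_1, …, v_n} ↦ {…, v_{i-1}, v_{i+1} - A(v_i, v_{i+1}) v_i, v_i, v_{i+2}, …}`. -/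
noncomputable def tauAct {n : ℕ} (i : ℕ) (Q : Fin n → M n) : Fin n → M n :=
  if h : 1 ≤ i ∧ i < n then
    Function.update
      (Function.update Q ⟨i, h.2⟩ (Q ⟨i - 1, by omega⟩)) ⟨i - 1, by omega⟩
      (Q ⟨i, h.2⟩ - formA (Q ⟨i - 1, by omega⟩) (Q ⟨i, h.2⟩) • Q ⟨i - 1, by omega⟩)
  else Q

/-- The action of the braid `τ_{i_1} τ_{i_2} ⋯ τ_{i_l}`, given by the word `[i_1, …, i_l]`; the
rightmost letter acts first. -/
noncomputable def braidAct {n : ℕ} (w : List ℕ) (Q : Fin n → M n) : Fin n → M n :=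
  w.foldr tauAct Q

/-- The braid `γ_n = β_ℓ β_{ℓ-2} ⋯ β_4 β_2`, where `β_k = τ_k τ_{k+1} ⋯ τ_{n-1}` and `ℓ` is the even
one of `n - 1` and `n - 2`. -/
def gammaWord (n : ℕ) : List ℕ :=
  (List.range ((n - 1) / 2)).reverse.flatMap fun q => List.Ico (2 * (q + 1)) n

/-- The braid `δ_{n,odd} = τ_1 τ_3 τ_5 ⋯`, the product of all `τ_i` with `i` odd, `i < n`. -/
def deltaOddWord (n : ℕ) : List ℕ := (List.range (n / 2)).map fun q => 2 * q + 1

/-- The `m`-th vector `v_m`, `1 ≤ m ≤ n`, of `Q = {v_1, …, v_n}`. -/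
noncomputable def nth {n : ℕ} (Q : Fin n → M n) (m : ℕ) : M n :=
  if h : 1 ≤ m ∧ m ≤ n then Q ⟨m - 1, by omega⟩ else 0

/-- `v_m(l) = v_m - s_1(Z) v_{m-1} + ⋯ + (-1)^{m-l} s_{m-l}(Z) v_l` for `l ≤ m`. -/
noncomputable def vml {n : ℕ} (Q : Fin n → M n) (m l : ℕ) : M n :=
  ∑ i ∈ Finset.range (m - l + 1), ((-1) ^ i * sSym n i) • nth Q (m - i)

/-- The basis `Q' = {v_1, v_n(2), v_2, v_{n-1}(3), v_3, …}`: `v_q` is at position `2q - 1` and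
`v_{n+1-q}(q+1)` at position `2q`. (The element of `Fin n` with value `j` is position `j + 1`.) For `n`
even the last vector is `v_{n/2+1}(n/2+1) = v_{n/2+1}`. -/
noncomputable def primeBasis {n : ℕ} (Q : Fin n → M n) : Fin n → M n := fun j =>
  if Even j.val then nth Q (j.val / 2 + 1)
  else vml Q (n + 1 - (j.val + 1) / 2) ((j.val + 1) / 2 + 1)

/-- The basis `Q'' = {v_n(1), v_1, v_{n-1}(2), v_2, …}`: `v_{n+1-q}(q)` is at position `2q - 1` and
`v_q` at position `2q`. For `n` odd the last vector is
`v_{(n+1)/2}((n+1)/2) = v_{(n+1)/2}`. -/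
noncomputable def doublePrimeBasis {n : ℕ} (Q : Fin n → M n) : Fin n → M n := fun j =>
  if Even j.val then vml Q (n - j.val / 2) (j.val / 2 + 1) else nth Q ((j.val + 1) / 2)

/-- The matrix of multiplication by `X` in the basis `1, X, …, X^{n-1}` of the K-theory algebra. -/
noncomputable def companion (n : ℕ) : Matrix (Fin n) (Fin n) (Laurent n) := fun i j =>
  if j.val + 1 = n then (-1) ^ (n - i.val + 1) * sSym n (n - i.val)
  else if i.val = j.val + 1 then 1 else 0

/-- The element of `M_n` that corresponds to `X^m`, `m ∈ ℤ`. -/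
noncomputable def powX (n : ℕ) (m : ℤ) : M n :=
  (companion n ^ m).mulVec fun i => if i.val = 0 then 1 else 0

/-- The basis of `M_n` corresponding to `Q_k = {Ψ^{k+1}, …, Ψ^{k+n}}`, that is, to
`X^k, …, X^{k+n-1}`. -/
noncomputable def basisQ (n : ℕ) (k : ℤ) : Fin n → M n := fun j => powX n (k + j.val)

/-- Evaluation of a Laurent polynomial at `Zₐ = e^{2πi zₐ}`. -/
noncomputable def evalZ {n : ℕ} (z : Fin n → ℂ) : Laurent n →ₐ[ℂ] ℂ :=
  AddMonoidAlgebra.lift ℂ ℂ (Fin n → ℤ)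
    { toFun := fun α => ∏ a, Complex.exp (2 * Real.pi * Complex.I * z a) ^ (α.toAdd a)
      map_one' := by simp
      map_mul' := fun α β => by
        simp [zpow_add₀ (Complex.exp_ne_zero _), Finset.prod_mul_distrib] }

/-- The identification of `M_n` with the module of solutions, `∑ Q_m(Z) e_m ↦
∑ Q_m(e^{2πi z}) Ψ^m`. -/
noncomputable def toSolution {n : ℕ} (v : M n) : Fam n := fun τ z =>
  ∑ j : Fin n, evalZ z (v j) • Psi (j.val + 1) τ z

/-! ### Stokes bases -/

/-- The number `s = r e^{-2πiφ}`. -/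
noncomputable def sPoint (r φ : ℝ) : ℂ := r * Complex.exp (-2 * Real.pi * Complex.I * φ)

/-- The logarithm of `p = s^n` for `s = r e^{-2πiφ}`: `log p = n (log r - 2πiφ)`. -/
noncomputable def logP (n : ℕ) (r φ : ℝ) : ℂ := n * (Real.log r - 2 * Real.pi * Complex.I * φ)

/-- `ω^m s`, where `ω = e^{2πi/n}`. -/
noncomputable def omegaS (n : ℕ) (m : ℤ) (r φ : ℝ) : ℂ :=
  Complex.exp (2 * Real.pi * Complex.I / n) ^ m * sPoint r φ

/-- `log(-ω^m s)`, with `arg(-ω^m s) = 2πm/n - π - 2πφ`. -/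
noncomputable def logNegOmegaS (n : ℕ) (m : ℤ) (r φ : ℝ) : ℂ :=
  Real.log r + (2 * Real.pi * m / n - Real.pi - 2 * Real.pi * φ) * Complex.I

/-- The asymptotic expansion, as `r → ∞` with `φ` and `z` fixed,
`I(s^n, y, z) = ((2π)^{(n-1)/2} / √n) e^{n ω^m s} (-ω^m s)^{∑ zₐ + (1-n)/2}
  ∏_j (y_j - ω^m s) (1 + O(1/s))`,
where `O(1/s)` is a function with values in the cohomology algebra. -/
def HasStokesAsymptotics {n : ℕ} (I : Fam n) (m : ℤ) (φ : ℝ) (z : Fin n → ℂ) : Prop :=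
  ∃ E : ℝ → HT z, (∀ i, (fun r => coord z (E r) i) =O[atTop] fun r : ℝ => r⁻¹) ∧
    ∀ᶠ r : ℝ in atTop, I (logP n r φ) z =
      ((((2 * Real.pi) ^ (((n : ℝ) - 1) / 2) / Real.sqrt n : ℝ) : ℂ) *
        Complex.exp (n * omegaS n m r φ) *
        Complex.exp ((∑ a, z a + (1 - n) / 2) * logNegOmegaS n m r φ)) •
      (weight (omegaS n m r φ) z * (1 + E r))

/-- `φ` is resonant if `φ = l/n` for an integer `l`. -/
def Resonant (n : ℕ) (φ : ℝ) : Prop := ∃ l : ℤ, φ = l / n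

/-- Stokes bases on the interval `(a, b)`: bases of solutions that, after a reordering, have the
prescribed asymptotics at every non-resonant `φ ∈ (a, b)`. The exponent `m` runs over the
representatives `k + 1, …, k + n` of the residues modulo `n`. The number `ω^m` depends only on the
residue; the choice of the representative fixes the branch of `arg(-ω^m s) = 2πm/n - π - 2πφ`, one and
the same over the whole interval. -/
structure IsStokesBasis (n : ℕ) (k : ℤ) (I : Fin n → Fam n) (a b : ℝ) : Prop where
  isSolutionBasis : IsSolutionBasis I
  asymptotics : ∃ σ : Equiv.Perm (Fin n), ∀ j : Fin n, ∀ φ ∈ Set.Ioo a b, ¬ Resonant n φ →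
    ∀ z ∈ generic n, HasStokesAsymptotics (I (σ j)) (k + (j.val + 1)) φ z

/-- `ε` is small: `(a, a + ε)` and `(a - 1/2 - ε, a - 1/2)` contain no point `r/(2n)`, `r ∈ ℤ`. -/
def IsSmall (n : ℕ) (a ε : ℝ) : Prop :=
  ∀ r : ℤ, ((r : ℝ) / (2 * n)) ∉ Set.Ioo a (a + ε) ∧
    ((r : ℝ) / (2 * n)) ∉ Set.Ioo (a - 1 / 2 - ε) (a - 1 / 2)

end EquivQDE

/-! The algebraic half rests on the fact that multiplication by X preserves the form A. In the basis
of powers X acts by the companion matrix of `∏(X - Z_a)`, and invariance is the relation `∑ (-1)^i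
s_i m_{N-i} = 0` together with the symmetry of the `s_i` under inversion of the variables
(`formA_companion`). Hence `Q_k` has the same Gram matrix as the standard basis for every k. The
relation also shows that mutating `v_m(l+1)` across `v_l` gives `v_m(l)` (`vml_mutation`). So each
factor of `γ_n` carries one vector from the end of the list leftwards while lowering its second
index, and `δ_{n,odd}` performs one more such step in disjoint pairs. Mutations preserve
exceptionality.

For the equations, the coordinates of `Ψ_J` in the basis g are, up to sign, a single scalar residue
series `fser` evaluated at parameters some of which are raised by 1: inserting a factor `z_a - t`
into the series is the same as raising `z_a`. The differential equation is then a recursion in the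
number of raised parameters. The difference equations reduce, term by term, to an identity between
R-matrices and weight functions. The `Ψ_J` are eigenvectors of the monodromy in `log p` with the
distinct eigenvalues `e^{2πi z_J}`, hence independent; uniqueness for the linear ODE makes them a
basis of solutions over periodic functions. A basis of `M_n` maps to another one because the
transition matrix is a Vandermonde matrix times the value of an invertible matrix.

For the asymptotics, `∑_J fser` is a Mellin-Barnes integral (`integral_barnes`). Its product of
Gamma functions is expanded in the functions `Γ(nw + κ - j)`, whose own Barnes integrals are pure
exponentials; this gives an expansion to every order for `|arg s| < π/2`
(`exists_sector_expansion`). On the lines `arg s = ±π` the crude bound of the residue series is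
already polynomial after division by the leading term. Since the order in the inner sector is
arbitrary, Phragmén-Lindelöf interpolation yields the leading asymptotics for all `|arg s| < π`
(`isBigO_fnorm_sub`).

Finally, for the solution `Ψ^m` put `y = m - nφ`; then `arg(-ω^m s) = 2πy/n - π`, so `Ψ^m` is under
control for `0 < y < n`, and its exponential is the smaller the closer y is to `n/2`. In `v_m(l)`
the correction terms sit at `y - 1, y - 2, …` and are negligible when `y < n`. When `n < y` the
linear relation between n + 1 consecutive rays replaces the sum by the complementary one, whose
dominant term sits at `y - n`. The ranges of φ where this works contain the stated intervals. -/

namespace EquivQDE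

/-! ### Symmetric functions: elementary against complete homogeneous -/

section Newton

-- A product of geometric series sums over exponent vectors of total degree N, and `Sym.equivNatSum`
-- matches these with the multisets of size N that index `hsymm`.
open MvPolynomial in
theorem coeff_prod_mk_pow {σ : Type*} [Fintype σ] [DecidableEq σ] (N : ℕ) :
    PowerSeries.coeff N (∏ a : σ, PowerSeries.mk fun k => (X a : MvPolynomial σ ℂ) ^ k) =
      hsymm σ ℂ N := by
  classical
  rw [PowerSeries.coeff_prod, hsymm]
  simp only [PowerSeries.coeff_mk]
  symm
  refine Finset.sum_bij' (fun s _ => (Sym.equivNatSum σ N s : σ →₀ ℕ))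
    (fun l hl => (Sym.equivNatSum σ N).symm ⟨l, by
      simpa [Finset.mem_finsuppAntidiag, Finsupp.sum_fintype] using hl⟩) ?_ ?_ ?_ ?_ ?_
  · intro s _
    have := (Sym.equivNatSum σ N s).2
    rw [Finsupp.sum_fintype _ _ (by simp)] at this
    exact Finset.mem_finsuppAntidiag.2 ⟨this, Finset.subset_univ _⟩
  · intro s _; exact Finset.mem_univ _
  · intro s _; simp
  · intro l hl; simp
  · intro s _
    simp only [Sym.coe_equivNatSum_apply_apply]
    exact Finset.prod_multiset_map_count _ _ |>.trans
      (Finset.prod_subset (Finset.subset_univ _) fun a _ ha => by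
        rw [Multiset.count_eq_zero_of_notMem (by simpa using ha), pow_zero])

-- The generating series `∏ 1/(1 - X_a T)` and `∏ (1 - X_a T)` are inverse to each other; this is
-- the vanishing of the coefficient of `T^N` in their product.
open MvPolynomial in
theorem sum_esymm_mul_hsymm {σ : Type*} [Fintype σ] [DecidableEq σ] {N : ℕ} (hN : N ≠ 0) :
    ∑ i ∈ Finset.range (N + 1), (-1) ^ i * esymm σ ℂ i * hsymm σ ℂ (N - i) = 0 := by
  classical
  have h1 : ∀ a : σ, (PowerSeries.mk fun k => (X a : MvPolynomial σ ℂ) ^ k) *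
      (1 - PowerSeries.C (X a) * PowerSeries.X) = 1 := by
    intro a
    ext d
    rw [mul_sub, mul_one, ← mul_assoc, map_sub]
    cases d with
    | zero => simp
    | succ d => rw [PowerSeries.coeff_succ_mul_X, PowerSeries.coeff_mul_C]; simp [pow_succ]
  have h2 : (∏ a : σ, PowerSeries.mk fun k => (X a : MvPolynomial σ ℂ) ^ k) *
      ∏ a : σ, (1 - PowerSeries.C (X a) * PowerSeries.X) = 1 := by
    rw [← Finset.prod_mul_distrib]; simp [h1]
  have h3 : ∀ i, PowerSeries.coeff i (∏ a : σ, (1 - PowerSeries.C (X a : MvPolynomial σ ℂ) *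
      PowerSeries.X)) = (-1) ^ i * esymm σ ℂ i := by
    intro i
    have : ∀ a : σ, (1 - PowerSeries.C (X a : MvPolynomial σ ℂ) * PowerSeries.X) =
        PowerSeries.C (-X a : MvPolynomial σ ℂ) * PowerSeries.X + 1 := by
      intro a; rw [map_neg]; ring
    simp_rw [this, Finset.prod_add_one, Finset.prod_mul_distrib, Finset.prod_const, map_sum,
      ← map_prod, PowerSeries.coeff_C_mul, PowerSeries.coeff_X_pow]
    rw [esymm, Finset.mul_sum, Finset.powersetCard_eq_filter, Finset.sum_filter]
    refine Finset.sum_congr rfl fun t _ => ?_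
    by_cases h : i = t.card
    · rw [if_pos h, if_pos h.symm, mul_one, h, Finset.prod_neg]
    · rw [if_neg h, if_neg (Ne.symm h), mul_zero]
  have h4 := congrArg (PowerSeries.coeff N) h2
  rw [mul_comm, PowerSeries.coeff_mul, Finset.Nat.sum_antidiagonal_eq_sum_range_succ_mk] at h4
  simp only [h3, coeff_prod_mk_pow] at h4
  rw [h4, PowerSeries.coeff_one, if_neg hN]

theorem sum_sSym_mul_mSym (n : ℕ) {N : ℕ} (hN : N ≠ 0) :
    ∑ i ∈ Finset.range (N + 1), (-1) ^ i * sSym n i * mSym n (N - i) = 0 := by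
  have := congrArg (MvPolynomial.aeval (Zvar (n := n))) (sum_esymm_mul_hsymm (σ := Fin n) hN)
  simpa [map_sum, sSym, mSym] using this

theorem sSym_zero (n : ℕ) : sSym n 0 = 1 := by simp [sSym]
theorem mSym_zero (n : ℕ) : mSym n 0 = 1 := by simp [mSym]

theorem mSym_eq_sum (n : ℕ) {N : ℕ} (hN : N ≠ 0) :
    mSym n N = ∑ i ∈ Finset.range N, (-1) ^ i * sSym n (i + 1) * mSym n (N - (i + 1)) := by
  have h := sum_sSym_mul_mSym n hN
  rw [Finset.sum_range_succ'] at h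
  simp only [pow_zero, sSym_zero, one_mul, Nat.sub_zero] at h
  rw [eq_comm, ← sub_eq_zero, ← neg_eq_zero, neg_sub, ← h, add_comm, sub_eq_add_neg, add_right_inj,
    ← Finset.sum_neg_distrib]
  exact Finset.sum_congr rfl fun i _ => by rw [pow_succ]; ring

/-- `bar` applied to an elementary symmetric function. -/
theorem bar_sSym_mul (n i : ℕ) (hi : i ≤ n) : bar (sSym n i) * sSym n n = sSym n (n - i) := by
  classical
  have hbarZ : ∀ a : Fin n, bar (Zvar a) * Zvar a = 1 := by
    intro a
    rw [bar, AddMonoidAlgebra.mapDomainAlgHom_apply, Zvar, AddMonoidAlgebra.mapDomain_single,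
      AddMonoidAlgebra.single_mul_single, AddMonoidAlgebra.one_def]
    simp
  have hs : ∀ j, sSym n j = ∑ t ∈ Finset.powersetCard j (Finset.univ : Finset (Fin n)),
      ∏ a ∈ t, Zvar a := by
    intro j; simp [sSym, MvPolynomial.esymm, map_sum, map_prod]
  have hn : sSym n n = ∏ a : Fin n, Zvar a := by
    rw [hs]
    have : Finset.powersetCard n (Finset.univ : Finset (Fin n)) = {Finset.univ} := by
      have h := Finset.powersetCard_self (Finset.univ : Finset (Fin n))
      rwa [Finset.card_univ, Fintype.card_fin] at h
    rw [this, Finset.sum_singleton]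
  rw [hs i, hn, hs (n - i), map_sum, Finset.sum_mul]
  -- Inverting the monomial of t and multiplying by the product of all variables gives the monomial
  -- of the complement of t.
  refine Finset.sum_bij' (fun t _ => tᶜ) (fun t _ => tᶜ) ?_ ?_ ?_ ?_ ?_
  · intro t ht
    rw [Finset.mem_powersetCard] at ht ⊢
    exact ⟨Finset.subset_univ _, by rw [Finset.card_compl, ht.2, Fintype.card_fin]⟩
  · intro t ht
    rw [Finset.mem_powersetCard] at ht ⊢
    exact ⟨Finset.subset_univ _, by rw [Finset.card_compl, ht.2, Fintype.card_fin]; omega⟩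
  · intro t _; simp
  · intro t _; simp
  · intro t _
    rw [← Finset.prod_mul_prod_compl t, map_prod, ← mul_assoc, ← Finset.prod_mul_distrib]
    simp [hbarZ]

end Newton
end EquivQDE
namespace EquivQDE

/-! ### The sesquilinear form: invariance under multiplication by X, exceptional bases -/

section Form
variable {n : ℕ}

theorem formA_add_right (u v w : M n) : formA u (v + w) = formA u v + formA u w := by
  simp only [formA, ← Finset.sum_add_distrib, Pi.add_apply]
  exact Finset.sum_congr rfl fun i _ => Finset.sum_congr rfl fun j _ => by ring

theorem formA_smul_right (c : Laurent n) (u v : M n) : formA u (c • v) = c * formA u v := by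
  simp only [formA, Finset.mul_sum, Pi.smul_apply, smul_eq_mul]
  exact Finset.sum_congr rfl fun i _ => Finset.sum_congr rfl fun j _ => by ring

theorem formA_add_left (u v w : M n) : formA (u + v) w = formA u w + formA v w := by
  simp only [formA, ← Finset.sum_add_distrib, Pi.add_apply, map_add]
  exact Finset.sum_congr rfl fun i _ => Finset.sum_congr rfl fun j _ => by ring

theorem formA_smul_left (c : Laurent n) (u v : M n) : formA (c • u) v = bar c * formA u v := by
  simp only [formA, Finset.mul_sum, Pi.smul_apply, smul_eq_mul, map_mul]
  exact Finset.sum_congr rfl fun i _ => Finset.sum_congr rfl fun j _ => by ring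

theorem formA_zero_right (u : M n) : formA u 0 = 0 := by simp [formA]

theorem formA_zero_left (u : M n) : formA 0 u = 0 := by simp [formA]

theorem formA_sub_right (u v w : M n) : formA u (v - w) = formA u v - formA u w := by
  have := formA_add_right u (v - w) w
  rw [sub_add_cancel] at this
  rw [this, add_sub_cancel_right]

theorem formA_sub_left (u v w : M n) : formA (u - v) w = formA u w - formA v w := by
  have := formA_add_left (u - v) v w
  rw [sub_add_cancel] at this
  rw [this, add_sub_cancel_right]

theorem formA_sum_right {ι : Type*} (s : Finset ι) (u : M n) (f : ι → M n) :
    formA u (∑ i ∈ s, f i) = ∑ i ∈ s, formA u (f i) := by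
  classical
  induction s using Finset.induction_on with
  | empty => simp [formA_zero_right]
  | insert a s ha ih => rw [Finset.sum_insert ha, Finset.sum_insert ha, formA_add_right, ih]

theorem formA_sum_left {ι : Type*} (s : Finset ι) (u : M n) (f : ι → M n) :
    formA (∑ i ∈ s, f i) u = ∑ i ∈ s, formA (f i) u := by
  classical
  induction s using Finset.induction_on with
  | empty => simp [formA_zero_left]
  | insert a s ha ih => rw [Finset.sum_insert ha, Finset.sum_insert ha, formA_add_left, ih]

theorem formA_single (i j : Fin n) :
    formA (Pi.single i 1) (Pi.single j 1) = if i ≤ j then mSym n (j.val - i.val) else 0 := by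
  rw [formA, Finset.sum_eq_single i, Finset.sum_eq_single j] <;> simp +contextual [Pi.single_apply]

/-- Two vectors are expanded in the standard basis. -/
theorem formA_eq_sum (v w : M n) :
    formA v w = ∑ i, ∑ j, bar (v i) * (w j * formA (Pi.single i 1) (Pi.single j 1)) := by
  simp only [formA_single]
  simp only [formA, mul_assoc]

theorem companion_mulVec_single (j : Fin n) (h : j.val + 1 < n) :
    (companion n).mulVec (Pi.single j 1) = Pi.single ⟨j.val + 1, h⟩ 1 := by
  rw [Matrix.mulVec_single_one]
  ext1 i
  simp only [Matrix.col_apply, companion, h.ne, if_false, Pi.single_apply, Fin.ext_iff]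

theorem companion_mulVec_last (j : Fin n) (h : j.val + 1 = n) (i : Fin n) :
    (companion n).mulVec (Pi.single j 1) i = (-1) ^ (n - i.val + 1) * sSym n (n - i.val) := by
  rw [Matrix.mulVec_single_one]
  simp [Matrix.col_apply, companion, h]

theorem formA_single_left (i : Fin n) (w : M n) :
    formA (Pi.single i 1) w = ∑ j : Fin n, w j * if i ≤ j then mSym n (j.val - i.val) else 0 := by
  rw [formA, Finset.sum_eq_single i] <;> simp +contextual

theorem formA_single_right (j : Fin n) (v : M n) :
    formA v (Pi.single j 1) = ∑ i : Fin n, bar (v i) * if i ≤ j then mSym n (j.val - i.val) else 0 := by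
  rw [formA]
  refine Finset.sum_congr rfl fun i _ => ?_
  rw [Finset.sum_eq_single j] <;> simp +contextual

/-- Expanding `X^n` by the defining relation turns the pairing into the recursion `mSym_eq_sum`.
Thus `X^n` pairs from the right as an additional basis vector `e_{n+1}` would. -/
theorem formA_single_last (i j : Fin n) (h : j.val + 1 = n) :
    formA (Pi.single i 1) ((companion n).mulVec (Pi.single j 1)) = mSym n (n - i.val) := by
  rw [formA_single_left]
  simp only [companion_mulVec_last j h, Fin.le_def]
  rw [Fin.sum_univ_eq_sum_range (fun l => (-1) ^ (n - l + 1) * sSym n (n - l) *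
    if i.val ≤ l then mSym n (l - i.val) else 0) n, ← Finset.sum_range_reflect,
    mSym_eq_sum n (N := n - i.val) (by omega)]
  symm
  -- After reflection, q stands for the basis vector with index `n - 1 - q`; the indices `q ≥ n - i`
  -- lie to the left of i and pair to zero.
  refine Finset.sum_subset_zero_on_sdiff (Finset.range_mono (Nat.sub_le _ _)) ?_ ?_
  · intro q hq
    simp only [Finset.mem_sdiff, Finset.mem_range] at hq
    rw [if_neg (by omega), mul_zero]
  · intro q hq
    rw [Finset.mem_range] at hq
    rw [if_pos (by omega), show n - (n - 1 - q) = q + 1 by omega,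
      show n - 1 - q - i.val = n - i.val - (q + 1) by omega]
    ring

theorem bar_sSym_sub (i : ℕ) (hi : i ≤ n) : bar (sSym n (n - i)) = sSym n i * bar (sSym n n) := by
  have h1 := bar_sSym_mul n (n - i) (Nat.sub_le _ _)
  have h2 := bar_sSym_mul n n le_rfl
  rw [Nat.sub_self, sSym_zero] at h2
  rw [Nat.sub_sub_self hi] at h1
  rw [← h1, mul_assoc, mul_comm (sSym n n), h2, mul_one]

/-- Semilinearity inverts the coefficients of `X^n`; since the inverse of `s_{n-l}` is `s_l` times
that of `s_n`, what remains is the relation between the `s_i` and `m_i` in degree j, multiplied by a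
unit. -/
theorem formA_last_single (i j : Fin n) (h : i.val + 1 = n) (hj : j.val ≠ 0) :
    formA ((companion n).mulVec (Pi.single i 1)) (Pi.single j 1) = 0 := by
  rw [formA_single_right]
  simp only [companion_mulVec_last i h, Fin.le_def]
  rw [Fin.sum_univ_eq_sum_range (fun l => bar ((-1) ^ (n - l + 1) * sSym n (n - l)) *
    if l ≤ j.val then mSym n (j.val - l) else 0) n]
  have h0 := congrArg (fun x => (-1) ^ (n + 1) * bar (sSym n n) * x) (sum_sSym_mul_mSym n hj)
  rw [mul_zero, Finset.mul_sum] at h0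
  refine Eq.trans ?_ h0
  symm
  refine Finset.sum_subset_zero_on_sdiff (Finset.range_mono j.2) ?_ ?_
  · intro q hq
    simp only [Finset.mem_sdiff, Finset.mem_range] at hq
    rw [if_neg (by omega), mul_zero]
  · intro q hq
    rw [Finset.mem_range] at hq
    have hs : ((-1 : Laurent n)) ^ (n + 1) * (-1) ^ q = (-1) ^ (n - q + 1) := by
      rw [← pow_add, show n + 1 + q = (n - q + 1) + 2 * q by omega, pow_add, pow_mul]; simp
    rw [if_pos (by omega), map_mul, bar_sSym_sub q (by omega), map_pow, map_neg, map_one, ← hs]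
    ring

/-- Here the relation in degree n occurs without its last term `s_n m_0`, and that term accounts for
the value 1. -/
theorem formA_last_last (i : Fin n) (h : i.val + 1 = n) :
    formA ((companion n).mulVec (Pi.single i 1)) ((companion n).mulVec (Pi.single i 1)) = 1 := by
  have h2 := bar_sSym_mul n n le_rfl
  rw [Nat.sub_self, sSym_zero] at h2
  have h1 : formA ((companion n).mulVec (Pi.single i 1)) ((companion n).mulVec (Pi.single i 1)) =
      ∑ l : Fin n, bar ((companion n).mulVec (Pi.single i 1) l) *
        formA (Pi.single l 1) ((companion n).mulVec (Pi.single i 1)) := by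
    simp only [formA_single_left]
    rw [formA]
    refine Finset.sum_congr rfl fun l _ => ?_
    rw [Finset.mul_sum]
    exact Finset.sum_congr rfl fun j _ => by ring
  rw [h1]
  simp only [formA_single_last _ i h, companion_mulVec_last i h]
  rw [Fin.sum_univ_eq_sum_range (fun l => bar ((-1) ^ (n - l + 1) * sSym n (n - l)) *
    mSym n (n - l)) n]
  have h0 := congrArg (fun x => (-1) ^ (n + 1) * bar (sSym n n) * x)
    (sum_sSym_mul_mSym n (N := n) (by omega))
  rw [mul_zero, Finset.mul_sum, Finset.sum_range_succ, Nat.sub_self, mSym_zero, mul_one] at h0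
  have h3 : (-1) ^ (n + 1) * bar (sSym n n) * ((-1) ^ n * sSym n n) = -1 := by
    rw [show (-1 : Laurent n) ^ (n + 1) * bar (sSym n n) * ((-1) ^ n * sSym n n) =
      (-1) ^ (2 * n) * (-1) * (bar (sSym n n) * sSym n n) by ring, h2, pow_mul]; simp
  rw [h3] at h0
  have h4 : ∀ q ∈ Finset.range n, bar ((-1) ^ (n - q + 1) * sSym n (n - q)) * mSym n (n - q) =
      (-1) ^ (n + 1) * bar (sSym n n) * ((-1) ^ q * sSym n q * mSym n (n - q)) := by
    intro q hq
    rw [Finset.mem_range] at hq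
    have hs : ((-1 : Laurent n)) ^ (n + 1) * (-1) ^ q = (-1) ^ (n - q + 1) := by
      rw [← pow_add, show n + 1 + q = (n - q + 1) + 2 * q by omega, pow_add, pow_mul]; simp
    rw [map_mul, bar_sSym_sub q (by omega), map_pow, map_neg, map_one, ← hs]
    ring
  rw [Finset.sum_congr rfl h4, eq_neg_of_add_eq_zero_left h0, neg_neg]

theorem formA_companion_single (i j : Fin n) :
    formA ((companion n).mulVec (Pi.single i 1)) ((companion n).mulVec (Pi.single j 1)) =
      formA (Pi.single i 1) (Pi.single j 1) := by
  rcases Nat.lt_or_ge (i.val + 1) n with hi | hi <;> rcases Nat.lt_or_ge (j.val + 1) n with hj | hj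
  · rw [companion_mulVec_single i hi, companion_mulVec_single j hj, formA_single, formA_single]
    simp only [Fin.le_def, Nat.add_le_add_iff_right, Nat.add_sub_add_right]
  · have hj' : j.val + 1 = n := by omega
    rw [companion_mulVec_single i hi, formA_single_last _ j hj', formA_single,
      if_pos (by rw [Fin.le_def]; omega)]
    congr 1
    simp only
    omega
  · rw [companion_mulVec_single j hj, formA_last_single i _ (by omega) (by simp), formA_single,
      if_neg (by rw [Fin.le_def]; omega)]
  · obtain rfl : i = j := by ext; omega
    rw [formA_last_last i (by omega), formA_single]
    simp [mSym_zero]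

/-- Multiplication by X is an isometry. By sesquilinearity it is enough to check basis vectors, and
only those pairs that contain the last one are not immediate. -/
theorem formA_companion (v w : M n) :
    formA ((companion n).mulVec v) ((companion n).mulVec w) = formA v w := by
  have h : ∀ v : M n, v = ∑ i, v i • (Pi.single i 1 : M n) := by
    intro v
    ext1 j
    simp [Finset.sum_apply, Pi.single_apply]
  have hC : ∀ v : M n, (companion n).mulVec v =
      ∑ i, v i • (companion n).mulVec (Pi.single i 1) := by
    intro v
    conv_lhs => rw [h v]
    rw [Matrix.mulVec_sum]
    exact Finset.sum_congr rfl fun i _ => Matrix.mulVec_smul _ _ _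
  rw [hC v, hC w, formA_eq_sum v w, formA_sum_left]
  refine Finset.sum_congr rfl fun i _ => ?_
  rw [formA_smul_left, formA_sum_right, Finset.mul_sum]
  refine Finset.sum_congr rfl fun j _ => ?_
  rw [formA_smul_right, formA_companion_single]

/-- The isometry property reads `C̄ᵀ G C = G` with a unitriangular Gram matrix G, so the
determinants of `C̄` and C multiply to 1. -/
theorem isUnit_det_companion : IsUnit (companion n).det := by
  classical
  let G : Matrix (Fin n) (Fin n) (Laurent n) :=
    fun i j => if i ≤ j then mSym n (j.val - i.val) else 0
  have hG : G.det = 1 := by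
    rw [Matrix.det_of_isUpperTriangular]
    · simp [G, mSym_zero]
    · intro i j hij
      exact if_neg (not_le.2 hij)
  have hf : ((companion n).map bar).transpose * G * companion n = G := by
    ext1 i j
    have := formA_companion_single i j
    rw [formA_single, Matrix.mulVec_single_one, Matrix.mulVec_single_one] at this
    rw [Matrix.mul_apply]
    simp only [Matrix.mul_apply, Finset.sum_mul]
    rw [Finset.sum_comm]
    refine Eq.trans ?_ this
    rw [formA]
    refine Finset.sum_congr rfl fun a _ => Finset.sum_congr rfl fun b _ => ?_
    simp only [Matrix.transpose_apply, Matrix.map_apply, Matrix.col_apply, G]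
    ring
  have h1 := congrArg Matrix.det hf
  rw [Matrix.det_mul, Matrix.det_mul, hG, mul_one] at h1
  exact IsUnit.of_mul_eq_one_right _ h1

theorem formA_companion_zpow (k : ℤ) (v w : M n) :
    formA ((companion n ^ k).mulVec v) ((companion n ^ k).mulVec w) = formA v w := by
  induction k using Int.induction_on generalizing v w with
  | zero => simp
  | succ i ih =>
    rw [Matrix.zpow_add_one isUnit_det_companion, ← Matrix.mulVec_mulVec, ← Matrix.mulVec_mulVec,
      ih, formA_companion]
  | pred i ih =>
    rw [Matrix.zpow_sub_one isUnit_det_companion, ← Matrix.mulVec_mulVec, ← Matrix.mulVec_mulVec,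
      ih, ← formA_companion ((companion n)⁻¹.mulVec v), Matrix.mulVec_mulVec, Matrix.mulVec_mulVec,
      Matrix.mul_nonsing_inv _ isUnit_det_companion, Matrix.one_mulVec, Matrix.one_mulVec]

theorem powX_add (k l : ℤ) : powX n (k + l) = (companion n ^ k).mulVec (powX n l) := by
  rw [powX, powX, Matrix.mulVec_mulVec, Matrix.zpow_add isUnit_det_companion]

theorem powX_fin (j : Fin n) : powX n j.val = Pi.single j 1 := by
  obtain ⟨j, hj⟩ := j
  induction j with
  | zero =>
    ext1 i
    simp [powX, Pi.single_apply, Fin.ext_iff]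
  | succ j ih =>
    have h := powX_add (n := n) 1 j
    rw [zpow_one, ih (by omega), companion_mulVec_single _ hj] at h
    rw [← h]
    congr 1
    push_cast
    ring

theorem basisQ_eq (k : ℤ) (j : Fin n) :
    basisQ n k j = (companion n ^ k).mulVec (Pi.single j 1) := by
  rw [basisQ, powX_add, powX_fin]

theorem formA_basisQ (k : ℤ) (i j : Fin n) :
    formA (basisQ n k i) (basisQ n k j) = if i ≤ j then mSym n (j.val - i.val) else 0 := by
  rw [basisQ_eq, basisQ_eq, formA_companion_zpow, formA_single]

theorem linearIndependent_of_span_eq_top {Q : Fin n → M n}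
    (h : Submodule.span (Laurent n) (Set.range Q) = ⊤) : LinearIndependent (Laurent n) Q :=
  linearIndependent_of_top_le_span_of_card_eq_finrank h.ge (by simp)

theorem span_basisQ (k : ℤ) : Submodule.span (Laurent n) (Set.range (basisQ n k)) = ⊤ := by
  rw [eq_top_iff]
  intro v _
  have hv : v = (companion n ^ k).mulVec ((companion n ^ (-k)).mulVec v) := by
    rw [Matrix.mulVec_mulVec, ← Matrix.zpow_add isUnit_det_companion, add_neg_cancel, zpow_zero,
      Matrix.one_mulVec]
  set u := (companion n ^ (-k)).mulVec v
  have hu : u = ∑ i, u i • (Pi.single i 1 : M n) := by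
    ext1 j
    simp [Finset.sum_apply, Pi.single_apply]
  rw [hv, hu, Matrix.mulVec_sum]
  refine Submodule.sum_mem _ fun i _ => ?_
  rw [Matrix.mulVec_smul, ← basisQ_eq]
  exact Submodule.smul_mem _ _ (Submodule.subset_span ⟨i, rfl⟩)

theorem isExceptional_basisQ (k : ℤ) : IsExceptional (basisQ n k) where
  linearIndependent := linearIndependent_of_span_eq_top (span_basisQ k)
  span_eq_top := span_basisQ k
  form_self i := by simp [formA_basisQ, mSym_zero]
  form_eq_zero i j h := by rw [formA_basisQ, if_neg (not_le.2 h)]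

theorem tauAct_eq {i : ℕ} (h1 : 1 ≤ i) (h2 : i < n) (Q : Fin n → M n) (j : Fin n) :
    tauAct i Q j = if j.val + 1 = i then Q ⟨i, h2⟩ -
        formA (Q ⟨i - 1, by omega⟩) (Q ⟨i, h2⟩) • Q ⟨i - 1, by omega⟩
      else if j.val = i then Q ⟨i - 1, by omega⟩ else Q j := by
  rw [tauAct, dif_pos ⟨h1, h2⟩]
  simp only [Function.update_apply, Fin.ext_iff]
  congr 1
  simp only [eq_iff_iff]
  omega

/-- The span does not change because both old vectors are recovered from the new ones, and n
spanning vectors of a free module of rank n are independent. -/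
theorem isExceptional_tauAct (i : ℕ) {Q : Fin n → M n} (hQ : IsExceptional Q) :
    IsExceptional (tauAct i Q) := by
  by_cases h : 1 ≤ i ∧ i < n
  swap
  · rwa [tauAct, dif_neg h]
  obtain ⟨h1, h2⟩ := h
  have hspan : Submodule.span (Laurent n) (Set.range (tauAct i Q)) = ⊤ := by
    rw [eq_top_iff, ← hQ.span_eq_top, Submodule.span_le]
    have hm : ∀ j, tauAct i Q j ∈ Submodule.span (Laurent n) (Set.range (tauAct i Q)) :=
      fun j => Submodule.subset_span ⟨j, rfl⟩
    have ha : Q ⟨i - 1, by omega⟩ ∈ Submodule.span (Laurent n) (Set.range (tauAct i Q)) := by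
      have := hm ⟨i, h2⟩
      rw [tauAct_eq h1 h2, if_neg (by simp), if_pos rfl] at this
      exact this
    rintro _ ⟨j, rfl⟩
    by_cases hj : j.val + 1 = i
    · have : j = ⟨i - 1, by omega⟩ := by ext; simp; omega
      rw [this]; exact ha
    · by_cases hj' : j.val = i
      · have hb := hm ⟨i - 1, by omega⟩
        rw [tauAct_eq h1 h2, if_pos (by simp; omega)] at hb
        have hj2 : j = ⟨i, h2⟩ := by ext; exact hj'
        rw [hj2]
        exact (Submodule.sub_mem_iff_left _ (Submodule.smul_mem _ _ ha)).1 hb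
      · have := hm j
        rwa [tauAct_eq h1 h2, if_neg hj, if_neg hj'] at this
  refine ⟨linearIndependent_of_span_eq_top hspan, hspan, ?_, ?_⟩
  · intro j
    rw [tauAct_eq h1 h2]
    split_ifs with h3 h4
    · rw [formA_sub_left, formA_sub_right, formA_sub_right, formA_smul_left, formA_smul_left,
        formA_smul_right, formA_smul_right, hQ.form_self, hQ.form_self,
        hQ.form_eq_zero ⟨i, h2⟩ ⟨i - 1, by omega⟩ (by rw [Fin.lt_def]; simp; omega)]
      ring
    · exact hQ.form_self _
    · exact hQ.form_self _
  · intro a b hab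
    rw [Fin.lt_def] at hab
    have hz : ∀ a b : Fin n, b.val < a.val → formA (Q a) (Q b) = 0 :=
      fun a b h => hQ.form_eq_zero a b h
    rw [tauAct_eq h1 h2, tauAct_eq h1 h2]
    split_ifs with h3 h4 h5 h6 h7 h8
    · omega
    · omega
    · rw [formA_sub_left, formA_smul_left, hz ⟨i, h2⟩ b (show b.val < i by omega),
        hz ⟨i - 1, by omega⟩ b (show b.val < i - 1 by omega)]
      simp
    -- The only orthogonality that is not inherited: the subtracted multiple of `v_i` is exactly
    -- what makes `v_i` orthogonal to the new vector before it.
    · rw [formA_sub_right, formA_smul_right, hQ.form_self, mul_one, sub_self]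
    · omega
    · exact hz ⟨i - 1, by omega⟩ b (show b.val < i - 1 by omega)
    · rw [formA_sub_right, formA_smul_right, hz a ⟨i, h2⟩ (show i < a.val by omega),
        hz a ⟨i - 1, by omega⟩ (show i - 1 < a.val by omega)]
      simp
    · exact hz a ⟨i - 1, by omega⟩ (show i - 1 < a.val by omega)
    · exact hz _ _ hab

theorem isExceptional_braidAct (w : List ℕ) {Q : Fin n → M n} (hQ : IsExceptional Q) :
    IsExceptional (braidAct w Q) := by
  induction w with
  | nil => exact hQ
  | cons i w ih => exact isExceptional_tauAct i ih

end Form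
end EquivQDE
namespace EquivQDE

/-! ### The braids `γ_n` and `δ_{n,odd}` acting on `Q_k` -/

section Braid
variable {n : ℕ}

theorem nth_of_le (Q : Fin n → M n) {m : ℕ} (h : 1 ≤ m) (h' : m ≤ n) :
    nth Q m = Q ⟨m - 1, by omega⟩ := dif_pos ⟨h, h'⟩

theorem nth_succ (Q : Fin n → M n) (j : Fin n) : nth Q (j.val + 1) = Q j := by
  rw [nth_of_le Q (by omega) j.2]; simp

theorem vml_self (Q : Fin n → M n) (m : ℕ) : vml Q m m = nth Q m := by
  simp [vml, sSym_zero]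

theorem formA_nth {Q : Fin n → M n}
    (hQ : ∀ i j, formA (Q i) (Q j) = if i ≤ j then mSym n (j.val - i.val) else 0)
    {l m : ℕ} (hl : 1 ≤ l) (hlm : l ≤ m) (hm : m ≤ n) :
    formA (nth Q l) (nth Q m) = mSym n (m - l) := by
  rw [nth_of_le Q hl (by omega), nth_of_le Q (by omega) hm, hQ, if_pos (by rw [Fin.le_def]; simp; omega)]
  simp only
  congr 1
  omega

/-- Moving `v_m(l + 1)` to the left over `v_l` produces `v_m(l)`. -/
theorem vml_mutation {Q : Fin n → M n}
    (hQ : ∀ i j, formA (Q i) (Q j) = if i ≤ j then mSym n (j.val - i.val) else 0)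
    {l m : ℕ} (hl : 1 ≤ l) (hlm : l < m) (hm : m ≤ n) :
    vml Q m (l + 1) - formA (nth Q l) (vml Q m (l + 1)) • nth Q l = vml Q m l := by
  -- The pairing is the sum of `(-1)^i s_i m_{m-l-i}` without its last term `i = m - l`, so it
  -- equals minus that term.
  have h1 : formA (nth Q l) (vml Q m (l + 1)) = -((-1) ^ (m - l) * sSym n (m - l)) := by
    have h := sum_sSym_mul_mSym n (N := m - l) (by omega)
    rw [Finset.sum_range_succ, Nat.sub_self, mSym_zero, mul_one] at h
    rw [eq_neg_iff_add_eq_zero, ← h, vml, formA_sum_right]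
    congr 1
    rw [show m - (l + 1) + 1 = m - l by omega]
    refine Finset.sum_congr rfl fun i hi => ?_
    rw [Finset.mem_range] at hi
    rw [formA_smul_right, formA_nth hQ hl (by omega) (by omega),
      show m - i - l = m - l - i by omega]
  rw [h1, neg_smul, sub_neg_eq_add]
  conv_rhs => rw [vml, Finset.sum_range_succ]
  rw [vml, show m - (l + 1) + 1 = m - l by omega, show m - (m - l) = l by omega]

theorem braidAct_append (w w' : List ℕ) (Q : Fin n → M n) :
    braidAct (w ++ w') Q = braidAct w (braidAct w' Q) := List.foldr_append

/-- The basis obtained from `Q` by the first `q` factors of `γ_n`. -/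
noncomputable def gammaStage (Q : Fin n → M n) (q : ℕ) : Fin n → M n := fun j =>
  if j.val < 2 * q then primeBasis Q j else nth Q (j.val - q + 1)

/-- The basis obtained from `gammaStage Q q` by moving its last vector to position `i`. -/
noncomputable def betaStage (Q : Fin n → M n) (q i : ℕ) : Fin n → M n := fun j =>
  if j.val + 1 < i then gammaStage Q q j
  else if j.val + 1 = i then vml Q (n - q) (i - q)
  else gammaStage Q q ⟨j.val - 1, by omega⟩

/-- The rightmost letter acts first. The last vector is `v_{n-q} = v_{n-q}(n-q)`, and the letter
`τ_i` moves it across `v_{i-q}`, which lowers its second index by one. The bound `2q + 2 ≤ i` keeps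
it to the right of the vectors that have their final place. -/
theorem braidAct_Ico {Q : Fin n → M n}
    (hQ : ∀ i j, formA (Q i) (Q j) = if i ≤ j then mSym n (j.val - i.val) else 0)
    (q d : ℕ) : ∀ i, i + d = n → 2 * q + 2 ≤ i →
      braidAct (List.Ico i n) (gammaStage Q q) = betaStage Q q i := by
  induction d with
  | zero =>
    intro i hi hq
    obtain rfl : i = n := by omega
    rw [List.Ico.self_empty]
    funext j
    change gammaStage Q q j = _
    rw [betaStage]
    split_ifs with h1 h2
    · rfl
    · rw [vml_self, gammaStage, if_neg (by omega)]
      congr 1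
      omega
    · omega
  | succ d ih =>
    intro i hi hq
    have hn : i < n := by omega
    rw [List.Ico.eq_cons hn]
    change tauAct i (braidAct (List.Ico (i + 1) n) (gammaStage Q q)) = _
    rw [ih (i + 1) (by omega) (by omega)]
    have e1 : betaStage Q q (i + 1) ⟨i, hn⟩ = vml Q (n - q) (i - q + 1) := by
      simp only [betaStage, lt_irrefl, if_false, if_true]
      congr 1; omega
    have e2 : betaStage Q q (i + 1) ⟨i - 1, by omega⟩ = nth Q (i - q) := by
      simp only [betaStage]
      rw [if_pos (by omega), gammaStage, if_neg (by simp only; omega)]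
      congr 1
      simp only
      omega
    funext j
    rw [tauAct_eq (by omega) hn, e1, e2, vml_mutation hQ (by omega) (by omega) (by omega)]
    by_cases h1 : j.val + 1 = i
    · rw [if_pos h1, betaStage, if_neg (by omega), if_pos h1]
    rw [if_neg h1]
    by_cases h2 : j.val = i
    · rw [if_pos h2, betaStage, if_neg (by omega), if_neg h1, gammaStage,
        if_neg (by simp only; omega)]
      congr 1
      simp only
      omega
    rw [if_neg h2, betaStage, betaStage]
    by_cases h3 : j.val + 1 < i
    · rw [if_pos (by omega), if_pos h3]
    · rw [if_neg (by omega), if_neg (by omega), if_neg h3, if_neg h1]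

/-- The range is reversed because `β_2` acts first. Each factor fixes two more positions: `v_{q+1}`
is already in place, and the transported vector stops just behind it. -/
theorem braidAct_gamma {Q : Fin n → M n}
    (hQ : ∀ i j, formA (Q i) (Q j) = if i ≤ j then mSym n (j.val - i.val) else 0)
    (K : ℕ) (hK : 2 * K + 1 ≤ n) :
    braidAct ((List.range K).reverse.flatMap fun q => List.Ico (2 * (q + 1)) n) Q =
      gammaStage Q K := by
  induction K with
  | zero =>
    funext j
    simp [gammaStage, braidAct, nth_succ]
  | succ K ih =>
    rw [List.range_succ, List.reverse_append, List.reverse_singleton, List.singleton_append,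
      List.flatMap_cons, braidAct_append, ih (by omega),
      braidAct_Ico hQ K (n - 2 * (K + 1)) _ (by omega) (by omega)]
    funext j
    rw [betaStage]
    split_ifs with h1 h2
    · rw [gammaStage, gammaStage]
      by_cases h : j.val < 2 * K
      · rw [if_pos h, if_pos (by omega)]
      · have hj : j.val = 2 * K := by omega
        rw [if_neg h, if_pos (by omega), primeBasis, if_pos (by simp [hj])]
        congr 1
        omega
    · rw [gammaStage, if_pos (by omega), primeBasis, if_neg (by
        rw [Nat.not_even_iff_odd]; exact ⟨K, by omega⟩)]
      congr 1 <;> omega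
    · rw [gammaStage, gammaStage, if_neg (by simp only; omega), if_neg (by omega)]
      congr 1
      simp only
      omega

theorem braidAct_gammaWord {Q : Fin n → M n}
    (hQ : ∀ i j, formA (Q i) (Q j) = if i ≤ j then mSym n (j.val - i.val) else 0) (hn : 1 ≤ n) :
    braidAct (gammaWord n) Q = primeBasis Q := by
  rw [gammaWord, braidAct_gamma hQ _ (by omega)]
  funext j
  rw [gammaStage]
  split_ifs with h
  · rfl
  -- Beyond the first `2⌊(n-1)/2⌋` positions there is one vector for n odd and two for n even. They
  -- are still vectors of Q, and the second of the two is read as `v_m(m)`.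
  · rw [primeBasis]
    split_ifs with h2
    · obtain ⟨a, ha⟩ := h2
      congr 1
      omega
    · rw [Nat.not_even_iff_odd] at h2
      obtain ⟨a, ha⟩ := h2
      rw [show n + 1 - (j.val + 1) / 2 = a + 2 by omega, show (j.val + 1) / 2 + 1 = a + 2 by omega,
        vml_self]
      congr 1
      omega

/-- The letters involve disjoint pairs of neighbouring positions, so each pair is mutated
independently of the others. -/
theorem braidAct_odd (K : ℕ) (hK : 2 * K ≤ n) (Q : Fin n → M n) (j : Fin n) :
    braidAct ((List.range K).map fun q => 2 * q + 1) Q j =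
      if h : j.val < 2 * K then
        if he : Even j.val then
          Q ⟨j.val + 1, by obtain ⟨a, ha⟩ := he; omega⟩ -
            formA (Q j) (Q ⟨j.val + 1, by obtain ⟨a, ha⟩ := he; omega⟩) • Q j
        else Q ⟨j.val - 1, by omega⟩
      else Q j := by
  induction K generalizing Q with
  | zero => simp [braidAct]
  | succ K ih =>
    rw [List.range_succ, List.map_append, braidAct_append, ih (by omega)]
    change (if h : j.val < 2 * K then _ else tauAct (2 * K + 1) Q j) = _
    have ht : ∀ i : Fin n, i.val < 2 * K → tauAct (2 * K + 1) Q i = Q i := fun i hi => by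
      rw [tauAct_eq (by omega) (by omega), if_neg (by omega), if_neg (by omega)]
    by_cases h : j.val < 2 * K
    · rw [dif_pos h, dif_pos (show j.val < 2 * (K + 1) by omega)]
      by_cases he : Even j.val
      · rw [dif_pos he, dif_pos he]
        have hl : j.val + 1 < 2 * K := by obtain ⟨a, ha⟩ := he; omega
        change tauAct (2 * K + 1) Q _ - formA (tauAct (2 * K + 1) Q _) (tauAct (2 * K + 1) Q _) •
          tauAct (2 * K + 1) Q _ = _
        rw [ht ⟨j.val + 1, by omega⟩ hl, ht j h]
      · rw [dif_neg he, dif_neg he]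
        exact ht ⟨j.val - 1, by omega⟩ (by simp only; omega)
    · rw [dif_neg h, tauAct_eq (by omega) (by omega)]
      by_cases h1 : j.val = 2 * K
      · rw [if_pos (by omega), dif_pos (by omega), dif_pos (by simp [h1])]
        have e1 : (⟨2 * K + 1, by omega⟩ : Fin n) = ⟨j.val + 1, by omega⟩ := by ext; simp [h1]
        have e2 : (⟨2 * K + 1 - 1, by omega⟩ : Fin n) = j := by ext; simp [h1]
        rw [e1, e2]
      · rw [if_neg (by omega)]
        by_cases h2 : j.val = 2 * K + 1
        · rw [if_pos h2, dif_pos (by omega), dif_neg (by rw [h2]; simp)]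
          congr 1
          ext
          simp [h2]
        · rw [if_neg h2, dif_neg (by omega)]

/-- The neighbours `v_{p+1}` and `v_{n-p}(p+2)` become `v_{n-p}(p+1)` and `v_{p+1}` by the same
mutation rule. For n odd the last vector has no partner and is already the right one. -/
theorem braidAct_deltaOddWord {Q : Fin n → M n}
    (hQ : ∀ i j, formA (Q i) (Q j) = if i ≤ j then mSym n (j.val - i.val) else 0) :
    braidAct (deltaOddWord n) (primeBasis Q) = doublePrimeBasis Q := by
  funext j
  rw [deltaOddWord, braidAct_odd _ (by omega)]
  by_cases h : j.val < 2 * (n / 2)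
  · rw [dif_pos h]
    by_cases he : Even j.val
    · rw [dif_pos he]
      obtain ⟨p, hp⟩ := he
      have e1 : primeBasis Q j = nth Q (p + 1) := by
        rw [primeBasis, if_pos ⟨p, hp⟩]; congr 1; omega
      have e2 : primeBasis Q ⟨j.val + 1, by omega⟩ = vml Q (n - p) (p + 1 + 1) := by
        rw [primeBasis, if_neg (by rw [Nat.not_even_iff_odd]; exact ⟨p, by simp only; omega⟩)]
        simp only
        congr 1 <;> omega
      rw [e1, e2, vml_mutation hQ (by omega) (by omega) (by omega), doublePrimeBasis,
        if_pos ⟨p, hp⟩]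
      congr 1 <;> omega
    · rw [dif_neg he, doublePrimeBasis, if_neg he]
      rw [Nat.not_even_iff_odd] at he
      obtain ⟨p, hp⟩ := he
      rw [primeBasis, if_pos ⟨p, by simp only; omega⟩]
      congr 1
      simp only
      omega
  · rw [dif_neg h]
    have he : Even j.val := ⟨n / 2, by omega⟩
    rw [primeBasis, doublePrimeBasis, if_pos he, if_pos he,
      show n - j.val / 2 = j.val / 2 + 1 by obtain ⟨p, hp⟩ := he; omega, vml_self]

end Braid

/-! ### Evaluation at `X = Z_J` -/

section Eval
variable {n : ℕ}

/-- The value of a Laurent polynomial `∑ v_j X^{j-1}` at `X = Z_J`. -/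
noncomputable def evalX (z : Fin n → ℂ) (J : Fin n) (v : M n) : ℂ :=
  ∑ j : Fin n, evalZ z (v j) * Complex.exp (2 * Real.pi * Complex.I * z J) ^ j.val

theorem evalZ_Zvar (z : Fin n → ℂ) (a : Fin n) :
    evalZ z (Zvar a) = Complex.exp (2 * Real.pi * Complex.I * z a) := by
  rw [evalZ, Zvar, AddMonoidAlgebra.lift_single]
  rw [one_smul]
  change ∏ b, Complex.exp (2 * Real.pi * Complex.I * z b) ^ ((Pi.single a 1 : Fin n → ℤ) b) = _
  rw [Finset.prod_eq_single a]
  · simp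
  · intro b _ hb
    simp [hb]
  · simp

theorem sum_evalZ_sSym (z : Fin n → ℂ) (J : Fin n) :
    ∑ i ∈ Finset.range (n + 1), (-1) ^ i * evalZ z (sSym n i) *
      Complex.exp (2 * Real.pi * Complex.I * z J) ^ (n - i) = 0 := by
  have h1 : ∀ i, evalZ z (sSym n i) = (Finset.univ.val.map fun a =>
      Complex.exp (2 * Real.pi * Complex.I * z a)).esymm i := by
    intro i
    rw [sSym, ← AlgHom.comp_apply, MvPolynomial.comp_aeval,
      MvPolynomial.aeval_esymm_eq_multiset_esymm]
    simp only [evalZ_Zvar]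
  have h2 := congrArg (Polynomial.eval (Complex.exp (2 * Real.pi * Complex.I * z J)))
    (Multiset.prod_X_sub_X_eq_sum_esymm (Finset.univ.val.map fun a : Fin n =>
      Complex.exp (2 * Real.pi * Complex.I * z a)))
  simp only [← h1, Multiset.card_map, Finset.card_val, Finset.card_fin,
    Polynomial.eval_finsetSum, Multiset.map_map] at h2
  rw [show (0 : ℂ) = Polynomial.eval (Complex.exp (2 * Real.pi * Complex.I * z J)) (∏ a : Fin n, (X - C (Complex.exp (2 * Real.pi * Complex.I * z a)))) by
    rw [Polynomial.eval_prod, Finset.prod_eq_zero (Finset.mem_univ J)]; simp]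
  refine Eq.trans ?_ h2.symm
  refine Finset.sum_congr rfl fun i _ => ?_
  simp [mul_assoc]

/-- The row of powers of `Z_J` is a left eigenvector of the companion matrix; for the last column
this is `sum_evalZ_sSym`, the vanishing of `∏ (X - Z_a)` at `X = Z_J`. -/
theorem evalX_companion (z : Fin n → ℂ) (J : Fin n) (v : M n) :
    evalX z J ((companion n).mulVec v) =
      Complex.exp (2 * Real.pi * Complex.I * z J) * evalX z J v := by
  simp only [evalX, Matrix.mulVec, dotProduct, map_sum, map_mul, Finset.sum_mul, Finset.mul_sum]
  rw [Finset.sum_comm]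
  refine Finset.sum_congr rfl fun j _ => ?_
  have h : ∑ i : Fin n, evalZ z (companion n i j) *
      Complex.exp (2 * Real.pi * Complex.I * z J) ^ i.val =
      Complex.exp (2 * Real.pi * Complex.I * z J) ^ (j.val + 1) := by
    by_cases hj : j.val + 1 = n
    · simp only [companion, if_pos hj]
      rw [Fin.sum_univ_eq_sum_range (fun i => evalZ z ((-1) ^ (n - i + 1) * sSym n (n - i)) *
        Complex.exp (2 * Real.pi * Complex.I * z J) ^ i) n, ← Finset.sum_range_reflect]
      have h0 := sum_evalZ_sSym z J
      rw [Finset.sum_range_succ', sSym_zero, map_one] at h0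
      simp only [pow_zero, one_mul, Nat.sub_zero] at h0
      rw [hj, eq_comm, ← sub_eq_zero, ← h0, add_comm, sub_eq_add_neg, add_right_inj,
        ← Finset.sum_neg_distrib]
      refine Finset.sum_congr rfl fun i hi => ?_
      rw [Finset.mem_range] at hi
      rw [show n - (n - 1 - i) = i + 1 by omega, show n - (i + 1) = n - 1 - i by omega,
        map_mul, map_pow, map_neg, map_one, pow_succ (-1 : ℂ) (i + 1)]
      ring
    · rw [Finset.sum_eq_single ⟨j.val + 1, by omega⟩]
      · simp [companion, hj]
      · intro i _ hi
        rw [companion, if_neg hj, if_neg (by simpa [Fin.ext_iff] using hi)]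
        simp
      · simp
  have h2 := congrArg (· * evalZ z (v j)) h
  simp only [Finset.sum_mul, pow_succ] at h2
  rw [show Complex.exp (2 * Real.pi * Complex.I * z J) * (evalZ z (v j) *
    Complex.exp (2 * Real.pi * Complex.I * z J) ^ j.val) = Complex.exp (2 * Real.pi * Complex.I * z J) ^ j.val *
    Complex.exp (2 * Real.pi * Complex.I * z J) * evalZ z (v j) by ring, ← h2]
  exact Finset.sum_congr rfl fun i _ => by ring

theorem evalX_companion_zpow (z : Fin n → ℂ) (J : Fin n) (k : ℤ) (v : M n) :
    evalX z J ((companion n ^ k).mulVec v) =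
      Complex.exp (2 * Real.pi * Complex.I * z J) ^ k * evalX z J v := by
  induction k using Int.induction_on generalizing v with
  | zero => simp
  | succ i ih =>
    rw [Matrix.zpow_add_one isUnit_det_companion, ← Matrix.mulVec_mulVec, ih, evalX_companion,
      zpow_add_one₀ (Complex.exp_ne_zero _)]
    ring
  | pred i ih =>
    have h := evalX_companion z J ((companion n)⁻¹.mulVec v)
    rw [Matrix.mulVec_mulVec, Matrix.mul_nonsing_inv _ isUnit_det_companion, Matrix.one_mulVec] at h
    rw [Matrix.zpow_sub_one isUnit_det_companion, ← Matrix.mulVec_mulVec, ih, h,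
      zpow_sub_one₀ (Complex.exp_ne_zero _)]
    have := Complex.exp_ne_zero (2 * Real.pi * Complex.I * z J)
    field_simp

theorem evalX_powX (z : Fin n → ℂ) (J : Fin n) (k : ℤ) :
    evalX z J (powX n k) = Complex.exp (2 * Real.pi * Complex.I * z J) ^ k := by
  rw [powX, evalX_companion_zpow]
  have : evalX z J (fun i : Fin n => if i.val = 0 then 1 else 0) = 1 := by
    rw [evalX, Finset.sum_eq_single (⟨0, J.pos⟩ : Fin n)]
    · simp
    · intro b _ hb
      rw [if_neg (by simpa [Fin.ext_iff] using hb)]; simp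
    · simp
  rw [this, mul_one]

/-- A class f(X, Z) is sent to `∑_J f(Z_J, Z) Ψ_J`, so all questions about images reduce to the
values at the roots. -/
theorem toSolution_eq (v : M n) (τ : ℂ) (z : Fin n → ℂ) :
    toSolution v τ z = ∑ J, evalX z J v • PsiJ J τ z := by
  simp only [toSolution, Psi, evalX, Finset.smul_sum, Finset.sum_smul]
  rw [Finset.sum_comm]
  refine Finset.sum_congr rfl fun J _ => Finset.sum_congr rfl fun j _ => ?_
  rw [smul_smul, add_sub_cancel_right, zpow_natCast]

theorem toSolution_powX (k : ℤ) (τ : ℂ) (z : Fin n → ℂ) :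
    toSolution (powX n k) τ z = Psi (k + 1) τ z := by
  rw [toSolution_eq, Psi]
  simp only [evalX_powX, add_sub_cancel_right]

end Eval
end EquivQDE
namespace EquivQDE

/-! ### Coordinates in the basis g and the operators in them -/

section Coordinates
variable {n : ℕ} (z : Fin n → ℂ)

theorem gBasis_apply (i : Fin n) : gBasis z i = gElem z i := by
  rw [gBasis, coe_basisOfTopLeSpanOfCardEqFinrank]

theorem coord_gElem (i j : Fin n) : coord z (gElem z i) j = if i = j then 1 else 0 := by
  rw [coord, ← gBasis_apply, Module.Basis.equivFun_self]

theorem coord_add (v w : HT z) (i : Fin n) : coord z (v + w) i = coord z v i + coord z w i := by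
  simp [coord]

theorem coord_sub (v w : HT z) (i : Fin n) : coord z (v - w) i = coord z v i - coord z w i := by
  simp [coord]

theorem coord_smul (c : ℂ) (v : HT z) (i : Fin n) : coord z (c • v) i = c * coord z v i := by
  simp [coord]

theorem coord_sum {ι : Type*} (s : Finset ι) (f : ι → HT z) (i : Fin n) :
    coord z (∑ a ∈ s, f a) i = ∑ a ∈ s, coord z (f a) i := by
  simp [coord]

theorem sum_coord (v : HT z) : ∑ i, coord z v i • gElem z i = v := by
  simp only [coord, ← gBasis_apply]
  exact (gBasis z).sum_equivFun v

variable {z} in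
theorem coord_ext {v w : HT z} (h : ∀ i, coord z v i = coord z w i) : v = w := by
  rw [← sum_coord z v, ← sum_coord z w]
  simp only [h]

/-- The class with given coordinates. -/
noncomputable def ofCoord (c : Fin n → ℂ) : HT z := (gBasis z).equivFun.symm c

theorem coord_ofCoord (c : Fin n → ℂ) (i : Fin n) : coord z (ofCoord z c) i = c i := by
  rw [coord, ofCoord, LinearEquiv.apply_symm_apply]

theorem linear_eq_sum_coord {E : Type*} [AddCommGroup E] [Module ℂ E] (L : HT z →ₗ[ℂ] E)
    (v : HT z) : L v = ∑ i, coord z v i • L (gElem z i) := by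
  conv_lhs => rw [← sum_coord z v]
  rw [map_sum]
  simp only [map_smul]

/-- Lets an operator act on an integrand term by term, as the qKZ verification requires. -/
theorem hasSum_linear {w : ℕ → HT z} {κ : ℕ → ℂ} {v : HT z}
    (h : ∀ i, HasSum (fun r => κ r * coord z (w r) i) (coord z v i)) (L : HT z →ₗ[ℂ] ℂ) :
    HasSum (fun r => κ r * L (w r)) (L v) := by
  rw [linear_eq_sum_coord z L v]
  have := hasSum_sum (s := Finset.univ) (fun i _ => (h i).mul_right (L (gElem z i)))
  convert! this using 2 with r
  rw [linear_eq_sum_coord z L (w r), Finset.mul_sum]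
  exact Finset.sum_congr rfl fun i _ => by rw [smul_eq_mul, mul_assoc]

/-- The difference `∏(u - z_a) - ∏(x - z_a)` telescopes when the factors are exchanged one at a time
in the given order; the second product vanishes in the algebra, and `u - x` can be cancelled. -/
theorem yPoly_eq : yPoly z = ∑ i, (∏ a ∈ Finset.Iio i, (X - C (algebraMap ℂ (HT z) (z a)))) *
    C (gElem z i) := by
  set Y := ∑ i, (∏ a ∈ Finset.Iio i, (X - C (algebraMap ℂ (HT z) (z a)))) * C (gElem z i)
  have hroot : ∏ a : Fin n, (xi z - algebraMap ℂ (HT z) (z a)) = 0 := by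
    have h2 : AdjoinRoot.mk (relPoly z) (∏ a, (X - C (z a))) = 0 := AdjoinRoot.mk_self
    rw [map_prod] at h2
    simpa [xi, AdjoinRoot.algebraMap_eq] using h2
  have h := Finset.prod_sub_ordered (Finset.univ : Finset (Fin n))
    (fun a => C (xi z - algebraMap ℂ (HT z) (z a))) (fun _ => C (xi z) - X)
  have h1 : (relPoly z).map (algebraMap ℂ (HT z)) = (X - C (xi z)) * Y := by
    change Polynomial.map _ (∏ a, (X - C (z a))) = _
    rw [Polynomial.map_prod]
    have e1 : ∀ a, (X - C (z a)).map (algebraMap ℂ (HT z)) =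
        C (xi z - algebraMap ℂ (HT z) (z a)) - (C (xi z) - X) := by
      intro a; simp
    simp only [e1]
    rw [h, ← map_prod, hroot, map_zero, zero_sub, Finset.mul_sum, ← Finset.sum_neg_distrib]
    refine Finset.sum_congr rfl fun i _ => ?_
    rw [gElem, map_prod]
    have e2 : ∀ a, C (xi z - algebraMap ℂ (HT z) (z a)) - (C (xi z) - X) =
        X - C (algebraMap ℂ (HT z) (z a)) := by
      intro a; rw [map_sub]; ring
    simp only [e2]
    have e3 : (Finset.univ.filter fun j => j < i) = Finset.Iio i := by ext; simp
    have e4 : (Finset.univ.filter fun j => i < j) = Finset.Ioi i := by ext; simp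
    rw [e3, e4]
    ring
  rw [yPoly, h1, mul_divByMonic_cancel_left _ (monic_X_sub_C _)]

theorem eval_yPoly (t : ℂ) : (yPoly z).eval (algebraMap ℂ (HT z) t) =
    ∑ i, (∏ a ∈ Finset.Iio i, (t - z a)) • gElem z i := by
  rw [yPoly_eq, eval_finsetSum]
  refine Finset.sum_congr rfl fun i _ => ?_
  rw [eval_mul, eval_prod, eval_C, Algebra.smul_def, map_prod]
  simp

/-- The coordinates of `∏_j (y_j - t)`. -/
noncomputable def weightCoord (t : ℂ) (i : Fin n) : ℂ :=
  (-1) ^ (n - 1 - i.val) * ∏ a ∈ Finset.Iio i, (z a - t)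

theorem coord_weight (t : ℂ) (i : Fin n) : coord z (weight t z) i = weightCoord z t i := by
  have h1 : weight t z = ((-1 : ℂ) ^ (n - 1)) • ∑ i, (∏ a ∈ Finset.Iio i, (t - z a)) • gElem z i := by
    rw [weight, eval_yPoly, Algebra.smul_def]
    simp
  rw [h1, coord_smul, coord_sum, Finset.sum_eq_single i]
  · rw [coord_smul, coord_gElem, if_pos rfl, mul_one, weightCoord]
    have h2 : ∏ a ∈ Finset.Iio i, (t - z a) = (-1) ^ i.val * ∏ a ∈ Finset.Iio i, (z a - t) := by
      have : ∀ a, t - z a = (-1) * (z a - t) := fun a => by ring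
      simp_rw [this, Finset.prod_mul_distrib, Finset.prod_const, Fin.card_Iio]
    rw [h2, ← mul_assoc, ← pow_add, show n - 1 + i.val = (n - 1 - i.val) + 2 * i.val by omega,
      pow_add, pow_mul]
    simp
  · intro j _ hj
    rw [coord_smul, coord_gElem, if_neg hj, mul_zero]
  · simp

/-- This is the defining relation of the Chern roots at `u = t`. It makes the weight invertible for
t away from the `z_a`, with inverse `(x - t) / ∏ (z_a - t)`. -/
theorem sub_mul_weight (t : ℂ) :
    (xi z - algebraMap ℂ (HT z) t) * weight t z = algebraMap ℂ (HT z) (∏ a, (z a - t)) := by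
  -- For `n = 0` the algebra is the zero ring, and the truncated exponent `n - 1` would spoil the
  -- sign computation.
  rcases Nat.eq_zero_or_pos n with rfl | hn
  · have h : (1 : HT z) = 0 := by
      have h2 : AdjoinRoot.mk (relPoly z) (∏ a, (X - C (z a))) = 0 := AdjoinRoot.mk_self
      rwa [Finset.univ_eq_empty, Finset.prod_empty, map_one] at h2
    rw [← mul_one (_ * _), h, mul_zero, ← mul_one (algebraMap _ _ _), h, mul_zero]
  have hrel : (relPoly z).map (algebraMap ℂ (HT z)) =
      ∏ a, (X - C (algebraMap ℂ (HT z) (z a))) := by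
    change Polynomial.map _ (∏ a, (X - C (z a))) = _
    rw [Polynomial.map_prod]
    simp
  have h := congrArg (Polynomial.eval (algebraMap ℂ (HT z) t))
    (Polynomial.mul_divByMonic_eq_iff_isRoot (p := (relPoly z).map (algebraMap ℂ (HT z)))
      (a := xi z) |>.2 (by
        rw [Polynomial.IsRoot, Polynomial.eval_map_algebraMap]
        exact (AdjoinRoot.aeval_eq _).trans AdjoinRoot.mk_self))
  rw [eval_mul, eval_sub, eval_X, eval_C, hrel, eval_prod] at h
  simp only [eval_sub, eval_X, eval_C, ← map_sub] at h
  rw [← map_prod] at h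
  have h2 : ∏ a, (z a - t) = (-1) ^ n * ∏ a, (t - z a) := by
    have : ∀ a, z a - t = (-1) * (t - z a) := fun a => by ring
    simp_rw [this, Finset.prod_mul_distrib, Finset.prod_const, Finset.card_fin]
  rw [h2, map_mul, ← h, weight, yPoly, hrel]
  simp only [map_pow, map_neg, map_one]
  obtain ⟨m, rfl⟩ : ∃ m, n = m + 1 := ⟨n - 1, by omega⟩
  rw [Nat.add_sub_cancel, pow_succ]
  ring

theorem xi_mul_gElem (i : Fin n) : xi z * gElem z i = z i • gElem z i +
    if h : i.val = 0 then 0 else gElem z ⟨i.val - 1, by omega⟩ := by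
  have h1 : xi z * gElem z i = z i • gElem z i +
      ∏ a ∈ Finset.Ici i, (xi z - algebraMap ℂ (HT z) (z a)) := by
    have h : Finset.Ici i = insert i (Finset.Ioi i) := by
      ext a; simp [le_iff_eq_or_lt]
    rw [h, Finset.prod_insert (by simp), Algebra.smul_def]
    change _ = _ + (xi z - _) * gElem z i
    ring
  rw [h1]
  congr 1
  split_ifs with hi
  · have h : Finset.Ici i = Finset.univ := by
      ext a
      simp [Fin.le_def, hi]
    rw [h]
    have h2 : AdjoinRoot.mk (relPoly z) (∏ a, (X - C (z a))) = 0 := AdjoinRoot.mk_self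
    rw [map_prod] at h2
    simpa [xi, AdjoinRoot.algebraMap_eq] using h2
  · rw [gElem]
    congr 1
    ext a
    simp only [Finset.mem_Ici, Finset.mem_Ioi, Fin.le_def, Fin.lt_def]
    omega

theorem one_eq_gElem (i : Fin n) (hi : i.val + 1 = n) : (1 : HT z) = gElem z i := by
  have h : Finset.Ioi i = ∅ := by
    ext a
    simp only [Finset.mem_Ioi, Fin.lt_def, Finset.notMem_empty, iff_false]
    omega
  rw [gElem, h, Finset.prod_empty]

theorem coord_xi_mul (v : HT z) (j : Fin n) : coord z (xi z * v) j =
    z j * coord z v j + if h : j.val + 1 < n then coord z v ⟨j.val + 1, h⟩ else 0 := by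
  conv_lhs => rw [← sum_coord z v]
  rw [Finset.mul_sum, coord_sum]
  simp only [mul_smul_comm, coord_smul, xi_mul_gElem, coord_add, coord_gElem, mul_add,
    Finset.sum_add_distrib]
  congr 1
  · simp [mul_comm]
  · split_ifs with h
    · rw [Finset.sum_eq_single ⟨j.val + 1, h⟩]
      · simp [coord_gElem]
      · intro i _ hi
        split_ifs with h0
        · simp [coord]
        · rw [coord_gElem, if_neg, mul_zero]
          intro h2
          apply hi
          ext
          have := congrArg Fin.val h2
          simp at this ⊢
          omega
      · simp
    · refine Finset.sum_eq_zero fun i _ => ?_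
      split_ifs with h0
      · simp [coord]
      · rw [coord_gElem, if_neg, mul_zero]
        intro h2
        have := congrArg Fin.val h2
        simp at this
        omega

/-- The g's are represented by monic polynomials of degrees `n - 1, …, 0`, so only the first has a
coefficient at `x^{n-1}`. Hence the quantum correction sees only the first coordinate. -/
theorem topCoeff_gElem (i : Fin n) :
    ((Polynomial.lcoeff ℂ (n - 1)).comp
      (AdjoinRoot.modByMonicHom (relPoly_monic z))) (gElem z i) = if i.val = 0 then 1 else 0 := by
  have h1 : gElem z i = AdjoinRoot.mk (relPoly z) (∏ a ∈ Finset.Ioi i, (X - C (z a))) := by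
    rw [map_prod]
    simp [gElem, xi, AdjoinRoot.algebraMap_eq]
  have hm : (∏ a ∈ Finset.Ioi i, (X - C (z a))).Monic :=
    monic_prod_of_monic _ _ fun a _ => monic_X_sub_C (z a)
  have hd : (∏ a ∈ Finset.Ioi i, (X - C (z a))).natDegree = n - 1 - i.val := by
    rw [natDegree_prod_of_monic _ _ fun a _ => monic_X_sub_C (z a)]
    simp
  rw [h1, LinearMap.comp_apply, AdjoinRoot.modByMonicHom_mk, (modByMonic_eq_self_iff (relPoly_monic z)).2]
  · rw [lcoeff_apply]
    split_ifs with h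
    · have := hm.coeff_natDegree
      rwa [hd, h, Nat.sub_zero] at this
    · exact coeff_eq_zero_of_natDegree_lt (by rw [hd]; omega)
  · refine Polynomial.degree_lt_degree ?_
    rw [hd, relPoly_natDegree]
    omega

/-- Quantum multiplication in coordinates. -/
theorem coord_quantumMul (p : ℂ) (v : HT z) (j : Fin n) :
    coord z (quantumMul p z v) j = z j * coord z v j +
      if h : j.val + 1 < n then coord z v ⟨j.val + 1, h⟩ else p * coord z v ⟨0, j.pos⟩ := by
  have h1 : ((Polynomial.lcoeff ℂ (n - 1)).comp
      (AdjoinRoot.modByMonicHom (relPoly_monic z))) v = coord z v ⟨0, j.pos⟩ := by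
    rw [linear_eq_sum_coord z _ v, Finset.sum_eq_single ⟨0, j.pos⟩]
    · rw [topCoeff_gElem]; simp
    · intro i _ hi
      rw [topCoeff_gElem, if_neg (by simpa [Fin.ext_iff] using hi), smul_zero]
    · simp
  rw [quantumMul, LinearMap.add_apply, LinearMap.smulRight_apply, LinearMap.mulLeft_apply, h1,
    coord_add, coord_xi_mul, add_assoc, coord_smul, Algebra.algebraMap_eq_smul_one, coord_smul,
    one_eq_gElem z ⟨n - 1, by have := j.pos; omega⟩ (by have := j.pos; simp only; omega),
    coord_gElem]
  congr 1
  split_ifs with h h2 h2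
  · have := congrArg Fin.val h2; simp at this; omega
  · simp
  · ring
  · exact absurd (Fin.ext (by simp only; omega)) h2

variable {z} in
theorem coord_rMatrix {a b : Fin n} (hab : a ≠ b) (u : ℂ) (v : HT z) (j : Fin n) :
    coord z (rMatrix z a b u v) j = if j = a then coord z v b + u * coord z v a
      else if j = b then coord z v a else coord z v j := by
  have hg : ∀ i, rMatrix z a b u (gElem z i) = if i = b then gElem z a else
      if i = a then gElem z b + u • gElem z a else gElem z i := by
    intro i
    conv_lhs => rw [← gBasis_apply, rMatrix, Module.Basis.constr_basis]
  rw [linear_eq_sum_coord z (rMatrix z a b u) v, coord_sum]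
  have h : ∀ i, coord z (coord z v i • rMatrix z a b u (gElem z i)) j =
      coord z v i * if i = b then (if a = j then 1 else 0) else
      if i = a then (if b = j then 1 else 0) + u * (if a = j then 1 else 0) else
        if i = j then 1 else 0 := by
    intro i
    rw [coord_smul, hg]
    congr 1
    split_ifs <;> simp_all [coord_add, coord_smul, coord_gElem]
  simp only [h]
  rw [← Finset.add_sum_erase _ _ (Finset.mem_univ b), ← Finset.add_sum_erase _ _
    (Finset.mem_erase.2 ⟨hab, Finset.mem_univ a⟩)]
  simp only [if_true, if_neg hab]
  have h2 : ∀ i ∈ (Finset.univ.erase b).erase a, (coord z v i * if i = b then (if a = j then (1 : ℂ) else 0) else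
      if i = a then (if b = j then 1 else 0) + u * (if a = j then 1 else 0) else
        if i = j then 1 else 0) = if j = i then coord z v i else 0 := by
    intro i hi
    simp only [Finset.mem_erase] at hi
    rw [if_neg hi.2.1, if_neg hi.1]
    simp [eq_comm]
  rw [Finset.sum_congr rfl h2, Finset.sum_ite_eq]
  simp only [Finset.mem_erase, Finset.mem_univ, and_true]
  by_cases h3 : j = a
  · subst h3; simp [hab, hab.symm, mul_comm]
  · by_cases h4 : j = b
    · subst h4; simp [h3, Ne.symm h3]
    · simp [h3, h4, Ne.symm h3, Ne.symm h4]

theorem coord_pPowNegE (p : ℂ) (i : Fin n) (v : HT z) (j : Fin n) :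
    coord z (pPowNegE p z i v) j = if j = i then p⁻¹ * coord z v j else coord z v j := by
  have hg : ∀ a, pPowNegE p z i (gElem z a) = if a = i then p⁻¹ • gElem z a else gElem z a := by
    intro a
    conv_lhs => rw [← gBasis_apply, pPowNegE, Module.Basis.constr_basis]
  rw [linear_eq_sum_coord z (pPowNegE p z i) v, coord_sum, Finset.sum_eq_single j]
  · rw [coord_smul, hg]
    split_ifs <;> simp [coord_smul, coord_gElem, mul_comm]
  · intro a _ ha
    rw [coord_smul, hg]
    split_ifs <;> simp [coord_smul, coord_gElem, ha]
  · simp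

end Coordinates
end EquivQDE
namespace EquivQDE

/-! ### The R-matrices acting on the weight functions -/

section QKZ
variable {n : ℕ} (z : Fin n → ℂ)

/-- `∏_{a < m, a ≠ i} (z_a - t)`. -/
noncomputable def omitProd (t : ℂ) (i : Fin n) (m : ℕ) : ℂ :=
  ∏ a ∈ Finset.univ.filter (fun a : Fin n => a.val < m ∧ a ≠ i), (z a - t)

theorem omitProd_succ (t : ℂ) (i : Fin n) {m : ℕ} (hm : m < n) (hi : i.val ≠ m) :
    omitProd z t i (m + 1) = (z ⟨m, hm⟩ - t) * omitProd z t i m := by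
  have h : (Finset.univ.filter fun a : Fin n => a.val < m + 1 ∧ a ≠ i) =
      insert ⟨m, hm⟩ (Finset.univ.filter fun a : Fin n => a.val < m ∧ a ≠ i) := by
    ext a
    simp only [Finset.mem_filter, Finset.mem_univ, true_and, Finset.mem_insert, Fin.ext_iff, ne_eq]
    omega
  rw [omitProd, h, Finset.prod_insert (by simp), omitProd]

theorem omitProd_zero (t : ℂ) (i : Fin n) : omitProd z t i 0 = 1 := by simp [omitProd]

theorem omitProd_congr {z w : Fin n → ℂ} {i : Fin n} (h : ∀ a ≠ i, z a = w a) (t : ℂ) (m : ℕ) :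
    omitProd z t i m = omitProd w t i m := by
  refine Finset.prod_congr rfl fun a ha => ?_
  rw [h a (Finset.mem_filter.1 ha).2.2]

theorem weightCoord_of_le (t : ℂ) {i j : Fin n} (h : j ≤ i) :
    weightCoord z t j = (-1) ^ (n - 1 - j.val) * omitProd z t i j.val := by
  rw [weightCoord, omitProd]
  congr 2
  ext a
  simp only [Finset.mem_Iio, Finset.mem_filter, Finset.mem_univ, true_and, Fin.lt_def, Fin.ext_iff,
    ne_eq]
  rw [Fin.le_def] at h
  omega

theorem weightCoord_of_lt (t : ℂ) {i j : Fin n} (h : i < j) :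
    weightCoord z t j = (-1) ^ (n - 1 - j.val) * ((z i - t) * omitProd z t i j.val) := by
  have h2 : Finset.Iio j =
      insert i (Finset.univ.filter fun a : Fin n => a.val < j.val ∧ a ≠ i) := by
    ext a
    simp only [Finset.mem_filter, Finset.mem_univ, true_and, Finset.mem_insert, Fin.ext_iff, ne_eq,
      Finset.mem_Iio, Fin.lt_def] at h ⊢
    omega
  rw [weightCoord, h2, Finset.prod_insert (by simp), omitProd]

theorem filter_take_succ (p : Fin n → Prop) [DecidablePred p] {m : ℕ} (hm : m < n) :
    ((List.finRange n).take (m + 1)).filter p = ((List.finRange n).take m).filter p ++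
      if p ⟨m, hm⟩ then [⟨m, hm⟩] else [] := by
  have h : m < (List.finRange n).length := by simpa using hm
  rw [← List.take_concat_get' _ _ h, List.filter_append, List.getElem_finRange]
  congr 1
  simp [List.filter_cons]

variable {z} in
theorem prod_filter_take_succ (p : Fin n → Prop) [DecidablePred p] (f : Fin n → Module.End ℂ (HT z))
    {m : ℕ} (hm : m < n) (hp : p ⟨m, hm⟩) :
    (((((List.finRange n).take (m + 1)).filter p).reverse.map f).prod : Module.End ℂ (HT z)) =
      f ⟨m, hm⟩ * ((((List.finRange n).take m).filter p).reverse.map f).prod := by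
  rw [filter_take_succ p hm, if_pos hp]
  simp

theorem neg_one_pow_sub {m : ℕ} (hm : m < n) : (-1 : ℂ) ^ (n - m) = -(-1) ^ (n - 1 - m) := by
  rw [show n - m = (n - 1 - m) + 1 by omega, pow_succ]
  ring

/-- The product `R_{i,n}(z_i - z_n) ⋯ R_{i,i+1}(z_i - z_{i+1})`. -/
noncomputable def upperR (i : Fin n) : Module.End ℂ (HT z) :=
  (((List.finRange n).filter (i < ·)).reverse.map fun b => rMatrix z i b (z i - z b)).prod

/-- The product `R_{i,i-1}(z_i - z_{i-1} - 1) ⋯ R_{i,1}(z_i - z_1 - 1)`. -/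
noncomputable def lowerR (i : Fin n) : Module.End ℂ (HT z) :=
  (((List.finRange n).filter (· < i)).reverse.map fun b => rMatrix z i b (z i - z b - 1)).prod

/-- Induction on the number m of processed indices. The coordinate along `g_i` always carries the
product with the factor `z_i - t` omitted, and a new R-matrix adds the factor of its index b by
`(z_i - t) - (z_i - z_b) = z_b - t`. -/
theorem coord_upperR_aux (t : ℂ) (i : Fin n) (v : HT z) (hv : ∀ j, coord z v j = weightCoord z t j)
    (m : ℕ) (hm : i.val + 1 ≤ m) : m ≤ n → ∀ j,
    coord z (((((List.finRange n).take m).filter (i < ·)).reverse.map fun b =>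
      rMatrix z i b (z i - z b)).prod v) j =
      if j = i then (-1) ^ (n - m) * omitProd z t i m
      else if i < j ∧ j.val < m then (-1) ^ (n - j.val) * omitProd z t i j.val
      else weightCoord z t j := by
  induction m, hm using Nat.le_induction with
  | base =>
    intro hn j
    have h : ((List.finRange n).take (i.val + 1)).filter (i < ·) = [] := by
      rw [List.filter_eq_nil_iff]
      intro a ha
      obtain ⟨k, hk, rfl⟩ := List.mem_take_iff_getElem.1 ha
      simp only [List.getElem_finRange, Fin.lt_def, decide_eq_true_eq]
      simp at hk ⊢
      omega
    rw [h, List.reverse_nil, List.map_nil, List.prod_nil, Module.End.one_apply, hv]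
    split_ifs with h1 h2
    · subst h1
      rw [weightCoord_of_le z t le_rfl, show n - (j.val + 1) = n - 1 - j.val by omega]
      congr 1
      rw [omitProd, omitProd]
      congr 1
      ext a
      simp only [Finset.mem_filter, Finset.mem_univ, true_and, Fin.ext_iff, ne_eq]
      omega
    · rw [Fin.lt_def] at h2; omega
    · rfl
  | succ m hm ih =>
    intro hn j
    have hm' : i < (⟨m, by omega⟩ : Fin n) := by rw [Fin.lt_def]; simp only; omega
    have e1 := ih (by omega) ⟨m, by omega⟩
    rw [if_neg hm'.ne', if_neg (by simp)] at e1
    have e2 := ih (by omega) i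
    rw [if_pos rfl] at e2
    rw [prod_filter_take_succ (i < ·) _ (by omega : m < n) hm', Module.End.mul_apply,
      coord_rMatrix hm'.ne, e1, e2, ih (by omega) j, weightCoord_of_lt z t hm', neg_one_pow_sub (by omega : m < n),
      omitProd_succ z t i (by omega : m < n) (by omega), show n - (m + 1) = n - 1 - m by omega]
    have hne : i.val ≠ m := by omega
    by_cases h1 : j = i
    · rw [if_pos h1, if_pos h1]
      ring
    · rw [if_neg h1, if_neg h1, if_neg h1]
      by_cases h2 : j = ⟨m, by omega⟩
      · subst h2
        rw [if_pos rfl, if_pos ⟨hm', by simp⟩, neg_one_pow_sub (by omega : m < n)]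
      · rw [if_neg h2]
        have h3 : j.val ≠ m := fun h => h2 (Fin.ext h)
        congr 1
        rw [eq_iff_iff]
        omega

theorem coord_upperR (t : ℂ) (i : Fin n) (j : Fin n) :
    coord z (upperR z i (weight t z)) j =
      if j = i then omitProd z t i n
      else if i < j then (-1) ^ (n - j.val) * omitProd z t i j.val
      else weightCoord z t j := by
  have h := coord_upperR_aux z t i _ (coord_weight z t) n i.2 le_rfl j
  rw [List.take_of_length_le (by simp)] at h
  rw [upperR, h]
  simp

/-- The same mechanism with shifted arguments: `(z_i - 1 - t) - (z_i - z_b - 1) = z_b - t`. The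
vector v is what arises from the upper product when its coordinate along `g_i` is replaced by
`(-1)^n` and all others are multiplied by `z_i - 1 - t`. -/
theorem coord_lowerR_aux (t : ℂ) (i : Fin n) (v : HT z)
    (hv : ∀ j, coord z v j = if j = i then (-1) ^ n else (z i - 1 - t) *
      coord z (upperR z i (weight t z)) j) (m : ℕ) : m ≤ i.val → ∀ j,
    coord z (((((List.finRange n).take m).filter (· < i)).reverse.map fun b =>
      rMatrix z i b (z i - z b - 1)).prod v) j =
      if j = i then (-1) ^ (n - m) * omitProd z t i m
      else if j.val < m then (-1) ^ (n - j.val) * omitProd z t i j.val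
      else coord z v j := by
  induction m with
  | zero =>
    intro hn j
    rw [List.take_zero, List.filter_nil, List.reverse_nil, List.map_nil, List.prod_nil,
      Module.End.one_apply, Nat.sub_zero, omitProd_zero, mul_one]
    split_ifs with h
    · rw [hv, if_pos h]
    · omega
    · rfl
  | succ m ih =>
    intro hn j
    have hm : m < n := by omega
    have hm' : (⟨m, hm⟩ : Fin n) < i := by rw [Fin.lt_def]; simp only; omega
    have e1 := ih (by omega) ⟨m, hm⟩
    rw [if_neg hm'.ne, if_neg (by simp)] at e1
    have e2 := ih (by omega) i
    rw [if_pos rfl] at e2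
    have e3 := hv ⟨m, hm⟩
    rw [if_neg hm'.ne, coord_upperR, if_neg hm'.ne, if_neg (not_lt.2 hm'.le),
      weightCoord_of_le z t hm'.le] at e3
    rw [prod_filter_take_succ (· < i) _ hm hm', Module.End.mul_apply,
      coord_rMatrix hm'.ne', e1, e2, ih (by omega) j, e3, neg_one_pow_sub hm,
      omitProd_succ z t i hm (by omega), show n - (m + 1) = n - 1 - m by omega]
    by_cases h1 : j = i
    · rw [if_pos h1, if_pos h1]
      ring
    · rw [if_neg h1, if_neg h1, if_neg h1]
      by_cases h2 : j = ⟨m, hm⟩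
      · subst h2
        rw [if_pos rfl, if_pos (by simp), neg_one_pow_sub hm]
      · rw [if_neg h2]
        have h3 : j.val ≠ m := fun h => h2 (Fin.ext h)
        congr 1
        rw [eq_iff_iff]
        omega

/-- The effect of the lower product of R-matrices on the weight functions. -/
theorem coord_lowerR (t : ℂ) (i : Fin n) (v : HT z)
    (hv : ∀ j, coord z v j = if j = i then (-1) ^ n else (z i - 1 - t) *
      coord z (upperR z i (weight t z)) j) (j : Fin n) :
    coord z (lowerR z i v) j = -weightCoord (z - Pi.single i 1) t j := by
  have hc : ∀ m, omitProd (z - Pi.single i 1) t i m = omitProd z t i m := fun m =>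
    omitProd_congr (fun a ha => by simp [ha]) t m
  have h := coord_lowerR_aux z t i v hv i.val le_rfl j
  have e : (List.finRange n).filter (· < i) = ((List.finRange n).take i.val).filter (· < i) := by
    conv_lhs => rw [← List.take_append_drop i.val (List.finRange n), List.filter_append]
    have hd : ((List.finRange n).drop i.val).filter (· < i) = [] := ?_
    · rw [hd, List.append_nil]
    rw [List.filter_eq_nil_iff]
    intro a ha
    obtain ⟨k, hk, rfl⟩ := List.mem_drop_iff_getElem.1 ha
    simp [Fin.lt_def]
  rw [← e] at h
  rw [lowerR, h]
  by_cases h1 : j = i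
  · subst h1
    rw [if_pos rfl, weightCoord_of_le _ t le_rfl, hc, neg_one_pow_sub j.2]
    ring
  · rw [if_neg h1]
    by_cases h2 : j.val < i.val
    · rw [if_pos h2, weightCoord_of_le _ t (i := i) (by rw [Fin.le_def]; omega), hc,
        neg_one_pow_sub j.2]
      ring
    · have h3 : i < j := by
        rw [Fin.lt_def]
        have : j.val ≠ i.val := fun h => h1 (Fin.ext h)
        omega
      rw [if_neg h2, hv, if_neg h1, coord_upperR, if_neg h1, if_pos h3, weightCoord_of_lt _ t h3, hc,
        neg_one_pow_sub j.2]
      simp only [Pi.sub_apply, Pi.single_eq_same]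
      ring

theorem qkzOp_apply (p : ℂ) (i : Fin n) (v : HT z) :
    qkzOp p z i v = lowerR z i (pPowNegE p z i (upperR z i v)) := rfl

/-- The projection along `g_i`. -/
noncomputable def dropCoord (i : Fin n) : Module.End ℂ (HT z) :=
  (gBasis z).constr ℂ fun j => if j = i then 0 else gElem z j

theorem coord_dropCoord (i : Fin n) (v : HT z) (j : Fin n) :
    coord z (dropCoord z i v) j = if j = i then 0 else coord z v j := by
  have hg : ∀ a, dropCoord z i (gElem z a) = if a = i then 0 else gElem z a := by
    intro a
    conv_lhs => rw [← gBasis_apply, dropCoord, Module.Basis.constr_basis]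
  rw [linear_eq_sum_coord z (dropCoord z i) v, coord_sum, Finset.sum_eq_single j]
  · rw [coord_smul, hg]
    split_ifs
    · simp [coord]
    · rw [coord_gElem, if_pos rfl, mul_one]
  · intro a _ ha
    rw [coord_smul, hg]
    split_ifs
    · simp [coord]
    · rw [coord_gElem, if_neg ha, mul_zero]
  · simp

/-- The coordinate along `g_i` is split off because its integral is evaluated separately: it
produces a factor p that cancels the `p⁻¹`. -/
theorem pPowNegE_eq (p : ℂ) (i : Fin n) (v : HT z) :
    pPowNegE p z i v = dropCoord z i v + (p⁻¹ * coord z v i) • gElem z i := by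
  refine coord_ext fun j => ?_
  rw [coord_pPowNegE, coord_add, coord_dropCoord, coord_smul, coord_gElem]
  by_cases h : j = i
  · subst h; simp
  · simp [h, Ne.symm h]

/-- The pointwise identity in t behind the difference equation. By linearity the two summands
separate the dropped coordinate from the rest, so that they can be summed over the poles
independently. -/
theorem coord_lowerR_dropCoord (t : ℂ) (i j : Fin n) :
    (z i - 1 - t) * coord z (lowerR z i (dropCoord z i (upperR z i (weight t z)))) j +
      (-1) ^ n * coord z (lowerR z i (gElem z i)) j = -weightCoord (z - Pi.single i 1) t j := by
  rw [← coord_lowerR z t i ((z i - 1 - t) • dropCoord z i (upperR z i (weight t z)) +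
    ((-1 : ℂ) ^ n) • gElem z i), map_add, map_smul, map_smul, coord_add, coord_smul, coord_smul]
  intro k
  rw [coord_add, coord_smul, coord_smul, coord_dropCoord, coord_gElem]
  by_cases h : k = i
  · subst h; simp
  · simp [h, Ne.symm h]

end QKZ
end EquivQDE
namespace EquivQDE

/-! ### The scalar residue series: contiguity, convergence, holomorphy -/

section Series
variable {n : ℕ}

theorem analyticAt_Gamma {s : ℂ} (h : ∀ m : ℕ, s ≠ -m) : AnalyticAt ℂ Complex.Gamma s := by
  have h1 : AnalyticAt ℂ (fun s => (Complex.Gamma s)⁻¹) s := by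
    have := Complex.differentiable_one_div_Gamma
    exact this.analyticAt s
  have h2 := h1.inv (inv_ne_zero (Complex.Gamma_ne_zero h))
  have e : (fun s => (Complex.Gamma s)⁻¹)⁻¹ = Complex.Gamma := by funext s; simp
  rwa [e] at h2

theorem generic_ne {z : Fin n → ℂ} (hz : z ∈ generic n) {a b : Fin n} (h : a ≠ b) (m : ℤ) :
    z a - z b + m ≠ 0 := by
  intro h0
  apply hz a b h (-m)
  push_cast
  linear_combination h0

theorem generic_add {z : Fin n → ℂ} (hz : z ∈ generic n) (m : Fin n → ℤ) :
    (fun a => z a + m a) ∈ generic n := by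
  intro a b hab k h
  apply generic_ne hz hab (m a - m b - k)
  push_cast
  linear_combination h

theorem generic_add_single {z : Fin n → ℂ} (hz : z ∈ generic n) (a : Fin n) :
    z + Pi.single a 1 ∈ generic n := by
  have := generic_add hz (Pi.single a 1)
  convert this using 1
  funext b
  by_cases h : b = a
  · subst h; simp
  · simp [h]

theorem generic_sub_single {z : Fin n → ℂ} (hz : z ∈ generic n) (a : Fin n) :
    z - Pi.single a 1 ∈ generic n := by
  have := generic_add hz (-Pi.single a 1)
  convert this using 1
  funext b
  by_cases h : b = a
  · subst h; simp [sub_eq_add_neg]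
  · simp [h]

/-- `coef z J r = (-1)^r / r! ∏_{b ≠ J} Γ(z_b - z_J - r)`. -/
noncomputable def coef (z : Fin n → ℂ) (J : Fin n) (r : ℕ) : ℂ :=
  (-1) ^ r / r.factorial * ∏ b ∈ Finset.univ.erase J, Complex.Gamma (z b - z J - r)

/-- The terms of the residue series at the poles `z_J + r`. -/
noncomputable def kap (z : Fin n → ℂ) (J : Fin n) (l : ℂ) (r : ℕ) : ℂ :=
  coef z J r * Complex.exp (l * (z J + r))

/-- The sum of the residues at the poles `z_J + r`. -/
noncomputable def fser (z : Fin n → ℂ) (J : Fin n) (l : ℂ) : ℂ := ∑' r, kap z J l r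

/-- The factors with `b ≠ J` come from `Γ(w + 1) = w Γ(w)`. The factor with `b = J` is `-(r + 1)`
and is absorbed by the factorial and the sign. -/
theorem coef_succ_mul {z : Fin n → ℂ} (hz : z ∈ generic n) (J : Fin n) (r : ℕ) :
    coef z J (r + 1) * ∏ a, (z a - (z J + (r + 1 : ℕ))) = coef z J r := by
  rw [coef, coef, ← Finset.mul_prod_erase _ _ (Finset.mem_univ J)]
  have h : ∏ b ∈ Finset.univ.erase J, Complex.Gamma (z b - z J - r) =
      (∏ b ∈ Finset.univ.erase J, Complex.Gamma (z b - z J - (r + 1 : ℕ))) *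
        ∏ b ∈ Finset.univ.erase J, (z b - (z J + (r + 1 : ℕ))) := by
    rw [← Finset.prod_mul_distrib]
    refine Finset.prod_congr rfl fun b hb => ?_
    have hb' := (Finset.mem_erase.1 hb).1
    have h0 : z b - z J - (r + 1 : ℕ) ≠ 0 := by
      have := generic_ne hz hb' (-(r + 1 : ℕ))
      intro h; apply this; push_cast at h ⊢; linear_combination h
    have := Complex.Gamma_add_one _ h0
    rw [← sub_sub, mul_comm, ← this]
    congr 1
    push_cast
    ring
  rw [h, Nat.factorial_succ]
  have h1 : ((r : ℂ) + 1) ≠ 0 := by exact_mod_cast Nat.succ_ne_zero r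
  have h2 : (r.factorial : ℂ) ≠ 0 := by exact_mod_cast r.factorial_ne_zero
  push_cast
  field_simp
  ring

theorem kap_succ_mul {z : Fin n → ℂ} (hz : z ∈ generic n) (J : Fin n) (l : ℂ) (r : ℕ) :
    kap z J l (r + 1) * ∏ a, (z a - (z J + (r + 1 : ℕ))) = Complex.exp l * kap z J l r := by
  rw [kap, kap, ← coef_succ_mul hz J r,
    show l * (z J + (r + 1 : ℕ)) = l + l * (z J + r) by push_cast; ring, Complex.exp_add]
  ring

theorem kap_add_single_of_ne {z : Fin n → ℂ} (hz : z ∈ generic n) {J a : Fin n} (h : J ≠ a) (l : ℂ)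
    (r : ℕ) : kap (z + Pi.single a 1) J l r = kap z J l r * (z a - (z J + r)) := by
  have h0 : z a - z J - r ≠ 0 := by
    have := generic_ne hz h.symm (-r)
    intro h; apply this; push_cast at h ⊢; linear_combination h
  have hm : a ∈ Finset.univ.erase J := Finset.mem_erase.2 ⟨h.symm, Finset.mem_univ a⟩
  rw [kap, kap, coef, coef, ← Finset.mul_prod_erase _ _ hm, ← Finset.mul_prod_erase _ _ hm]
  have e : ∏ b ∈ (Finset.univ.erase J).erase a,
      Complex.Gamma ((z + Pi.single a 1 : Fin n → ℂ) b - (z + Pi.single a 1 : Fin n → ℂ) J - r) =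
      ∏ b ∈ (Finset.univ.erase J).erase a, Complex.Gamma (z b - z J - r) := by
    refine Finset.prod_congr rfl fun b hb => ?_
    simp [(Finset.mem_erase.1 hb).1, h]
  rw [e]
  simp only [Pi.add_apply, Pi.single_eq_same, Pi.single_eq_of_ne h, add_zero]
  rw [show z a + 1 - z J - (r : ℂ) = z a - z J - r + 1 by ring, Complex.Gamma_add_one _ h0]
  ring

theorem kap_add_single_self (z : Fin n → ℂ) (a : Fin n) (l : ℂ) (r : ℕ) :
    kap (z + Pi.single a 1) a l r = kap z a l (r + 1) * (z a - (z a + (r + 1 : ℕ))) := by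
  have e : ∏ b ∈ Finset.univ.erase a,
      Complex.Gamma ((z + Pi.single a 1 : Fin n → ℂ) b - (z + Pi.single a 1 : Fin n → ℂ) a - r) =
      ∏ b ∈ Finset.univ.erase a, Complex.Gamma (z b - z a - (r + 1 : ℕ)) := by
    refine Finset.prod_congr rfl fun b hb => ?_
    simp only [Pi.add_apply, Pi.single_eq_same, Pi.single_eq_of_ne (Finset.mem_erase.1 hb).1]
    congr 1
    push_cast
    ring
  rw [kap, kap, coef, coef, e, Nat.factorial_succ]
  have h1 : ((r : ℂ) + 1) ≠ 0 := by exact_mod_cast Nat.succ_ne_zero r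
  have h2 : (r.factorial : ℂ) ≠ 0 := by exact_mod_cast r.factorial_ne_zero
  simp only [Pi.add_apply, Pi.single_eq_same]
  rw [show l * (z a + 1 + (r : ℂ)) = l * (z a + ((r + 1 : ℕ) : ℂ)) by push_cast; ring]
  push_cast
  field_simp
  ring

/-- Insertion of the factor `z_a - t` amounts to the shift `z_a ↦ z_a + 1`. -/
theorem hasSum_kap_add_single {z : Fin n → ℂ} (hz : z ∈ generic n) (J a : Fin n) (l : ℂ)
    (P : ℂ → ℂ) (s : ℂ) :
    HasSum (fun r : ℕ => kap (z + Pi.single a 1) J l r * P ((z + Pi.single a 1 : Fin n → ℂ) J + r)) s ↔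
      HasSum (fun r : ℕ => kap z J l r * ((z a - (z J + r)) * P (z J + r))) s := by
  by_cases h : J = a
  · subst h
    -- For `a = J` the inserted factor vanishes at the first pole, so the remaining poles are those
    -- that start at `z_J + 1`.
    rw [← hasSum_nat_add_iff' (f := fun r : ℕ => kap z J l r * ((z J - (z J + r)) * P (z J + r))) 1]
    simp only [Finset.range_one, Finset.sum_singleton, Nat.cast_zero, add_zero, sub_self, zero_mul,
      mul_zero, sub_zero]
    have e : (fun r : ℕ => kap (z + Pi.single J 1) J l r *
        P ((z + Pi.single J 1 : Fin n → ℂ) J + r)) = fun r : ℕ => kap z J l (r + 1) *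
        ((z J - (z J + (r + 1 : ℕ))) * P (z J + (r + 1 : ℕ))) := by
      funext r
      rw [kap_add_single_self, mul_assoc]
      simp only [Pi.add_apply, Pi.single_eq_same]
      rw [show z J + 1 + (r : ℂ) = z J + ((r + 1 : ℕ) : ℂ) by push_cast; ring]
    rw [e]
  · have e : (fun r : ℕ => kap (z + Pi.single a 1) J l r *
        P ((z + Pi.single a 1 : Fin n → ℂ) J + r)) = fun r : ℕ => kap z J l r *
        ((z a - (z J + r)) * P (z J + r)) := by
      funext r
      rw [kap_add_single_of_ne hz h, mul_assoc]
      simp [h]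
    rw [e]

theorem Gamma_sub_nat {d : ℂ} (hd : ∀ k : ℤ, d ≠ k) (r : ℕ) :
    Complex.Gamma (d - r) * ∏ k ∈ Finset.range r, (d - (k + 1 : ℕ)) = Complex.Gamma d := by
  induction r with
  | zero => simp
  | succ r ih =>
    have h0 : d - (r + 1 : ℕ) ≠ 0 := sub_ne_zero.2 (by exact_mod_cast hd ((r + 1 : ℕ) : ℤ))
    rw [Finset.prod_range_succ, ← ih, show d - (r : ℂ) = d - (r + 1 : ℕ) + 1 by push_cast; ring,
      Complex.Gamma_add_one _ h0]
    ring

/-- Each application of the functional equation divides by a number at distance at least δ from 0.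
This loses a geometric factor only, which `1 / r!` will outweigh. -/
theorem norm_Gamma_sub_nat_le {d : ℂ} {δ : ℝ} (hδ : 0 < δ) (hd : ∀ k : ℤ, δ ≤ ‖d - k‖) (r : ℕ) :
    ‖Complex.Gamma (d - r)‖ ≤ ‖Complex.Gamma d‖ * δ⁻¹ ^ r := by
  have h := Gamma_sub_nat (d := d) (fun k hk => by
    have := hd k
    rw [hk, sub_self, norm_zero] at this
    linarith) r
  have h2 : δ ^ r ≤ ‖∏ k ∈ Finset.range r, (d - (k + 1 : ℕ))‖ := by
    rw [norm_prod]
    calc δ ^ r = ∏ k ∈ Finset.range r, δ := by simp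
      _ ≤ _ := Finset.prod_le_prod (fun _ _ => hδ.le) fun k _ => by
        exact_mod_cast hd ((k + 1 : ℕ) : ℤ)
  rw [← h, norm_mul, mul_assoc, inv_pow]
  refine le_mul_of_one_le_right (norm_nonneg _) ?_
  rw [← div_eq_mul_inv, one_le_div (by positivity)]
  exact h2

theorem exists_dist_int_le {d : ℂ} (hd : ∀ k : ℤ, d ≠ k) :
    ∃ δ > 0, ∀ᶠ w : ℂ in 𝓝 d, ∀ k : ℤ, δ ≤ ‖w - (k : ℂ)‖ := by
  have hcl : IsClosed (Set.range (fun k : ℤ => (k : ℂ))) := by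
    exact Complex.isClosed_range_intCast
  have hn : d ∉ Set.range (fun k : ℤ => (k : ℂ)) := by
    rintro ⟨k, hk⟩; exact hd k hk.symm
  obtain ⟨ε, hε, hb⟩ := Metric.isOpen_iff.1 hcl.isOpen_compl d hn
  refine ⟨ε / 2, by positivity, ?_⟩
  filter_upwards [Metric.ball_mem_nhds d (half_pos hε)] with w hw k
  by_contra! hlt
  have : (k : ℂ) ∈ Metric.ball d ε := by
    rw [Metric.mem_ball] at hw ⊢
    calc dist (k : ℂ) d ≤ dist (k : ℂ) w + dist w d := dist_triangle _ _ _
      _ < ε / 2 + ε / 2 := by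
        rw [dist_comm, dist_eq_norm]
        linarith
      _ = ε := by ring
  exact hb this ⟨k, rfl⟩

theorem isOpen_generic : IsOpen (generic n) := by
  rw [isOpen_iff_mem_nhds]
  intro z hz
  have h : ∀ a b : Fin n, a ≠ b → ∀ᶠ w in 𝓝 z, ∀ m : ℤ, w a - w b ≠ (m : ℂ) := by
    intro a b hab
    obtain ⟨δ, hδ, h⟩ := exists_dist_int_le (hz a b hab)
    have hc : Tendsto (fun w : Fin n → ℂ => w a - w b) (𝓝 z) (𝓝 (z a - z b)) :=
      (by fun_prop : Continuous fun w : Fin n → ℂ => w a - w b).tendsto z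
    filter_upwards [hc.eventually h] with w hw m hm
    have := hw m
    rw [hm, sub_self, norm_zero] at this
    linarith
  have h2 : ∀ᶠ w in 𝓝 z, ∀ a b : Fin n, a ≠ b → ∀ m : ℤ, w a - w b ≠ (m : ℂ) := by
    rw [eventually_all]
    intro a
    rw [eventually_all]
    intro b
    by_cases hab : a = b
    · simp [hab]
    · filter_upwards [h a b hab] with w hw _ using hw
  exact h2

/-- The constants are uniform for w near z: the distance from the differences of parameters to the
integers stays bounded below, and Gamma stays bounded there. -/
theorem exists_coef_bound {z : Fin n → ℂ} (hz : z ∈ generic n) (J : Fin n) :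
    ∃ C D : ℝ, 0 < C ∧ 0 < D ∧ ∀ᶠ w in 𝓝 z, ∀ r : ℕ, ‖coef w J r‖ ≤ C * D ^ r / r.factorial := by
  have h1 : ∀ b : Fin n, b ≠ J → ∃ δ > 0, ∃ B > 0, ∀ᶠ w in 𝓝 z, (∀ k : ℤ, δ ≤ ‖w b - w J - (k : ℂ)‖) ∧
      ‖Complex.Gamma (w b - w J)‖ ≤ B := by
    intro b hb
    obtain ⟨δ, hδ, h⟩ := exists_dist_int_le (hz b J hb)
    have hc : Tendsto (fun w : Fin n → ℂ => w b - w J) (𝓝 z) (𝓝 (z b - z J)) :=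
      (by fun_prop : Continuous fun w : Fin n → ℂ => w b - w J).tendsto z
    have hG : ContinuousAt Complex.Gamma (z b - z J) := (Complex.differentiableAt_Gamma _ fun m => by
      have := hz b J hb (-m); push_cast at this; exact this).continuousAt
    have hb2 : ∀ᶠ s in 𝓝 (z b - z J), ‖Complex.Gamma s‖ < ‖Complex.Gamma (z b - z J)‖ + 1 :=
      hG.norm.eventually_lt continuousAt_const (by simp)
    refine ⟨δ, hδ, ‖Complex.Gamma (z b - z J)‖ + 1, by positivity, ?_⟩
    filter_upwards [hc.eventually h, hc.eventually hb2] with w hw hw2 using ⟨hw, hw2.le⟩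
  choose! δ hδ B hB h using h1
  refine ⟨∏ b ∈ Finset.univ.erase J, B b, ∏ b ∈ Finset.univ.erase J, (δ b)⁻¹,
    Finset.prod_pos fun b hb => hB b (Finset.mem_erase.1 hb).1,
    Finset.prod_pos fun b hb => inv_pos.2 (hδ b (Finset.mem_erase.1 hb).1), ?_⟩
  have h2 : ∀ᶠ w in 𝓝 z, ∀ b ∈ Finset.univ.erase J, (∀ k : ℤ, δ b ≤ ‖w b - w J - (k : ℂ)‖) ∧
      ‖Complex.Gamma (w b - w J)‖ ≤ B b := by
    rw [Filter.eventually_all_finset]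
    exact fun b hb => h b (Finset.mem_erase.1 hb).1
  filter_upwards [h2] with w hw r
  rw [coef, norm_mul, norm_div, norm_pow, norm_neg, norm_one, one_pow, Complex.norm_natCast,
    norm_prod, ← Finset.prod_pow, ← Finset.prod_mul_distrib, one_div_mul_eq_div]
  gcongr with b hb
  have hb1 := (Finset.mem_erase.1 hb).1
  refine (norm_Gamma_sub_nat_le (hδ b hb1) (hw b hb).1 r).trans ?_
  have := hδ b hb1
  gcongr
  exact (hw b hb).2

theorem exists_kap_bound {z : Fin n → ℂ} (hz : z ∈ generic n) (J : Fin n) (l : ℂ) :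
    ∃ u : ℕ → ℝ, Summable u ∧ ∀ᶠ q : ℂ × (Fin n → ℂ) in 𝓝 (l, z), ∀ r, ‖kap q.2 J q.1 r‖ ≤ u r := by
  obtain ⟨C, D, hC, hD, h⟩ := exists_coef_bound hz J
  set L := ‖l‖ + 1
  set A := ‖z J‖ + 1
  refine ⟨fun r => C * Real.exp (L * A) * ((D * Real.exp L) ^ r / r.factorial), 
    (Real.summable_pow_div_factorial _).mul_left _, ?_⟩
  have e1 : ∀ᶠ q : ℂ × (Fin n → ℂ) in 𝓝 (l, z), ‖q.1‖ < L :=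
    (by fun_prop : Continuous fun q : ℂ × (Fin n → ℂ) => ‖q.1‖).continuousAt.eventually_lt
      continuousAt_const (by simp [L])
  have e2 : ∀ᶠ q : ℂ × (Fin n → ℂ) in 𝓝 (l, z), ‖q.2 J‖ < A :=
    (by fun_prop : Continuous fun q : ℂ × (Fin n → ℂ) => ‖q.2 J‖).continuousAt.eventually_lt
      continuousAt_const (by simp [A])
  have e3 : ∀ᶠ q : ℂ × (Fin n → ℂ) in 𝓝 (l, z), ∀ r : ℕ, ‖coef q.2 J r‖ ≤ C * D ^ r / r.factorial :=
    (continuous_snd.tendsto (l, z)).eventually h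
  filter_upwards [e1, e2, e3] with q h1 h2 h3 r
  rw [kap, norm_mul]
  have h4 : ‖Complex.exp (q.1 * (q.2 J + r))‖ ≤ Real.exp (L * A) * Real.exp L ^ r := by
    rw [Complex.norm_exp, ← Real.exp_nat_mul, ← Real.exp_add]
    refine Real.exp_le_exp.2 ((Complex.re_le_norm _).trans ?_)
    rw [norm_mul]
    calc ‖q.1‖ * ‖q.2 J + r‖ ≤ L * (A + r) := by
          gcongr
          refine (norm_add_le _ _).trans ?_
          rw [Complex.norm_natCast]
          gcongr
      _ = L * A + r * L := by ring
  calc _ ≤ C * D ^ r / r.factorial * (Real.exp (L * A) * Real.exp L ^ r) := by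
        gcongr
        exact h3 r
    _ = _ := by rw [mul_pow]; ring

theorem summable_kap {z : Fin n → ℂ} (hz : z ∈ generic n) (J : Fin n) (l : ℂ) :
    Summable (kap z J l) := by
  obtain ⟨u, hu, h⟩ := exists_kap_bound hz J l
  exact Summable.of_norm_bounded hu h.self_of_nhds

theorem hasSum_kap {z : Fin n → ℂ} (hz : z ∈ generic n) (J : Fin n) (l : ℂ) :
    HasSum (kap z J l) (fser z J l) := (summable_kap hz J l).hasSum

/-- A locally bounded series of holomorphic functions on a normed space is holomorphic. -/
theorem differentiableAt_tsum_of_bound {E : Type*} [NormedAddCommGroup E] [NormedSpace ℂ E]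
    {F : ℕ → E → ℂ} {u : ℕ → ℝ} (hu : Summable u) {x : E}
    (hF : ∀ᶠ y in 𝓝 x, ∀ r, DifferentiableAt ℂ (F r) y) (hb : ∀ᶠ y in 𝓝 x, ∀ r, ‖F r y‖ ≤ u r) :
    DifferentiableAt ℂ (fun y => ∑' r, F r y) x := by
  obtain ⟨ε, hε, hball⟩ := Metric.eventually_nhds_iff_ball.1 (hF.and hb)
  -- Cauchy's estimate on discs of radius `ε / 3` in complex lines bounds the derivatives by the
  -- same summable majorant, so termwise differentiation applies.
  have hder : ∀ r, ∀ y ∈ Metric.ball x (ε / 2), ‖fderiv ℂ (F r) y‖ ≤ u r / (ε / 3) := by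
    intro r y hy
    let _ : NormedSpace ℝ E := NormedSpace.restrictScalars ℝ ℂ E
    have hu0 : 0 ≤ u r := (norm_nonneg _).trans ((hball x (Metric.mem_ball_self hε)).2 r)
    refine ContinuousLinearMap.opNorm_le_of_unit_norm (𝕜 := ℂ) (by positivity) fun v hv => ?_
    have hmem : ∀ s : ℂ, ‖s‖ ≤ ε / 3 → y + s • v ∈ Metric.ball x ε := by
      intro s hs
      rw [Metric.mem_ball] at hy ⊢
      calc dist (y + s • v) x ≤ dist (y + s • v) y + dist y x := dist_triangle _ _ _
        _ < ε := by
          rw [dist_eq_norm, add_sub_cancel_left, norm_smul, hv, mul_one]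
          linarith
    have hc : ∀ s : ℂ, HasDerivAt (fun s : ℂ => y + s • v) v s := by
      intro s
      simpa using ((hasDerivAt_id s).smul_const v).const_add y
    have h0 : HasDerivAt (fun s : ℂ => F r (y + s • v)) (fderiv ℂ (F r) y v) 0 := by
      have hd : DifferentiableAt ℂ (F r) (y + (0 : ℂ) • v) :=
        (hball _ (hmem 0 (by simp; positivity))).1 r
      have := hd.hasFDerivAt.comp_hasDerivAt (0 : ℂ) (hc 0)
      rw [zero_smul, add_zero] at this
      exact this
    rw [← h0.deriv]
    refine Complex.norm_deriv_le_of_forall_mem_sphere_norm_le (by positivity) ?_ ?_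
    · refine DifferentiableOn.diffContOnCl fun s hs => ?_
      rw [closure_ball _ (by positivity), mem_closedBall_zero_iff] at hs
      exact (((hball _ (hmem s hs)).1 r).comp s (hc s).differentiableAt).differentiableWithinAt
    · intro s hs
      rw [mem_sphere_zero_iff_norm] at hs
      exact (hball _ (hmem s hs.le)).2 r
  have hx : x ∈ Metric.ball x (ε / 2) := Metric.mem_ball_self (by positivity)
  let _ : NormedSpace ℝ E := NormedSpace.restrictScalars ℝ ℂ E
  refine (hasFDerivAt_tsum_of_isPreconnected (hu.div_const (ε / 3)) Metric.isOpen_ball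
    (convex_ball x (ε / 2)).isPreconnected (fun r y hy => ?_) hder hx
    (Summable.of_norm_bounded hu (hball x (Metric.mem_ball_self hε)).2) hx).differentiableAt
  exact ((hball y (Metric.ball_subset_ball (by linarith) hy)).1 r).hasFDerivAt

theorem differentiableAt_finset_prod {E ι : Type*} [NormedAddCommGroup E] [NormedSpace ℂ E]
    (u : Finset ι) {f : ι → E → ℂ} {x : E} (h : ∀ i ∈ u, DifferentiableAt ℂ (f i) x) :
    DifferentiableAt ℂ (fun y => ∏ i ∈ u, f i y) x := by
  classical
  induction u using Finset.induction_on with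
  | empty => simp
  | insert a u ha ih =>
    simp only [Finset.prod_insert ha]
    exact (h a (Finset.mem_insert_self a u)).mul
      (ih fun i hi => h i (Finset.mem_insert_of_mem hi))

theorem differentiableAt_kap {z : Fin n → ℂ} (hz : z ∈ generic n) (J : Fin n) (l : ℂ) (r : ℕ) :
    DifferentiableAt ℂ (fun q : ℂ × (Fin n → ℂ) => kap q.2 J q.1 r) (l, z) := by
  have hp : ∀ a : Fin n, DifferentiableAt ℂ (fun q : ℂ × (Fin n → ℂ) => q.2 a) (l, z) := by
    intro a
    exact ((ContinuousLinearMap.proj (R := ℂ) (φ := fun _ : Fin n => ℂ) a).comp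
      (ContinuousLinearMap.snd ℂ ℂ (Fin n → ℂ))).differentiableAt
  unfold kap coef
  refine DifferentiableAt.mul (DifferentiableAt.mul (differentiableAt_const _) ?_) ?_
  · refine differentiableAt_finset_prod _ fun b hb => ?_
    have hd : DifferentiableAt ℂ Complex.Gamma (z b - z J - r) := by
      refine Complex.differentiableAt_Gamma _ fun m hm => ?_
      refine generic_ne hz (Finset.mem_erase.1 hb).1 (m - r) ?_
      push_cast
      linear_combination hm
    exact DifferentiableAt.comp (l, z) (f := fun q : ℂ × (Fin n → ℂ) => q.2 b - q.2 J - r) hd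
      (((hp b).sub (hp J)).sub_const _)
  · exact (differentiableAt_fst.mul ((hp J).add_const _)).cexp

theorem differentiableAt_fser {z : Fin n → ℂ} (hz : z ∈ generic n) (J : Fin n) (l : ℂ) :
    DifferentiableAt ℂ (fun q : ℂ × (Fin n → ℂ) => fser q.2 J q.1) (l, z) := by
  obtain ⟨u, hu, h⟩ := exists_kap_bound hz J l
  refine differentiableAt_tsum_of_bound hu ?_ h
  filter_upwards [(continuous_snd.tendsto (l, z)).eventually (isOpen_generic.mem_nhds hz)]
    with q hq r using differentiableAt_kap hq J q.1 r

/-- Differentiation inserts the position of the pole, `z_J + r = z_a - (z_a - (z_J + r))`; the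
second part is a raised parameter. The index a is free, and this is what lets the recursion of the
differential equation proceed. -/
theorem hasDerivAt_fser {z : Fin n → ℂ} (hz : z ∈ generic n) (J a : Fin n) (l : ℂ) :
    HasDerivAt (fser z J) (z a * fser z J l - fser (z + Pi.single a 1) J l) l := by
  obtain ⟨u, hu, h⟩ := exists_kap_bound hz J l
  have h2 : ∀ᶠ l' in 𝓝 l, ∀ r, ‖kap z J l' r‖ ≤ u r :=
    ((by fun_prop : Continuous fun l' : ℂ => (l', z)).tendsto l).eventually h
  obtain ⟨ε, hε, hb⟩ := Metric.eventually_nhds_iff_ball.1 h2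
  have hk : ∀ r l', HasDerivAt (fun l' => kap z J l' r) (kap z J l' r * (z J + r)) l' := by
    intro r l'
    have := ((hasDerivAt_id l').mul_const (z J + r)).cexp.const_mul (coef z J r)
    rw [kap, mul_assoc]
    simpa only [id, one_mul] using! this
  have h3 := Complex.hasSum_deriv_of_summable_norm hu
    (fun r l' _ => (hk r l').differentiableAt.differentiableWithinAt) Metric.isOpen_ball
    (fun r l' hl' => hb l' hl' r) (Metric.mem_ball_self hε)
  have hd : DifferentiableAt ℂ (fser z J) l := by
    have := differentiableAt_fser hz J l
    exact this.comp l (f := fun l' : ℂ => (l', z)) (by fun_prop)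
  simp only [(hk _ _).deriv] at h3
  have h4 : HasSum (fun r : ℕ => kap z J l r * (z a - (z J + r))) (fser (z + Pi.single a 1) J l) := by
    have := (hasSum_kap_add_single hz J a l (fun _ => 1) (fser (z + Pi.single a 1) J l)).1
      (by simpa using hasSum_kap (generic_add_single hz a) J l)
    simpa using this
  have h5 := ((hasSum_kap hz J l).mul_left (z a)).sub h4
  have h6 : deriv (fser z J) l = z a * fser z J l - fser (z + Pi.single a 1) J l := by
    refine h3.unique ?_
    convert! h5 using 2 with r
    ring
  rw [← h6]
  exact hd.hasDerivAt

end Series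
end EquivQDE
namespace EquivQDE

/-! ### Residues of the master function and the coordinates of `Ψ_J` -/

section Residue
variable {n : ℕ}

/-- By Cauchy's formula the circle integrals are constant for small radii, so the limit in the
definition exists. -/
theorem residue_eq {f g : ℂ → ℂ} {c : ℂ} (hg : AnalyticAt ℂ g c)
    (h : ∀ᶠ t in 𝓝[≠] c, f t = g t / (t - c)) : residue f c = g c := by
  obtain ⟨ε, hε, hb⟩ := Metric.eventually_nhds_iff_ball.1
    (hg.eventually_analyticAt.and (eventually_nhdsWithin_iff.1 h))
  refine Tendsto.limUnder_eq ?_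
  refine tendsto_const_nhds.congr' ?_
  filter_upwards [Ioo_mem_nhdsGT hε] with ρ hρ
  have h1 : circleIntegral f c ρ = circleIntegral (fun t => (t - c)⁻¹ • g t) c ρ := by
    refine circleIntegral.integral_congr hρ.1.le fun t ht => ?_
    have ht' : t ∈ Metric.ball c ε := by
      rw [mem_sphere_iff_norm] at ht
      rw [mem_ball_iff_norm, ht]
      exact hρ.2
    have hne : t ≠ c := by
      rintro rfl
      rw [mem_sphere_iff_norm, sub_self, norm_zero] at ht
      exact hρ.1.ne ht
    change f t = _
    rw [(hb t ht').2 hne, smul_eq_mul, div_eq_inv_mul]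
  have h2 : DiffContOnCl ℂ g (Metric.ball c ρ) := by
    refine DifferentiableOn.diffContOnCl fun t ht => ?_
    rw [closure_ball _ hρ.1.ne'] at ht
    exact (hb t (Metric.closedBall_subset_ball hρ.2 ht)).1.differentiableAt.differentiableWithinAt
  rw [h1, h2.circleIntegral_sub_inv_smul (Metric.mem_ball_self hρ.1), smul_eq_mul, ← mul_assoc,
    inv_mul_cancel₀ (by simp [Real.pi_ne_zero]), one_mul]

theorem Gamma_add_nat {w : ℂ} (m : ℕ) (h : ∀ k < m, w + k ≠ 0) :
    Complex.Gamma (w + m) = (∏ k ∈ Finset.range m, (w + k)) * Complex.Gamma w := by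
  induction m with
  | zero => simp
  | succ m ih =>
    rw [Finset.prod_range_succ, Nat.cast_succ, ← add_assoc,
      Complex.Gamma_add_one _ (h m (Nat.lt_succ_self m)), ih fun k hk => h k (hk.trans (Nat.lt_succ_self m))]
    ring

/-- `π i (2 - n) + log p`. -/
noncomputable def lam (n : ℕ) (τ : ℂ) : ℂ := Real.pi * Complex.I * (2 - n) + τ

theorem exp_lam (n : ℕ) (τ : ℂ) : Complex.exp (lam n τ) = (-1) ^ n * Complex.exp τ := by
  rw [lam, Complex.exp_add]
  congr 1
  have : Complex.exp (Real.pi * Complex.I * (2 - n)) * Complex.exp (n * (Real.pi * Complex.I)) = 1 := by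
    rw [← Complex.exp_add, show (Real.pi * Complex.I * (2 - n) + n * (Real.pi * Complex.I) : ℂ) =
      2 * Real.pi * Complex.I by ring, Complex.exp_two_pi_mul_I]
  rw [Complex.exp_nat_mul, Complex.exp_pi_mul_I] at this
  have h2 : ((-1 : ℂ) ^ n) * (-1) ^ n = 1 := by rw [← mul_pow]; simp
  calc _ = Complex.exp (Real.pi * Complex.I * (2 - n)) * ((-1) ^ n * (-1) ^ n) := by rw [h2, mul_one]
    _ = _ := by rw [← mul_assoc, this, one_mul]

theorem analyticAt_weightCoord (z : Fin n → ℂ) (i : Fin n) (c : ℂ) :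
    AnalyticAt ℂ (fun t => weightCoord z t i) c := by
  refine Differentiable.analyticAt (fun t => ?_) c
  unfold weightCoord
  exact (differentiableAt_finset_prod _ fun b _ => by fun_prop).const_mul _

/-- The integrand `e^{lt} ∏ₐ Γ(zₐ - t)`. -/
noncomputable def barnes (z : Fin n → ℂ) (l t : ℂ) : ℂ :=
  Complex.exp (l * t) * ∏ a, Complex.Gamma (z a - t)

theorem exists_barnes_eq_div {z : Fin n → ℂ} (hz : z ∈ generic n) (J : Fin n) (l : ℂ) (r : ℕ) :
    ∃ g : ℂ → ℂ, AnalyticAt ℂ g (z J + r) ∧ g (z J + r) = -kap z J l r ∧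
      ∀ᶠ t in 𝓝[≠] (z J + r : ℂ), barnes z l t = g t / (t - (z J + r)) := by
  set c := z J + (r : ℂ)
  -- The pole of `Γ(z_J - t)` is exposed by `Γ(w) = Γ(w + r + 1) / ∏_{k ≤ r} (w + k)` with `w = z_J
  -- - t`: the factor `k = r` is `-(t - (z_J + r))`, which is left out, and the minus sign is kept
  -- in front.
  let g : ℂ → ℂ := fun t => -(Complex.exp (l * t) *
    (Complex.Gamma (z J - t + (r + 1 : ℕ)) / ∏ k ∈ Finset.range r, (z J - t + k)) *
    (∏ b ∈ Finset.univ.erase J, Complex.Gamma (z b - t)))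
  have hfac : ∀ k ∈ Finset.range r, z J - c + k ≠ 0 := by
    intro k hk h
    rw [Finset.mem_range] at hk
    have : (k : ℂ) = r := by simp only [c] at h; linear_combination h
    exact hk.ne (by exact_mod_cast this)
  have hg : AnalyticAt ℂ g c := by
    refine ((AnalyticAt.mul ?_ (AnalyticAt.div ?_ ?_ ?_)).mul ?_).neg
    · exact Differentiable.analyticAt (by fun_prop) c
    · refine AnalyticAt.fun_comp (analyticAt_Gamma fun m => ?_) (Differentiable.analyticAt (by fun_prop) c)
      intro h
      have : (1 : ℂ) + m = 0 := by simp only [c] at h; push_cast at h; linear_combination h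
      exact absurd this (by exact_mod_cast (by omega : 1 + m ≠ 0))
    · exact Differentiable.analyticAt
        (fun t => differentiableAt_finset_prod _ fun b _ => by fun_prop) c
    · exact Finset.prod_ne_zero_iff.2 hfac
    · refine Finset.analyticAt_fun_prod _ fun b hb => ?_
      refine AnalyticAt.fun_comp (analyticAt_Gamma fun m => ?_) (Differentiable.analyticAt (by fun_prop) c)
      intro h
      refine generic_ne hz (Finset.mem_erase.1 hb).1 (m - r) ?_
      push_cast
      simp only [c] at h
      linear_combination h
  have hval : g c = -(kap z J (l) r) := by
    have h1 : z J - c + ((r + 1 : ℕ) : ℂ) = 1 := by simp only [c]; push_cast; ring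
    have h2 : ∏ k ∈ Finset.range r, (z J - c + k) = (-1) ^ r * r.factorial := by
      have : ∀ k ∈ Finset.range r, z J - c + k = (-1) * ((r - k : ℕ) : ℂ) := by
        intro k hk
        rw [Finset.mem_range] at hk
        rw [Nat.cast_sub hk.le]
        simp only [c]
        ring
      rw [Finset.prod_congr rfl this, Finset.prod_mul_distrib, Finset.prod_const, Finset.card_range,
        ← Nat.cast_prod]
      congr 2
      rw [← Finset.prod_range_reflect, ← Finset.prod_range_add_one_eq_factorial]
      exact Finset.prod_congr rfl fun k hk => by rw [Finset.mem_range] at hk; omega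
    have h3 : ∏ b ∈ Finset.univ.erase J, Complex.Gamma (z b - c) =
        ∏ b ∈ Finset.univ.erase J, Complex.Gamma (z b - z J - r) :=
      Finset.prod_congr rfl fun b _ => by rw [← sub_sub]
    have h4 : ((-1 : ℂ) ^ r)⁻¹ = (-1) ^ r := by
      rw [← inv_pow]; norm_num
    simp only [g]
    rw [h1, Complex.Gamma_one, h2, h3, kap, coef, one_div, mul_inv, h4]
    ring
  refine ⟨g, hg, hval, ?_⟩
  have hnear : ∀ᶠ t in 𝓝 c, ∀ k ∈ Finset.range r, z J - t + k ≠ 0 := by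
    rw [Filter.eventually_all_finset]
    intro k hk
    exact (by fun_prop : Continuous fun t : ℂ => z J - t + k).continuousAt.eventually_ne (hfac k hk)
  filter_upwards [hnear.filter_mono nhdsWithin_le_nhds, self_mem_nhdsWithin] with t ht htc
  have htc' : t - c ≠ 0 := sub_ne_zero.2 htc
  have h5 : z J - t + r ≠ 0 := by
    intro h; apply htc'; simp only [c]; linear_combination -h
  have h6 := Gamma_add_nat (w := z J - t) (r + 1) (by
    intro k hk
    rcases Nat.lt_succ_iff_lt_or_eq.1 hk with h | h
    · exact ht k (Finset.mem_range.2 h)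
    · rw [h]; exact h5)
  rw [Finset.prod_range_succ] at h6
  have h7 : ∏ k ∈ Finset.range r, (z J - t + k) ≠ 0 := Finset.prod_ne_zero_iff.2 ht
  simp only [g]
  rw [h6, barnes, ← Finset.mul_prod_erase _ _ (Finset.mem_univ J)]
  rw [eq_div_iff htc']
  have h8 : t - c = -(z J - t + r) := by simp only [c]; ring
  rw [h8]
  field_simp

theorem residue_masterFun {z : Fin n → ℂ} (hz : z ∈ generic n) (J i : Fin n) (τ : ℂ) (r : ℕ) :
    residue (fun t => masterFun t τ z * coord z (weight t z) i) (z J + r) =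
      -(kap z J (lam n τ) r * weightCoord z (z J + r) i) := by
  obtain ⟨g, hg, hval, h⟩ := exists_barnes_eq_div hz J (lam n τ) r
  rw [← neg_mul, ← hval]
  refine residue_eq (hg.mul (analyticAt_weightCoord z i _)) ?_
  filter_upwards [h] with t ht
  change barnes z (lam n τ) t * _ = g t * _ / _
  rw [ht, coord_weight, div_mul_eq_mul_div]

theorem coord_PsiJ {z : Fin n → ℂ} (hz : z ∈ generic n) (J i : Fin n) (τ : ℂ) :
    coord z (PsiJ J τ z) i = ∑' r : ℕ, kap z J (lam n τ) r * weightCoord z (z J + r) i := by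
  rw [PsiJ]
  change coord z (ofCoord z _) i = _
  rw [coord_ofCoord]
  simp only [residue_masterFun hz, tsum_neg, neg_neg]

/-- The parameters `(z_1 + 1, …, z_m + 1, z_{m+1}, …, z_n)`. -/
def raise (z : Fin n → ℂ) (m : ℕ) : Fin n → ℂ := fun a => if a.val < m then z a + 1 else z a

theorem raise_zero (z : Fin n → ℂ) : raise z 0 = z := by funext a; simp [raise]

theorem raise_succ (z : Fin n → ℂ) {m : ℕ} (hm : m < n) :
    raise z (m + 1) = raise z m + Pi.single ⟨m, hm⟩ 1 := by
  funext a
  simp only [raise, Pi.add_apply, Pi.single_apply, Fin.ext_iff]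
  split_ifs <;> first | omega | simp

theorem raise_apply_self (z : Fin n → ℂ) {m : ℕ} (hm : m < n) : raise z m ⟨m, hm⟩ = z ⟨m, hm⟩ := by
  simp [raise]

theorem generic_raise {z : Fin n → ℂ} (hz : z ∈ generic n) (m : ℕ) : raise z m ∈ generic n := by
  have := generic_add hz fun a => if a.val < m then 1 else 0
  convert this using 1
  funext a
  rw [raise]
  split_ifs <;> simp

theorem hasSum_kap_raise {z : Fin n → ℂ} (hz : z ∈ generic n) (J : Fin n) (l : ℂ) {m : ℕ}
    (hm : m ≤ n) (P : ℂ → ℂ) (s : ℂ) :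
    HasSum (fun r : ℕ => kap (raise z m) J l r * P (raise z m J + r)) s ↔
      HasSum (fun r : ℕ => kap z J l r *
        ((∏ a ∈ Finset.univ.filter (fun a : Fin n => a.val < m), (z a - (z J + r))) *
          P (z J + r))) s := by
  induction m generalizing P with
  | zero => simp [raise_zero]
  | succ m ih =>
    rw [raise_succ z hm, hasSum_kap_add_single (generic_raise hz m), raise_apply_self,
      ih (by omega) (fun t => (z ⟨m, hm⟩ - t) * P t)]
    have h : (Finset.univ.filter fun a : Fin n => a.val < m + 1) =
        insert ⟨m, hm⟩ (Finset.univ.filter fun a : Fin n => a.val < m) := by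
      ext a
      simp only [Finset.mem_filter, Finset.mem_univ, true_and, Finset.mem_insert, Fin.ext_iff]
      omega
    have e : ∀ r : ℕ, (∏ a ∈ Finset.univ.filter (fun a : Fin n => a.val < m + 1), (z a - (z J + r))) =
        (∏ a ∈ Finset.univ.filter (fun a : Fin n => a.val < m), (z a - (z J + r))) *
          (z ⟨m, hm⟩ - (z J + r)) := by
      intro r
      rw [h, Finset.prod_insert (by simp), mul_comm]
    simp only [e, mul_assoc]

/-- The i-th coordinate of the weight is, up to sign, the product of `z_a - t` over the a before i,
and such a product raises exactly these parameters. -/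
theorem hasSum_coord_PsiJ {z : Fin n → ℂ} (hz : z ∈ generic n) (J i : Fin n) (l : ℂ) :
    HasSum (fun r : ℕ => kap z J l r * weightCoord z (z J + r) i)
      ((-1) ^ (n - 1 - i.val) * fser (raise z i.val) J l) := by
  have h := (hasSum_kap_raise hz J l i.2.le (fun _ => 1) (fser (raise z i.val) J l)).1
    (by simpa using hasSum_kap (generic_raise hz i.val) J l)
  have h2 := h.mul_left ((-1) ^ (n - 1 - i.val))
  convert! h2 using 2 with r
  have e : (Finset.univ.filter fun a : Fin n => a.val < i.val) = Finset.Iio i := by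
    ext a; simp only [Finset.mem_filter, Finset.mem_univ, true_and, Finset.mem_Iio, Fin.lt_def]
  rw [weightCoord, e]
  ring

theorem coord_PsiJ_eq {z : Fin n → ℂ} (hz : z ∈ generic n) (J i : Fin n) (τ : ℂ) :
    coord z (PsiJ J τ z) i = (-1) ^ (n - 1 - i.val) * fser (raise z i.val) J (lam n τ) := by
  rw [coord_PsiJ hz, (hasSum_coord_PsiJ hz J i _).tsum_eq]

/-- With all factors inserted the term at the first pole vanishes and the recursion of the terms
multiplies the others by `e^l`. This closes the chain of coordinates and is the source of the entry
p in quantum multiplication. -/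
theorem fser_raise_all {z : Fin n → ℂ} (hz : z ∈ generic n) (J : Fin n) (l : ℂ) :
    fser (raise z n) J l = Complex.exp l * fser z J l := by
  have h := (hasSum_kap_raise hz J l le_rfl (fun _ => 1) (fser (raise z n) J l)).1
    (by simpa using hasSum_kap (generic_raise hz n) J l)
  have e : (Finset.univ.filter fun a : Fin n => a.val < n) = Finset.univ := by ext a; simp
  simp only [mul_one, e] at h
  rw [← hasSum_nat_add_iff' 1] at h
  simp only [Finset.range_one, Finset.sum_singleton, Nat.cast_zero, add_zero] at h
  rw [Finset.prod_eq_zero (Finset.mem_univ J) (sub_self _), mul_zero, sub_zero] at h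
  simp only [kap_succ_mul hz] at h
  exact h.unique ((hasSum_kap hz J l).mul_left _)

end Residue
end EquivQDE
namespace EquivQDE

/-! ### The Jackson integrals solve the joint system -/

section Jackson
variable {n : ℕ}

theorem fser_raise_one {z : Fin n → ℂ} (hz : z ∈ generic n) (J : Fin n) (l : ℂ) :
    HasSum (fun r : ℕ => kap z J l r * ∏ a, (z a - (z J + r))) (Complex.exp l * fser z J l) := by
  rw [← hasSum_nat_add_iff' 1]
  simp only [Finset.range_one, Finset.sum_singleton, Nat.cast_zero, add_zero]
  rw [Finset.prod_eq_zero (Finset.mem_univ J) (sub_self _), mul_zero, sub_zero]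
  simp only [kap_succ_mul hz]
  exact (hasSum_kap hz J l).mul_left _

theorem hasSum_coord_weight {z : Fin n → ℂ} (hz : z ∈ generic n) (J i : Fin n) (τ : ℂ) :
    HasSum (fun r : ℕ => kap z J (lam n τ) r * coord z (weight (z J + r) z) i)
      (coord z (PsiJ J τ z) i) := by
  simp only [coord_weight, coord_PsiJ_eq hz]
  exact hasSum_coord_PsiJ hz J i _

theorem differentiableOn_coord_PsiJ (J i : Fin n) :
    DifferentiableOn ℂ (fun q : ℂ × (Fin n → ℂ) => coord q.2 (PsiJ J q.1 q.2) i)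
      (Set.univ ×ˢ generic n) := by
  have h : ∀ q ∈ (Set.univ ×ˢ generic n : Set (ℂ × (Fin n → ℂ))), coord q.2 (PsiJ J q.1 q.2) i =
      (-1) ^ (n - 1 - i.val) * fser (raise q.2 i.val) J (lam n q.1) :=
    fun q hq => coord_PsiJ_eq hq.2 J i q.1
  refine DifferentiableOn.congr (fun q hq => ?_) h
  refine (DifferentiableAt.const_mul ?_ _).differentiableWithinAt
  have hm : (fun q : ℂ × (Fin n → ℂ) => fser (raise q.2 i.val) J (lam n q.1)) =
      (fun q : ℂ × (Fin n → ℂ) => fser q.2 J q.1) ∘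
        fun q => (lam n q.1, q.2 + raise 0 i.val) := by
    funext q
    simp only [Function.comp]
    congr 1
    funext a
    simp only [raise, Pi.add_apply, Pi.zero_apply]
    split_ifs <;> simp
  rw [hm]
  have e : q.2 + raise 0 i.val = raise q.2 i.val := by
    funext a
    simp only [raise, Pi.add_apply, Pi.zero_apply]
    split_ifs <;> simp
  refine DifferentiableAt.comp q ?_ (by unfold lam; fun_prop)
  rw [e]
  exact differentiableAt_fser (generic_raise hq.2 _) J _

/-- The operator of the quantum differential equation in coordinates. -/
noncomputable def flowOp (z : Fin n → ℂ) (τ : ℂ) (v : Fin n → ℂ) : Fin n → ℂ := fun i =>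
  z i * v i + if h : i.val + 1 < n then v ⟨i.val + 1, h⟩ else Complex.exp τ * v ⟨0, i.pos⟩

theorem coord_quantumMul_exp (z : Fin n → ℂ) (τ : ℂ) (v : HT z) :
    coord z (quantumMul (Complex.exp τ) z v) = flowOp z τ (coord z v) := by
  funext i
  exact coord_quantumMul z _ v i

/-- A sequence with `h_i' = z_i h_i - h_{i+1}` and `h_n = e^l h_0` gives, with alternating signs,
a solution of the quantum differential equation. -/
theorem hasDerivAt_alternate {z : Fin n → ℂ} {h : ℕ → ℂ → ℂ} {τ : ℂ}
    (hd : ∀ i : Fin n, HasDerivAt (h i) (z i * h i (lam n τ) - h (i + 1) (lam n τ)) (lam n τ))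
    (hn : h n (lam n τ) = Complex.exp (lam n τ) * h 0 (lam n τ)) :
    HasDerivAt (fun τ' => fun i : Fin n => (-1) ^ (n - 1 - i.val) * h i (lam n τ'))
      (flowOp z τ fun i : Fin n => (-1) ^ (n - 1 - i.val) * h i (lam n τ)) τ := by
  rw [hasDerivAt_pi]
  intro i
  have h2 : HasDerivAt (lam n) 1 τ := by
    unfold lam
    exact (hasDerivAt_id τ).const_add _
  have h3 := ((hd i).comp τ h2).const_mul ((-1 : ℂ) ^ (n - 1 - i.val))
  convert! h3 using 1
  rw [flowOp, mul_one, mul_sub, mul_left_comm, sub_eq_add_neg]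
  congr 1
  split_ifs with hi
  · rw [show n - 1 - i.val = (n - 1 - (i.val + 1)) + 1 by omega, pow_succ]
    ring
  · have hi' : i.val + 1 = n := by omega
    simp only [hi', hn, exp_lam]
    rw [show n - 1 - i.val = 0 by omega, pow_zero, Nat.sub_zero]
    have : (-1 : ℂ) ^ n = -(-1) ^ (n - 1) := by
      rw [show n = (n - 1) + 1 by omega, pow_succ, Nat.add_sub_cancel]
      ring
    rw [this]
    ring

theorem coord_PsiJ_fun {z : Fin n → ℂ} (hz : z ∈ generic n) (J : Fin n) (τ : ℂ) :
    coord z (PsiJ J τ z) = fun i : Fin n => (-1) ^ (n - 1 - i.val) * fser (raise z i.val) J (lam n τ) :=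
  _root_.funext fun i => coord_PsiJ_eq hz J i τ

theorem hasDerivAt_coord_PsiJ {z : Fin n → ℂ} (hz : z ∈ generic n) (J : Fin n) (τ : ℂ) :
    HasDerivAt (fun τ' => coord z (PsiJ J τ' z)) (flowOp z τ (coord z (PsiJ J τ z))) τ := by
  simp only [coord_PsiJ_fun hz]
  refine hasDerivAt_alternate (h := fun i => fser (raise z i) J) (fun i => ?_) ?_
  · have h1 := hasDerivAt_fser (generic_raise hz i.val) J i (lam n τ)
    have hs := raise_succ z i.2
    have hself := raise_apply_self z i.2
    simp only [Fin.eta] at hs hself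
    rwa [← hs, hself] at h1
  · rw [fser_raise_all hz, raise_zero]

/-- Everything is written as a sum over the poles with the lower parameters `z'`, where `z = z' + 1`
in the i-th place; passing from z to `z'` inserts the factor `z'_i - t = z_i - 1 - t` required by
the pointwise R-matrix identity. -/
theorem coord_qkz_PsiJ {z : Fin n → ℂ} (hz : z ∈ generic n) (J i j : Fin n) (τ : ℂ) :
    coord (z - Pi.single i 1) (PsiJ J τ (z - Pi.single i 1)) j =
      -coord z (qkzOp (Complex.exp τ) z i (PsiJ J τ z)) j := by
  obtain ⟨z', hz', rfl⟩ : ∃ z' : Fin n → ℂ, z' ∈ generic n ∧ z = z' + Pi.single i 1 :=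
    ⟨z - Pi.single i 1, generic_sub_single hz i, (sub_add_cancel _ _).symm⟩
  rw [add_sub_cancel_right]
  set z := z' + Pi.single i 1 with hzdef
  have hzi : z i = z' i + 1 := by simp [hzdef]
  set l := lam n τ
  set v := PsiJ J τ z
  have hlin := fun L : HT z →ₗ[ℂ] ℂ =>
    hasSum_linear z (fun a => hasSum_coord_weight hz J a τ) L
  have hU := hlin ((gBasis z).coord i ∘ₗ upperR z i)
  have hU1 : ∀ t, ((gBasis z).coord i ∘ₗ upperR z i) (weight t z) = omitProd z t i n := by
    intro t
    have := coord_upperR z t i i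
    rw [if_pos rfl] at this
    exact this
  simp only [hU1] at hU
  -- The coordinate along `g_i` after the upper R-matrices: the inserted factor completes the
  -- omitted product to `∏ (z'_a - t)`, whose sum is `e^l` times the series for `z'`.
  have hU2 := (hasSum_kap_add_single hz' J i l (fun t => omitProd z t i n) _).1 hU
  have hprod : ∀ t, (z' i - t) * omitProd z t i n = ∏ a, (z' a - t) := by
    intro t
    rw [← Finset.mul_prod_erase _ _ (Finset.mem_univ i)]
    congr 1
    refine Finset.prod_congr ?_ fun a ha => ?_
    · ext a; simp
    · rw [hzdef, Pi.add_apply, Pi.single_apply, if_neg (Finset.mem_erase.1 ha).1, add_zero]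
  simp only [hprod] at hU2
  have hU3 := hU2.unique (fser_raise_one hz' J l)
  have hD := hlin ((gBasis z).coord j ∘ₗ lowerR z i ∘ₗ dropCoord z i ∘ₗ upperR z i)
  have hD2 := (hasSum_kap_add_single hz' J i l (fun t =>
    ((gBasis z).coord j ∘ₗ lowerR z i ∘ₗ dropCoord z i ∘ₗ upperR z i) (weight t z)) _).1 hD
  have hS := hD2.add ((hasSum_kap hz' J l).mul_right ((-1) ^ n * coord z (lowerR z i (gElem z i)) j))
  have hX : ∀ t, (z' i - t) * ((gBasis z).coord j ∘ₗ lowerR z i ∘ₗ dropCoord z i ∘ₗ upperR z i)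
      (weight t z) + (-1) ^ n * coord z (lowerR z i (gElem z i)) j = -weightCoord z' t j := by
    intro t
    have := coord_lowerR_dropCoord z t i j
    rw [hzi, add_sub_cancel_right] at this
    rw [show z' = z - Pi.single i 1 by rw [hzdef, add_sub_cancel_right]] at this ⊢
    exact this
  simp only [← mul_add, hX] at hS
  have hP := (hasSum_coord_weight hz' J j τ).neg
  simp only [coord_weight, ← mul_neg] at hP
  have key := hP.unique hS
  rw [neg_eq_iff_eq_neg.1 key, qkzOp_apply, pPowNegE_eq, map_add, map_smul, coord_add, coord_smul]
  -- Here `e^l = (-1)^n p`, so the `p⁻¹` from `p^{-E_i}` leaves the sign `(-1)^n` that appears in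
  -- the pointwise identity.
  have hc : (Complex.exp τ)⁻¹ * coord z (upperR z i v) i = (-1) ^ n * fser z' J l := by
    have : coord z (upperR z i v) i = Complex.exp l * fser z' J l := hU3
    rw [this, exp_lam]
    field_simp
  rw [hc]
  change -(coord z (lowerR z i (dropCoord z i (upperR z i v))) j + _) = _
  ring

theorem isSolution_PsiJ (J : Fin n) : IsSolution (PsiJ J) where
  holomorphic := differentiableOn_coord_PsiJ J
  qde τ z hz i := by
    rw [coord_quantumMul_exp]
    exact hasDerivAt_pi.1 (hasDerivAt_coord_PsiJ hz J τ) i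
  qkz τ _ hz i j := coord_qkz_PsiJ hz J i j τ

end Jackson
end EquivQDE
namespace EquivQDE

/-! ### Uniqueness for the differential equation and independence of the `Ψ_J` -/

section Uniqueness
variable {n : ℕ}

theorem norm_flowOp_le (z : Fin n → ℂ) (τ : ℂ) (v : Fin n → ℂ) :
    ‖flowOp z τ v‖ ≤ (‖z‖ + 1 + ‖Complex.exp τ‖) * ‖v‖ := by
  refine (pi_norm_le_iff_of_nonneg (by positivity)).2 fun i => ?_
  have h1 : ‖z i * v i‖ ≤ ‖z‖ * ‖v‖ := by
    rw [norm_mul]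
    exact mul_le_mul (norm_le_pi_norm z i) (norm_le_pi_norm v i) (norm_nonneg _) (norm_nonneg _)
  refine (norm_add_le _ _).trans ?_
  rw [add_assoc, add_mul]
  refine add_le_add h1 ?_
  split_ifs with h
  · calc _ ≤ 1 * ‖v‖ := by rw [one_mul]; exact norm_le_pi_norm v _
      _ ≤ _ := by gcongr; simp
  · rw [norm_mul]
    gcongr
    · simp
    · exact norm_le_pi_norm v _

theorem flowOp_sum {ι : Type*} (s : Finset ι) (z : Fin n → ℂ) (τ : ℂ) (a : ι → ℂ)
    (v : ι → Fin n → ℂ) : flowOp z τ (∑ j ∈ s, a j • v j) = ∑ j ∈ s, a j • flowOp z τ (v j) := by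
  funext i
  simp only [flowOp, Finset.sum_apply, Pi.smul_apply, smul_eq_mul, mul_add, Finset.sum_add_distrib,
    Finset.mul_sum]
  congr 1
  · exact Finset.sum_congr rfl fun j _ => by ring
  · split_ifs with h
    · rfl
    · exact Finset.sum_congr rfl fun j _ => by ring

theorem flowOp_sub (z : Fin n → ℂ) (τ : ℂ) (v w : Fin n → ℂ) :
    flowOp z τ (v - w) = flowOp z τ v - flowOp z τ w := by
  funext i
  simp only [flowOp, Pi.sub_apply]
  split_ifs <;> ring

/-- Grönwall's inequality along the segment from `τ₀` to τ; convexity of U keeps the segment inside,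
and the operator is bounded on it by compactness. -/
theorem eq_zero_of_flow {z : Fin n → ℂ} {U : Set ℂ} (hU : Convex ℝ U) {F : ℂ → Fin n → ℂ}
    (hF : ∀ τ ∈ U, HasDerivAt F (flowOp z τ (F τ)) τ) {τ₀ : ℂ} (h₀ : τ₀ ∈ U) (h : F τ₀ = 0)
    {τ : ℂ} (hτ : τ ∈ U) : F τ = 0 := by
  let γ : ℝ → ℂ := fun t => τ₀ + t * (τ - τ₀)
  have hγ : ∀ t ∈ Set.Icc (0 : ℝ) 1, γ t ∈ U := by
    intro t ht
    have := hU.add_smul_sub_mem h₀ hτ ht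
    simpa [γ] using this
  have hγd : ∀ t, HasDerivAt γ (τ - τ₀) t := by
    intro t
    have := ((hasDerivAt_id t).ofReal_comp.mul_const (τ - τ₀)).const_add τ₀
    simpa [γ] using this
  have hd : ∀ t ∈ Set.Icc (0 : ℝ) 1,
      HasDerivAt (fun t => F (γ t)) ((τ - τ₀) • flowOp z (γ t) (F (γ t))) t :=
    fun t ht => (hF _ (hγ t ht)).scomp t (hγd t)
  have hcont : ContinuousOn (fun t : ℝ => ‖τ - τ₀‖ * (‖z‖ + 1 + ‖Complex.exp (γ t)‖))
      (Set.Icc 0 1) := by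
    have : Continuous γ := by fun_prop
    fun_prop
  obtain ⟨K, hK⟩ := isCompact_Icc.bddAbove_image hcont
  have hg := norm_le_gronwallBound_of_norm_deriv_right_le (f := fun t => F (γ t)) (δ := 0) (K := K)
    (ε := 0) (a := 0) (b := 1) (fun t ht => (hd t ht).continuousAt.continuousWithinAt)
    (fun t ht => (hd t ⟨ht.1, ht.2.le⟩).hasDerivWithinAt) (by simp [γ, h]) (fun t ht => ?_) 1
    (by simp)
  · rw [gronwallBound_ε0_δ0] at hg
    simpa [γ] using hg
  · rw [norm_smul, add_zero]
    calc _ ≤ ‖τ - τ₀‖ * ((‖z‖ + 1 + ‖Complex.exp (γ t)‖) * ‖F (γ t)‖) := by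
          gcongr; exact norm_flowOp_le _ _ _
      _ = (‖τ - τ₀‖ * (‖z‖ + 1 + ‖Complex.exp (γ t)‖)) * ‖F (γ t)‖ := by ring
      _ ≤ _ := by
          gcongr
          exact hK ⟨t, ⟨ht.1, ht.2.le⟩, rfl⟩

theorem coef_zero_ne {z : Fin n → ℂ} (hz : z ∈ generic n) (J : Fin n) : coef z J 0 ≠ 0 := by
  rw [coef]
  refine mul_ne_zero (by simp) (Finset.prod_ne_zero_iff.2 fun b hb => ?_)
  refine Complex.Gamma_ne_zero fun m h => ?_
  apply generic_ne hz (Finset.mem_erase.1 hb).1 m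
  push_cast at h ⊢
  linear_combination h

/-- As `Re l → -∞` only the first pole survives. Its coefficient is a product of Gamma values and
does not vanish, so the series is not identically zero. -/
theorem tendsto_fser {z : Fin n → ℂ} (hz : z ∈ generic n) (J : Fin n) :
    Tendsto (fun x : ℝ => Complex.exp (-(x * z J)) * fser z J x) atBot (𝓝 (coef z J 0)) := by
  have hs : Summable fun r => ‖kap z J 0 r‖ := (summable_kap hz J 0).norm
  have h := tendsto_tsum_of_dominated_convergence (𝓕 := atBot)
    (f := fun (x : ℝ) (r : ℕ) => Complex.exp (-(x * z J)) * kap z J x r)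
    (g := fun r : ℕ => if r = 0 then coef z J 0 else 0) hs ?_ ?_
  · simpa [fser, tsum_mul_left] using h
  · intro r
    have e : ∀ x : ℝ, Complex.exp (-(x * z J)) * kap z J x r = coef z J r * ((Real.exp (x * r) : ℝ) : ℂ) := by
      intro x
      rw [kap, mul_left_comm, ← Complex.exp_add]
      push_cast
      congr 2; ring
    simp only [e]
    split_ifs with hr
    · subst hr; simp
    · have h1 : Tendsto (fun x : ℝ => Real.exp (x * r)) atBot (𝓝 0) :=
        Real.tendsto_exp_atBot.comp (tendsto_id.atBot_mul_const (by positivity))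
      have := ((Complex.continuous_ofReal.tendsto 0).comp h1).const_mul (coef z J r)
      simpa using this
  · filter_upwards [eventually_le_atBot (0 : ℝ)] with x hx r
    have : Complex.exp (-(x * z J)) * kap z J x r = coef z J r * ((Real.exp (x * r) : ℝ) : ℂ) := by
      rw [kap, mul_left_comm, ← Complex.exp_add]
      push_cast
      congr 2; ring
    rw [this, norm_mul, kap, norm_mul]
    gcongr
    simp only [zero_mul, Complex.exp_zero, norm_one, Complex.norm_real, Real.norm_eq_abs, Real.abs_exp]
    exact Real.exp_le_one_iff.2 (mul_nonpos_of_nonpos_of_nonneg hx (by positivity))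

theorem fser_add_two_pi {z : Fin n → ℂ} (J : Fin n) (l : ℂ) :
    fser z J (l + 2 * Real.pi * Complex.I) = Complex.exp (2 * Real.pi * Complex.I * z J) * fser z J l := by
  rw [fser, fser, ← tsum_mul_left]
  congr 1
  funext r
  rw [kap, kap, mul_left_comm, ← Complex.exp_add]
  congr 1
  rw [Complex.exp_eq_exp_iff_exists_int]
  exact ⟨r, by push_cast; ring⟩

theorem PsiJ_add_two_pi {z : Fin n → ℂ} (hz : z ∈ generic n) (J : Fin n) (τ : ℂ) :
    PsiJ J (τ + 2 * Real.pi * Complex.I) z = Complex.exp (2 * Real.pi * Complex.I * z J) • PsiJ J τ z := by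
  refine coord_ext fun i => ?_
  rw [coord_smul, coord_PsiJ_eq hz, coord_PsiJ_eq hz]
  have : lam n (τ + 2 * Real.pi * Complex.I) = lam n τ + 2 * Real.pi * Complex.I := by
    rw [lam, lam]; ring
  rw [this, fser_add_two_pi, mul_left_comm]
  congr 1
  rw [Complex.exp_eq_exp_iff_exists_int]
  simp only [raise]
  split_ifs
  · exact ⟨1, by push_cast; ring⟩
  · exact ⟨0, by push_cast; ring⟩

theorem exp_two_pi_injective {z : Fin n → ℂ} (hz : z ∈ generic n) :
    Function.Injective fun J => Complex.exp (2 * Real.pi * Complex.I * z J) := by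
  intro J K h
  by_contra hJK
  obtain ⟨m, hm⟩ := Complex.exp_eq_exp_iff_exists_int.1 h
  refine hz J K hJK m ?_
  have := Complex.two_pi_I_ne_zero
  refine mul_left_cancel₀ this ?_
  linear_combination hm

/-- The `Ψ_J` are eigenvectors of the translation `τ ↦ τ + 2πi`. Their eigenvalues `e^{2πi z_J}` are
distinct because the parameters do not differ by integers. -/
theorem linearIndependent_PsiJ {z : Fin n → ℂ} (hz : z ∈ generic n) :
    LinearIndependent ℂ fun (J : Fin n) => fun τ : ℂ => PsiJ J τ z := by
  let T : Module.End ℂ (ℂ → HT z) :=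
    LinearMap.funLeft ℂ (HT z) fun τ => τ + 2 * Real.pi * Complex.I
  refine Module.End.eigenvectors_linearIndependent' T
    (fun J => Complex.exp (2 * Real.pi * Complex.I * z J)) (exp_two_pi_injective hz) _ fun J => ?_
  rw [Module.End.hasEigenvector_iff, Module.End.mem_eigenspace_iff]
  refine ⟨_root_.funext fun τ => PsiJ_add_two_pi hz J τ, fun h0 => ?_⟩
  have hzero : ∀ l : ℂ, fser z J l = 0 := by
    intro l
    have h1 := congrFun h0 (l - Real.pi * Complex.I * (2 - n))
    have h2 := coord_PsiJ_eq hz J ⟨0, J.pos⟩ (l - Real.pi * Complex.I * (2 - n))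
    rw [h1] at h2
    simp only [Pi.zero_apply, raise_zero, lam, add_sub_cancel] at h2
    have h3 : coord z (0 : HT z) ⟨0, J.pos⟩ = 0 := by simp [coord]
    rw [h3] at h2
    exact (mul_eq_zero.1 h2.symm).resolve_left (pow_ne_zero _ (by norm_num))
  have := tendsto_fser hz J
  simp only [hzero, mul_zero] at this
  exact coef_zero_ne hz J (tendsto_nhds_unique this tendsto_const_nhds)

theorem hasDerivAt_sum_PsiJ {z : Fin n → ℂ} (hz : z ∈ generic n) (a : Fin n → ℂ) (τ : ℂ) :
    HasDerivAt (fun τ' => ∑ J, a J • coord z (PsiJ J τ' z))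
      (flowOp z τ (∑ J, a J • coord z (PsiJ J τ z))) τ := by
  rw [flowOp_sum]
  exact HasDerivAt.fun_sum fun J _ => (hasDerivAt_coord_PsiJ hz J τ).const_smul (a J)

theorem coord_sum_smul {ι : Type*} (s : Finset ι) (z : Fin n → ℂ) (a : ι → ℂ) (v : ι → HT z) :
    coord z (∑ j ∈ s, a j • v j) = ∑ j ∈ s, a j • coord z (v j) := by
  funext i
  rw [coord_sum, Finset.sum_apply]
  exact Finset.sum_congr rfl fun j _ => coord_smul z _ _ _

/-- A combination that vanishes at one point vanishes identically, by uniqueness for the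
differential equation. -/
theorem linearIndependent_PsiJ_apply {z : Fin n → ℂ} (hz : z ∈ generic n) (τ : ℂ) :
    LinearIndependent ℂ fun (J : Fin n) => coord z (PsiJ J τ z) := by
  rw [Fintype.linearIndependent_iff]
  intro a ha
  have h := Fintype.linearIndependent_iff.1 (linearIndependent_PsiJ hz) a
  refine h (_root_.funext fun τ' => ?_)
  have h0 := eq_zero_of_flow convex_univ (fun τ _ => hasDerivAt_sum_PsiJ hz a τ) (Set.mem_univ τ) ha
    (Set.mem_univ τ')
  refine coord_ext fun i => ?_
  rw [Finset.sum_apply]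
  change coord z (∑ J, a J • PsiJ J τ' z) i = coord z 0 i
  rw [coord_sum_smul, h0]
  simp [coord]

/-- The fundamental matrix formed by the Jackson integrals. -/
noncomputable def fundMat (τ : ℂ) (z : Fin n → ℂ) : Matrix (Fin n) (Fin n) ℂ :=
  Matrix.of fun i J => coord z (PsiJ J τ z) i

theorem det_fundMat_ne {z : Fin n → ℂ} (hz : z ∈ generic n) (τ : ℂ) : (fundMat τ z).det ≠ 0 := by
  have h : LinearIndependent ℂ (fundMat τ z).col := linearIndependent_PsiJ_apply hz τ
  rw [Matrix.linearIndependent_cols_iff_isUnit, Matrix.isUnit_iff_isUnit_det] at h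
  exact h.ne_zero

theorem mulVec_fundMat (τ : ℂ) (z : Fin n → ℂ) (a : Fin n → ℂ) :
    (fundMat τ z).mulVec a = ∑ J, a J • coord z (PsiJ J τ z) := by
  funext i
  simp only [Matrix.mulVec, dotProduct, fundMat, Matrix.of_apply, Finset.sum_apply, Pi.smul_apply,
    smul_eq_mul, mul_comm]

/-- Cramer's rule for a nonsingular matrix. -/
noncomputable def cramerSol (A : Matrix (Fin n) (Fin n) ℂ) (b : Fin n → ℂ) : Fin n → ℂ :=
  fun J => (A.updateCol J b).det / A.det

theorem mulVec_cramerSol {A : Matrix (Fin n) (Fin n) ℂ} (h : A.det ≠ 0) (b : Fin n → ℂ) :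
    A.mulVec (cramerSol A b) = b := by
  have h1 : cramerSol A b = A.det⁻¹ • A.cramer b := by
    funext J
    rw [cramerSol, Pi.smul_apply, Matrix.cramer_apply, smul_eq_mul, div_eq_inv_mul]
  rw [h1, Matrix.mulVec_smul, Matrix.mulVec_cramer, smul_smul, inv_mul_cancel₀ h, one_smul]

theorem eq_sum_PsiJ_of_flow {z : Fin n → ℂ} (hz : z ∈ generic n) {U : Set ℂ} (hU : Convex ℝ U)
    {F : ℂ → Fin n → ℂ} (hF : ∀ τ ∈ U, HasDerivAt F (flowOp z τ (F τ)) τ) {τ₀ : ℂ} (h₀ : τ₀ ∈ U)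
    {τ : ℂ} (hτ : τ ∈ U) :
    F τ = ∑ J, cramerSol (fundMat τ₀ z) (F τ₀) J • coord z (PsiJ J τ z) := by
  rw [← sub_eq_zero]
  refine eq_zero_of_flow hU (z := z) (F := fun τ => F τ - ∑ J, cramerSol (fundMat τ₀ z) (F τ₀) J •
    coord z (PsiJ J τ z)) (fun τ hτ => ?_) h₀ ?_ hτ
  · rw [flowOp_sub]
    exact (hF τ hτ).sub (hasDerivAt_sum_PsiJ hz _ τ)
  · rw [← mulVec_fundMat, mulVec_cramerSol (det_fundMat_ne hz τ₀), sub_self]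

end Uniqueness
end EquivQDE
namespace EquivQDE

/-! ### Bases of the module of solutions over periodic functions -/

section Bases
variable {n : ℕ}

namespace IsPeriodicScalar
variable {c d : (Fin n → ℂ) → ℂ}

theorem const (a : ℂ) : IsPeriodicScalar fun _ : Fin n → ℂ => a :=
  ⟨differentiableOn_const a, fun _ _ _ => rfl⟩

theorem mul (hc : IsPeriodicScalar c) (hd : IsPeriodicScalar d) :
    IsPeriodicScalar fun z => c z * d z :=
  ⟨hc.1.mul hd.1, fun z hz i => by rw [hc.2 z hz, hd.2 z hz]⟩

theorem div (hc : IsPeriodicScalar c) (hd : IsPeriodicScalar d) (h : ∀ z ∈ generic n, d z ≠ 0) :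
    IsPeriodicScalar fun z => c z / d z :=
  ⟨by simp only [div_eq_mul_inv]; exact hc.1.mul (hd.1.inv h), fun z hz i => by rw [hc.2 z hz, hd.2 z hz]⟩

theorem sum {ι : Type*} (s : Finset ι) {f : ι → (Fin n → ℂ) → ℂ} (h : ∀ i ∈ s, IsPeriodicScalar (f i)) :
    IsPeriodicScalar fun z => ∑ i ∈ s, f i z :=
  ⟨DifferentiableOn.fun_sum fun i hi => (h i hi).1,
    fun z hz j => Finset.sum_congr rfl fun i hi => (h i hi).2 z hz j⟩

theorem prod {ι : Type*} (s : Finset ι) {f : ι → (Fin n → ℂ) → ℂ} (h : ∀ i ∈ s, IsPeriodicScalar (f i)) :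
    IsPeriodicScalar fun z => ∏ i ∈ s, f i z := by
  refine ⟨fun z hz => (differentiableAt_finset_prod s fun i hi => ?_).differentiableWithinAt,
    fun z hz j => Finset.prod_congr rfl fun i hi => (h i hi).2 z hz j⟩
  exact (h i hi).1.differentiableAt (isOpen_generic.mem_nhds hz)

theorem det {A : (Fin n → ℂ) → Matrix (Fin n) (Fin n) ℂ}
    (h : ∀ i j, IsPeriodicScalar fun z => A z i j) : IsPeriodicScalar fun z => (A z).det := by
  simp only [Matrix.det_apply]
  refine sum _ fun σ _ => ?_
  have := (const (n := n) ((Equiv.Perm.sign σ : ℤ) : ℂ)).mul (prod Finset.univ fun i _ => h (σ i) i)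
  convert this using 2
  rw [Units.smul_def, zsmul_eq_mul]

theorem sub_single (hc : IsPeriodicScalar c) {z : Fin n → ℂ} (hz : z ∈ generic n) (i : Fin n) :
    c (z - Pi.single i 1) = c z := by
  rw [← hc.2 _ (generic_sub_single hz i) i, sub_add_cancel]

end IsPeriodicScalar

theorem differentiableOn_det {E : Type*} [NormedAddCommGroup E] [NormedSpace ℂ E] {U : Set E}
    (hU : IsOpen U) {A : E → Matrix (Fin n) (Fin n) ℂ}
    (h : ∀ i j, DifferentiableOn ℂ (fun z => A z i j) U) :
    DifferentiableOn ℂ (fun z => (A z).det) U := by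
  simp only [Matrix.det_apply']
  refine DifferentiableOn.fun_sum fun σ _ => DifferentiableOn.const_mul (fun z hz => ?_) _
  exact (differentiableAt_finset_prod _ fun i _ =>
    (h (σ i) i).differentiableAt (hU.mem_nhds hz)).differentiableWithinAt

theorem IsSolution.sum_smul {ι : Type*} (s : Finset ι) {I : ι → Fam n} {c : ι → (Fin n → ℂ) → ℂ}
    (hI : ∀ i ∈ s, IsSolution (I i)) (hc : ∀ i ∈ s, IsPeriodicScalar (c i)) :
    IsSolution fun τ z => ∑ i ∈ s, c i z • I i τ z where
  holomorphic i := by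
    simp only [coord_sum, coord_smul]
    refine DifferentiableOn.fun_sum fun j hj => DifferentiableOn.mul ?_ ((hI j hj).holomorphic i)
    exact (hc j hj).1.comp differentiableOn_snd fun q hq => hq.2
  qde τ z hz i := by
    simp only [map_sum, map_smul, coord_sum, coord_smul]
    exact HasDerivAt.fun_sum fun j hj => ((hI j hj).qde τ z hz i).const_mul _
  qkz τ z hz i j := by
    simp only [map_sum, map_smul, coord_sum, coord_smul, ← Finset.sum_neg_distrib]
    refine Finset.sum_congr rfl fun a ha => ?_
    rw [(hc a ha).sub_single hz, (hI a ha).qkz τ z hz, mul_neg]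

theorem hasDerivAt_coord {F : Fam n} (hF : IsSolution F) {z : Fin n → ℂ} (hz : z ∈ generic n) (τ : ℂ) :
    HasDerivAt (fun τ => coord z (F τ z)) (flowOp z τ (coord z (F τ z))) τ := by
  rw [← coord_quantumMul_exp, hasDerivAt_pi]
  exact hF.qde τ z hz

theorem IsSolution.differentiableOn_coord_zero {F : Fam n} (hF : IsSolution F) (i : Fin n) :
    DifferentiableOn ℂ (fun z => coord z (F 0 z) i) (generic n) :=
  (hF.holomorphic i).comp (f := fun z : Fin n → ℂ => ((0 : ℂ), z)) (by fun_prop)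
    fun z hz => ⟨Set.mem_univ _, hz⟩

/-- At fixed z a solution is the combination of the `Ψ_J` that agrees with it at `τ = 0`. The
coefficients are ratios of determinants of holomorphic functions by Cramer's rule. -/
theorem isSolutionBasis_PsiJ : IsSolutionBasis fun J : Fin n => PsiJ J where
  isSolution := isSolution_PsiJ
  independent z hz := linearIndependent_PsiJ hz
  generates F hF := by
    have key : ∀ τ, ∀ z ∈ generic n,
        F τ z = ∑ J, cramerSol (fundMat 0 z) (coord z (F 0 z)) J • PsiJ J τ z := by
      intro τ z hz
      have := eq_sum_PsiJ_of_flow hz convex_univ (F := fun τ => coord z (F τ z))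
        (fun τ _ => hasDerivAt_coord hF hz τ) (Set.mem_univ (0 : ℂ)) (Set.mem_univ τ)
      refine coord_ext fun i => ?_
      rw [coord_sum_smul, ← this]
    refine ⟨fun J z => cramerSol (fundMat 0 z) (coord z (F 0 z)) J, fun J => ⟨?_, ?_⟩, key⟩
    · have hm : ∀ i J, DifferentiableOn ℂ (fun z : Fin n → ℂ => fundMat 0 z i J) (generic n) :=
        fun i J => (isSolution_PsiJ J).differentiableOn_coord_zero i
      simp only [cramerSol, div_eq_mul_inv]
      refine (differentiableOn_det isOpen_generic fun i j => ?_).mul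
        ((differentiableOn_det isOpen_generic hm).inv fun z hz => det_fundMat_ne hz 0)
      simp only [Matrix.updateCol_apply]
      split_ifs
      · exact hF.differentiableOn_coord_zero i
      · exact hm i j
    · intro z' hz' i
      obtain ⟨z, hz, rfl⟩ : ∃ z : Fin n → ℂ, z ∈ generic n ∧ z' = z - Pi.single i 1 :=
        ⟨z' + Pi.single i 1, generic_add_single hz' i, (add_sub_cancel_right _ _).symm⟩
      rw [sub_add_cancel]
      -- Periodicity: the solution and all `Ψ_J` are transported by the same linear qKZ operator, so
      -- the coefficients at z also serve at the shifted point, where they are unique by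
      -- independence.
      have h1 : coord (z - Pi.single i 1) (F 0 (z - Pi.single i 1)) =
          ∑ J, cramerSol (fundMat 0 z) (coord z (F 0 z)) J •
            coord (z - Pi.single i 1) (PsiJ J 0 (z - Pi.single i 1)) := by
        funext j
        rw [hF.qkz 0 z hz, key 0 z hz]
        simp only [map_sum, map_smul, coord_sum, coord_smul, Finset.sum_apply, Pi.smul_apply,
          smul_eq_mul, ← Finset.sum_neg_distrib, (isSolution_PsiJ _).qkz 0 z hz, mul_neg]
        rw [← key 0 z hz]
      have h2 : coord (z - Pi.single i 1) (F 0 (z - Pi.single i 1)) = ∑ J,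
          cramerSol (fundMat 0 (z - Pi.single i 1)) (coord (z - Pi.single i 1) (F 0 (z - Pi.single i 1))) J •
            coord (z - Pi.single i 1) (PsiJ J 0 (z - Pi.single i 1)) := by
        conv_lhs => rw [key 0 _ hz', coord_sum_smul]
      have h3 := h1.symm.trans h2
      rw [← sub_eq_zero, ← Finset.sum_sub_distrib] at h3
      simp only [← sub_smul] at h3
      exact sub_eq_zero.1 (Fintype.linearIndependent_iff.1 (linearIndependent_PsiJ_apply hz' 0) _ h3 J)

/-- The determinant is itself a nowhere vanishing periodic function on generic parameters, so
Cramer's rule inverts the matrix within the ring of scalars. -/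
theorem IsSolutionBasis.mul_matrix {P : Fin n → Fam n} (hP : IsSolutionBasis P)
    {B : (Fin n → ℂ) → Matrix (Fin n) (Fin n) ℂ} (hB : ∀ i j, IsPeriodicScalar fun z => B z i j)
    (hdet : ∀ z ∈ generic n, (B z).det ≠ 0) :
    IsSolutionBasis fun j => (fun τ z => ∑ J, B z J j • P J τ z : Fam n) where
  isSolution j := IsSolution.sum_smul _ (fun J _ => hP.isSolution J) fun J _ => hB J j
  generates F hF := by
    obtain ⟨c, hc, h⟩ := hP.generates F hF
    refine ⟨fun j z => cramerSol (B z) (fun J => c J z) j, fun j => ?_, fun τ z hz => ?_⟩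
    · refine (IsPeriodicScalar.det fun i j' => ?_).div (IsPeriodicScalar.det hB) hdet
      simp only [Matrix.updateCol_apply]
      split_ifs
      · exact hc i
      · exact hB i j'
    · rw [h τ z hz]
      simp only [Finset.smul_sum, smul_smul]
      rw [Finset.sum_comm]
      refine Finset.sum_congr rfl fun J _ => ?_
      rw [← Finset.sum_smul]
      congr 1
      have := congrFun (mulVec_cramerSol (hdet z hz) fun J => c J z) J
      rw [← this, Matrix.mulVec, dotProduct]
      exact Finset.sum_congr rfl fun j _ => mul_comm _ _
  independent z hz := by
    rw [Fintype.linearIndependent_iff]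
    intro a ha
    have h1 : ∑ J, (B z).mulVec a J • (fun τ => P J τ z) = 0 := by
      rw [← ha]
      funext τ
      simp only [Finset.sum_apply, Pi.smul_apply, Finset.smul_sum, smul_smul]
      rw [Finset.sum_comm]
      refine Finset.sum_congr rfl fun J _ => ?_
      rw [← Finset.sum_smul, Matrix.mulVec, dotProduct]
      congr 1
      exact Finset.sum_congr rfl fun j _ => mul_comm _ _
    have h2 := Fintype.linearIndependent_iff.1 (hP.independent z hz) _ h1
    exact congrFun (Matrix.eq_zero_of_mulVec_eq_zero (hdet z hz) (_root_.funext h2))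

theorem isPeriodicScalar_exp (a : Fin n) :
    IsPeriodicScalar fun z : Fin n → ℂ => Complex.exp (2 * Real.pi * Complex.I * z a) := by
  refine ⟨by fun_prop, fun z _ i => ?_⟩
  rw [Complex.exp_eq_exp_iff_exists_int]
  refine ⟨if a = i then 1 else 0, ?_⟩
  rw [Pi.add_apply, Pi.single_apply]
  split_ifs <;> push_cast <;> ring

theorem isPeriodicScalar_exp_zpow (a : Fin n) (m : ℤ) :
    IsPeriodicScalar fun z : Fin n → ℂ => Complex.exp (2 * Real.pi * Complex.I * z a) ^ m := by
  refine ⟨?_, fun z hz i => by rw [(isPeriodicScalar_exp a).2 z hz]⟩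
  simp only [← Complex.exp_int_mul]
  fun_prop

theorem isPeriodicScalar_evalZ (f : Laurent n) : IsPeriodicScalar fun z => evalZ z f := by
  have h : ∀ z : Fin n → ℂ, evalZ z f = ∑ α ∈ f.coeff.support,
      f.coeff α * ∏ a, Complex.exp (2 * Real.pi * Complex.I * z a) ^ α a := by
    intro z
    rw [evalZ, AddMonoidAlgebra.lift_apply, Finsupp.sum]
    rfl
  simp only [h]
  exact IsPeriodicScalar.sum _ fun α _ => (IsPeriodicScalar.const _).mul
    (IsPeriodicScalar.prod _ fun a _ => isPeriodicScalar_exp_zpow a _)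

theorem isPeriodicScalar_evalX (v : M n) (J : Fin n) : IsPeriodicScalar fun z => evalX z J v := by
  unfold evalX
  refine IsPeriodicScalar.sum _ fun j _ => (isPeriodicScalar_evalZ _).mul ?_
  simpa using isPeriodicScalar_exp_zpow J (j.val : ℤ)

/-- The matrix factors into the Vandermonde matrix of the distinct numbers `Z_J` and the value of a
matrix which is invertible over Laurent polynomials because its columns span. -/
theorem det_evalX_ne {Q : Fin n → M n} (hQ : Submodule.span (Laurent n) (Set.range Q) = ⊤)
    {z : Fin n → ℂ} (hz : z ∈ generic n) : (Matrix.of fun J j => evalX z J (Q j)).det ≠ 0 := by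
  have h1 : (Matrix.of fun J j => evalX z J (Q j)) =
      (Matrix.vandermonde fun J => Complex.exp (2 * Real.pi * Complex.I * z J)) *
        ((Matrix.of fun i j => Q j i).map (evalZ z)) := by
    ext J j
    rw [Matrix.mul_apply, Matrix.of_apply, evalX]
    exact Finset.sum_congr rfl fun i _ => mul_comm _ _
  have h2 : ∀ i, ∃ c : Fin n → Laurent n, ∑ j, c j • Q j = Pi.single i 1 := by
    intro i
    have : (Pi.single i 1 : M n) ∈ Submodule.span (Laurent n) (Set.range Q) := by
      rw [hQ]; trivial
    exact Submodule.mem_span_range_iff_exists_fun _ |>.1 this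
  choose c hc using h2
  have h3 : (Matrix.of fun i j => Q j i) * (Matrix.of fun j i => c i j) =
      (1 : Matrix (Fin n) (Fin n) (Laurent n)) := by
    refine Matrix.ext fun i j => ?_
    rw [Matrix.mul_apply]
    have := congrFun (hc j) i
    simp only [Finset.sum_apply, Pi.smul_apply, smul_eq_mul, Pi.single_apply] at this
    rw [Matrix.one_apply, ← this]
    exact Finset.sum_congr rfl fun k _ => by rw [Matrix.of_apply, Matrix.of_apply, mul_comm]
  have h4 : ((Matrix.of fun i j => Q j i).map (evalZ z)).det ≠ 0 := by
    have := congrArg Matrix.det h3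
    rw [Matrix.det_mul, Matrix.det_one] at this
    have h5 := congrArg (evalZ z) this
    rw [map_mul, map_one, AlgHom.map_det] at h5
    exact left_ne_zero_of_mul_eq_one h5
  rw [h1, Matrix.det_mul]
  exact mul_ne_zero (Matrix.det_vandermonde_ne_zero_iff.2 (exp_two_pi_injective hz)) h4

/-- The images of a basis of `M_n` form a basis of solutions. -/
theorem isSolutionBasis_toSolution {Q : Fin n → M n}
    (hQ : Submodule.span (Laurent n) (Set.range Q) = ⊤) :
    IsSolutionBasis fun j => toSolution (Q j) := by
  have h := isSolutionBasis_PsiJ.mul_matrix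
    (B := fun z => Matrix.of fun J j => evalX z J (Q j))
    (fun J j => isPeriodicScalar_evalX (Q j) J) fun z hz => det_evalX_ne hQ hz
  convert h using 2 with j
  funext τ z
  exact toSolution_eq (Q j) τ z

end Bases
end EquivQDE
namespace EquivQDE

/-! ### Exponential bounds for the Gamma function -/

section GammaBounds
open MeasureTheory

theorem norm_cpow_mul_exp (W S : ℂ) {t : ℝ} (ht : 0 < t) :
    ‖(t : ℂ) ^ (W - 1) * Complex.exp (-(S * t))‖ = t ^ (W.re - 1) * Real.exp (-(S.re * t)) := by
  rw [norm_mul, Complex.norm_cpow_eq_rpow_re_of_pos ht, Complex.norm_exp]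
  simp

theorem aestronglyMeasurable_cpow_mul_exp (W S : ℂ) : AEStronglyMeasurable
    (fun t : ℝ => (t : ℂ) ^ (W - 1) * Complex.exp (-(S * t))) (volume.restrict (Set.Ioi 0)) := by
  refine ContinuousOn.aestronglyMeasurable (fun t ht => ?_) measurableSet_Ioi
  have : (t : ℂ) ∈ Complex.slitPlane := by
    rw [Complex.ofReal_mem_slitPlane]; exact ht
  refine ContinuousAt.continuousWithinAt (ContinuousAt.mul ?_ (by fun_prop))
  exact ContinuousAt.cpow (by fun_prop) continuousAt_const this

theorem integrableOn_rpow_mul_exp_neg {a b : ℝ} (ha : 0 < a) (hb : 0 < b) :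
    IntegrableOn (fun t : ℝ => t ^ (a - 1) * Real.exp (-(b * t))) (Set.Ioi 0) := by
  have := integrableOn_rpow_mul_exp_neg_mul_rpow (s := a - 1) (p := 1) (b := b) (by linarith) one_pos hb
  simpa using this

theorem integrableOn_cpow_mul_exp {W S : ℂ} (hW : 0 < W.re) (hS : 0 < S.re) :
    IntegrableOn (fun t : ℝ => (t : ℂ) ^ (W - 1) * Complex.exp (-(S * t))) (Set.Ioi 0) := by
  refine (integrableOn_rpow_mul_exp_neg hW hS).mono' (aestronglyMeasurable_cpow_mul_exp W S) ?_
  filter_upwards [ae_restrict_mem measurableSet_Ioi] with t ht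
  exact (norm_cpow_mul_exp W S ht).le

theorem hasDerivAt_integral_cpow_mul_exp {W S : ℂ} (hW : 0 < W.re) (hS : 0 < S.re) :
    DifferentiableAt ℂ
      (fun S : ℂ => ∫ t : ℝ in Set.Ioi 0, (t : ℂ) ^ (W - 1) * Complex.exp (-(S * t))) S := by
  have hb := integrableOn_rpow_mul_exp_neg (a := W.re + 1) (b := S.re / 2) (by linarith) (by linarith)
  refine (hasDerivAt_integral_of_dominated_loc_of_deriv_le (μ := volume.restrict (Set.Ioi 0))
    (F' := fun S (t : ℝ) => -((t : ℂ) ^ (W + 1 - 1) * Complex.exp (-(S * t))))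
    (Metric.ball_mem_nhds S (half_pos hS)) (Eventually.of_forall fun S =>
      aestronglyMeasurable_cpow_mul_exp W S) (integrableOn_cpow_mul_exp hW hS)
    (aestronglyMeasurable_cpow_mul_exp (W + 1) S).neg ?_ hb ?_).2.differentiableAt
  · filter_upwards [ae_restrict_mem measurableSet_Ioi] with t ht S' hS'
    have h1 : S.re / 2 ≤ S'.re := by
      have h2 := (Complex.abs_re_le_norm (S' - S)).trans (mem_ball_iff_norm.1 hS').le
      rw [Complex.sub_re, abs_le] at h2
      linarith
    rw [norm_neg, norm_cpow_mul_exp _ _ ht, Complex.add_re, Complex.one_re]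
    have : 0 < t := ht
    gcongr
  · filter_upwards [ae_restrict_mem measurableSet_Ioi] with t ht S' _
    have ht' : (t : ℂ) ≠ 0 := by
      have : 0 < t := ht
      exact_mod_cast this.ne'
    have h1 : (t : ℂ) ^ (W + 1 - 1) = t ^ (W - 1) * t := by
      rw [show W + 1 - 1 = (W - 1) + 1 by ring, Complex.cpow_add _ _ ht', Complex.cpow_one]
    have h2 : HasDerivAt (fun S : ℂ => -(S * t)) (-(1 * t)) S' := ((hasDerivAt_id S').mul_const _).neg
    have h3 := h2.cexp.const_mul ((t : ℂ) ^ (W - 1))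
    convert! h3 using 1
    rw [h1]; ring

/-- Both sides are holomorphic in S on the right half-plane and agree for real S, where the integral
is classical. -/
theorem integral_cpow_mul_exp {W S : ℂ} (hW : 0 < W.re) (hS : 0 < S.re) :
    ∫ t : ℝ in Set.Ioi 0, (t : ℂ) ^ (W - 1) * Complex.exp (-(S * t)) = S ^ (-W) * Complex.Gamma W := by
  have hopen : IsOpen {S : ℂ | 0 < S.re} := isOpen_lt continuous_const Complex.continuous_re
  have hconv : Convex ℝ {S : ℂ | 0 < S.re} := convex_halfSpace_re_gt 0
  have h1 : DifferentiableOn ℂ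
      (fun S : ℂ => ∫ t : ℝ in Set.Ioi 0, (t : ℂ) ^ (W - 1) * Complex.exp (-(S * t))) {S : ℂ | 0 < S.re} :=
    fun S hS => (hasDerivAt_integral_cpow_mul_exp hW hS).differentiableWithinAt
  have h2 : DifferentiableOn ℂ (fun S : ℂ => S ^ (-W) * Complex.Gamma W) {S : ℂ | 0 < S.re} :=
    fun S hS => ((differentiableAt_id.cpow_const (Or.inl hS)).mul_const _).differentiableWithinAt
  refine (h1.analyticOnNhd hopen).eqOn_of_preconnected_of_frequently_eq (h2.analyticOnNhd hopen)
    hconv.isPreconnected (z₀ := 1) (by simp) ?_ hS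
  have h3 : Tendsto (fun x : ℝ => (x : ℂ)) (𝓝[>] 1) (𝓝[≠] 1) := by
    refine tendsto_nhdsWithin_of_tendsto_nhds_of_eventually_within _ ?_ ?_
    · exact (Complex.continuous_ofReal.tendsto' 1 1 (by simp)).mono_left nhdsWithin_le_nhds
    · filter_upwards [self_mem_nhdsWithin] with x hx
      have : (1 : ℝ) < x := hx
      simp only [Set.mem_compl_iff, Set.mem_singleton_iff]
      exact_mod_cast this.ne'
  refine h3.frequently (Eventually.frequently ?_)
  filter_upwards [self_mem_nhdsWithin] with x hx
  have hx0 : (0 : ℝ) < x := lt_trans one_pos hx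
  rw [Complex.integral_cpow_mul_exp_neg_mul_Ioi hW hx0, one_div, Complex.inv_cpow, Complex.cpow_neg]
  rw [Complex.arg_ofReal_of_nonneg hx0.le]
  exact Real.pi_pos.ne

/-- Exponential bound for `Γ(W) S^{-W}`, with `S = e^ℓ` in the right half-plane. -/
theorem norm_Gamma_mul_exp_le {W l : ℂ} (hW : 0 < W.re) (hl : |l.im| < Real.pi / 2) :
    ‖Complex.Gamma W * Complex.exp (-W * l)‖ ≤
      Real.Gamma W.re * (Complex.exp l).re ^ (-W.re) := by
  have hS : 0 < (Complex.exp l).re := by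
    rw [Complex.exp_re]
    exact mul_pos (Real.exp_pos _) (Real.cos_pos_of_mem_Ioo (abs_lt.1 hl))
  have hpi := Real.pi_pos
  have h1 : Complex.exp l ^ (-W) = Complex.exp (-W * l) := by
    rw [Complex.cpow_def_of_ne_zero (Complex.exp_ne_zero _), Complex.log_exp, mul_comm]
    · linarith [(abs_lt.1 hl).1]
    · linarith [(abs_lt.1 hl).2]
  rw [← h1, mul_comm, ← integral_cpow_mul_exp hW hS]
  refine (norm_integral_le_integral_norm _).trans (le_of_eq ?_)
  rw [setIntegral_congr_fun measurableSet_Ioi fun t ht => norm_cpow_mul_exp W _ ht,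
    Real.integral_rpow_mul_exp_neg_mul_Ioi hW hS, one_div, Real.inv_rpow hS.le, Real.rpow_neg hS.le,
    mul_comm]

/-- Euler's integral is taken with `S = e^{±iθ}`, the sign being that of `Im W`; the factor `S^{-W}`
then yields the decay `e^{-θ|Im W|}`. -/
theorem norm_Gamma_le {W : ℂ} (hW : 0 < W.re) {θ : ℝ} (h0 : 0 ≤ θ) (hθ : θ < Real.pi / 2) :
    ‖Complex.Gamma W‖ ≤ Real.Gamma W.re * Real.cos θ ^ (-W.re) * Real.exp (-(θ * |W.im|)) := by
  obtain ⟨ε, hε, hεW⟩ : ∃ ε : ℝ, |ε| = 1 ∧ ε * W.im = |W.im| := by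
    rcases le_total 0 W.im with h | h
    · exact ⟨1, by simp, by rw [abs_of_nonneg h, one_mul]⟩
    · exact ⟨-1, by simp, by rw [abs_of_nonpos h]; ring⟩
  have h1 := norm_Gamma_mul_exp_le (W := W) (l := ((ε * θ : ℝ) : ℂ) * Complex.I) hW (by
    simpa [abs_mul, hε, abs_of_nonneg h0] using hθ)
  have h2 : (Complex.exp (((ε * θ : ℝ) : ℂ) * Complex.I)).re = Real.cos θ := by
    rw [Complex.exp_ofReal_mul_I_re, ← Real.cos_abs, abs_mul, hε, one_mul, Real.cos_abs]
  have h3 : ‖Complex.exp (-W * (((ε * θ : ℝ) : ℂ) * Complex.I))‖ = Real.exp (θ * |W.im|) := by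
    rw [Complex.norm_exp, ← hεW]
    congr 1
    simp
    ring
  rw [norm_mul, h2, h3] at h1
  rw [Real.exp_neg, ← div_eq_mul_inv, le_div_iff₀ (Real.exp_pos _)]
  exact h1

/-- Exponential decay of the Gamma function on vertical strips. -/
theorem exists_norm_Gamma_le (A B : ℝ) {θ : ℝ} (h0 : 0 ≤ θ) (hθ : θ < Real.pi / 2) :
    ∃ C > 0, ∀ W : ℂ, A ≤ W.re → W.re ≤ B → 1 ≤ |W.im| →
      ‖Complex.Gamma W‖ ≤ C * Real.exp (-(θ * |W.im|)) := by
  obtain ⟨m, hm⟩ := exists_nat_gt (1 - A)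
  have hcos : 0 < Real.cos θ := Real.cos_pos_of_mem_Ioo ⟨by linarith [Real.pi_pos], hθ⟩
  have hcont : ContinuousOn (fun x : ℝ => Real.Gamma x * Real.cos θ ^ (-x)) (Set.Icc 1 (B + m)) := by
    refine ContinuousOn.mul (fun x hx => ?_) ?_
    · refine (Real.differentiableAt_Gamma fun k => ?_).continuousAt.continuousWithinAt
      have := hx.1
      have : (0 : ℝ) ≤ k := k.cast_nonneg
      intro h; linarith
    · exact ContinuousOn.rpow continuousOn_const continuousOn_id.neg fun x _ => Or.inl hcos.ne'
  obtain ⟨C, hC⟩ := isCompact_Icc.bddAbove_image hcont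
  refine ⟨max C 1, by positivity, fun W hA hB hW => ?_⟩
  have him : W.im ≠ 0 := by
    intro h; rw [h, abs_zero] at hW; linarith
  have h1 : Complex.Gamma (W + m) = (∏ k ∈ Finset.range m, (W + k)) * Complex.Gamma W :=
    Gamma_add_nat m fun k _ h => him (by simpa using congrArg Complex.im h)
  have h2 : 1 ≤ ‖∏ k ∈ Finset.range m, (W + k)‖ := by
    rw [norm_prod]
    refine Finset.prod_induction _ (fun x : ℝ => 1 ≤ x)
      (fun a b => one_le_mul_of_one_le_of_one_le) le_rfl fun k _ => ?_
    have := Complex.abs_im_le_norm (W + k)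
    simp only [Complex.add_im, Complex.natCast_im, add_zero] at this
    linarith
  have h3 := norm_Gamma_le (W := W + m) (by simp; linarith) h0 hθ
  simp only [Complex.add_im, Complex.natCast_im, add_zero, Complex.add_re, Complex.natCast_re] at h3
  have h4 : Real.Gamma (W.re + m) * Real.cos θ ^ (-(W.re + m)) ≤ max C 1 :=
    (hC ⟨W.re + m, ⟨by linarith, by linarith⟩, rfl⟩).trans (le_max_left _ _)
  calc ‖Complex.Gamma W‖ ≤ ‖∏ k ∈ Finset.range m, (W + k)‖ * ‖Complex.Gamma W‖ :=
        le_mul_of_one_le_left (norm_nonneg _) h2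
    _ = ‖Complex.Gamma (W + m)‖ := by rw [h1, norm_mul]
    _ ≤ _ := h3.trans (by gcongr)

end GammaBounds
end EquivQDE
namespace EquivQDE

/-! ### Shifting a vertical line of integration across simple poles -/

section StripShift
open MeasureTheory

/-- Removal of isolated singularities. -/
theorem analyticAt_limUnder {φ k : ℂ → ℂ} {w₀ : ℂ} (hk : AnalyticAt ℂ k w₀)
    (h : ∀ᶠ w in 𝓝[≠] w₀, φ w = k w) :
    AnalyticAt ℂ (fun w => limUnder (𝓝[≠] w) φ) w₀ := by
  refine hk.congr ?_
  rw [eventually_nhdsWithin_iff] at h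
  filter_upwards [h.eventually_nhds, hk.eventually_analyticAt] with w hw hkw
  symm
  refine Tendsto.limUnder_eq ?_
  refine (hkw.continuousAt.tendsto.mono_left nhdsWithin_le_nhds).congr' ?_
  by_cases hww : w = w₀
  · subst hww
    exact (eventually_nhdsWithin_iff.2 hw).mono fun u hu => hu.symm
  · filter_upwards [hw.filter_mono nhdsWithin_le_nhds,
      (isOpen_ne.mem_nhds hww : {u | u ≠ w₀} ∈ 𝓝 w) |> mem_nhdsWithin_of_mem_nhds] with u hu hu2
    exact (hu hu2).symm

theorem limUnder_eq_of_continuousAt {φ : ℂ → ℂ} {w : ℂ} (h : ContinuousAt φ w) :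
    limUnder (𝓝[≠] w) φ = φ w :=
  (h.tendsto.mono_left nhdsWithin_le_nhds).limUnder_eq

/-- A polar part is integrable over a vertical line only in the symmetric sense. A line to the right
of the pole gives π and one to the left gives -π, so the two together account for `2π` per residue.
-/
theorem tendsto_integral_inv_of_pos {σ : ℝ} (hσ : 0 < σ) (τ : ℝ) :
    Tendsto (fun T : ℝ => ∫ y in (-T)..T, ((σ : ℂ) + (y - τ : ℝ) * Complex.I)⁻¹) atTop (𝓝 Real.pi) := by
  have hslit : ∀ y : ℝ, (σ : ℂ) + (y - τ : ℝ) * Complex.I ∈ Complex.slitPlane := fun y =>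
    Or.inl (by simpa using hσ)
  have hder : ∀ y : ℝ, HasDerivAt
      (fun y : ℝ => -Complex.I * Complex.log ((σ : ℂ) + (y - τ : ℝ) * Complex.I))
      (((σ : ℂ) + (y - τ : ℝ) * Complex.I)⁻¹) y := by
    intro y
    have h1 : HasDerivAt (fun y : ℝ => (σ : ℂ) + (y - τ : ℝ) * Complex.I) (1 * Complex.I) y :=
      ((((hasDerivAt_id y).sub_const τ).ofReal_comp).mul_const Complex.I).const_add _
    have h2 := (h1.clog_real (hslit y)).const_mul (-Complex.I)
    convert! h2 using 1
    rw [one_mul, mul_div_assoc', neg_mul, Complex.I_mul_I, neg_neg, one_div]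
  have hcont : Continuous fun y : ℝ => ((σ : ℂ) + (y - τ : ℝ) * Complex.I)⁻¹ :=
    Continuous.inv₀ (by fun_prop) fun y => Complex.slitPlane_ne_zero (hslit y)
  have hval : ∀ T : ℝ, ∫ y in (-T)..T, ((σ : ℂ) + (y - τ : ℝ) * Complex.I)⁻¹ =
      -Complex.I * Complex.log ((σ : ℂ) + (T - τ : ℝ) * Complex.I) -
      -Complex.I * Complex.log ((σ : ℂ) + (-T - τ : ℝ) * Complex.I) := fun T =>
    intervalIntegral.integral_eq_sub_of_hasDerivAt (fun y _ => hder y)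
      (hcont.intervalIntegrable _ _)
  -- The two logarithms of the primitive are rescaled by T; the terms `log T` cancel and the
  -- arguments tend to `±i`.
  have hscale : ∀ᶠ T : ℝ in atTop, -Complex.I * Complex.log ((σ : ℂ) + (T - τ : ℝ) * Complex.I) -
      -Complex.I * Complex.log ((σ : ℂ) + (-T - τ : ℝ) * Complex.I) =
      -Complex.I * Complex.log (((σ * T⁻¹ : ℝ) : ℂ) + (1 - τ * T⁻¹ : ℝ) * Complex.I) -
      -Complex.I * Complex.log (((σ * T⁻¹ : ℝ) : ℂ) + (-1 - τ * T⁻¹ : ℝ) * Complex.I) := by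
    filter_upwards [eventually_gt_atTop (0 : ℝ)] with T hT
    have hT' : (T : ℂ) ≠ 0 := by exact_mod_cast hT.ne'
    have e : ∀ s : ℝ, (σ : ℂ) + (s * T - τ : ℝ) * Complex.I =
        (T : ℂ) * (((σ * T⁻¹ : ℝ) : ℂ) + (s - τ * T⁻¹ : ℝ) * Complex.I) := by
      intro s; push_cast; field_simp
    have hne : ∀ s : ℝ, (((σ * T⁻¹ : ℝ) : ℂ) + (s - τ * T⁻¹ : ℝ) * Complex.I) ≠ 0 := by
      intro s h
      have := congrArg Complex.re h
      simp at this
      rcases this with h | h <;> linarith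
    have e1 := e 1
    have e2 := e (-1)
    rw [one_mul] at e1
    rw [neg_one_mul] at e2
    rw [e1, e2, Complex.log_ofReal_mul hT (hne 1), Complex.log_ofReal_mul hT (hne (-1))]
    ring
  have hinv : Tendsto (fun T : ℝ => T⁻¹) atTop (𝓝 0) := tendsto_inv_atTop_zero
  have hlim : ∀ s : ℝ, s ≠ 0 → Tendsto (fun T : ℝ =>
      Complex.log (((σ * T⁻¹ : ℝ) : ℂ) + (s - τ * T⁻¹ : ℝ) * Complex.I)) atTop
        (𝓝 (Complex.log ((s : ℂ) * Complex.I))) := by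
    intro s hs
    have h1 : Tendsto (fun T : ℝ => ((σ * T⁻¹ : ℝ) : ℂ) + (s - τ * T⁻¹ : ℝ) * Complex.I) atTop
        (𝓝 ((s : ℂ) * Complex.I)) := by
      have h2 : Continuous fun u : ℝ => ((σ * u : ℝ) : ℂ) + (s - τ * u : ℝ) * Complex.I := by fun_prop
      have h3 := (h2.tendsto 0).comp hinv
      simpa [Function.comp_def] using h3
    refine h1.clog ?_
    right; simpa using hs
  have := ((hlim 1 one_ne_zero).const_mul (-Complex.I)).sub
    ((hlim (-1) (by norm_num)).const_mul (-Complex.I))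
  simp only [hval]
  refine Tendsto.congr' (hscale.mono fun T hT => hT.symm) ?_
  convert this using 2
  push_cast
  rw [one_mul, neg_one_mul, Complex.log_I, Complex.log_neg_I]
  linear_combination (Real.pi : ℂ) * Complex.I_sq

theorem tendsto_integral_inv_of_neg {σ : ℝ} (hσ : σ < 0) (τ : ℝ) :
    Tendsto (fun T : ℝ => ∫ y in (-T)..T, ((σ : ℂ) + (y - τ : ℝ) * Complex.I)⁻¹) atTop
      (𝓝 (-Real.pi)) := by
  refine (tendsto_integral_inv_of_pos (neg_pos.2 hσ) (-τ)).neg.congr fun T => ?_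
  have := intervalIntegral.integral_comp_neg (a := -T) (b := T)
    (fun y : ℝ => ((σ : ℂ) + (y - τ : ℝ) * Complex.I)⁻¹)
  rw [neg_neg] at this
  rw [← this, ← intervalIntegral.integral_neg]
  refine intervalIntegral.integral_congr fun y _ => ?_
  rw [← inv_neg]
  congr 1
  push_cast
  ring

/-- Bounded decay in a vertical strip: an exponential bound for large imaginary part. -/
def StripDecay (f : ℂ → ℂ) (a b : ℝ) : Prop :=
  ∃ C η Y : ℝ, 0 < C ∧ 0 < η ∧ 0 ≤ Y ∧ ∀ σ ∈ Set.Icc a b, ∀ y : ℝ, Y ≤ |y| →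
    ‖f (σ + y * Complex.I)‖ ≤ C * Real.exp (-(η * |y|))

theorem integrable_exp_neg_mul_abs {η : ℝ} (h : 0 < η) :
    Integrable fun y : ℝ => Real.exp (-(η * |y|)) := by
  rw [← integrableOn_univ, ← Set.Iic_union_Ioi (a := (0 : ℝ)), integrableOn_union]
  constructor
  · refine (integrableOn_exp_mul_Iic h 0).congr_fun (fun y hy => ?_) measurableSet_Iic
    dsimp only
    rw [abs_of_nonpos hy, mul_neg, neg_neg]
  · refine (integrableOn_exp_mul_Ioi (neg_neg_iff_pos.2 h) 0).congr_fun (fun y hy => ?_)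
      measurableSet_Ioi
    dsimp only
    rw [abs_of_pos hy, neg_mul]

theorem StripDecay.integrable {f : ℂ → ℂ} {a b σ : ℝ} (h : StripDecay f a b) (hσ : σ ∈ Set.Icc a b)
    (hc : Continuous fun y : ℝ => f (σ + y * Complex.I)) :
    Integrable fun y : ℝ => f (σ + y * Complex.I) := by
  obtain ⟨C, η, Y, hC, hη, hY, hb⟩ := h
  obtain ⟨D, hD⟩ := (isCompact_Icc (a := -Y) (b := Y)).bddAbove_image
    (f := fun y : ℝ => ‖f (σ + y * Complex.I)‖ * Real.exp (η * |y|))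
    (hc.norm.mul (by fun_prop)).continuousOn
  refine ((integrable_exp_neg_mul_abs hη).const_mul (max C D)).mono' hc.aestronglyMeasurable
    (Eventually.of_forall fun y => ?_)
  rcases le_total Y |y| with h1 | h1
  · exact (hb σ hσ y h1).trans (by gcongr; exact le_max_left _ _)
  · have := hD ⟨y, abs_le.1 h1, rfl⟩
    rw [Real.exp_neg, ← div_eq_mul_inv, le_div_iff₀ (Real.exp_pos _)]
    exact this.trans (le_max_right _ _)

/-- The difference of the integrals over two vertical lines is the sum of the residues at the simple
poles between them. -/
theorem integral_strip_shift {f : ℂ → ℂ} {a b : ℝ} (hab : a < b) (P : Finset ℂ) (ρ : ℂ → ℂ)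
    (hP : ∀ p ∈ P, a < p.re ∧ p.re < b)
    (hf : ∀ w : ℂ, a ≤ w.re → w.re ≤ b → w ∉ P → AnalyticAt ℂ f w)
    (hpole : ∀ p ∈ P, ∃ h : ℂ → ℂ, AnalyticAt ℂ h p ∧ h p = ρ p ∧ ∀ᶠ w in 𝓝[≠] p, f w = h w / (w - p))
    (hdec : StripDecay f a b) :
    (∫ y : ℝ, f (b + y * Complex.I)) - ∫ y : ℝ, f (a + y * Complex.I) = 2 * Real.pi * ∑ p ∈ P, ρ p := by
  -- All polar parts are subtracted at once, and g fills in the removable singularities by limits,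
  -- so that Cauchy's theorem on rectangles applies to g.
  set φ : ℂ → ℂ := fun w => f w - ∑ p ∈ P, ρ p * (w - p)⁻¹ with hφ
  set g : ℂ → ℂ := fun w => limUnder (𝓝[≠] w) φ with hg
  have hterm : ∀ w p : ℂ, w ≠ p → AnalyticAt ℂ (fun u => ρ p * (u - p)⁻¹) w := fun w p hwp =>
    analyticAt_const.mul (AnalyticAt.inv (by fun_prop) (sub_ne_zero.2 hwp))
  have hφa : ∀ w : ℂ, a ≤ w.re → w.re ≤ b → w ∉ P → AnalyticAt ℂ φ w := fun w h1 h2 h3 =>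
    (hf w h1 h2 h3).sub (Finset.analyticAt_fun_sum _ fun p hp =>
      hterm w p fun h => h3 (h ▸ hp))
  have hgφ : ∀ w : ℂ, a ≤ w.re → w.re ≤ b → w ∉ P → g w = φ w := fun w h1 h2 h3 =>
    limUnder_eq_of_continuousAt (hφa w h1 h2 h3).continuousAt
  have hga : ∀ w : ℂ, a ≤ w.re → w.re ≤ b → AnalyticAt ℂ g w := by
    intro w h1 h2
    by_cases h3 : w ∈ P
    · obtain ⟨h, ha, hw, he⟩ := hpole w h3
      obtain ⟨ps, hps⟩ := ha
      have hd : AnalyticAt ℂ (dslope h w) w := ⟨_, hps.has_fpower_series_dslope_fslope⟩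
      refine analyticAt_limUnder (hd.sub (Finset.analyticAt_fun_sum (P.erase w) fun p hp =>
        hterm w p (Finset.mem_erase.1 hp).1.symm)) ?_
      filter_upwards [he, self_mem_nhdsWithin] with u hu huw
      simp only [hφ, Pi.sub_apply]
      rw [← Finset.add_sum_erase _ _ h3, hu, dslope_of_ne _ huw, slope_def_field, hw]
      rw [div_eq_mul_inv, div_eq_mul_inv]
      ring
    · exact analyticAt_limUnder (hφa w h1 h2 h3) (Eventually.of_forall fun _ => rfl)
  have hlinea : ∀ y : ℝ, ((a : ℂ) + y * Complex.I) ∉ P := fun y hy => by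
    have := (hP _ hy).1; simp at this
  have hlineb : ∀ y : ℝ, ((b : ℂ) + y * Complex.I) ∉ P := fun y hy => by
    have := (hP _ hy).2; simp at this
  have hla : ∀ σ y : ℝ, ((σ : ℂ) + y * Complex.I).re = σ := by intro σ y; simp
  have hline : ∀ σ ∈ Set.Icc a b, (∀ y : ℝ, ((σ : ℂ) + y * Complex.I) ∉ P) →
      Continuous fun y : ℝ => f (σ + y * Complex.I) := by
    intro σ hσ h
    rw [continuous_iff_continuousAt]
    intro y
    exact ContinuousAt.comp (f := fun y : ℝ => (σ : ℂ) + y * Complex.I)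
      (hf _ (by rw [hla]; exact hσ.1) (by rw [hla]; exact hσ.2) (h y)).continuousAt (by fun_prop)
  have hma : a ∈ Set.Icc a b := ⟨le_rfl, hab.le⟩
  have hmb : b ∈ Set.Icc a b := ⟨hab.le, le_rfl⟩
  -- the integrals of `g` over the two lines
  have hvert : ∀ σ ∈ Set.Icc a b, (∀ y : ℝ, ((σ : ℂ) + y * Complex.I) ∉ P) → ∀ ε : ℝ,
      (∀ p ∈ P, Tendsto (fun T : ℝ => ∫ y in (-T)..T, ((σ : ℂ) + y * Complex.I - p)⁻¹) atTop
        (𝓝 (ε * Real.pi))) →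
      Tendsto (fun T : ℝ => ∫ y in (-T)..T, g (σ + y * Complex.I)) atTop
        (𝓝 ((∫ y : ℝ, f (σ + y * Complex.I)) - ∑ p ∈ P, ρ p * (ε * Real.pi))) := by
    intro σ hσ h ε hε
    have hcf := hline σ hσ h
    have h1 := intervalIntegral_tendsto_integral (hdec.integrable hσ hcf) tendsto_neg_atTop_atBot
      tendsto_id
    have h2 := tendsto_finsetSum P fun p hp => (hε p hp).const_mul (ρ p)
    refine (h1.sub h2).congr fun T => ?_
    have hci : ∀ p ∈ P, Continuous fun y : ℝ => ρ p * ((σ : ℂ) + y * Complex.I - p)⁻¹ := fun p hp =>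
      continuous_const.mul (Continuous.inv₀ (by fun_prop) fun y hy => h y (by
        rw [sub_eq_zero.1 hy]; exact hp))
    simp only [← intervalIntegral.integral_const_mul, id]
    rw [← intervalIntegral.integral_finsetSum fun p hp => (hci p hp).intervalIntegrable _ _,
      ← intervalIntegral.integral_sub (hcf.intervalIntegrable _ _)
        ((continuous_finsetSum _ hci).intervalIntegrable _ _)]
    refine intervalIntegral.integral_congr fun y _ => ?_
    exact (hgφ _ (by rw [hla]; exact hσ.1) (by rw [hla]; exact hσ.2) (h y)).symm
  have hvb := hvert b hmb hlineb 1 fun p hp => by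
    have := tendsto_integral_inv_of_pos (sub_pos.2 (hP p hp).2) p.im
    convert! this using 2 with T
    · refine intervalIntegral.integral_congr fun y _ => ?_
      congr 1
      apply Complex.ext <;> simp
    · simp
  have hva := hvert a hma hlinea (-1) fun p hp => by
    have := tendsto_integral_inv_of_neg (sub_neg.2 (hP p hp).1) p.im
    convert! this using 2 with T
    · refine intervalIntegral.integral_congr fun y _ => ?_
      congr 1
      apply Complex.ext <;> simp
    · simp
  -- the horizontal sides
  obtain ⟨C, η, Y, hC, hη, hY, hb⟩ := hdec
  set δ : ℝ → ℝ := fun T => C * Real.exp (-(η * T)) + ∑ p ∈ P, ‖ρ p‖ * (T - |p.im|)⁻¹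
  have hδ : Tendsto δ atTop (𝓝 0) := by
    have h1 : Tendsto (fun T : ℝ => C * Real.exp (-(η * T))) atTop (𝓝 (C * 0)) :=
      (Real.tendsto_exp_neg_atTop_nhds_zero.comp (tendsto_id.const_mul_atTop hη)).const_mul C
    have h2 := tendsto_finsetSum P fun p _ => (tendsto_inv_atTop_zero.comp
      (tendsto_atTop_add_const_right atTop (-|p.im|) tendsto_id)).const_mul ‖ρ p‖
    simpa [δ, Function.comp_def, sub_eq_add_neg] using h1.add h2
  have hbound : ∀ᶠ T : ℝ in atTop, ∀ s : ℝ, |s| = T → ∀ x ∈ Set.Icc a b,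
      ‖g (x + s * Complex.I)‖ ≤ δ T := by
    have hT : ∀ᶠ T : ℝ in atTop, ∀ p ∈ P, |p.im| < T :=
      (Filter.eventually_all_finset P).2 fun p _ => eventually_gt_atTop _
    filter_upwards [hT, eventually_ge_atTop Y] with T hT hTY s hs x hx
    have hnot : ((x : ℂ) + s * Complex.I) ∉ P := fun hp => by
      have := hT _ hp
      simp [hs] at this
    rw [hgφ _ (by rw [hla]; exact hx.1) (by rw [hla]; exact hx.2) hnot]
    refine (norm_sub_le _ _).trans (add_le_add ?_ ((norm_sum_le _ _).trans
      (Finset.sum_le_sum fun p hp => ?_)))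
    · have := hb x hx s (by rw [hs]; exact hTY)
      rwa [hs] at this
    · rw [norm_mul, norm_inv]
      have h1 : 0 < T - |p.im| := sub_pos.2 (hT p hp)
      have h2 : T - |p.im| ≤ ‖(x : ℂ) + s * Complex.I - p‖ := by
        have h3 := Complex.abs_im_le_norm ((x : ℂ) + s * Complex.I - p)
        have h4 := abs_sub_abs_le_abs_sub s p.im
        simp only [Complex.sub_im, Complex.add_im, Complex.ofReal_im, Complex.mul_im,
          Complex.ofReal_re, Complex.I_im, Complex.I_re, mul_one, mul_zero, zero_add, add_zero] at h3
        rw [hs] at h4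
        linarith
      gcongr
  have hlim : Tendsto (fun T : ℝ => (∫ y in (-T)..T, g (b + y * Complex.I)) -
      ∫ y in (-T)..T, g (a + y * Complex.I)) atTop (𝓝 0) := by
    have hz : Tendsto (fun T => 2 * (δ T * |b - a|)) atTop (𝓝 0) := by
      simpa using (hδ.mul_const |b - a|).const_mul 2
    refine squeeze_zero_norm' ?_ hz
    filter_upwards [hbound, eventually_gt_atTop 0] with T hT hT0
    have hrect := Complex.integral_boundary_rect_eq_zero_of_differentiableOn g
      ((a : ℂ) + (-T : ℝ) * Complex.I) ((b : ℂ) + (T : ℝ) * Complex.I) (by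
        intro w hw
        have hw1 := hw.1
        simp only [hla, Set.mem_preimage, Set.uIcc_of_le hab.le] at hw1
        exact (hga w hw1.1 hw1.2).differentiableAt.differentiableWithinAt)
    have him : ∀ σ y : ℝ, ((σ : ℂ) + y * Complex.I).im = y := by intro σ y; simp
    simp only [hla, him] at hrect
    have hh : ∀ s : ℝ, |s| = T → ‖∫ x in a..b, g (x + s * Complex.I)‖ ≤ δ T * |b - a| := fun s hs =>
      intervalIntegral.norm_integral_le_of_norm_le_const fun x hx => by
        rw [Set.uIoc_of_le hab.le] at hx
        exact hT s hs x ⟨hx.1.le, hx.2⟩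
    have h1 := hh T (abs_of_pos hT0)
    have h2 := hh (-T) (by rw [abs_neg, abs_of_pos hT0])
    simp only [smul_eq_mul] at hrect
    have h3 : Complex.I * ((∫ y in (-T)..T, g (b + y * Complex.I)) -
        ∫ y in (-T)..T, g (a + y * Complex.I)) =
        (∫ x in a..b, g (x + (T : ℝ) * Complex.I)) - ∫ x in a..b, g (x + (-T : ℝ) * Complex.I) := by
      linear_combination hrect
    have h4 := congrArg norm h3
    rw [norm_mul, Complex.norm_I, one_mul] at h4
    rw [h4]
    refine (norm_sub_le _ _).trans ?_
    linarith
  -- The two vertical integrals of g have equal limits, since the horizontal sides contribute at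
  -- most δ(T), which tends to 0; comparing with the polar parts gives the residues.
  have hfin := tendsto_nhds_unique (hvb.sub hva) hlim
  rw [← sub_eq_zero, ← hfin, Finset.mul_sum]
  simp only [← Finset.sum_mul]
  rw [← Finset.mul_sum]
  push_cast
  ring

end StripShift
end EquivQDE
namespace EquivQDE

/-! ### The Mellin-Barnes integral as the sum of all residue series -/

section Barnes
open MeasureTheory
variable {n : ℕ}

theorem analyticAt_barnes {z : Fin n → ℂ} {l t : ℂ} (h : ∀ a, ∀ m : ℕ, t ≠ z a + m) :
    AnalyticAt ℂ (barnes z l) t := by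
  refine AnalyticAt.mul (Differentiable.analyticAt (by fun_prop) t)
    (Finset.analyticAt_fun_prod _ fun a _ => ?_)
  refine AnalyticAt.fun_comp (analyticAt_Gamma fun m hm => h a m ?_)
    (Differentiable.analyticAt (by fun_prop) t)
  linear_combination -hm

/-- Each Gamma factor decays like `e^{-θ|y|}` for any `θ < π/2`, while the exponential grows at most
like `e^{|Im l||y|}`. A θ strictly between `|Im l|/n` and `π/2` leaves a positive rate. -/
theorem stripDecay_barnes (z : Fin n → ℂ) {l : ℂ} (hl : |l.im| < n * (Real.pi / 2)) (A B : ℝ) :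
    StripDecay (barnes z l) A B := by
  have hpi := Real.pi_pos
  have hn : (0 : ℝ) < n := by
    by_contra h
    have : (n : ℝ) = 0 := le_antisymm (not_lt.1 h) n.cast_nonneg
    rw [this, zero_mul] at hl
    exact absurd hl (not_lt.2 (abs_nonneg _))
  obtain ⟨θ, hθ1, hθ2⟩ := exists_between (show |l.im| / n < Real.pi / 2 by rw [div_lt_iff₀ hn]; linarith)
  have hθ0 : 0 ≤ θ := le_trans (by positivity) hθ1.le
  choose C hC hCb using fun a : Fin n => exists_norm_Gamma_le ((z a).re - B) ((z a).re - A) hθ0 hθ2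
  refine ⟨Real.exp (|l.re| * max |A| |B|) * ∏ a, (C a * Real.exp (θ * |(z a).im|)), n * θ - |l.im|,
    1 + ∑ a, |(z a).im|, mul_pos (Real.exp_pos _) (Finset.prod_pos fun a _ =>
      mul_pos (hC a) (Real.exp_pos _)), ?_, by positivity, fun σ hσ y hy => ?_⟩
  · rw [div_lt_iff₀ hn] at hθ1; linarith
  have h1 : ‖Complex.exp (l * (σ + y * Complex.I))‖ ≤
      Real.exp (|l.re| * max |A| |B|) * Real.exp (|l.im| * |y|) := by
    rw [Complex.norm_exp, ← Real.exp_add]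
    apply Real.exp_le_exp.2
    have e : (l * (σ + y * Complex.I)).re = l.re * σ + -(l.im * y) := by simp; ring
    rw [e]
    have h2 : |σ| ≤ max |A| |B| := abs_le_max_abs_abs hσ.1 hσ.2
    refine add_le_add ((le_abs_self _).trans ?_) ((neg_le_abs _).trans (abs_mul _ _).le)
    rw [abs_mul]
    gcongr
  have h2 : ∀ a, ‖Complex.Gamma (z a - (σ + y * Complex.I))‖ ≤
      C a * Real.exp (θ * |(z a).im|) * Real.exp (-(θ * |y|)) := by
    intro a
    have h3 : |(z a).im| ≤ ∑ a, |(z a).im| :=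
      Finset.single_le_sum (f := fun a => |(z a).im|) (fun _ _ => abs_nonneg _) (Finset.mem_univ a)
    have h4 : |y| - |(z a).im| ≤ |(z a).im - y| := by
      have := abs_sub_abs_le_abs_sub y (z a).im
      rwa [abs_sub_comm] at this
    have h5 := hCb a (z a - (σ + y * Complex.I)) (by simp; linarith [hσ.2]) (by simp; linarith [hσ.1])
      (by simp; linarith)
    refine h5.trans ?_
    rw [mul_assoc, ← Real.exp_add]
    have := hC a
    gcongr
    simp only [Complex.sub_im, Complex.add_im, Complex.ofReal_im, Complex.mul_im, Complex.ofReal_re,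
      Complex.I_im, Complex.I_re, mul_one, mul_zero, zero_add, add_zero]
    nlinarith
  rw [barnes, norm_mul, norm_prod]
  calc _ ≤ (Real.exp (|l.re| * max |A| |B|) * Real.exp (|l.im| * |y|)) *
        ∏ a, (C a * Real.exp (θ * |(z a).im|) * Real.exp (-(θ * |y|))) := by
        gcongr with a
        exact h2 a
    _ = _ := by
        rw [Finset.prod_mul_distrib, Finset.prod_const, Finset.card_univ, Fintype.card_fin,
          ← Real.exp_nat_mul, show -((n * θ - |l.im|) * |y|) = |l.im| * |y| + n * (-(θ * |y|)) by ring,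
          Real.exp_add]
        ring

theorem barnes_add_one (z : Fin n → ℂ) (l t : ℂ) (h : ∀ a, z a - (t + 1) ≠ 0) :
    barnes z l (t + 1) * ∏ a, (z a - (t + 1)) = Complex.exp l * barnes z l t := by
  rw [barnes, barnes, mul_assoc, ← Finset.prod_mul_distrib, mul_add, mul_one, Complex.exp_add]
  have : ∀ a, Complex.Gamma (z a - (t + 1)) * (z a - (t + 1)) = Complex.Gamma (z a - t) := by
    intro a
    rw [mul_comm, ← Complex.Gamma_add_one _ (h a)]
    congr 1; ring
  rw [Finset.prod_congr rfl fun a _ => this a]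
  ring

theorem exists_line (z : Fin n → ℂ) (σ : ℝ) : ∃ s > σ, ∀ a, ∀ m : ℤ, (z a).re - s ≠ m := by
  have hc : (⋃ a : Fin n, Set.range fun m : ℤ => (z a).re - m).Countable :=
    Set.countable_iUnion fun a => Set.countable_range _
  obtain ⟨s, hs, hσ⟩ := (hc.dense_compl ℝ).exists_gt σ
  refine ⟨s, hσ, fun a m h => hs ?_⟩
  exact Set.mem_iUnion.2 ⟨a, m, by dsimp only; linarith⟩

/-- By the functional equation, passing from the line `s + N` to `s + N + 1` multiplies the
integrand by `e^l / ∏(z_a - t - 1)`, with t on the line `s + N`. Hence the `L¹` norms eventually at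
least halve at every step. -/
theorem tendsto_integral_barnes {z : Fin n → ℂ} {l : ℂ} (hl : |l.im| < n * (Real.pi / 2)) {s : ℝ}
    (hs : ∀ a, ∀ m : ℤ, (z a).re - s ≠ m) :
    Tendsto (fun N : ℕ => ∫ y : ℝ, barnes z l ((s + N : ℝ) + y * Complex.I)) atTop (𝓝 0) := by
  have hn : 0 < n := by
    rcases Nat.eq_zero_or_pos n with rfl | h
    · rw [Nat.cast_zero, zero_mul] at hl
      exact absurd hl (not_lt.2 (abs_nonneg _))
    · exact h
  have hint : ∀ N : ℕ, Integrable fun y : ℝ => barnes z l ((s + N : ℝ) + y * Complex.I) := by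
    intro N
    refine (stripDecay_barnes z hl (s + N) (s + N)).integrable ⟨le_rfl, le_rfl⟩ ?_
    rw [continuous_iff_continuousAt]
    intro y
    refine ContinuousAt.comp (f := fun y : ℝ => ((s + N : ℝ) : ℂ) + y * Complex.I)
      (analyticAt_barnes fun a m h => hs a (N - m) ?_).continuousAt (by fun_prop)
    have := congrArg Complex.re h
    simp at this
    push_cast
    linarith
  set c : ℕ → ℝ := fun N => ∫ y : ℝ, ‖barnes z l ((s + N : ℝ) + y * Complex.I)‖
  have hstep : ∀ N : ℕ, c (N + 1) * ∏ a, |(z a).re - s - (N + 1)| ≤ Real.exp l.re * c N := by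
    intro N
    rw [← integral_mul_const, ← integral_const_mul]
    refine integral_mono ((hint (N + 1)).norm.mul_const _) ((hint N).norm.const_mul _) fun y => ?_
    have hne : ∀ a, z a - (((s + N : ℝ) : ℂ) + y * Complex.I + 1) ≠ 0 := by
      intro a h
      have := congrArg Complex.re h
      simp at this
      refine hs a (N + 1) ?_
      push_cast
      linarith
    have h1 := congrArg norm (barnes_add_one z l (((s + N : ℝ) : ℂ) + y * Complex.I) hne)
    rw [norm_mul, norm_mul, norm_prod, Complex.norm_exp] at h1
    have e : ((s + (N + 1 : ℕ) : ℝ) : ℂ) + y * Complex.I = ((s + N : ℝ) : ℂ) + y * Complex.I + 1 := by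
      push_cast; ring
    dsimp only
    rw [← h1, e]
    gcongr with a
    have := Complex.abs_re_le_norm (z a - (((s + N : ℝ) : ℂ) + y * Complex.I + 1))
    simp only [Complex.sub_re, Complex.add_re, Complex.ofReal_re, Complex.mul_re, Complex.ofReal_im,
      Complex.I_re, Complex.I_im, mul_zero, zero_mul, sub_zero, add_zero, Complex.one_re] at this
    rwa [show (z a).re - s - ((N : ℝ) + 1) = (z a).re - (s + N + 1) by ring]
  have hprod : Tendsto (fun N : ℕ => ∏ a, |(z a).re - s - ((N : ℝ) + 1)|) atTop atTop := by
    have h1 : ∀ a, Tendsto (fun N : ℕ => |(z a).re - s - ((N : ℝ) + 1)|) atTop atTop := by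
      intro a
      refine tendsto_abs_atBot_atTop.comp ?_
      have : Tendsto (fun N : ℕ => ((N : ℝ) + 1)) atTop atTop :=
        tendsto_atTop_add_const_right _ _ tendsto_natCast_atTop_atTop
      simpa [sub_eq_add_neg] using tendsto_atBot_add_const_left atTop ((z a).re - s)
        (tendsto_neg_atTop_atBot.comp this)
    refine tendsto_atTop_mono' atTop ?_ (h1 ⟨0, hn⟩)
    filter_upwards [Filter.eventually_all.2 fun a => (h1 a).eventually_ge_atTop 1] with N hN
    rw [← Finset.mul_prod_erase _ _ (Finset.mem_univ (⟨0, hn⟩ : Fin n))]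
    refine le_mul_of_one_le_right (abs_nonneg _) ?_
    exact Finset.prod_induction _ (fun x : ℝ => 1 ≤ x)
      (fun a b => one_le_mul_of_one_le_of_one_le) le_rfl fun a _ => hN a
  have hc0 : ∀ N, 0 ≤ c N := fun N => integral_nonneg fun y => norm_nonneg _
  have hsum : Summable c := by
    refine summable_of_ratio_norm_eventually_le (r := 1 / 2) (by norm_num) ?_
    filter_upwards [hprod.eventually_ge_atTop (2 * Real.exp l.re)] with N hN
    rw [Real.norm_of_nonneg (hc0 _), Real.norm_of_nonneg (hc0 _)]
    have h1 := hstep N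
    have h2 := mul_le_mul_of_nonneg_left hN (hc0 (N + 1))
    have h3 := Real.exp_pos l.re
    have h4 : c (N + 1) * 2 * Real.exp l.re ≤ c N * Real.exp l.re := by linarith
    have := le_of_mul_le_mul_right h4 h3
    linarith
  exact squeeze_zero_norm (fun N => norm_integral_le_integral_norm _) hsum.tendsto_atTop_zero

theorem pole_injective {z : Fin n → ℂ} (hz : z ∈ generic n) :
    Function.Injective fun x : (_ : Fin n) × ℕ => z x.1 + (x.2 : ℂ) := by
  rintro ⟨a, r⟩ ⟨b, q⟩ h
  dsimp only at h
  by_cases hab : a = b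
  · subst hab
    have : (r : ℂ) = q := add_left_cancel h
    have : r = q := by exact_mod_cast this
    rw [this]
  · refine absurd ?_ (generic_ne hz hab (r - q))
    push_cast
    linear_combination h

/-- The Mellin-Barnes integral is the sum of the residue series. -/
theorem integral_barnes {z : Fin n → ℂ} (hz : z ∈ generic n) {l : ℂ}
    (hl : |l.im| < n * (Real.pi / 2)) {σ : ℝ} (hσ : ∀ a, σ < (z a).re) :
    ∫ y : ℝ, barnes z l (σ + y * Complex.I) = 2 * Real.pi * ∑ J, fser z J l := by
  obtain ⟨s, hsσ, hs⟩ := exists_line z σ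
  set pole : (_ : Fin n) × ℕ → ℂ := fun x => z x.1 + (x.2 : ℂ) with hpole
  -- The number of poles `z_J + r` to the left of the line with abscissa `s + N`.
  set K : ℕ → Fin n → ℕ := fun N J => ⌈s + N - (z J).re⌉₊
  have hK : ∀ N J r, r < K N J ↔ (z J).re + r < s + N := by
    intro N J r
    rw [Nat.lt_ceil]
    constructor <;> intro h <;> linarith
  set S : ℕ → Finset ((_ : Fin n) × ℕ) := fun N => Finset.univ.sigma fun J => Finset.range (K N J)
  have hS : ∀ N x, x ∈ S N ↔ (pole x).re < s + N := by
    intro N x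
    simp only [S, Finset.mem_sigma, Finset.mem_univ, true_and, Finset.mem_range, hK, hpole,
      Complex.add_re, Complex.natCast_re]
  -- The residue as a function of the position of the pole; it is well defined because poles of
  -- different series never coincide for generic z.
  set ρ : ℂ → ℂ := Function.extend pole (fun x => -kap z x.1 l x.2) 0
  have hρ : ∀ x, ρ (pole x) = -kap z x.1 l x.2 := fun x => (pole_injective hz).extend_apply _ _ x
  have hshift : ∀ N : ℕ, (∫ y : ℝ, barnes z l ((s + N : ℝ) + y * Complex.I)) -
      ∫ y : ℝ, barnes z l (σ + y * Complex.I) =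
      2 * Real.pi * -(∑ J, ∑ r ∈ Finset.range (K N J), kap z J l r) := by
    intro N
    have hN : (0 : ℝ) ≤ N := N.cast_nonneg
    rw [integral_strip_shift (by linarith) ((S N).image pole) ρ ?_ ?_ ?_ (stripDecay_barnes z hl _ _)]
    · rw [Finset.sum_image (pole_injective hz).injOn, Finset.sum_sigma, ← Finset.sum_neg_distrib]
      have hρ' : ∀ (a : Fin n) (r : ℕ), ρ (z a + r) = -kap z a l r := fun a r => hρ ⟨a, r⟩
      simp only [hρ', Finset.sum_neg_distrib]
    · intro p hp
      obtain ⟨x, hx, rfl⟩ := Finset.mem_image.1 hp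
      refine ⟨?_, (hS N x).1 hx⟩
      have h1 := hσ x.1
      have h2 : (0 : ℝ) ≤ x.2 := Nat.cast_nonneg _
      simp only [hpole, Complex.add_re, Complex.natCast_re]
      linarith
    · intro w _ hw hwP
      refine analyticAt_barnes fun a m h => ?_
      rcases hw.lt_or_eq with h1 | h1
      · refine hwP (Finset.mem_image.2 ⟨⟨a, m⟩, (hS N _).2 ?_, h.symm⟩)
        rwa [show pole ⟨a, m⟩ = w from h.symm]
      · refine hs a (N - m) ?_
        rw [h] at h1
        simp at h1
        push_cast
        linarith
    · intro p hp
      obtain ⟨x, hx, rfl⟩ := Finset.mem_image.1 hp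
      obtain ⟨g, hg, hv, he⟩ := exists_barnes_eq_div hz x.1 l x.2
      exact ⟨g, hg, by rw [hρ, hv], he⟩
  have hKt : ∀ J, Tendsto (fun N => K N J) atTop atTop := by
    intro J
    refine tendsto_nat_ceil_atTop.comp ?_
    have := tendsto_atTop_add_const_left atTop (s - (z J).re)
      (tendsto_natCast_atTop_atTop (R := ℝ))
    refine this.congr fun N => ?_
    ring
  have h1 : Tendsto (fun N => 2 * Real.pi * -(∑ J, ∑ r ∈ Finset.range (K N J), kap z J l r)) atTop
      (𝓝 (2 * Real.pi * -(∑ J, fser z J l) : ℂ)) :=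
    (tendsto_finsetSum _ fun J _ =>
      (hasSum_kap hz J l).tendsto_sum_nat.comp (hKt J)).neg.const_mul _
  have h2 := (tendsto_integral_barnes hl hs).sub_const (∫ y : ℝ, barnes z l (σ + y * Complex.I))
  have h3 := tendsto_nhds_unique (h2.congr hshift) h1
  linear_combination -h3

end Barnes
end EquivQDE
namespace EquivQDE

/-! ### The ratio of `∏ Γ(c_a + w)` to `Γ(nw + κ)` and its limit -/

section GammaRatio

theorem tendsto_Gamma_div {s : ℂ} (hs : 0 < s.re) :
    Tendsto (fun N : ℕ => Complex.Gamma (s + N + 1) / (Complex.exp (s * Real.log N) * N.factorial))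
      atTop (𝓝 1) := by
  have hΓ : Complex.Gamma s ≠ 0 := Complex.Gamma_ne_zero_of_re_pos hs
  have h := (Complex.GammaSeq_tendsto_Gamma s).inv₀ hΓ |>.const_mul (Complex.Gamma s)
  rw [mul_inv_cancel₀ hΓ] at h
  refine h.congr' ?_
  filter_upwards [eventually_gt_atTop 0] with N hN
  have hne : ∀ k : ℕ, s + k ≠ 0 := fun k h => by
    have := congrArg Complex.re h
    simp at this
    have : (0 : ℝ) ≤ k := k.cast_nonneg
    linarith
  have h1 := Gamma_add_nat (w := s) (N + 1) fun k _ => hne k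
  have h2 : (N : ℂ) ^ s = Complex.exp (s * Real.log N) := by
    rw [Complex.cpow_def_of_ne_zero (by exact_mod_cast hN.ne'), Complex.ofReal_log N.cast_nonneg,
      Complex.ofReal_natCast, mul_comm]
  rw [Complex.GammaSeq, h2, show s + N + 1 = s + (N + 1 : ℕ) by push_cast; ring, h1, inv_div]
  ring

/-- Stirling's formula for both factorials; the powers of e and N cancel, and only the constants
remain. -/
theorem tendsto_factorial_ratio {n : ℕ} (hn : 0 < n) :
    Tendsto (fun N : ℕ => √N * (N.factorial / √N) ^ n * (n : ℝ) ^ (n * N) / (n * N).factorial) atTop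
      (𝓝 (√(2 * Real.pi) ^ n / (√(2 * Real.pi) * √n))) := by
  have hn' : (0 : ℝ) < n := by exact_mod_cast hn
  have h1 : Tendsto (fun N : ℕ => Stirling.stirlingSeq N * √2) atTop (𝓝 √(2 * Real.pi)) := by
    have := Stirling.tendsto_stirlingSeq_sqrt_pi.mul_const √2
    rwa [← Real.sqrt_mul Real.pi_pos.le, mul_comm] at this
  have h2 := h1.comp ((strictMono_mul_left_of_pos hn).tendsto_atTop)
  have hne : √(2 * Real.pi) ≠ 0 := (Real.sqrt_pos.2 (by positivity)).ne'
  have h3 := (h1.pow n).div (h2.mul_const √n) (mul_ne_zero hne (Real.sqrt_pos.2 hn').ne')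
  refine h3.congr' ?_
  filter_upwards [eventually_gt_atTop 0] with N hN
  have hN' : (0 : ℝ) < N := by exact_mod_cast hN
  have key : ∀ m : ℕ, 0 < m → (m.factorial : ℝ) =
      Stirling.stirlingSeq m * √2 * √m * (m / Real.exp 1) ^ m := by
    intro m hm
    have hm' : (0 : ℝ) < m := by exact_mod_cast hm
    rw [Stirling.stirlingSeq, Real.sqrt_mul (by norm_num)]
    have := (Real.sqrt_pos.2 hm').ne'
    field_simp
  have hst : Stirling.stirlingSeq (n * N) ≠ 0 := by
    obtain ⟨m, hm⟩ : ∃ m, n * N = m + 1 := ⟨n * N - 1, by have := Nat.mul_pos hn hN; omega⟩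
    rw [hm]
    exact (Stirling.stirlingSeq'_pos m).ne'
  simp only [Pi.div_apply, Function.comp]
  rw [key N hN, key (n * N) (Nat.mul_pos hn hN)]
  push_cast
  rw [Real.sqrt_mul hn'.le]
  have a1 := (Real.sqrt_pos.2 hn').ne'
  have a2 := (Real.sqrt_pos.2 hN').ne'
  have a3 := Real.exp_ne_zero 1
  have e1 : Stirling.stirlingSeq N * √2 * √N * (N / Real.exp 1) ^ N / √N =
      Stirling.stirlingSeq N * √2 * (N / Real.exp 1) ^ N := by field_simp
  have e2 : ((n : ℝ) * N / Real.exp 1) ^ (n * N) = (n : ℝ) ^ (n * N) * ((N / Real.exp 1) ^ N) ^ n := by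
    rw [mul_div_assoc, mul_pow, ← pow_mul, mul_comm N n]
  rw [e1, e2, mul_pow _ (((N : ℝ) / Real.exp 1) ^ N)]
  have a4 : ((N : ℝ) / Real.exp 1) ^ N ≠ 0 := by positivity
  field_simp

variable {n : ℕ}

/-- The exponent `∑ₐ cₐ - (n - 1)/2`. -/
noncomputable def kappa (c : Fin n → ℂ) : ℂ := ∑ a, c a - ((n : ℂ) - 1) / 2

/-- `∏ₐ Γ(cₐ + w) n^{nw} / Γ(nw + κ)`. -/
noncomputable def gammaRatio (c : Fin n → ℂ) (w : ℂ) : ℂ :=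
  (∏ a, Complex.Gamma (c a + w)) * Complex.exp (n * w * Real.log n) / Complex.Gamma (n * w + kappa c)

/-- The limit of `gammaRatio` at infinity. -/
noncomputable def gammaRatioLim (c : Fin n → ℂ) : ℂ :=
  ((√(2 * Real.pi) ^ n / (√(2 * Real.pi) * √n) : ℝ) : ℂ) * Complex.exp ((1 - kappa c) * Real.log n)

theorem tendsto_gammaRatio (hn : 0 < n) (c : Fin n → ℂ) {w : ℂ} (h1 : ∀ a, 0 < (c a + w).re)
    (h2 : 0 < (n * w + kappa c).re) :
    Tendsto (fun N : ℕ => gammaRatio c (w + N + 1)) atTop (𝓝 (gammaRatioLim c)) := by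
  -- Chosen so that `n(w + N + 1) + κ = s' + nN + 1`, which puts the denominator in the form
  -- required by Euler's limit along the subsequence nN.
  set s' : ℂ := n * w + kappa c + (n - 1)
  have hn1 : (1 : ℝ) ≤ n := by exact_mod_cast hn
  have hs' : 0 < s'.re := by
    simp only [s', Complex.add_re, Complex.sub_re, Complex.natCast_re, Complex.one_re] at h2 ⊢
    linarith
  have t1 := tendsto_finsetProd Finset.univ fun a _ => tendsto_Gamma_div (h1 a)
  have t2 := (tendsto_Gamma_div hs').comp ((strictMono_mul_left_of_pos hn).tendsto_atTop)
  have t3 := (Complex.continuous_ofReal.tendsto _).comp (tendsto_factorial_ratio hn)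
  have t4 := ((t1.div t2 one_ne_zero).mul t3).mul_const (Complex.exp ((1 - kappa c) * Real.log n))
  simp only [Finset.prod_const_one, div_one, one_mul] at t4
  refine t4.congr' ?_
  filter_upwards [eventually_gt_atTop 0] with N hN
  have hN' : (0 : ℝ) < N := by exact_mod_cast hN
  have hn' : (0 : ℝ) < n := by exact_mod_cast hn
  have hsq : √(N : ℝ) = Real.exp (Real.log N / 2) := by
    rw [Real.exp_half, Real.exp_log hN']
  have e1 : √(N : ℝ) * (N.factorial / √N) ^ n * (n : ℝ) ^ (n * N) / (n * N).factorial =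
      Real.exp ((1 - n) / 2 * Real.log N + n * N * Real.log n) * N.factorial ^ n / (n * N).factorial := by
    have h3 : (n : ℝ) ^ (n * N) = Real.exp (n * N * Real.log n) := by
      rw [← Real.rpow_natCast, Real.rpow_def_of_pos hn']
      push_cast
      ring_nf
    have h4 : √(N : ℝ) * (N.factorial / √N) ^ n =
        Real.exp ((1 - n) / 2 * Real.log N) * N.factorial ^ n := by
      rw [div_pow, hsq, ← Real.exp_nat_mul,
        show (1 - n) / 2 * Real.log N = Real.log N / 2 - n * (Real.log N / 2) by ring, Real.exp_sub]
      ring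
    rw [h4, h3, Real.exp_add]
    ring
  have e2 : ∏ a, Complex.exp ((c a + w) * Real.log N) = Complex.exp ((∑ a, c a + n * w) * Real.log N) := by
    rw [← Complex.exp_sum, ← Finset.sum_mul, Finset.sum_add_distrib]
    simp
  have e3 : Real.log ((n * N : ℕ) : ℝ) = Real.log n + Real.log N := by
    rw [Nat.cast_mul, Real.log_mul hn'.ne' hN'.ne']
  have e4 : n * (w + N + 1) + kappa c = s' + (n * N : ℕ) + 1 := by
    simp only [s']; push_cast; ring
  have e5 : ∀ a, c a + (w + N + 1) = c a + w + N + 1 := fun a => by ring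
  have hX : (N.factorial : ℂ) ≠ 0 := by exact_mod_cast N.factorial_ne_zero
  have hY : ((n * N).factorial : ℂ) ≠ 0 := by exact_mod_cast (n * N).factorial_ne_zero
  simp only [Function.comp, e1, Pi.div_apply, Finset.prod_div_distrib, Finset.prod_mul_distrib, e2, e3,
    Finset.prod_const, Finset.card_univ, Fintype.card_fin, gammaRatio, e4, e5]
  push_cast
  have key : Complex.exp (s' * (Real.log n + Real.log N)) *
      Complex.exp ((1 - n) / 2 * Real.log N + n * N * Real.log n) *
      Complex.exp ((1 - kappa c) * Real.log n) =
      Complex.exp (n * (w + N + 1) * Real.log n) * Complex.exp ((∑ a, c a + n * w) * Real.log N) := by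
    rw [← Complex.exp_add, ← Complex.exp_add, ← Complex.exp_add]
    congr 1
    simp only [s', kappa]
    ring
  push_cast at key
  have hA := Complex.exp_ne_zero ((∑ a, c a + n * w) * Real.log N)
  have hB := Complex.exp_ne_zero (s' * (Real.log n + Real.log N))
  push_cast at hA hB
  generalize Complex.exp (s' * (Complex.log n + Complex.log N)) = b at *
  generalize Complex.exp ((∑ a, c a + n * w) * Complex.log N) = x at *
  generalize Complex.exp ((1 - n) / 2 * Complex.log N + n * N * Complex.log n) = y at *
  generalize Complex.exp ((1 - kappa c) * Complex.log n) = d at *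
  generalize Complex.exp (n * (w + N + 1) * Complex.log n) = f at *
  generalize ∏ a, Complex.Gamma (c a + w + N + 1) = p
  generalize Complex.Gamma (s' + n * N + 1) = q
  by_cases hG : q = 0
  · rw [hG]; simp
  field_simp
  linear_combination p * key

end GammaRatio
end EquivQDE
namespace EquivQDE

/-! ### Formal expansion of the ratio in inverse factorials -/

section Expansion

/-- `∏ (1 + d_i ξ)`. -/
noncomputable def linProd {ι : Type*} (s : Finset ι) (d : ι → ℂ) (ξ : ℂ) : ℂ := ∏ i ∈ s, (1 + d i * ξ)

theorem linProd_zero {ι : Type*} (s : Finset ι) (d : ι → ℂ) : linProd s d 0 = 1 := by simp [linProd]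

theorem analyticAt_linProd {ι : Type*} (s : Finset ι) (d : ι → ℂ) (ξ : ℂ) :
    AnalyticAt ℂ (linProd s d) ξ :=
  Finset.analyticAt_fun_prod _ fun _ _ => Differentiable.analyticAt (by fun_prop) ξ

theorem analyticAt_linProd_inv {ι : Type*} (s : Finset ι) (d : ι → ℂ) :
    AnalyticAt ℂ (fun ξ => (linProd s d ξ)⁻¹) 0 :=
  (analyticAt_linProd s d 0).inv (by rw [linProd_zero]; exact one_ne_zero)

theorem hasDerivAt_linProd {ι : Type*} (s : Finset ι) (d : ι → ℂ) :
    HasDerivAt (linProd s d) (∑ i ∈ s, d i) 0 := by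
  classical
  induction s using Finset.induction_on with
  | empty =>
    have : linProd (∅ : Finset ι) d = fun _ => 1 := by funext ξ; simp [linProd]
    rw [this, Finset.sum_empty]
    exact hasDerivAt_const _ _
  | insert i s hi ih =>
    have e : linProd (insert i s) d = fun ξ => (1 + d i * ξ) * linProd s d ξ := by
      funext ξ; rw [linProd, Finset.prod_insert hi, linProd]
    rw [e, Finset.sum_insert hi]
    have h1 : HasDerivAt (fun ξ : ℂ => 1 + d i * ξ) (d i * 1) 0 :=
      ((hasDerivAt_id (0 : ℂ)).const_mul (d i)).const_add 1
    convert! h1.mul ih using 1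
    rw [linProd_zero]; ring

theorem hasDerivAt_linProd_inv {ι : Type*} (s : Finset ι) (d : ι → ℂ) :
    HasDerivAt (fun ξ => (linProd s d ξ)⁻¹) (-∑ i ∈ s, d i) 0 := by
  have := (hasDerivAt_linProd s d).inv (by rw [linProd_zero]; exact one_ne_zero)
  rw [linProd_zero, one_pow, div_one] at this
  exact this

theorem prod_add_eq {ι : Type*} (s : Finset ι) (d : ι → ℂ) {m : ℂ} (hm : m ≠ 0) {w : ℂ} (hw : w ≠ 0) :
    ∏ i ∈ s, (m * w + d i) = (m * w) ^ s.card * linProd s (fun i => d i / m) w⁻¹ := by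
  rw [linProd, ← Finset.prod_const, ← Finset.prod_mul_distrib]
  refine Finset.prod_congr rfl fun i _ => ?_
  field_simp

theorem AnalyticAt.exists_eq_mul {f : ℂ → ℂ} (hf : AnalyticAt ℂ f 0) (h0 : f 0 = 0) :
    ∃ g : ℂ → ℂ, AnalyticAt ℂ g 0 ∧ (∀ ξ, f ξ = ξ * g ξ) ∧ g 0 = deriv f 0 := by
  obtain ⟨p, hp⟩ := hf
  refine ⟨dslope f 0, ⟨_, hp.has_fpower_series_dslope_fslope⟩, fun ξ => ?_, dslope_same f 0⟩
  have := sub_smul_dslope f 0 ξ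
  rw [h0, sub_zero, sub_zero, smul_eq_mul] at this
  exact this.symm

theorem AnalyticAt.exists_bound {f : ℂ → ℂ} (hf : AnalyticAt ℂ f 0) :
    ∃ C > 0, ∀ᶠ ξ in 𝓝 (0 : ℂ), ‖f ξ‖ ≤ C := by
  refine ⟨‖f 0‖ + 1, by positivity, ?_⟩
  filter_upwards [hf.continuousAt.norm.eventually (gt_mem_nhds (lt_add_one ‖f 0‖))] with ξ h using h.le

variable {n : ℕ} (c : Fin n → ℂ)

/-- The ratio `gammaRatio c (w + 1) / gammaRatio c w` as a function of `ξ = 1/w`. -/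
noncomputable def ratioSer (ξ : ℂ) : ℂ :=
  linProd Finset.univ c ξ * (linProd (Finset.range n) (fun i => (kappa c + i) / n) ξ)⁻¹

theorem analyticAt_ratioSer : AnalyticAt ℂ (ratioSer c) 0 :=
  (analyticAt_linProd _ _ 0).mul (analyticAt_linProd_inv _ _)

theorem ratioSer_zero : ratioSer c 0 = 1 := by simp [ratioSer, linProd_zero]

variable {c} in
-- The shift κ is chosen for this: the sum of the `c_a` equals the sum of `(κ + i)/n` over `i < n`,
-- so the step ratio is `1 + O(1/w²)`.
theorem hasDerivAt_ratioSer (hn : 0 < n) : HasDerivAt (ratioSer c) 0 0 := by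
  have hn' : (n : ℂ) ≠ 0 := by exact_mod_cast hn.ne'
  have h := (hasDerivAt_linProd Finset.univ c).mul
    (hasDerivAt_linProd_inv (Finset.range n) (fun i => (kappa c + i) / n))
  convert! h using 1
  rw [linProd_zero, linProd_zero, ← Finset.sum_div, Finset.sum_add_distrib, ← Nat.cast_sum,
    Finset.sum_range_id, Finset.sum_const, Finset.card_range, Nat.cast_div_charZero
      (even_iff_two_dvd.1 (Nat.even_mul_pred_self n)), kappa, Nat.cast_mul, Nat.cast_sub hn]
  simp only [nsmul_eq_mul]
  push_cast
  field_simp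
  ring

theorem gammaRatio_add_one (hn : 0 < n) {w : ℂ} (hw : 0 < w.re) (h1 : ∀ a, 0 < (c a + w).re)
    (h2 : 0 < (n * w + kappa c).re) : gammaRatio c (w + 1) = ratioSer c w⁻¹ * gammaRatio c w := by
  have hn' : (n : ℂ) ≠ 0 := by exact_mod_cast hn.ne'
  have hw' : w ≠ 0 := by rintro rfl; simp at hw
  have e1 : ∏ a, Complex.Gamma (c a + (w + 1)) =
      w ^ n * linProd Finset.univ c w⁻¹ * ∏ a, Complex.Gamma (c a + w) := by
    have := prod_add_eq Finset.univ c one_ne_zero hw'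
    simp only [one_mul, div_one, Finset.card_univ, Fintype.card_fin] at this
    rw [← this, ← Finset.prod_mul_distrib]
    refine Finset.prod_congr rfl fun a _ => ?_
    rw [← add_assoc, Complex.Gamma_add_one, add_comm (c a)]
    intro h
    have := h1 a
    rw [h] at this
    simp at this
  have e2 : Complex.Gamma (n * (w + 1) + kappa c) = (n * w) ^ n *
      linProd (Finset.range n) (fun i => (kappa c + i) / n) w⁻¹ * Complex.Gamma (n * w + kappa c) := by
    have := prod_add_eq (Finset.range n) (fun i : ℕ => kappa c + i) hn' hw'
    rw [Finset.card_range] at this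
    rw [← this, show n * (w + 1) + kappa c = n * w + kappa c + n by ring, Gamma_add_nat n]
    · simp only [add_assoc]
    · intro k _ h
      have h3 := congrArg Complex.re h
      rw [Complex.add_re, Complex.natCast_re, Complex.zero_re] at h3
      have : (0 : ℝ) ≤ k := k.cast_nonneg
      linarith
  have e3 : Complex.exp (n * (w + 1) * Real.log n) = n ^ n * Complex.exp (n * w * Real.log n) := by
    rw [mul_add, mul_one, add_mul, Complex.exp_add, mul_comm]
    congr 1
    rw [Complex.exp_nat_mul, ← Complex.ofReal_exp, Real.exp_log (by exact_mod_cast hn)]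
    simp
  rw [gammaRatio, gammaRatio, e1, e2, e3, ratioSer, mul_pow]
  have : (n : ℂ) ^ n ≠ 0 := pow_ne_zero _ hn'
  have : w ^ n ≠ 0 := pow_ne_zero _ hw'
  by_cases hG : Complex.Gamma (n * w + kappa c) = 0
  · rw [hG]; simp
  by_cases hL : linProd (Finset.range n) (fun i => (kappa c + i) / n) w⁻¹ = 0
  · rw [hL]; simp
  field_simp

/-- The function `1 / ∏_{i=1}^{j} (nw + κ - i)`. -/
noncomputable def invFac (j : ℕ) (w : ℂ) : ℂ := (∏ i ∈ Finset.range j, (n * w + kappa c - (i + 1)))⁻¹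

/-- `invFac` as a function of `ξ = 1/w`. -/
noncomputable def invFacSer (j : ℕ) (ξ : ℂ) : ℂ :=
  ((n : ℂ)⁻¹ * ξ) ^ j * (linProd (Finset.range j) (fun i => (kappa c - (i + 1)) / n) ξ)⁻¹

/-- The defect of `invFac` in the difference equation of `gammaRatio`, divided by `ξ^j`. -/
noncomputable def defectSer (j : ℕ) (ξ : ℂ) : ℂ :=
  (n : ℂ)⁻¹ ^ j * ((linProd (Finset.range j) (fun i => (n + kappa c - (i + 1)) / n) ξ)⁻¹ -
    ratioSer c ξ * (linProd (Finset.range j) (fun i => (kappa c - (i + 1)) / n) ξ)⁻¹)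

theorem invFac_eq (hn : 0 < n) (j : ℕ) {w : ℂ} (hw : w ≠ 0) : invFac c j w = invFacSer c j w⁻¹ := by
  have hn' : (n : ℂ) ≠ 0 := by exact_mod_cast hn.ne'
  have := prod_add_eq (Finset.range j) (fun i : ℕ => kappa c - (i + 1)) hn' hw
  rw [Finset.card_range] at this
  simp only [invFac, invFacSer, add_sub_assoc, this, mul_inv, ← inv_pow]

theorem invFac_add_one (hn : 0 < n) (j : ℕ) {w : ℂ} (hw : w ≠ 0) : invFac c j (w + 1) -
    ratioSer c w⁻¹ * invFac c j w = w⁻¹ ^ j * defectSer c j w⁻¹ := by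
  have hn' : (n : ℂ) ≠ 0 := by exact_mod_cast hn.ne'
  have := prod_add_eq (Finset.range j) (fun i : ℕ => n + kappa c - (i + 1)) hn' hw
  rw [Finset.card_range] at this
  rw [invFac_eq c hn j hw, invFacSer, defectSer, invFac]
  have e : ∀ i : ℕ, n * (w + 1) + kappa c - (i + 1) = n * w + (n + kappa c - (i + 1)) := fun i => by ring
  simp only [e, this, mul_inv, ← inv_pow, mul_pow]
  ring

theorem analyticAt_defectSer (j : ℕ) : AnalyticAt ℂ (defectSer c j) 0 :=
  analyticAt_const.mul ((analyticAt_linProd_inv _ _).sub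
    ((analyticAt_ratioSer c).mul (analyticAt_linProd_inv _ _)))

theorem defectSer_zero (j : ℕ) : defectSer c j 0 = 0 := by
  simp [defectSer, linProd_zero, ratioSer_zero]

/-- The leading coefficient `-j n^{-j}` is nonzero for `j > 0`, so the j-th basis function can
remove an error of order `w^{-j-1}`. For `j = 0` it vanishes, which is the initial gain of one
order. -/
theorem deriv_defectSer (hn : 0 < n) (j : ℕ) : deriv (defectSer c j) 0 = -j * (n : ℂ)⁻¹ ^ j := by
  have hn' : (n : ℂ) ≠ 0 := by exact_mod_cast hn.ne'
  have h := ((hasDerivAt_linProd_inv (Finset.range j) fun i : ℕ => (n + kappa c - (i + 1)) / n).sub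
    ((hasDerivAt_ratioSer (c := c) hn).mul (hasDerivAt_linProd_inv (Finset.range j)
      fun i : ℕ => (kappa c - (i + 1)) / n))).const_mul ((n : ℂ)⁻¹ ^ j)
  refine (HasDerivAt.deriv (f := defectSer c j) h).trans ?_
  rw [ratioSer_zero, zero_mul, zero_add, one_mul, mul_comm (-(j : ℂ))]
  congr 1
  have : ∀ i ∈ Finset.range j, (n + kappa c - ((i : ℂ) + 1)) / n = 1 + (kappa c - (i + 1)) / n := by
    intro i _; field_simp; ring
  rw [Finset.sum_congr rfl this, Finset.sum_add_distrib]
  simp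

theorem exists_expansion_coeff (hn : 0 < n) (M : ℕ) : ∃ a : ℕ → ℂ, a 0 = 1 ∧
    ∃ g : ℂ → ℂ, AnalyticAt ℂ g 0 ∧
      ∀ ξ, ∑ j ∈ Finset.range (M + 1), a j * (ξ ^ j * defectSer c j ξ) = ξ ^ (M + 2) * g ξ := by
  have hn' : (n : ℂ) ≠ 0 := by exact_mod_cast hn.ne'
  induction M with
  | zero =>
    obtain ⟨g, hg, he, h0⟩ := AnalyticAt.exists_eq_mul (analyticAt_defectSer c 0) (defectSer_zero c 0)
    rw [deriv_defectSer c hn, Nat.cast_zero, neg_zero, zero_mul] at h0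
    obtain ⟨g', hg', he', -⟩ := AnalyticAt.exists_eq_mul hg h0
    refine ⟨fun _ => 1, rfl, g', hg', fun ξ => ?_⟩
    rw [zero_add, Finset.sum_range_one, he, he']
    ring
  | succ M ih =>
    obtain ⟨a, ha, g, hg, he⟩ := ih
    obtain ⟨m, hm, hme, hm0⟩ := AnalyticAt.exists_eq_mul (analyticAt_defectSer c (M + 1))
      (defectSer_zero c (M + 1))
    rw [deriv_defectSer c hn] at hm0
    have hm0' : m 0 ≠ 0 := by
      rw [hm0]
      refine mul_ne_zero (neg_ne_zero.2 (by exact_mod_cast M.succ_ne_zero)) ?_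
      exact pow_ne_zero _ (inv_ne_zero hn')
    -- The new coefficient cancels the constant term of the remaining error, which therefore gains a
    -- further factor ξ.
    set α := -g 0 / m 0
    obtain ⟨g', hg', he', -⟩ := AnalyticAt.exists_eq_mul (f := fun ξ => g ξ + α * m ξ)
      (hg.add (analyticAt_const.mul hm)) (by simp only [α]; field_simp; ring)
    refine ⟨Function.update a (M + 1) α, ?_, g', hg', fun ξ => ?_⟩
    · rw [Function.update_of_ne (by omega), ha]
    · rw [Finset.sum_range_succ, Function.update_self]
      have : ∀ j ∈ Finset.range (M + 1), Function.update a (M + 1) α j * (ξ ^ j * defectSer c j ξ) =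
          a j * (ξ ^ j * defectSer c j ξ) := fun j hj => by
        rw [Function.update_of_ne (Finset.mem_range.1 hj).ne]
      rw [Finset.sum_congr rfl this, he, hme]
      linear_combination ξ ^ (M + 2) * he' ξ

end Expansion
end EquivQDE
namespace EquivQDE

/-! ### The error of the inverse factorial expansion -/

section ExpansionBound

/-- A discrete Grönwall inequality run from infinity: the errors are known to vanish there, and both
the multipliers and the inhomogeneous terms are summable perturbations. -/
theorem norm_le_of_recursion {d p e : ℕ → ℂ} {x : ℕ → ℝ} {A B : ℝ} (hx : Summable x)
    (hx0 : ∀ k, 0 ≤ x k) (hA : 0 ≤ A) (hB : 0 ≤ B) (hd : ∀ k, d k = p k * (d (k + 1) - e k))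
    (hp : ∀ k, ‖p k‖ ≤ Real.exp (A * x k)) (he : ∀ k, ‖e k‖ ≤ B * x k)
    (hlim : Tendsto d atTop (𝓝 0)) :
    ‖d 0‖ ≤ Real.exp (A * ∑' k, x k) * (B * ∑' k, x k) := by
  have h1 : ∀ N : ℕ, ‖d 0‖ ≤ Real.exp (A * ∑ k ∈ Finset.range N, x k) *
      (‖d N‖ + B * ∑ k ∈ Finset.range N, x k) := by
    intro N
    induction N with
    | zero => simp
    | succ N ih =>
      refine ih.trans ?_
      have hs : 0 ≤ ∑ k ∈ Finset.range N, x k := Finset.sum_nonneg fun k _ => hx0 k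
      have h2 : ‖d N‖ ≤ Real.exp (A * x N) * (‖d (N + 1)‖ + B * x N) := by
        rw [hd N, norm_mul]
        refine mul_le_mul (hp N) ((norm_sub_le _ _).trans (add_le_add le_rfl (he N))) (norm_nonneg _)
          (Real.exp_pos _).le
      have h3 : 1 ≤ Real.exp (A * x N) := Real.one_le_exp (mul_nonneg hA (hx0 N))
      rw [Finset.sum_range_succ, mul_add A, Real.exp_add, mul_assoc]
      refine mul_le_mul_of_nonneg_left ?_ (Real.exp_pos _).le
      have h4 : B * ∑ k ∈ Finset.range N, x k ≤ Real.exp (A * x N) * (B * ∑ k ∈ Finset.range N, x k) :=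
        le_mul_of_one_le_left (mul_nonneg hB hs) h3
      calc _ ≤ _ := add_le_add h2 h4
        _ = _ := by ring
  have h2 : Tendsto (fun N => Real.exp (A * ∑ k ∈ Finset.range N, x k) *
      (‖d N‖ + B * ∑ k ∈ Finset.range N, x k)) atTop
      (𝓝 (Real.exp (A * ∑' k, x k) * (0 + B * ∑' k, x k))) := by
    have h3 := hx.hasSum.tendsto_sum_nat
    have h4 := hlim.norm
    rw [norm_zero] at h4
    exact ((Real.continuous_exp.tendsto _).comp (h3.const_mul A)).mul (h4.add (h3.const_mul B))
  rw [zero_add] at h2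
  exact ge_of_tendsto' h2 h1

theorem summable_inv_sq : Summable fun k : ℕ => (((k : ℝ) + 1) ^ 2)⁻¹ := by
  have := (summable_nat_add_iff 1).2 (Real.summable_nat_pow_inv.2 one_lt_two)
  simpa using this

variable {n : ℕ} (c : Fin n → ℂ)

/-- The asymptotic expansion of `gammaRatio` in the functions `invFac`. -/
theorem exists_gammaRatio_expansion (hn : 0 < n) (M : ℕ) : ∃ a : ℕ → ℂ, a 0 = 1 ∧
    ∃ C σ₁ : ℝ, 0 ≤ C ∧ ∀ w : ℂ, σ₁ ≤ w.re →
      ‖gammaRatio c w - gammaRatioLim c * ∑ j ∈ Finset.range (M + 1), a j * invFac c j w‖ ≤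
        C * ‖w‖⁻¹ ^ M := by
  have hn1 : (1 : ℝ) ≤ n := by exact_mod_cast hn
  obtain ⟨a, ha, g, hg, hge⟩ := exists_expansion_coeff c hn M
  obtain ⟨C₁, hC₁, hgb⟩ := AnalyticAt.exists_bound hg
  -- the inverse ratio
  have hinv : AnalyticAt ℂ (fun ξ => (ratioSer c ξ)⁻¹ - 1) 0 :=
    ((analyticAt_ratioSer c).inv (by rw [ratioSer_zero]; exact one_ne_zero)).sub analyticAt_const
  obtain ⟨p₁, hp₁, hp₁e, hp₁0⟩ := AnalyticAt.exists_eq_mul hinv (by rw [ratioSer_zero]; simp)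
  have hp₁0' : p₁ 0 = 0 := by
    rw [hp₁0]
    have := ((hasDerivAt_ratioSer (c := c) hn).inv (by rw [ratioSer_zero]; exact one_ne_zero)).sub_const 1
    simpa using this.deriv
  obtain ⟨p₂, hp₂, hp₂e, -⟩ := AnalyticAt.exists_eq_mul hp₁ hp₁0'
  obtain ⟨C₂, hC₂, hp₂b⟩ := AnalyticAt.exists_bound hp₂
  have hne : ∀ᶠ ξ in 𝓝 (0 : ℂ), ratioSer c ξ ≠ 0 :=
    (analyticAt_ratioSer c).continuousAt.eventually_ne (by rw [ratioSer_zero]; exact one_ne_zero)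
  obtain ⟨δ, hδ, hball⟩ := Metric.eventually_nhds_iff_ball.1 (hgb.and (hp₂b.and hne))
  -- Large enough that every `1/(w + k)` lies in the disc of the local estimates and that all Gamma
  -- arguments have positive real part.
  set σ₁ : ℝ := 1 + δ⁻¹ + ∑ b, ‖c b‖ + ‖kappa c‖
  have hs0 : 0 ≤ ∑ b, ‖c b‖ := Finset.sum_nonneg fun _ _ => norm_nonneg _
  have hδi : 0 < δ⁻¹ := inv_pos.2 hδ
  set P : ℂ → ℂ := fun w => ∑ j ∈ Finset.range (M + 1), a j * invFac c j w
  set L := gammaRatioLim c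
  set Z := ∑' k : ℕ, (((k : ℝ) + 1) ^ 2)⁻¹
  have hZ : 0 ≤ Z := tsum_nonneg fun k => by positivity
  refine ⟨a, ha, Real.exp (C₂ * Z) * (‖L‖ * C₁ * Z), σ₁, by positivity, fun w hw => ?_⟩
  have hκ := norm_nonneg (kappa c)
  have hw1 : 1 ≤ w.re := by linarith
  have hwn : 1 ≤ ‖w‖ := hw1.trans ((le_abs_self _).trans (Complex.abs_re_le_norm w))
  have hre : ∀ k : ℕ, (w + k).re = w.re + k := fun k => by simp
  have hnorm1 : ∀ k : ℕ, (k : ℝ) + 1 ≤ ‖w + k‖ := fun k => by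
    have := (le_abs_self _).trans (Complex.abs_re_le_norm (w + k))
    rw [hre] at this
    linarith
  have hnorm2 : ∀ k : ℕ, ‖w‖ ≤ ‖w + k‖ := fun k => by
    rw [Complex.norm_def, Complex.norm_def]
    refine Real.sqrt_le_sqrt ?_
    rw [Complex.normSq_apply, Complex.normSq_apply, hre, Complex.add_im, Complex.natCast_im, add_zero]
    have : (0 : ℝ) ≤ k := k.cast_nonneg
    nlinarith
  have hwk : ∀ k : ℕ, w + k ≠ 0 := fun k => norm_pos_iff.1 (by linarith [hnorm2 k])
  have hξ : ∀ k : ℕ, (w + k)⁻¹ ∈ Metric.ball (0 : ℂ) δ := fun k => by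
    rw [mem_ball_zero_iff, norm_inv]
    refine inv_lt_of_inv_lt₀ hδ ?_
    have := (le_abs_self _).trans (Complex.abs_re_le_norm w)
    linarith [hnorm2 k]
  have hc1 : ∀ (k : ℕ) (b : Fin n), 0 < (c b + (w + k)).re := fun k b => by
    rw [Complex.add_re, hre]
    have h1 := (neg_le_abs (c b).re).trans (Complex.abs_re_le_norm (c b))
    have h2 : ‖c b‖ ≤ ∑ b, ‖c b‖ :=
      Finset.single_le_sum (f := fun b => ‖c b‖) (fun _ _ => norm_nonneg _) (Finset.mem_univ b)
    have : (0 : ℝ) ≤ k := k.cast_nonneg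
    linarith
  have hc2 : ∀ k : ℕ, 0 < (n * (w + k) + kappa c).re := fun k => by
    have h1 := (neg_le_abs (kappa c).re).trans (Complex.abs_re_le_norm (kappa c))
    have : (0 : ℝ) ≤ k := k.cast_nonneg
    have e : ((n : ℂ) * (w + k)).re = n * (w.re + k) := by
      rw [Complex.mul_re, hre]; simp
    rw [Complex.add_re, e]
    have : w.re + k ≤ n * (w.re + k) := le_mul_of_one_le_left (by linarith) hn1
    linarith
  have hw0 : 0 < w.re := by linarith
  set D : ℕ → ℂ := fun k => gammaRatio c (w + k) - L * P (w + k)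
  have hD0 : D 0 = gammaRatio c w - L * P w := by simp [D]
  have hPlim : Tendsto (fun N : ℕ => P (w + N)) atTop (𝓝 1) := by
    have hinv0 : Tendsto (fun N : ℕ => (w + N)⁻¹) atTop (𝓝 0) := by
      rw [tendsto_zero_iff_norm_tendsto_zero]
      refine squeeze_zero (fun N => norm_nonneg _) (fun N => ?_)
        (tendsto_one_div_add_atTop_nhds_zero_nat (𝕜 := ℝ))
      rw [norm_inv, one_div]
      exact inv_anti₀ (by positivity) (hnorm1 N)
    have hcont : ContinuousAt (fun ξ => ∑ j ∈ Finset.range (M + 1), a j * invFacSer c j ξ) 0 := by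
      refine AnalyticAt.continuousAt (𝕜 := ℂ) ?_
      refine Finset.analyticAt_fun_sum _ fun j _ => analyticAt_const.mul (AnalyticAt.mul ?_ (analyticAt_linProd_inv _ _))
      exact Differentiable.analyticAt (by fun_prop) _
    have h0 : ∑ j ∈ Finset.range (M + 1), a j * invFacSer c j 0 = 1 := by
      rw [Finset.sum_range_succ', Finset.sum_eq_zero fun j _ => ?_]
      · simp [invFacSer, linProd_zero, ha]
      · simp [invFacSer]
    have := hcont.tendsto.comp hinv0
    rw [h0] at this
    refine this.congr fun N => ?_
    exact Finset.sum_congr rfl fun j _ => by rw [invFac_eq c hn j (hwk N)]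
  have hDlim : Tendsto D atTop (𝓝 0) := by
    have h1 := tendsto_gammaRatio hn c (w := w) (by simpa using hc1 0) (by simpa using hc2 0)
    have h2 : Tendsto (fun N : ℕ => gammaRatio c (w + N)) atTop (𝓝 L) := by
      rw [← tendsto_add_atTop_iff_nat 1]
      refine h1.congr fun N => ?_
      rw [add_assoc]; push_cast; rfl
    simpa using h2.sub (hPlim.const_mul L)
  have hrec : ∀ k, D k = (ratioSer c (w + k)⁻¹)⁻¹ *
      (D (k + 1) - -(L * ((w + k)⁻¹ ^ (M + 2) * g (w + k)⁻¹))) := by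
    intro k
    have h1 := gammaRatio_add_one c hn (w := w + k) (by rw [hre]; positivity) (hc1 k) (hc2 k)
    have h2 : P (w + k + 1) - ratioSer c (w + k)⁻¹ * P (w + k) = (w + k)⁻¹ ^ (M + 2) * g (w + k)⁻¹ := by
      rw [← hge, Finset.mul_sum, ← Finset.sum_sub_distrib]
      refine Finset.sum_congr rfl fun j _ => ?_
      rw [← invFac_add_one c hn j (hwk k)]
      ring
    have h3 : w + ((k + 1 : ℕ) : ℂ) = w + k + 1 := by push_cast; ring
    have h4 := (hball _ (hξ k)).2.2
    simp only [D]
    rw [h3, h1, ← h2, eq_inv_mul_iff_mul_eq₀ h4]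
    ring
  have hb := norm_le_of_recursion summable_inv_sq (fun k => by positivity) hC₂.le
    (B := ‖L‖ * C₁ * ‖w‖⁻¹ ^ M) (by positivity) hrec (fun k => ?_) (fun k => ?_) hDlim
  · rw [hD0] at hb
    refine hb.trans (le_of_eq ?_)
    ring
  · have h1 : (ratioSer c (w + k)⁻¹)⁻¹ = 1 + (w + k)⁻¹ * ((w + k)⁻¹ * p₂ (w + k)⁻¹) := by
      rw [← hp₂e, ← hp₁e]; ring
    have h2 : ‖(w + k : ℂ)⁻¹‖ ≤ ((k : ℝ) + 1)⁻¹ := by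
      rw [norm_inv]; exact inv_anti₀ (by positivity) (hnorm1 k)
    rw [h1]
    refine (norm_add_le _ _).trans ?_
    rw [norm_one, norm_mul, norm_mul, add_comm]
    refine le_trans (add_le_add ?_ le_rfl) (Real.add_one_le_exp _)
    calc _ ≤ ((k : ℝ) + 1)⁻¹ * (((k : ℝ) + 1)⁻¹ * C₂) := by
          gcongr
          exact (hball _ (hξ k)).2.1
      _ = _ := by rw [← inv_pow]; ring
  -- Of the `M + 2` powers of `1/(w + k)`, two make the sum over k converge and the other M give the
  -- stated order in w.
  · rw [norm_neg, norm_mul, norm_mul, norm_pow, norm_inv, pow_add]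
    have h2 : ‖(w + k : ℂ)‖⁻¹ ≤ ((k : ℝ) + 1)⁻¹ := inv_anti₀ (by positivity) (hnorm1 k)
    have h3 : ‖(w + k : ℂ)‖⁻¹ ≤ ‖w‖⁻¹ := inv_anti₀ (by linarith) (hnorm2 k)
    calc _ ≤ ‖L‖ * (‖w‖⁻¹ ^ M * ((k : ℝ) + 1)⁻¹ ^ 2 * C₁) := by
          gcongr
          exact (hball _ (hξ k)).1
      _ = _ := by rw [← inv_pow]; ring

end ExpansionBound
end EquivQDE
namespace EquivQDE

/-! ### The asymptotic expansion for `|arg s| < π/2` -/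

section Sector
open MeasureTheory

/-- The case of one parameter equal to 0, where the residue series is the exponential series; it
evaluates the Barnes integral of a single Gamma function. -/
theorem fser_one (l : ℂ) : fser (0 : Fin 1 → ℂ) 0 l = Complex.exp (-Complex.exp l) := by
  have he : (Finset.univ.erase 0 : Finset (Fin 1)) = ∅ := by decide
  have h : ∀ r, kap (0 : Fin 1 → ℂ) 0 l r = (-Complex.exp l) ^ r / r.factorial := fun r => by
    rw [kap, coef]
    simp only [Pi.zero_apply, zero_add]
    rw [he, Finset.prod_empty, mul_one, mul_comm l, Complex.exp_nat_mul, neg_pow (Complex.exp l)]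
    ring
  rw [fser, tsum_congr h]
  generalize -Complex.exp l = S
  rw [Complex.exp_eq_exp_ℂ, NormedSpace.exp_eq_tsum_div]

theorem generic_one : (0 : Fin 1 → ℂ) ∈ generic 1 := fun a b h => absurd (Subsingleton.elim a b) h

theorem barnes_one (l t : ℂ) : barnes (0 : Fin 1 → ℂ) l t = Complex.exp (l * t) * Complex.Gamma (-t) := by
  simp [barnes]

theorem integrable_and_integral_Gamma_mul_exp {l : ℂ} (hl : |l.im| < Real.pi / 2) {V : ℂ}
    (hV : 0 < V.re) {m : ℝ} (hm : 0 < m) :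
    Integrable (fun y : ℝ => Complex.Gamma (V - m * y * Complex.I) *
      Complex.exp (-(V - m * y * Complex.I) * l)) ∧
    ∫ y : ℝ, Complex.Gamma (V - m * y * Complex.I) * Complex.exp (-(V - m * y * Complex.I) * l) =
      2 * Real.pi / m * Complex.exp (-Complex.exp l) := by
  have hl' : |l.im| < (1 : ℕ) * (Real.pi / 2) := by simpa using hl
  set F : ℝ → ℂ := fun y => barnes (0 : Fin 1 → ℂ) l ((-V.re : ℝ) + y * Complex.I)
  have h1 : ∫ y, F y = 2 * Real.pi * Complex.exp (-Complex.exp l) := by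
    rw [integral_barnes generic_one hl' (σ := -V.re) (fun a => by simpa using hV)]
    simp [fser_one]
  have h2 : Integrable F := by
    refine (stripDecay_barnes (0 : Fin 1 → ℂ) hl' (-V.re) (-V.re)).integrable ⟨le_rfl, le_rfl⟩ ?_
    rw [continuous_iff_continuousAt]
    intro y
    refine ContinuousAt.comp (f := fun y : ℝ => ((-V.re : ℝ) : ℂ) + y * Complex.I)
      (analyticAt_barnes fun a k h => ?_).continuousAt (by fun_prop)
    have := congrArg Complex.re h
    simp at this
    have : (0 : ℝ) ≤ k := k.cast_nonneg
    linarith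
  have e : ∀ y : ℝ, Complex.Gamma (V - m * y * Complex.I) * Complex.exp (-(V - m * y * Complex.I) * l) =
      F (m * y - V.im) := by
    intro y
    have : (((-V.re : ℝ) : ℂ) + (m * y - V.im : ℝ) * Complex.I) = -(V - m * y * Complex.I) := by
      conv_rhs => rw [← Complex.re_add_im V]
      push_cast; ring
    simp only [F]
    rw [this, barnes_one, neg_neg, mul_comm, mul_comm l]
  simp only [e]
  refine ⟨(h2.comp_sub_right V.im).comp_mul_left' hm.ne', ?_⟩
  rw [Measure.integral_comp_mul_left (fun y => F (y - V.im)) m, integral_sub_right_eq_self F, h1,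
    abs_of_pos (inv_pos.2 hm), Complex.real_smul]
  push_cast
  ring

/-- By scaling, the left side is `∫ t^{x-1} e^{-xt} dt`, and `log t ≤ t - 1` bounds the integrand by
`e^{1-x} e^{-t}`. -/
theorem Gamma_mul_rpow_le {x : ℝ} (hx : 1 ≤ x) : Real.Gamma x * x ^ (-x) ≤ Real.exp (1 - x) := by
  have hx0 : 0 < x := by linarith
  have h1 := Real.integral_rpow_mul_exp_neg_mul_Ioi hx0 hx0
  have h2 : Real.Gamma x * x ^ (-x) = ∫ t in Set.Ioi (0 : ℝ), t ^ (x - 1) * Real.exp (-(x * t)) := by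
    rw [h1, one_div, Real.inv_rpow hx0.le, Real.rpow_neg hx0.le, mul_comm]
  have h3 : ∫ t in Set.Ioi (0 : ℝ), Real.exp (1 - x) * Real.exp (-t) = Real.exp (1 - x) := by
    rw [integral_const_mul, integral_exp_neg_Ioi_zero, mul_one]
  rw [h2, ← h3]
  refine setIntegral_mono_on (integrableOn_rpow_mul_exp_neg hx0 hx0) ?_ measurableSet_Ioi fun t ht => ?_
  · refine Integrable.const_mul ?_ _
    have := exp_neg_integrableOn_Ioi 0 one_pos
    simpa [IntegrableOn] using this
  · have ht' : 0 < t := ht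
    rw [Real.rpow_def_of_pos ht', ← Real.exp_add, ← Real.exp_add]
    apply Real.exp_le_exp.2
    have := Real.log_le_sub_one_of_pos ht'
    nlinarith

variable {n : ℕ}

/-- The sum of all residue series. -/
noncomputable def fsum (z : Fin n → ℂ) (l : ℂ) : ℂ := ∑ J, fser z J l

/-- `fsum` divided by its leading behaviour, in the variable `ζ = log s`. -/
noncomputable def fnorm (z : Fin n → ℂ) (ζ : ℂ) : ℂ :=
  fsum z (n * ζ) * Complex.exp (-(kappa z * ζ)) * Complex.exp (n * Complex.exp ζ)

/-- The constant `(2π)^{(n-1)/2} / √n`. -/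
noncomputable def stokesConst (n : ℕ) : ℝ := √(2 * Real.pi) ^ n / (√(2 * Real.pi) * √n)

theorem barnes_eq_gammaRatio (z : Fin n → ℂ) (ζ : ℂ) {t : ℂ}
    (h : 0 < (n * -t + kappa z).re) :
    barnes z (n * ζ) t = Complex.exp (kappa z * (Real.log n + ζ)) *
      (Complex.Gamma (n * -t + kappa z) *
        Complex.exp (-(n * -t + kappa z) * (Real.log n + ζ)) * gammaRatio z (-t)) := by
  have hG := Complex.Gamma_ne_zero_of_re_pos h
  have e : Complex.exp (n * ζ * t) = Complex.exp (kappa z * (Real.log n + ζ)) *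
      Complex.exp (-(n * -t + kappa z) * (Real.log n + ζ)) * Complex.exp (n * -t * Real.log n) := by
    rw [← Complex.exp_add, ← Complex.exp_add]
    congr 1
    ring
  rw [barnes, gammaRatio, e]
  simp only [← sub_eq_add_neg]
  generalize Complex.Gamma (n * -t + kappa z) = q at hG ⊢
  field_simp

theorem Gamma_mul_invFac (z : Fin n → ℂ) (j : ℕ) {w : ℂ} (h : (j : ℝ) < (n * w + kappa z).re) :
    Complex.Gamma (n * w + kappa z) * invFac z j w = Complex.Gamma (n * w + kappa z - j) := by
  set W := n * w + kappa z
  have hne : ∀ k : ℕ, W - j + k ≠ 0 := fun k h0 => by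
    have := congrArg Complex.re h0
    rw [Complex.add_re, Complex.sub_re, Complex.natCast_re, Complex.natCast_re, Complex.zero_re] at this
    have : (0 : ℝ) ≤ k := k.cast_nonneg
    linarith
  have h1 := Gamma_add_nat (w := W - j) j fun k _ => hne k
  rw [sub_add_cancel] at h1
  have h2 : ∏ i ∈ Finset.range j, (W - (i + 1)) = ∏ k ∈ Finset.range j, (W - j + k) := by
    rw [← Finset.prod_range_reflect]
    refine Finset.prod_congr rfl fun i hi => ?_
    rw [Finset.mem_range] at hi
    have : ((j - 1 - i : ℕ) : ℂ) = j - 1 - i := by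
      rw [Nat.cast_sub (by omega), Nat.cast_sub (by omega)]; simp
    rw [this]; ring
  have h3 : ∏ k ∈ Finset.range j, (W - j + k) ≠ 0 := Finset.prod_ne_zero_iff.2 fun k _ => hne k
  rw [invFac, h1, h2]
  field_simp

theorem gammaRatioLim_eq (hn : 0 < n) (z : Fin n → ℂ) :
    Complex.exp (kappa z * Real.log n) * gammaRatioLim z = n * stokesConst n := by
  have : Complex.exp (kappa z * Real.log n) * Complex.exp ((1 - kappa z) * Real.log n) = n := by
    rw [← Complex.exp_add, ← add_mul, add_sub_cancel, one_mul, ← Complex.ofReal_exp,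
      Real.exp_log (by exact_mod_cast hn)]
    simp
  rw [gammaRatioLim, mul_left_comm, this, stokesConst, mul_comm]

/-- The asymptotic expansion in the sector `|arg s| < π/2`. -/
theorem exists_sector_expansion (hn : 0 < n) {z : Fin n → ℂ} (hz : z ∈ generic n) (M : ℕ) :
    ∃ a : ℕ → ℂ, a 0 = stokesConst n ∧ ∀ θ : ℝ, |θ| < Real.pi / 2 → ∃ C : ℝ, ∀ᶠ x : ℝ in atTop,
      ‖fnorm z (x + θ * Complex.I) - ∑ j ∈ Finset.range (M + 3), a j *
        Complex.exp (-(j * (x + θ * Complex.I)))‖ ≤ C * Real.exp (-(M * x)) := by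
  have hn' : (0 : ℝ) < n := by exact_mod_cast hn
  have hnC : (n : ℂ) ≠ 0 := by exact_mod_cast hn.ne'
  -- Two orders beyond M: they supply the integrable factor `1/(1 + y²)` on the line.
  obtain ⟨a, ha, C, σ₁, hC, hb⟩ := exists_gammaRatio_expansion z hn (M + 2)
  set L := gammaRatioLim z
  set κ := kappa z
  refine ⟨fun j => stokesConst n * (a j * Complex.exp (-(j * Real.log n))), by simp [ha], fun θ hθ => ?_⟩
  have hcos : 0 < Real.cos θ := Real.cos_pos_of_mem_Ioo (abs_lt.1 hθ)
  set K : ℝ := ‖Complex.exp (κ * Real.log n)‖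
  refine ⟨(2 * Real.pi)⁻¹ * (K * (C * Real.exp 1 * ((2 / Real.cos θ) ^ M * Real.pi))), ?_⟩
  have hXt : Tendsto (fun x : ℝ => n * Real.cos θ * Real.exp x) atTop atTop :=
    Real.tendsto_exp_atTop.const_mul_atTop (by positivity)
  filter_upwards [hXt.eventually_ge_atTop (2 * ‖κ‖ + M + 4 + 2 * n + n * |σ₁| + n * ∑ b, ‖z b‖)] with x hx
  set X := n * Real.cos θ * Real.exp x with hXdef
  set ζ : ℂ := x + θ * Complex.I
  set l : ℂ := Real.log n + ζ
  have hlim : l.im = θ := by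
    simp only [l, ζ, Complex.add_im, Complex.ofReal_im, Complex.mul_im, Complex.I_im, Complex.I_re,
      Complex.ofReal_re]
    ring
  have hlre : l.re = Real.log n + x := by
    simp only [l, ζ, Complex.add_re, Complex.ofReal_im, Complex.mul_re, Complex.I_im, Complex.I_re,
      Complex.ofReal_re]
    ring
  have hl : |l.im| < Real.pi / 2 := by rw [hlim]; exact hθ
  have hexpl : Complex.exp l = n * Complex.exp ζ := by
    simp only [l]
    rw [Complex.exp_add, ← Complex.ofReal_exp, Real.exp_log hn', Complex.ofReal_natCast]
  have hX : (Complex.exp l).re = X := by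
    rw [Complex.exp_re, hlre, hlim, Real.exp_add, Real.exp_log hn', hXdef]
    ring
  have hκ0 := norm_nonneg κ
  have hs0 : 0 ≤ ∑ b, ‖z b‖ := Finset.sum_nonneg fun _ _ => norm_nonneg _
  have hκre : |κ.re| ≤ ‖κ‖ := Complex.abs_re_le_norm κ
  have hM0 : (0 : ℝ) ≤ M := M.cast_nonneg
  have hnσ : 0 ≤ n * |σ₁| := by positivity
  have hns : 0 ≤ n * ∑ b, ‖z b‖ := by positivity
  -- The line passes through the saddle point: on it `Re(nw + κ) = X = Re e^l` for `w = -t`, which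
  -- makes the bound of `Γ(W) e^{-Wl}` equal to `Γ(X) X^{-X} ≤ e^{1-X}`, of the exact exponential
  -- order.
  set σ : ℝ := (κ.re - X) / n
  have hσX : n * σ = κ.re - X := by simp only [σ]; field_simp
  have hσ1 : σ ≤ -(X / (2 * n)) := by
    simp only [σ]
    rw [div_le_iff₀ hn', neg_mul, div_mul_eq_mul_div, le_neg, div_le_iff₀ (by positivity)]
    have := (abs_le.1 hκre).2
    nlinarith
  have hσ2 : 1 ≤ X / (2 * n) := by
    rw [le_div_iff₀ (by positivity)]
    linarith
  have hσ3 : |σ₁| + ∑ b, ‖z b‖ + 1 ≤ -σ := by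
    have h1 := (abs_le.1 hκre).2
    have h2 : n * (|σ₁| + ∑ b, ‖z b‖ + 1) ≤ n * -σ := by
      rw [mul_neg, hσX]; linarith
    exact le_of_mul_le_mul_left h2 hn'
  have ht : ∀ y : ℝ, n * -((σ : ℂ) + y * Complex.I) + κ = (κ - (n * σ : ℝ)) - (n : ℝ) * y * Complex.I := by
    intro y; push_cast; ring
  have hVre : (κ - (n * σ : ℝ)).re = X := by
    rw [Complex.sub_re, Complex.ofReal_re, hσX]; ring
  have hWre : ∀ y : ℝ, (n * -((σ : ℂ) + y * Complex.I) + κ).re = X := by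
    intro y
    rw [ht, Complex.sub_re, hVre]; simp
  have hX0 : 0 < X := by linarith
  -- the three integrands
  set F : ℝ → ℂ := fun y => barnes z (n * ζ) (σ + y * Complex.I)
  set T : ℕ → ℝ → ℂ := fun j y => Complex.Gamma (κ - (n * σ : ℝ) - j - (n : ℝ) * y * Complex.I) *
    Complex.exp (-(κ - (n * σ : ℝ) - j - (n : ℝ) * y * Complex.I) * l)
  have hjX : ∀ j ∈ Finset.range (M + 3), (j : ℝ) < X := fun j hj => by
    have : (j : ℝ) ≤ M + 2 := by exact_mod_cast Nat.lt_succ_iff.1 (Finset.mem_range.1 hj)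
    linarith
  have hT : ∀ j ∈ Finset.range (M + 3), Integrable (T j) ∧
      ∫ y, T j y = 2 * Real.pi / n * Complex.exp (-Complex.exp l) := fun j hj => by
    have := integrable_and_integral_Gamma_mul_exp hl (V := κ - (n * σ : ℝ) - j)
      (by rw [Complex.sub_re, hVre, Complex.natCast_re]; linarith [hjX j hj]) hn'
    simpa [T] using this
  have hF : ∫ y, F y = 2 * Real.pi * fsum z (n * ζ) := by
    refine integral_barnes hz ?_ fun b => ?_
    · have : ((n : ℂ) * ζ).im = n * θ := by simp [ζ]
      rw [this, abs_mul, abs_of_pos hn']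
      gcongr
    · have h1 := (neg_le_abs (z b).re).trans (Complex.abs_re_le_norm (z b))
      have h2 : ‖z b‖ ≤ ∑ b, ‖z b‖ :=
        Finset.single_le_sum (f := fun b => ‖z b‖) (fun _ _ => norm_nonneg _) (Finset.mem_univ b)
      linarith [abs_nonneg σ₁]
  have hFi : Integrable F := by
    have himn : |((n : ℂ) * ζ).im| < n * (Real.pi / 2) := by
      have : ((n : ℂ) * ζ).im = n * θ := by simp [ζ]
      rw [this, abs_mul, abs_of_pos hn']
      gcongr
    refine (stripDecay_barnes z himn σ σ).integrable ⟨le_rfl, le_rfl⟩ ?_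
    rw [continuous_iff_continuousAt]
    intro y
    refine ContinuousAt.comp (f := fun y : ℝ => (σ : ℂ) + y * Complex.I)
      (analyticAt_barnes fun b k h => ?_).continuousAt (by fun_prop)
    have h0 := congrArg Complex.re h
    simp at h0
    have h1 := (neg_le_abs (z b).re).trans (Complex.abs_re_le_norm (z b))
    have h2 : ‖z b‖ ≤ ∑ b, ‖z b‖ :=
      Finset.single_le_sum (f := fun b => ‖z b‖) (fun _ _ => norm_nonneg _) (Finset.mem_univ b)
    have : (0 : ℝ) ≤ k := k.cast_nonneg
    linarith [abs_nonneg σ₁]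
  set S : ℝ → ℂ := fun y => Complex.exp (κ * l) *
    (L * ∑ j ∈ Finset.range (M + 3), a j * (Complex.exp (-(j * l)) * T j y))
  have hSi : Integrable S :=
    ((integrable_finsetSum _ fun j hj => ((hT j hj).1.const_mul _).const_mul _).const_mul _).const_mul _
  have hSint : ∫ y, S y = Complex.exp (κ * l) * (L * ∑ j ∈ Finset.range (M + 3),
      a j * (Complex.exp (-(j * l)) * (2 * Real.pi / n * Complex.exp (-Complex.exp l)))) := by
    simp only [S, integral_const_mul]
    rw [integral_finsetSum _ fun j hj => ((hT j hj).1.const_mul _).const_mul _]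
    congr 2
    refine Finset.sum_congr rfl fun j hj => ?_
    rw [integral_const_mul, integral_const_mul, (hT j hj).2]
  -- The barnes integrand with its Gamma ratio replaced by the truncated expansion; the difference
  -- is the exponential bound times the error of the ratio.
  have hdiff : ∀ y, ‖F y - S y‖ ≤ ‖Complex.exp (κ * l)‖ *
      (C * Real.exp (1 - X) * ((X / (2 * n))⁻¹ ^ M * (1 + y ^ 2)⁻¹)) := by
    intro y
    set t : ℂ := (σ : ℂ) + y * Complex.I
    have h1 := barnes_eq_gammaRatio z ζ (t := t) (by rw [hWre y]; exact hX0)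
    have h2 : S y = Complex.exp (κ * l) * (Complex.Gamma (n * -t + κ) *
        Complex.exp (-(n * -t + κ) * l) *
          (L * ∑ j ∈ Finset.range (M + 3), a j * invFac z j (-t))) := by
      simp only [S, Finset.mul_sum]
      refine Finset.sum_congr rfl fun j hj => ?_
      have h3 := Gamma_mul_invFac z j (w := -t) (by rw [hWre y]; exact hjX j hj)
      have h4 : κ - (n * σ : ℝ) - j - (n : ℝ) * y * Complex.I = n * -t + κ - j := by
        rw [ht]; ring
      have h5 : Complex.exp (-(j * l)) * Complex.exp (-(n * -t + κ - j) * l) =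
          Complex.exp (-(n * -t + κ) * l) := by
        rw [← Complex.exp_add]; congr 1; ring
      simp only [T]
      rw [h4, ← h5, ← h3]
      ring
    have h3 : F y - S y = Complex.exp (κ * l) * (Complex.Gamma (n * -t + κ) *
        Complex.exp (-(n * -t + κ) * l) * (gammaRatio z (-t) -
          L * ∑ j ∈ Finset.range (M + 3), a j * invFac z j (-t))) := by
      rw [h2]
      change barnes z (n * ζ) t - _ = _
      rw [h1]
      ring
    have h4 : ‖Complex.Gamma (n * -t + κ) * Complex.exp (-(n * -t + κ) * l)‖ ≤ Real.exp (1 - X) := by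
      refine (norm_Gamma_mul_exp_le (by rw [hWre y]; exact hX0) hl).trans ?_
      rw [hWre y, hX]
      exact Gamma_mul_rpow_le (by linarith)
    have h5 := hb (-t) (by
      simp only [t, Complex.neg_re, Complex.add_re, Complex.ofReal_re, Complex.mul_re,
        Complex.ofReal_im, Complex.I_re, Complex.I_im, mul_zero, zero_mul, sub_zero, add_zero]
      linarith [le_abs_self σ₁])
    have htsq : ‖t‖ ^ 2 = σ ^ 2 + y ^ 2 := by
      rw [← Complex.normSq_eq_norm_sq, Complex.normSq_apply]
      simp [t]; ring
    have h6 : X / (2 * n) ≤ ‖t‖ := by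
      refine abs_le_of_sq_le_sq' ?_ (norm_nonneg _) |>.2
      rw [htsq]
      nlinarith [sq_nonneg y]
    have h7 : 1 + y ^ 2 ≤ ‖t‖ ^ 2 := by
      rw [htsq]
      nlinarith
    rw [h3, norm_mul, norm_mul]
    refine mul_le_mul_of_nonneg_left ?_ (norm_nonneg _)
    have h8 : C * ‖-t‖⁻¹ ^ (M + 2) ≤ C * ((X / (2 * n))⁻¹ ^ M * (1 + y ^ 2)⁻¹) := by
      refine mul_le_mul_of_nonneg_left ?_ hC
      rw [norm_neg, pow_add]
      refine mul_le_mul ?_ ?_ (by positivity) (by positivity)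
      · refine pow_le_pow_left₀ (by positivity) ?_ M
        exact inv_anti₀ (by positivity) h6
      · rw [inv_pow]; exact inv_anti₀ (by positivity) h7
    calc _ ≤ Real.exp (1 - X) * (C * ((X / (2 * n))⁻¹ ^ M * (1 + y ^ 2)⁻¹)) :=
          mul_le_mul h4 (h5.trans h8) (norm_nonneg _) (Real.exp_pos _).le
      _ = _ := by ring
  have hint : ‖(∫ y, F y) - ∫ y, S y‖ ≤ ‖Complex.exp (κ * l)‖ *
      (C * Real.exp (1 - X) * ((X / (2 * n))⁻¹ ^ M * Real.pi)) := by
    rw [← integral_sub hFi hSi]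
    refine (norm_integral_le_of_norm_le (((integrable_inv_one_add_sq.const_mul _).const_mul _).const_mul _)
      (Eventually.of_forall hdiff)).trans (le_of_eq ?_)
    rw [integral_const_mul, integral_const_mul, integral_const_mul, integral_univ_inv_one_add_sq]
  rw [hF, hSint] at hint
  have hpi : (Real.pi : ℂ) ≠ 0 := by exact_mod_cast Real.pi_ne_zero
  have hκl : Complex.exp (κ * l) = Complex.exp (κ * Real.log n) * Complex.exp (κ * ζ) := by
    rw [← Complex.exp_add, ← mul_add]
  -- Every term `Γ(nw + κ - j)` integrates to the same exponential `e^{-e^l}` times `e^{-jl}`, so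
  -- the truncated expansion integrates to a polynomial in `1/s` times the leading behaviour.
  have hmain : fnorm z ζ - ∑ j ∈ Finset.range (M + 3),
      stokesConst n * (a j * Complex.exp (-(j * Real.log n))) * Complex.exp (-(j * ζ)) =
      (2 * Real.pi : ℂ)⁻¹ * (Complex.exp (-(κ * ζ)) * Complex.exp (Complex.exp l)) *
      (2 * Real.pi * fsum z (n * ζ) - Complex.exp (κ * l) * (L * ∑ j ∈ Finset.range (M + 3),
        a j * (Complex.exp (-(j * l)) * (2 * Real.pi / n * Complex.exp (-Complex.exp l))))) := by
    have hS : ∑ j ∈ Finset.range (M + 3),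
        stokesConst n * (a j * Complex.exp (-(j * Real.log n))) * Complex.exp (-(j * ζ)) =
        stokesConst n * ∑ j ∈ Finset.range (M + 3), a j * Complex.exp (-(j * l)) := by
      rw [Finset.mul_sum]
      refine Finset.sum_congr rfl fun j _ => ?_
      have : Complex.exp (-(j * l)) = Complex.exp (-(j * Real.log n)) * Complex.exp (-(j * ζ)) := by
        rw [← Complex.exp_add]; congr 1; simp only [l]; ring
      rw [this]; ring
    have hS2 : ∑ j ∈ Finset.range (M + 3),
        a j * (Complex.exp (-(j * l)) * (2 * Real.pi / n * Complex.exp (-Complex.exp l))) =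
        (∑ j ∈ Finset.range (M + 3), a j * Complex.exp (-(j * l))) *
          (2 * Real.pi / n * Complex.exp (-Complex.exp l)) := by
      rw [Finset.sum_mul]
      exact Finset.sum_congr rfl fun j _ => by ring
    have hL := gammaRatioLim_eq hn z
    have hc1 : Complex.exp (-(κ * ζ)) * Complex.exp (κ * ζ) = 1 := by
      rw [← Complex.exp_add]; simp
    have hc2 : Complex.exp (Complex.exp l) * Complex.exp (-Complex.exp l) = 1 := by
      rw [← Complex.exp_add]; simp
    rw [hS, hS2, fnorm, ← hexpl, hκl]
    set A := ∑ j ∈ Finset.range (M + 3), a j * Complex.exp (-(j * l))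
    have e1 : (2 * Real.pi : ℂ)⁻¹ * (Complex.exp (-(κ * ζ)) * Complex.exp (Complex.exp l)) *
        (2 * Real.pi * fsum z (n * ζ) - Complex.exp (κ * Real.log n) * Complex.exp (κ * ζ) *
          (L * (A * (2 * Real.pi / n * Complex.exp (-Complex.exp l))))) =
        fsum z (n * ζ) * Complex.exp (-(κ * ζ)) * Complex.exp (Complex.exp l) -
        (Complex.exp (-(κ * ζ)) * Complex.exp (κ * ζ)) *
        (Complex.exp (Complex.exp l) * Complex.exp (-Complex.exp l)) *
        (Complex.exp (κ * Real.log n) * L) * A / n := by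
      field_simp
    rw [e1, hc1, hc2, hL]
    simp only [κ]
    field_simp
  rw [hmain, norm_mul, norm_mul, norm_mul]
  have hnx : ‖Complex.exp (Complex.exp l)‖ = Real.exp X := by rw [Complex.norm_exp, hX]
  have hpin : ‖(2 * Real.pi : ℂ)⁻¹‖ = (2 * Real.pi)⁻¹ := by
    rw [norm_inv, norm_mul, Complex.norm_real, Real.norm_of_nonneg Real.pi_pos.le]; simp
  have hκn : ‖Complex.exp (κ * l)‖ * ‖Complex.exp (-(κ * ζ))‖ = K := by
    rw [hκl, norm_mul, mul_assoc, ← norm_mul, ← Complex.exp_add]; simp [K]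
  have hXp : (X / (2 * n))⁻¹ ^ M = (2 / Real.cos θ) ^ M * Real.exp (-(M * x)) := by
    have : (X / (2 * n))⁻¹ = 2 / Real.cos θ * Real.exp (-x) := by
      rw [hXdef, Real.exp_neg]
      have := Real.exp_ne_zero x
      field_simp
    rw [this, mul_pow, ← Real.exp_nat_mul]
    ring_nf
  calc _ ≤ ‖(2 * Real.pi : ℂ)⁻¹‖ * (‖Complex.exp (-(κ * ζ))‖ * ‖Complex.exp (Complex.exp l)‖) *
        (‖Complex.exp (κ * l)‖ * (C * Real.exp (1 - X) * ((X / (2 * n))⁻¹ ^ M * Real.pi))) := by gcongr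
    _ = (2 * Real.pi)⁻¹ * ((‖Complex.exp (κ * l)‖ * ‖Complex.exp (-(κ * ζ))‖) *
        (C * (Real.exp X * Real.exp (1 - X)) * ((X / (2 * n))⁻¹ ^ M * Real.pi))) := by
        rw [hnx, hpin]; ring
    _ = _ := by
        rw [hκn, hXp, ← Real.exp_add, add_sub_cancel]; ring

end Sector
end EquivQDE
namespace EquivQDE

/-! ### Phragmén-Lindelöf interpolation in a strip -/

section PhragmenLindelof

/-- Interpolation of exponential growth rates between the boundary lines of a horizontal strip. -/
theorem isBigO_strip_interpolation {α β : ℝ} (hαβ : α < β) (hw : β - α < Real.pi) {g : ℂ → ℂ}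
    (hg : Differentiable ℂ g) {C A μ₁ μ₂ : ℝ} (hC : 0 ≤ C) (hA : 0 ≤ A)
    (hin : ∀ x θ : ℝ, α ≤ θ → θ ≤ β →
      ‖g (x + θ * Complex.I)‖ ≤ C * Real.exp (A * |x| + A * Real.exp x))
    (hα : (fun x : ℝ => g (x + α * Complex.I)) =O[atTop] fun x => Real.exp (μ₁ * x))
    (hβ : (fun x : ℝ => g (x + β * Complex.I)) =O[atTop] fun x => Real.exp (μ₂ * x))
    {θ : ℝ} (h₁ : α ≤ θ) (h₂ : θ ≤ β) :
    (fun x : ℝ => g (x + θ * Complex.I)) =O[atTop] fun x =>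
      Real.exp ((μ₁ + (μ₂ - μ₁) / (β - α) * (θ - α)) * x) := by
  have hβα : 0 < β - α := sub_pos.2 hαβ
  set k := (μ₂ - μ₁) / (β - α)
  set μ : ℝ → ℝ := fun θ => μ₁ + k * (θ - α)
  have hμα : μ α = μ₁ := by simp [μ]
  have hμβ : μ β = μ₂ := by simp only [μ, k]; field_simp; ring
  set m := |μ₁| + |k| * (β - α)
  have hm : ∀ θ, α ≤ θ → θ ≤ β → |μ θ| ≤ m := fun θ h1 h2 => by
    refine (abs_add_le _ _).trans ?_
    rw [abs_mul, abs_of_nonneg (sub_nonneg.2 h1)]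
    simp only [m]
    gcongr
  have hm0 : 0 ≤ m := by positivity
  set c : ℝ := (α + β) / 2
  set c₀ := Real.cos ((β - α) / 2)
  have hc₀ : 0 < c₀ := Real.cos_pos_of_mem_Ioo ⟨by linarith [Real.pi_pos], by linarith⟩
  have hcos : ∀ θ, α ≤ θ → θ ≤ β → c₀ ≤ Real.cos (θ - c) := fun θ h1 h2 => by
    rw [← Real.cos_abs (θ - c)]
    refine Real.cos_le_cos_of_nonneg_of_le_pi (abs_nonneg _) (by linarith) ?_
    rw [abs_le]
    constructor <;> simp only [c] <;> linarith
  -- The quadratic exponent has real part `-xθ` times k, so the first factor has modulus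
  -- `e^{-μ(θ)x}` with μ the linear interpolation. The last factor controls `x → -∞` and is harmless
  -- for `x → +∞`.
  set h : ℂ → ℂ := fun ζ => g ζ * Complex.exp (-((μ₁ - k * α : ℝ) * ζ) + k * (Complex.I * ζ ^ 2 / 2)) *
    Complex.exp (-Complex.exp (-(ζ - c * Complex.I)))
  have hh : ∀ x θ : ℝ, ‖h (x + θ * Complex.I)‖ = ‖g (x + θ * Complex.I)‖ * Real.exp (-(μ θ * x)) *
      Real.exp (-(Real.exp (-x) * Real.cos (θ - c))) := by
    intro x θ
    simp only [h]
    rw [norm_mul, norm_mul, Complex.norm_exp, Complex.norm_exp]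
    congr 3
    · simp [μ, pow_two]; ring
    · rw [Complex.neg_re, Complex.exp_re]
      have e1 : (-((x : ℂ) + θ * Complex.I - c * Complex.I)).re = -x := by simp
      have e2 : (-((x : ℂ) + θ * Complex.I - c * Complex.I)).im = -(θ - c) := by simp
      rw [e1, e2, Real.cos_neg]
  have hbd : ∀ θ, α ≤ θ → θ ≤ β →
      ((fun x : ℝ => g (x + θ * Complex.I)) =O[atTop] fun x => Real.exp (μ θ * x)) →
      ∃ C', ∀ x : ℝ, ‖h (x + θ * Complex.I)‖ ≤ C' := by
    intro θ h1 h2 hO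
    obtain ⟨C₁, hC₁⟩ := hO.bound
    obtain ⟨X, hX'⟩ := (hC₁.and (eventually_ge_atTop 0)).exists_forall_of_atTop
    have hX0 : 0 ≤ X := (hX' X le_rfl).2
    have hX : ∀ x, X ≤ x → _ := fun x hx => (hX' x hx).1
    set D := A + m + 1
    have hD : 0 < D := by positivity
    refine ⟨max C₁ (C * Real.exp (D * (2 * X) + A * Real.exp X + D * (Real.log (D / c₀) - 1))),
      fun x => ?_⟩
    rw [hh]
    rcases le_total X x with hx | hx
    · refine le_max_of_le_left ?_
      have hb := hX x hx
      rw [Real.norm_of_nonneg (Real.exp_pos _).le] at hb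
      have e : Real.exp (-(Real.exp (-x) * Real.cos (θ - c))) ≤ 1 := by
        rw [Real.exp_le_one_iff, neg_nonpos]
        exact mul_nonneg (Real.exp_pos _).le (hc₀.le.trans (hcos θ h1 h2))
      calc _ ≤ ‖g (x + θ * Complex.I)‖ * Real.exp (-(μ θ * x)) * 1 := by gcongr
        _ ≤ C₁ * Real.exp (μ θ * x) * Real.exp (-(μ θ * x)) * 1 := by gcongr
        _ = C₁ := by rw [mul_assoc C₁, ← Real.exp_add]; simp
    · refine le_max_of_le_right ?_
      have e1 : -(μ θ * x) ≤ m * |x| := by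
        refine (neg_le_abs _).trans ?_
        rw [abs_mul]
        gcongr
        exact hm θ h1 h2
      have e2 : |x| ≤ 2 * X - x := by rw [abs_le]; constructor <;> linarith
      have e3 : c₀ * Real.exp (-x) ≤ Real.exp (-x) * Real.cos (θ - c) := by
        rw [mul_comm]; gcongr; exact hcos θ h1 h2
      -- The tangent to the exponential at `log(D/c₀)`: its slope D beats the linear growth of g and
      -- of the first factor as `x → -∞`.
      have e4 : D * (1 + (-x - Real.log (D / c₀))) ≤ c₀ * Real.exp (-x) := by
        have e5 : c₀ * Real.exp (-x) = D * Real.exp (-x - Real.log (D / c₀)) := by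
          rw [Real.exp_sub, Real.exp_log (by positivity)]
          field_simp
        rw [e5]
        refine mul_le_mul_of_nonneg_left ?_ hD.le
        have := Real.add_one_le_exp (-x - Real.log (D / c₀))
        linarith
      have e6 : A * Real.exp x ≤ A * Real.exp X := by gcongr
      have e7 : (A + m) * |x| ≤ D * (2 * X - x) := by
        refine mul_le_mul (by simp only [D]; linarith) e2 (abs_nonneg _) hD.le
      calc _ ≤ C * Real.exp (A * |x| + A * Real.exp x) * Real.exp (-(μ θ * x)) *
            Real.exp (-(Real.exp (-x) * Real.cos (θ - c))) := by
            gcongr; exact hin x θ h1 h2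
        _ = C * Real.exp (A * |x| + A * Real.exp x + -(μ θ * x) +
            -(Real.exp (-x) * Real.cos (θ - c))) := by
            rw [mul_assoc, mul_assoc, ← Real.exp_add, ← Real.exp_add]; ring_nf
        _ ≤ _ := by
            refine mul_le_mul_of_nonneg_left (Real.exp_le_exp.2 ?_) hC
            linarith
  obtain ⟨C₁, hC₁⟩ := hbd α le_rfl hαβ.le (by rw [hμα]; exact hα)
  obtain ⟨C₂, hC₂⟩ := hbd β hαβ.le le_rfl (by rw [hμβ]; exact hβ)
  have hdec : ∀ ζ : ℂ, ζ = (ζ.re : ℂ) + (ζ.im : ℝ) * Complex.I := fun ζ => (Complex.re_add_im ζ).symm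
  have key : ∀ x : ℝ, ‖h (x + θ * Complex.I)‖ ≤ max C₁ C₂ := by
    intro x
    refine _root_.PhragmenLindelof.horizontal_strip (a := α) (b := β) ?_ ?_ ?_ ?_ ?_ ?_
    · refine Differentiable.diffContOnCl ?_
      fun_prop
    -- The growth is of order `e^{A e^{|x|}}` with exponent 1, which is admissible precisely because
    -- the strip is narrower than π.
    · refine ⟨1, by rwa [lt_div_iff₀ hβα, one_mul], 2 * A + m, ?_⟩
      refine IsBigO.of_bound C ?_
      rw [eventually_inf_principal]
      refine Eventually.of_forall fun ζ hζ => ?_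
      have hζ' : α < ζ.im ∧ ζ.im < β := hζ
      rw [hdec ζ, hh, Real.norm_of_nonneg (Real.exp_pos _).le, ← hdec ζ]
      have e0 := hin ζ.re ζ.im hζ'.1.le hζ'.2.le
      rw [← hdec ζ] at e0
      have e : Real.exp (-(Real.exp (-ζ.re) * Real.cos (ζ.im - c))) ≤ 1 := by
        rw [Real.exp_le_one_iff, neg_nonpos]
        exact mul_nonneg (Real.exp_pos _).le (hc₀.le.trans (hcos _ hζ'.1.le hζ'.2.le))
      have e1 : -(μ ζ.im * ζ.re) ≤ m * |ζ.re| := by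
        refine (neg_le_abs _).trans ?_
        rw [abs_mul]
        gcongr
        exact hm _ hζ'.1.le hζ'.2.le
      have e2 : |ζ.re| ≤ Real.exp |ζ.re| := by linarith [Real.add_one_le_exp |ζ.re|]
      have e3 : Real.exp ζ.re ≤ Real.exp |ζ.re| := Real.exp_le_exp.2 (le_abs_self _)
      have e4 : A * |ζ.re| ≤ A * Real.exp |ζ.re| := by gcongr
      have e5 : A * Real.exp ζ.re ≤ A * Real.exp |ζ.re| := by gcongr
      have e6 : m * |ζ.re| ≤ m * Real.exp |ζ.re| := by gcongr
      calc _ ≤ C * Real.exp (A * |ζ.re| + A * Real.exp ζ.re) * Real.exp (-(μ ζ.im * ζ.re)) * 1 := by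
            gcongr
        _ = C * Real.exp (A * |ζ.re| + A * Real.exp ζ.re + -(μ ζ.im * ζ.re)) := by
            rw [mul_one, mul_assoc, ← Real.exp_add]
        _ ≤ _ := by
            rw [one_mul]
            gcongr
            linarith
    · intro ζ hζ
      rw [hdec ζ, hζ]
      exact le_max_of_le_left (hC₁ _)
    · intro ζ hζ
      rw [hdec ζ, hζ]
      exact le_max_of_le_right (hC₂ _)
    · simpa using h₁
    · simpa using h₂
  refine IsBigO.of_bound (max C₁ C₂ * Real.exp 1) ?_
  filter_upwards [eventually_ge_atTop 0] with x hx
  have h3 := key x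
  rw [hh] at h3
  rw [Real.norm_of_nonneg (Real.exp_pos _).le]
  have h4 : Real.exp (-(Real.exp (-x) * Real.cos (θ - c))) * Real.exp 1 ≥ 1 := by
    rw [← Real.exp_add]
    refine Real.one_le_exp ?_
    have e1 : Real.exp (-x) ≤ 1 := Real.exp_le_one_iff.2 (by linarith)
    have e2 := Real.cos_le_one (θ - c)
    have e3 : Real.exp (-x) * Real.cos (θ - c) ≤ 1 * 1 :=
      mul_le_mul e1 e2 (hc₀.le.trans (hcos θ h₁ h₂)) zero_le_one
    linarith
  have h5 : Real.exp (-(μ θ * x)) * Real.exp (μ θ * x) = 1 := by rw [← Real.exp_add]; simp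
  calc ‖g (x + θ * Complex.I)‖ ≤ ‖g (x + θ * Complex.I)‖ *
        (Real.exp (-(Real.exp (-x) * Real.cos (θ - c))) * Real.exp 1) :=
        le_mul_of_one_le_right (norm_nonneg _) h4
    _ = ‖g (x + θ * Complex.I)‖ * (Real.exp (-(μ θ * x)) * Real.exp (μ θ * x)) *
        (Real.exp (-(Real.exp (-x) * Real.cos (θ - c))) * Real.exp 1) := by rw [h5, mul_one]
    _ = (‖g (x + θ * Complex.I)‖ * Real.exp (-(μ θ * x)) *
        Real.exp (-(Real.exp (-x) * Real.cos (θ - c)))) * (Real.exp 1 * Real.exp (μ θ * x)) := by ring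
    _ ≤ max C₁ C₂ * (Real.exp 1 * Real.exp (μ θ * x)) := by gcongr
    _ = _ := by ring

end PhragmenLindelof

/-! ### Crude growth bounds with the exact exponential rate -/

section Growth
variable {n : ℕ}

/-- Euler's sequence for `Γ(-d)` is bounded, so the product of the `d - k` is at least `r!` up to a
power of r. Unlike the bound by a geometric factor, this loses only a polynomial. -/
theorem exists_norm_Gamma_sub_nat_le {d : ℂ} (hd : ∀ k : ℤ, d ≠ k) :
    ∃ (K : ℝ) (N : ℕ), 0 ≤ K ∧ ∀ r : ℕ, ‖Complex.Gamma (d - r)‖ ≤ K * (r + 1 : ℝ) ^ N / r.factorial := by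
  obtain ⟨B, hB⟩ := (Complex.GammaSeq_tendsto_Gamma (-d)).norm.bddAbove_range
  obtain ⟨N, hN⟩ := exists_nat_ge d.re
  refine ⟨‖Complex.Gamma d‖ * (1 + ‖d‖ * |B|), N, by positivity, fun r => ?_⟩
  have hd0 : d ≠ 0 := by simpa using hd 0
  rcases Nat.eq_zero_or_pos r with rfl | hr
  · simp only [Nat.cast_zero, sub_zero, zero_add, one_pow, mul_one, Nat.factorial_zero, Nat.cast_one,
      div_one]
    exact le_mul_of_one_le_right (norm_nonneg _) (by linarith [mul_nonneg (norm_nonneg d) (abs_nonneg B)])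
  have h1 := Gamma_sub_nat hd r
  have hr0 : (r : ℂ) ≠ 0 := by exact_mod_cast hr.ne'
  have hrp : (0 : ℝ) < r := by exact_mod_cast hr
  have h2 : ∏ j ∈ Finset.range (r + 1), (-d + j) =
      (-1) ^ (r + 1) * (d * ∏ k ∈ Finset.range r, (d - (k + 1 : ℕ))) := by
    have : ∀ j ∈ Finset.range (r + 1), -d + j = -1 * (d - j) := fun j _ => by ring
    rw [Finset.prod_congr rfl this, Finset.prod_mul_distrib, Finset.prod_const, Finset.card_range,
      Finset.prod_range_succ']
    simp [mul_comm]
  have hP : ∏ k ∈ Finset.range r, (d - (k + 1 : ℕ)) ≠ 0 :=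
    Finset.prod_ne_zero_iff.2 fun k _ => sub_ne_zero.2 (by exact_mod_cast hd ((k + 1 : ℕ) : ℤ))
  have h3 : ‖Complex.GammaSeq (-d) r‖ * (‖d‖ * ‖∏ k ∈ Finset.range r, (d - (k + 1 : ℕ))‖) =
      (r : ℝ) ^ (-d.re) * r.factorial := by
    have : ‖(r : ℂ) ^ (-d)‖ = (r : ℝ) ^ (-d.re) := by
      have := Complex.norm_cpow_eq_rpow_re_of_pos hrp (-d)
      simpa using this
    rw [Complex.GammaSeq, h2, norm_div, norm_mul, norm_mul, norm_mul, norm_pow, norm_neg, norm_one,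
      one_pow, one_mul, this, Complex.norm_natCast]
    have := norm_ne_zero_iff.2 hP
    have := norm_ne_zero_iff.2 hd0
    field_simp
  have h4 : ‖Complex.GammaSeq (-d) r‖ ≤ |B| := (hB ⟨r, rfl⟩).trans (le_abs_self B)
  have h5 : (r : ℝ) ^ d.re ≤ (r + 1 : ℝ) ^ N := by
    calc (r : ℝ) ^ d.re ≤ (r : ℝ) ^ (N : ℝ) :=
          Real.rpow_le_rpow_of_exponent_le (by exact_mod_cast hr) hN
      _ = (r : ℝ) ^ N := Real.rpow_natCast _ _
      _ ≤ _ := by gcongr; linarith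
  set P := ∏ k ∈ Finset.range r, (d - (k + 1 : ℕ))
  have hPn : 0 < ‖P‖ := norm_pos_iff.2 hP
  have h6 : (r.factorial : ℝ) ≤ ‖P‖ * ((1 + ‖d‖ * |B|) * (r + 1 : ℝ) ^ N) := by
    have h7 : (r.factorial : ℝ) = (r : ℝ) ^ d.re * (‖Complex.GammaSeq (-d) r‖ * (‖d‖ * ‖P‖)) := by
      rw [h3, ← mul_assoc, ← Real.rpow_add hrp]; simp
    rw [h7]
    calc _ ≤ (r + 1 : ℝ) ^ N * (|B| * (‖d‖ * ‖P‖)) := by gcongr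
      _ = ‖P‖ * ((‖d‖ * |B|) * (r + 1 : ℝ) ^ N) := by ring
      _ ≤ _ := by gcongr; linarith
  rw [le_div_iff₀ (by positivity)]
  refine le_of_mul_le_mul_right ?_ hPn
  calc _ = (‖Complex.Gamma (d - r)‖ * ‖P‖) * r.factorial := by ring
    _ = ‖Complex.Gamma d‖ * r.factorial := by rw [← norm_mul, h1]
    _ ≤ ‖Complex.Gamma d‖ * (‖P‖ * ((1 + ‖d‖ * |B|) * (r + 1 : ℝ) ^ N)) := by gcongr
    _ = _ := by ring

theorem exists_norm_coef_le {z : Fin n → ℂ} (hz : z ∈ generic n) (J : Fin n) :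
    ∃ (K : ℝ) (N : ℕ), 0 ≤ K ∧ ∀ r : ℕ, ‖coef z J r‖ ≤ K * (r + 1 : ℝ) ^ N / (r.factorial : ℝ) ^ n := by
  have h : ∀ b : Fin n, ∃ (K : ℝ) (N : ℕ), 0 ≤ K ∧ (b ≠ J → ∀ r : ℕ,
      ‖Complex.Gamma (z b - z J - r)‖ ≤ K * (r + 1 : ℝ) ^ N / r.factorial) := fun b => by
    by_cases hb : b = J
    · exact ⟨0, 0, le_rfl, fun h => absurd hb h⟩
    · obtain ⟨K, N, h0, h1⟩ := exists_norm_Gamma_sub_nat_le (hz b J hb)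
      exact ⟨K, N, h0, fun _ => h1⟩
  choose K N hK hb using h
  refine ⟨∏ b ∈ Finset.univ.erase J, K b, ∑ b ∈ Finset.univ.erase J, N b,
    Finset.prod_nonneg fun b _ => hK b, fun r => ?_⟩
  have hcard : (Finset.univ.erase J).card = n - 1 := by simp
  have hn : 1 + (n - 1) = n := by have := J.pos; omega
  rw [coef, norm_mul, norm_div, norm_pow, norm_neg, norm_one, one_pow, Complex.norm_natCast, norm_prod]
  calc _ ≤ 1 / (r.factorial : ℝ) *
        ∏ b ∈ Finset.univ.erase J, (K b * (r + 1 : ℝ) ^ N b / r.factorial) := by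
        gcongr with b hb'
        exact hb b (Finset.ne_of_mem_erase hb') r
    _ = _ := by
        rw [Finset.prod_div_distrib, Finset.prod_mul_distrib, Finset.prod_pow_eq_pow_sum,
          Finset.prod_const, hcard]
        have e : (r.factorial : ℝ) ^ n = r.factorial * (r.factorial : ℝ) ^ (n - 1) := by
          rw [← pow_succ', add_comm (n - 1), hn]
        rw [e]
        field_simp

/-- Of the n factors `ρ^r/r!` all but one are bounded by `e^ρ`. The last is kept for summation, with
ρ enlarged by the factor `exp(1/(ρ+1))` to absorb the polynomial; this factor is so close to 1 that
the total rate stays `e^{nρ}`. -/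
theorem pow_mul_pow_le (hn : 0 < n) (N r : ℕ) {ρ : ℝ} (hρ : 0 ≤ ρ) :
    (r + 1 : ℝ) ^ N * (ρ ^ r / r.factorial) ^ n ≤
      N.factorial * (ρ + 1) ^ N * Real.exp 1 * Real.exp ((n - 1) * ρ) *
        ((Real.exp (ρ + 1)⁻¹ * ρ) ^ r / r.factorial) := by
  set q := Real.exp (ρ + 1)⁻¹
  have hρ1 : 0 < ρ + 1 := by linarith
  have h1 : (r + 1 : ℝ) ^ N ≤ N.factorial * (ρ + 1) ^ N * (Real.exp 1 * q ^ r) := by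
    have h := Real.pow_div_factorial_le_exp ((r + 1) / (ρ + 1)) (by positivity) N
    have h2 : Real.exp ((r + 1) / (ρ + 1)) ≤ Real.exp 1 * q ^ r := by
      simp only [q]
      rw [← Real.exp_nat_mul, ← Real.exp_add]
      refine Real.exp_le_exp.2 ?_
      have : (ρ + 1)⁻¹ ≤ 1 := inv_le_one_of_one_le₀ (by linarith)
      rw [add_div, div_eq_mul_inv, one_div]
      linarith
    have h3 := h.trans h2
    rw [div_pow, div_div, div_le_iff₀ (by positivity)] at h3
    linarith
  have h2 : (ρ ^ r / r.factorial) ^ n ≤ Real.exp ((n - 1) * ρ) * (ρ ^ r / r.factorial) := by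
    obtain ⟨k, rfl⟩ : ∃ k, n = k + 1 := ⟨n - 1, by omega⟩
    rw [pow_succ]
    refine mul_le_mul_of_nonneg_right ?_ (by positivity)
    have := Real.pow_div_factorial_le_exp ρ hρ r
    have e : ((k + 1 : ℕ) - 1 : ℝ) * ρ = k * ρ := by push_cast; ring
    rw [e, Real.exp_nat_mul]
    gcongr
  calc _ ≤ (N.factorial * (ρ + 1) ^ N * (Real.exp 1 * q ^ r)) *
        (Real.exp ((n - 1) * ρ) * (ρ ^ r / r.factorial)) := by gcongr
    _ = _ := by rw [mul_pow]; ring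

theorem exp_inv_mul_le {ρ : ℝ} (hρ : 0 ≤ ρ) : Real.exp (ρ + 1)⁻¹ * ρ ≤ ρ + Real.exp 1 := by
  have hρ1 : 0 < ρ + 1 := by linarith
  have ht : (ρ + 1)⁻¹ ≤ 1 := inv_le_one_of_one_le₀ (by linarith)
  have h1 : Real.exp (ρ + 1)⁻¹ ≤ Real.exp 1 := Real.exp_le_exp.2 ht
  have h2 : Real.exp (ρ + 1)⁻¹ * (1 - (ρ + 1)⁻¹) ≤ 1 := by
    have := Real.add_one_le_exp (-(ρ + 1)⁻¹)
    have h3 : Real.exp (ρ + 1)⁻¹ * Real.exp (-(ρ + 1)⁻¹) = 1 := by rw [← Real.exp_add]; simp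
    refine le_trans (mul_le_mul_of_nonneg_left ?_ (Real.exp_pos _).le) h3.le
    linarith
  have h3 : Real.exp (ρ + 1)⁻¹ * ρ ≤ ρ + 1 := by
    have := mul_le_mul_of_nonneg_right h2 hρ1.le
    have e : Real.exp (ρ + 1)⁻¹ * (1 - (ρ + 1)⁻¹) * (ρ + 1) = Real.exp (ρ + 1)⁻¹ * ρ := by
      field_simp; ring
    linarith
  linarith [Real.add_one_le_exp (1 : ℝ)]

theorem exists_norm_fser_le {z : Fin n → ℂ} (hz : z ∈ generic n) (J : Fin n) :
    ∃ C B : ℝ, 0 ≤ C ∧ 0 ≤ B ∧ ∀ x θ : ℝ, |θ| ≤ Real.pi →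
      ‖fser z J (n * (x + θ * Complex.I))‖ ≤ C * Real.exp (B * |x| + n * Real.exp x) := by
  obtain ⟨K, N, hK, h⟩ := exists_norm_coef_le hz J
  have hn : 0 < n := J.pos
  refine ⟨K * Real.exp (n * Real.pi * ‖z J‖) * (N.factorial * 2 ^ N * Real.exp 1) *
    Real.exp (Real.exp 1), n * ‖z J‖ + N, by positivity, by positivity, fun x θ hθ => ?_⟩
  set ρ := Real.exp x
  have hρ : 0 ≤ ρ := (Real.exp_pos x).le
  set q := Real.exp (ρ + 1)⁻¹
  set W := K * Real.exp (n * ((|x| + Real.pi) * ‖z J‖))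
  set V := N.factorial * (ρ + 1) ^ N * Real.exp 1 * Real.exp ((n - 1) * ρ)
  have hterm : ∀ r, ‖kap z J (n * (x + θ * Complex.I)) r‖ ≤ W * (V * ((q * ρ) ^ r / r.factorial)) := by
    intro r
    have h1 : ‖Complex.exp (n * (x + θ * Complex.I) * (z J + r))‖ ≤
        Real.exp (n * ((|x| + Real.pi) * ‖z J‖)) * (ρ ^ r) ^ n := by
      have e : (ρ ^ r) ^ n = Real.exp (n * (r * x)) := by
        rw [← Real.exp_nat_mul, ← Real.exp_nat_mul]
      rw [Complex.norm_exp, e, ← Real.exp_add]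
      refine Real.exp_le_exp.2 ?_
      have e2 : (n * (x + θ * Complex.I) * (z J + r) : ℂ).re =
          n * ((x + θ * Complex.I) * z J : ℂ).re + n * (r * x) := by
        have : (n * (x + θ * Complex.I) * (z J + r) : ℂ) =
          (n : ℝ) * ((x + θ * Complex.I) * z J) + ((n * (r * x) : ℝ) + (n * r * θ : ℝ) * Complex.I) := by
          push_cast; ring
        rw [this, Complex.add_re, Complex.re_ofReal_mul]
        simp
      rw [e2]
      gcongr
      refine (Complex.re_le_norm _).trans ?_
      rw [norm_mul]
      gcongr
      refine (norm_add_le _ _).trans ?_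
      rw [norm_mul, Complex.norm_I, mul_one, Complex.norm_real, Complex.norm_real]
      exact add_le_add le_rfl hθ
    rw [kap, norm_mul]
    calc _ ≤ (K * (r + 1 : ℝ) ^ N / (r.factorial : ℝ) ^ n) *
          (Real.exp (n * ((|x| + Real.pi) * ‖z J‖)) * (ρ ^ r) ^ n) := by gcongr; exact h r
      _ = W * ((r + 1 : ℝ) ^ N * (ρ ^ r / r.factorial) ^ n) := by rw [div_pow]; ring
      _ ≤ _ := by
          refine mul_le_mul_of_nonneg_left ((pow_mul_pow_le hn N r hρ).trans (le_of_eq ?_)) (by positivity)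
          rfl
  have hsum : HasSum (fun r : ℕ => W * (V * ((q * ρ) ^ r / r.factorial))) (W * (V * Real.exp (q * ρ))) := by
    have := NormedSpace.expSeries_div_hasSum_exp (q * ρ)
    rw [← Real.exp_eq_exp_ℝ] at this
    exact (this.mul_left V).mul_left W
  have h1 := tsum_of_norm_bounded hsum hterm
  refine h1.trans ?_
  have h2 : (ρ + 1) ^ N ≤ 2 ^ N * Real.exp (N * |x|) := by
    rw [Real.exp_nat_mul, ← mul_pow]
    have e1 : ρ ≤ Real.exp |x| := Real.exp_le_exp.2 (le_abs_self x)
    have e2 : 1 ≤ Real.exp |x| := Real.one_le_exp (abs_nonneg x)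
    gcongr
    linarith
  calc W * (V * Real.exp (q * ρ)) ≤ W * ((N.factorial * (2 ^ N * Real.exp (N * |x|)) * Real.exp 1 *
        Real.exp ((n - 1) * ρ)) * Real.exp (ρ + Real.exp 1)) := by
        simp only [V]
        gcongr
        exact exp_inv_mul_le hρ
    _ = K * (N.factorial * 2 ^ N * Real.exp 1) * (Real.exp (n * ((|x| + Real.pi) * ‖z J‖)) *
        Real.exp (N * |x|) * Real.exp ((n - 1) * ρ) * Real.exp (ρ + Real.exp 1)) := by
        simp only [W]; ring
    _ = K * (N.factorial * 2 ^ N * Real.exp 1) * (Real.exp (n * Real.pi * ‖z J‖) *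
        Real.exp (Real.exp 1) * Real.exp ((n * ‖z J‖ + N) * |x| + n * ρ)) := by
        congr 1
        simp only [← Real.exp_add]
        congr 1
        ring
    _ = _ := by ring

/-- The series contributes `n e^x` and the normalizing exponential `n e^x cos θ`. The sum vanishes
for `θ = ±π`, and on these lines the growth in s is only polynomial. -/
theorem exists_norm_fnorm_le {z : Fin n → ℂ} (hz : z ∈ generic n) :
    ∃ C B : ℝ, 0 ≤ C ∧ 0 ≤ B ∧ ∀ x θ : ℝ, |θ| ≤ Real.pi →
      ‖fnorm z (x + θ * Complex.I)‖ ≤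
        C * Real.exp (B * |x| + n * Real.exp x * (1 + Real.cos θ)) := by
  choose C B hC hB h using fun J => exists_norm_fser_le hz J
  set κ := kappa z
  refine ⟨(∑ J, C J) * Real.exp (‖κ‖ * Real.pi), ∑ J, B J + ‖κ‖,
    mul_nonneg (Finset.sum_nonneg fun J _ => hC J) (Real.exp_pos _).le,
    add_nonneg (Finset.sum_nonneg fun J _ => hB J) (norm_nonneg _), fun x θ hθ => ?_⟩
  have h1 : ‖fsum z (n * (x + θ * Complex.I))‖ ≤
      (∑ J, C J) * Real.exp ((∑ J, B J) * |x| + n * Real.exp x) := by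
    rw [fsum, Finset.sum_mul]
    refine (norm_sum_le _ _).trans (Finset.sum_le_sum fun J _ => (h J x θ hθ).trans ?_)
    have := Finset.single_le_sum (f := B) (fun J _ => hB J) (Finset.mem_univ J)
    have := hC J
    gcongr
  have h2 : ‖Complex.exp (-(κ * (x + θ * Complex.I)))‖ ≤ Real.exp (‖κ‖ * (|x| + Real.pi)) := by
    rw [Complex.norm_exp]
    refine Real.exp_le_exp.2 ((Complex.re_le_norm _).trans ?_)
    rw [norm_neg, norm_mul]
    gcongr
    refine (norm_add_le _ _).trans ?_
    rw [norm_mul, Complex.norm_I, mul_one, Complex.norm_real, Complex.norm_real]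
    exact add_le_add le_rfl hθ
  have h3 : ‖Complex.exp (n * Complex.exp (x + θ * Complex.I))‖ = Real.exp (n * Real.exp x * Real.cos θ) := by
    rw [Complex.norm_exp, ← Complex.ofReal_natCast, Complex.re_ofReal_mul, Complex.exp_re]
    simp [mul_assoc]
  rw [fnorm, norm_mul, norm_mul, h3]
  calc _ ≤ ((∑ J, C J) * Real.exp ((∑ J, B J) * |x| + n * Real.exp x)) *
        Real.exp (‖κ‖ * (|x| + Real.pi)) * Real.exp (n * Real.exp x * Real.cos θ) := by
        have := (norm_nonneg _).trans h1
        gcongr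
    _ = _ := by
        rw [mul_assoc, mul_assoc, ← Real.exp_add, ← Real.exp_add, mul_assoc (∑ J, C J), ← Real.exp_add]
        ring_nf

end Growth
end EquivQDE
namespace EquivQDE

/-! ### Leading asymptotics for `|arg s| < π` -/

section SectorPi
variable {n : ℕ}

theorem differentiable_fsum {z : Fin n → ℂ} (hz : z ∈ generic n) : Differentiable ℂ (fsum z) := by
  intro l
  refine DifferentiableAt.fun_sum fun J _ => ?_
  exact (differentiableAt_fser hz J l).comp (f := fun l : ℂ => (l, z)) l (by fun_prop)

theorem differentiable_fnorm {z : Fin n → ℂ} (hz : z ∈ generic n) : Differentiable ℂ (fnorm z) := by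
  have h : Differentiable ℂ fun ζ : ℂ => fsum z (n * ζ) :=
    (differentiable_fsum hz).comp (by fun_prop : Differentiable ℂ fun ζ : ℂ => (n : ℂ) * ζ)
  unfold fnorm
  fun_prop

theorem norm_exp_neg_nat_mul (j : ℕ) (x θ : ℝ) :
    ‖Complex.exp (-(j * (x + θ * Complex.I)))‖ = Real.exp (-(j * x)) := by
  rw [Complex.norm_exp, Complex.neg_re, ← Complex.ofReal_natCast, Complex.re_ofReal_mul]
  simp

theorem isBigO_sum_sub_head (a : ℕ → ℂ) (m : ℕ) (θ : ℝ) :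
    (fun x : ℝ => ∑ j ∈ Finset.range (m + 1), a j * Complex.exp (-(j * (x + θ * Complex.I))) - a 0)
      =O[atTop] fun x => Real.exp (-x) := by
  have h : ∀ x : ℝ, ∑ j ∈ Finset.range (m + 1), a j * Complex.exp (-(j * (x + θ * Complex.I))) - a 0 =
      ∑ j ∈ Finset.range m, a (j + 1) * Complex.exp (-((j + 1 : ℕ) * (x + θ * Complex.I))) := fun x => by
    rw [Finset.sum_range_succ']
    simp
  simp only [h]
  refine IsBigO.fun_sum fun j _ => ?_
  refine IsBigO.of_bound ‖a (j + 1)‖ ?_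
  filter_upwards [eventually_ge_atTop 0] with x hx
  rw [norm_mul, norm_exp_neg_nat_mul, Real.norm_of_nonneg (Real.exp_pos _).le]
  gcongr
  push_cast
  nlinarith [mul_nonneg (Nat.cast_nonneg (α := ℝ) j) hx]

/-- Subtracting a long truncated expansion leaves a function that is very small on a ray of the
inner sector and polynomially bounded on `arg s = ±π`. Interpolation makes it small on every ray in
between, once the expansion is long enough for that ray. -/
theorem isBigO_fnorm_sub (hn : 0 < n) {z : Fin n → ℂ} (hz : z ∈ generic n) {θ : ℝ} (hθ : |θ| < Real.pi) :
    (fun x : ℝ => fnorm z (x + θ * Complex.I) - stokesConst n) =O[atTop] fun x => Real.exp (-x) := by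
  obtain ⟨C, B, hC, hB, hb⟩ := exists_norm_fnorm_le hz
  have hπ := Real.pi_pos
  have reduce : ∀ M : ℕ, ∀ a : ℕ → ℂ, a 0 = stokesConst n → ∀ μ : ℝ, μ ≤ -1 →
      (fun x : ℝ => fnorm z (x + θ * Complex.I) - ∑ j ∈ Finset.range (M + 3),
        a j * Complex.exp (-(j * (x + θ * Complex.I)))) =O[atTop] (fun x => Real.exp (μ * x)) →
      (fun x : ℝ => fnorm z (x + θ * Complex.I) - stokesConst n) =O[atTop] fun x => Real.exp (-x) := by
    intro M a ha μ hμ h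
    have h1 : (fun x : ℝ => Real.exp (μ * x)) =O[atTop] fun x => Real.exp (-x) := by
      refine IsBigO.of_bound 1 ?_
      filter_upwards [eventually_ge_atTop 0] with x hx
      rw [Real.norm_of_nonneg (Real.exp_pos _).le, Real.norm_of_nonneg (Real.exp_pos _).le, one_mul]
      gcongr
      nlinarith
    have h2 := (h.trans h1).add (isBigO_sum_sub_head a (M + 2) θ)
    refine h2.congr_left fun x => ?_
    rw [ha]; ring
  have sector : ∀ M : ℕ, ∃ a : ℕ → ℂ, a 0 = stokesConst n ∧ (∀ θ : ℝ, |θ| < Real.pi / 2 →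
      (fun x : ℝ => fnorm z (x + θ * Complex.I) - ∑ j ∈ Finset.range (M + 3),
        a j * Complex.exp (-(j * (x + θ * Complex.I)))) =O[atTop] fun x => Real.exp (-M * x)) := by
    intro M
    obtain ⟨a, ha, h⟩ := exists_sector_expansion hn hz M
    refine ⟨a, ha, fun θ hθ => ?_⟩
    obtain ⟨C', hC'⟩ := h θ hθ
    refine IsBigO.of_bound C' (hC'.mono fun x hx => ?_)
    rwa [Real.norm_of_nonneg (Real.exp_pos _).le, neg_mul]
  have hdiff : ∀ (M : ℕ) (a : ℕ → ℂ), Differentiable ℂ fun ζ : ℂ => fnorm z ζ -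
      ∑ j ∈ Finset.range (M + 3), a j * Complex.exp (-(j * ζ)) := fun M a =>
    (differentiable_fnorm hz).sub (by fun_prop)
  have hgrow : ∀ (M : ℕ) (a : ℕ → ℂ) (x θ : ℝ), |θ| ≤ Real.pi →
      ‖fnorm z (x + θ * Complex.I) - ∑ j ∈ Finset.range (M + 3),
        a j * Complex.exp (-(j * (x + θ * Complex.I)))‖ ≤
      (C + ∑ j ∈ Finset.range (M + 3), ‖a j‖) *
        Real.exp ((B + 2 * n + (M + 3)) * |x| + (B + 2 * n + (M + 3)) * Real.exp x) := by
    intro M a x θ hθ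
    have hM : (0 : ℝ) ≤ M := M.cast_nonneg
    have hn0 : (0 : ℝ) ≤ n := n.cast_nonneg
    have hx := abs_nonneg x
    have he := Real.exp_pos x
    have hcos : 1 + Real.cos θ ≤ 2 := by linarith [Real.cos_le_one θ]
    have e0 : n * Real.exp x * (1 + Real.cos θ) ≤ n * Real.exp x * 2 := by gcongr
    have e1 : 0 ≤ (M + 3) * |x| := by positivity
    have e2 : 0 ≤ (B + (M + 3)) * Real.exp x := by positivity
    have e3 : 0 ≤ n * |x| := by positivity
    have e4 : 0 ≤ n * Real.exp x := by positivity
    have e5 : 0 ≤ B * |x| := by positivity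
    refine (norm_sub_le _ _).trans ?_
    rw [add_mul, Finset.sum_mul]
    refine add_le_add ((hb x θ hθ).trans ?_) ((norm_sum_le _ _).trans (Finset.sum_le_sum fun j hj => ?_))
    · refine mul_le_mul_of_nonneg_left (Real.exp_le_exp.2 ?_) hC
      linarith
    · rw [norm_mul, norm_exp_neg_nat_mul]
      refine mul_le_mul_of_nonneg_left (Real.exp_le_exp.2 ?_) (norm_nonneg _)
      have hj' : (j : ℝ) ≤ M + 3 := by exact_mod_cast (Finset.mem_range.1 hj).le
      have e6 : -(j * x) ≤ j * |x| := by
        rw [← mul_neg]; exact mul_le_mul_of_nonneg_left (neg_le_abs x) j.cast_nonneg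
      have e7 : j * |x| ≤ (M + 3) * |x| := by gcongr
      linarith
  have hline : ∀ (M : ℕ) (a : ℕ → ℂ) (θ : ℝ), |θ| = Real.pi →
      (fun x : ℝ => fnorm z (x + θ * Complex.I) - ∑ j ∈ Finset.range (M + 3),
        a j * Complex.exp (-(j * (x + θ * Complex.I)))) =O[atTop] fun x => Real.exp (B * x) := by
    intro M a θ hθ
    refine IsBigO.of_bound (C + ∑ j ∈ Finset.range (M + 3), ‖a j‖) ?_
    filter_upwards [eventually_ge_atTop 0] with x hx
    rw [Real.norm_of_nonneg (Real.exp_pos _).le, add_mul, Finset.sum_mul]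
    refine (norm_sub_le _ _).trans ?_
    refine add_le_add ((hb x θ hθ.le).trans (le_of_eq ?_))
      ((norm_sum_le _ _).trans (Finset.sum_le_sum fun j hj => ?_))
    · rw [← Real.cos_abs, hθ, Real.cos_pi, abs_of_nonneg hx]; simp
    · rw [norm_mul, norm_exp_neg_nat_mul]
      refine mul_le_mul_of_nonneg_left (Real.exp_le_exp.2 ?_) (norm_nonneg _)
      have : 0 ≤ (j : ℝ) * x := mul_nonneg j.cast_nonneg hx
      have : 0 ≤ B * x := mul_nonneg hB hx
      linarith
  obtain ⟨h1, h2⟩ := abs_lt.1 hθ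
  have hA : ∀ M : ℕ, 0 ≤ B + 2 * n + (M + 3) := fun M => by positivity
  have hK : ∀ (M : ℕ) (a : ℕ → ℂ), 0 ≤ C + ∑ j ∈ Finset.range (M + 3), ‖a j‖ := fun M a => by positivity
  rcases lt_or_ge |θ| (Real.pi / 2) with h | h
  · obtain ⟨a, ha, hs⟩ := sector 1
    exact reduce 1 a ha (-1) le_rfl (by simpa using hs θ h)
  have hq : |Real.pi / 4| < Real.pi / 2 := by rw [abs_of_pos (by positivity)]; linarith
  rcases le_abs'.1 h with h | h
  · set t := (θ - -Real.pi) / (-(Real.pi / 4) - -Real.pi)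
    have hw : 0 < -(Real.pi / 4) - -Real.pi := by linarith
    have ht : 0 < t := div_pos (by linarith) hw
    -- With t the relative position of θ in the strip, the interpolated exponent is `B(1 - t) - Mt`,
    -- which this M makes at most -1.
    obtain ⟨M, hM⟩ := exists_nat_ge ((B + 1) / t)
    rw [div_le_iff₀ ht] at hM
    obtain ⟨a, ha, hs⟩ := sector M
    refine reduce M a ha _ ?_ (isBigO_strip_interpolation (α := -Real.pi) (β := -(Real.pi / 4))
      (by linarith) (by linarith) (hdiff M a) (hK M a) (hA M)
      (fun x θ h1 h2 => hgrow M a x θ (abs_le.2 ⟨h1, by linarith⟩))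
      (μ₁ := B) (μ₂ := -M) ?_ ?_ h1.le (by linarith))
    · have e : (-M - B) / (-(Real.pi / 4) - -Real.pi) * (θ - -Real.pi) = (-M - B) * t := by
        rw [div_mul_eq_mul_div, mul_div_assoc]
      rw [e]
      nlinarith
    · have := hline M a (-Real.pi) (by rw [abs_neg, abs_of_pos hπ])
      simpa using this
    · have := hs (-(Real.pi / 4)) (by rwa [abs_neg])
      simpa using this
  · set t := (θ - Real.pi / 4) / (Real.pi - Real.pi / 4)
    have hw : 0 < Real.pi - Real.pi / 4 := by linarith
    have ht : t < 1 := by rw [div_lt_one hw]; linarith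
    have ht0 : 0 < t := div_pos (by linarith) hw
    obtain ⟨M, hM⟩ := exists_nat_ge ((B + 1) / (1 - t))
    rw [div_le_iff₀ (by linarith)] at hM
    obtain ⟨a, ha, hs⟩ := sector M
    refine reduce M a ha _ ?_ (isBigO_strip_interpolation (α := Real.pi / 4) (β := Real.pi)
      (by linarith) (by linarith) (hdiff M a) (hK M a) (hA M)
      (fun x θ h1 h2 => hgrow M a x θ (abs_le.2 ⟨by linarith, h2⟩))
      (μ₁ := -M) (μ₂ := B) ?_ ?_ (by linarith) h2.le)
    · have e : (B - -M) / (Real.pi - Real.pi / 4) * (θ - Real.pi / 4) = (B - -M) * t := by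
        rw [div_mul_eq_mul_div, mul_div_assoc]
      rw [e]
      nlinarith
    · exact hs (Real.pi / 4) hq
    · exact hline M a Real.pi (abs_of_pos hπ)

end SectorPi
end EquivQDE
namespace EquivQDE

/-! ### Rays: dominance, wrapping, and the sums that define `v_m(l)` -/

section StokesLines
variable {n : ℕ}

/-- The logarithm of `-ω^m s` in terms of `y = m - nφ`. -/
noncomputable def logArg (n : ℕ) (y r : ℝ) : ℂ :=
  Real.log r + (2 * Real.pi * y / n - Real.pi : ℝ) * Complex.I

/-- The value of `fsum` on the ray with parameter `y`. -/
noncomputable def raySum (z : Fin n → ℂ) (y r : ℝ) : ℂ := fsum z (n * logArg n y r)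

/-- The leading asymptotics on the ray with parameter `y`. -/
noncomputable def rayMain (z : Fin n → ℂ) (y r : ℝ) : ℂ :=
  Complex.exp (kappa z * logArg n y r) * Complex.exp (-(n * Complex.exp (logArg n y r)))

theorem rayMain_ne_zero (z : Fin n → ℂ) (y r : ℝ) : rayMain z y r ≠ 0 :=
  mul_ne_zero (Complex.exp_ne_zero _) (Complex.exp_ne_zero _)

theorem raySum_mul_inv (z : Fin n → ℂ) (y r : ℝ) :
    raySum z y r * (rayMain z y r)⁻¹ = fnorm z (logArg n y r) := by
  rw [raySum, rayMain, fnorm, mul_inv, ← Complex.exp_neg, ← Complex.exp_neg, neg_neg, mul_assoc]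

theorem fser_add_int_mul (z : Fin n → ℂ) (J : Fin n) (l : ℂ) (p : ℤ) :
    fser z J (l + p * (2 * Real.pi * Complex.I)) =
      Complex.exp (2 * Real.pi * Complex.I * z J) ^ p * fser z J l := by
  have h0 := Complex.exp_ne_zero (2 * Real.pi * Complex.I * z J)
  induction p using Int.induction_on with
  | zero => simp
  | succ p ih =>
    have h := fser_add_two_pi (z := z) J (l + (p : ℤ) * (2 * Real.pi * Complex.I))
    rw [ih] at h
    have e : l + (p : ℤ) * (2 * Real.pi * Complex.I) + 2 * Real.pi * Complex.I =
        l + (p + 1 : ℤ) * (2 * Real.pi * Complex.I) := by push_cast; ring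
    rw [e] at h
    rw [h, zpow_add_one₀ h0]
    ring
  | pred p ih =>
    have h := fser_add_two_pi (z := z) J (l + (-p - 1 : ℤ) * (2 * Real.pi * Complex.I))
    have e : l + ((-p - 1 : ℤ) : ℂ) * (2 * Real.pi * Complex.I) + 2 * Real.pi * Complex.I =
        l + (-p : ℤ) * (2 * Real.pi * Complex.I) := by push_cast; ring
    rw [e, ih] at h
    rw [zpow_sub_one₀ h0, mul_right_comm (_ ^ _), h]
    field_simp

/-- Moving y by an integer p turns the argument of the residue series by `2πp`, that is, applies the
p-th power of the monodromy. -/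
theorem raySum_add_int (hn : 0 < n) (z : Fin n → ℂ) (y r : ℝ) (p : ℤ) :
    raySum z (y + p) r =
      ∑ J, Complex.exp (2 * Real.pi * Complex.I * z J) ^ p * fser z J (n * logArg n y r) := by
  have hn' : (n : ℂ) ≠ 0 := by exact_mod_cast hn.ne'
  have e : n * logArg n (y + p) r = n * logArg n y r + p * (2 * Real.pi * Complex.I) := by
    simp only [logArg]
    push_cast
    field_simp
    ring
  rw [raySum, fsum, e]
  exact Finset.sum_congr rfl fun J _ => fser_add_int_mul z J _ p

/-- The linear relation between `n + 1` consecutive rays. -/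
theorem sum_sSym_mul_raySum (hn : 0 < n) (z : Fin n → ℂ) (y r : ℝ) :
    ∑ i ∈ Finset.range (n + 1), (-1) ^ i * evalZ z (sSym n i) * raySum z (y - i) r = 0 := by
  have h : ∀ i ∈ Finset.range (n + 1), (-1) ^ i * evalZ z (sSym n i) * raySum z (y - i) r =
      ∑ J, ((-1) ^ i * evalZ z (sSym n i) * Complex.exp (2 * Real.pi * Complex.I * z J) ^ (n - i)) *
        fser z J (n * logArg n (y - n) r) := fun i hi => by
    have hi' : i ≤ n := Nat.lt_succ_iff.1 (Finset.mem_range.1 hi)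
    have e : y - i = (y - n) + ((n - i : ℕ) : ℤ) := by push_cast [hi']; ring
    rw [e, raySum_add_int hn, Finset.mul_sum]
    exact Finset.sum_congr rfl fun J _ => by rw [zpow_natCast]; ring
  rw [Finset.sum_congr rfl h, Finset.sum_comm]
  refine Finset.sum_eq_zero fun J _ => ?_
  rw [← Finset.sum_mul, sum_evalZ_sSym, zero_mul]

theorem evalZ_sSym_self (z : Fin n → ℂ) :
    evalZ z (sSym n n) = ∏ a, Complex.exp (2 * Real.pi * Complex.I * z a) := by
  have h : MvPolynomial.esymm (Fin n) ℂ n = ∏ a, MvPolynomial.X a := by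
    rw [MvPolynomial.esymm]
    have : Finset.powersetCard n (Finset.univ : Finset (Fin n)) = {Finset.univ} := by
      have := Finset.powersetCard_self (Finset.univ : Finset (Fin n))
      simpa using this
    rw [this, Finset.sum_singleton]
  rw [sSym, h, map_prod, map_prod]
  simp only [MvPolynomial.aeval_X, evalZ_Zvar]

theorem exp_two_pi_mul_kappa (z : Fin n → ℂ) :
    Complex.exp (2 * Real.pi * Complex.I * kappa z) = -(-1) ^ n * evalZ z (sSym n n) := by
  rw [evalZ_sSym_self, ← Complex.exp_sum, ← Finset.mul_sum]
  have e : 2 * Real.pi * Complex.I * kappa z = 2 * Real.pi * Complex.I * ∑ a, z a +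
      (Real.pi * Complex.I - n * (Real.pi * Complex.I)) := by rw [kappa]; ring
  have h1 : Complex.exp (n * (Real.pi * Complex.I)) = (-1) ^ n := by
    rw [Complex.exp_nat_mul, Complex.exp_pi_mul_I]
  rw [e, Complex.exp_add, Complex.exp_sub, h1, Complex.exp_pi_mul_I]
  have h2 : ((-1 : ℂ) ^ n) * (-1) ^ n = 1 := by rw [← mul_pow]; simp
  have h3 : ((-1 : ℂ) ^ n) ≠ 0 := pow_ne_zero _ (by norm_num)
  field_simp
  rw [pow_two, h2]

/-- A shift of y by n is a full turn of s: the exponential is unchanged and the power of s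
contributes `e^{2πiκ}`, which is the coefficient of the last term in the linear relation up to sign.
-/
theorem rayMain_add_nat (hn : 0 < n) (z : Fin n → ℂ) (y r : ℝ) :
    rayMain z (y + n) r = -(-1) ^ n * evalZ z (sSym n n) * rayMain z y r := by
  have hn' : (n : ℂ) ≠ 0 := by exact_mod_cast hn.ne'
  have e : logArg n (y + n) r = logArg n y r + 2 * Real.pi * Complex.I := by
    simp only [logArg]
    push_cast
    field_simp
    ring
  rw [rayMain, e, Complex.exp_add (logArg n y r), Complex.exp_two_pi_mul_I, mul_one, mul_add, Complex.exp_add,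
    mul_comm (kappa z) (2 * Real.pi * Complex.I), exp_two_pi_mul_kappa, rayMain]
  ring

theorem abs_ray_arg (hn : 0 < n) (y : ℝ) :
    |2 * Real.pi * y / n - Real.pi| = 2 * Real.pi / n * |y - n / 2| := by
  have hn' : (0 : ℝ) < n := by exact_mod_cast hn
  rw [← abs_of_pos (a := 2 * Real.pi / n) (by have := Real.pi_pos; positivity), ← abs_mul]
  congr 1
  field_simp

theorem abs_ray_arg_lt (hn : 0 < n) {y : ℝ} (h0 : 0 < y) (h1 : y < n) :
    |2 * Real.pi * y / n - Real.pi| < Real.pi := by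
  have hn' : (0 : ℝ) < n := by exact_mod_cast hn
  have hπ := Real.pi_pos
  rw [abs_ray_arg hn]
  have h2 : |y - n / 2| < n / 2 := by rw [abs_lt]; constructor <;> linarith
  calc _ < 2 * Real.pi / n * (n / 2) := by gcongr
    _ = Real.pi := by field_simp

theorem isBigO_raySum (hn : 0 < n) {z : Fin n → ℂ} (hz : z ∈ generic n) {y : ℝ} (h0 : 0 < y) (h1 : y < n) :
    (fun r : ℝ => raySum z y r * (rayMain z y r)⁻¹ - stokesConst n) =O[atTop] fun r => r⁻¹ := by
  have h := (isBigO_fnorm_sub hn hz (abs_ray_arg_lt hn h0 h1)).comp_tendsto Real.tendsto_log_atTop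
  refine h.congr' ?_ ?_
  · exact Eventually.of_forall fun r => by simp only [raySum_mul_inv]; rfl
  · filter_upwards [eventually_gt_atTop 0] with r hr
    simp only [Function.comp_apply]
    rw [Real.exp_neg, Real.exp_log hr]

/-- The modulus of the exponential is `e^{-nr cos θ}` with `|θ|` proportional to `|y - n/2|`. A ray
closer to the centre has a larger cosine, hence is exponentially smaller. -/
theorem isBigO_rayMain_mul_inv (hn : 0 < n) (z : Fin n → ℂ) {y y' : ℝ} (h0 : 0 < y) (h1 : y < n)
    (h : |y' - n / 2| < |y - n / 2|) :
    (fun r : ℝ => rayMain z y' r * (rayMain z y r)⁻¹) =O[atTop] fun r => r⁻¹ := by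
  have hn' : (0 : ℝ) < n := by exact_mod_cast hn
  have hπ := Real.pi_pos
  set θ := 2 * Real.pi * y / n - Real.pi
  set θ' := 2 * Real.pi * y' / n - Real.pi
  have hcos : Real.cos θ < Real.cos θ' := by
    rw [← Real.cos_abs θ, ← Real.cos_abs θ']
    refine Real.cos_lt_cos_of_nonneg_of_le_pi (abs_nonneg _) (abs_ray_arg_lt hn h0 h1).le ?_
    rw [abs_ray_arg hn, abs_ray_arg hn]
    gcongr
  set δ := n * (Real.cos θ' - Real.cos θ)
  have hδ : 0 < δ := mul_pos hn' (sub_pos.2 hcos)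
  set K := ‖Complex.exp (kappa z * ((θ' - θ : ℝ) * Complex.I))‖
  refine IsBigO.of_bound (K * δ⁻¹) ?_
  filter_upwards [eventually_gt_atTop 0] with r hr
  have e : rayMain z y' r * (rayMain z y r)⁻¹ = Complex.exp (kappa z * ((θ' - θ : ℝ) * Complex.I)) *
      Complex.exp (n * Complex.exp (logArg n y r) - n * Complex.exp (logArg n y' r)) := by
    rw [rayMain, rayMain, mul_inv, ← Complex.exp_neg, ← Complex.exp_neg, ← Complex.exp_add,
      ← Complex.exp_add, ← Complex.exp_add, ← Complex.exp_add]
    congr 1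
    simp only [logArg, θ, θ']
    push_cast
    ring
  have hre : ∀ y, (n * Complex.exp (logArg n y r)).re = n * (r * Real.cos (2 * Real.pi * y / n - Real.pi)) := by
    intro y
    rw [← Complex.ofReal_natCast, Complex.re_ofReal_mul, logArg, Complex.exp_add, ← Complex.ofReal_exp,
      Real.exp_log hr, Complex.re_ofReal_mul, Complex.exp_ofReal_mul_I_re]
  have hexp : Real.exp (-(δ * r)) ≤ δ⁻¹ * r⁻¹ := by
    rw [Real.exp_neg, ← mul_inv]
    refine inv_anti₀ (by positivity) ?_
    linarith [Real.add_one_le_exp (δ * r)]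
  rw [e, norm_mul, Complex.norm_exp (_ - _), Complex.sub_re, hre, hre, Real.norm_of_nonneg (by positivity),
    mul_assoc K]
  refine mul_le_mul_of_nonneg_left (le_trans (le_of_eq ?_) hexp) (norm_nonneg (Complex.exp _))
  congr 1
  simp only [δ, θ, θ']
  ring

theorem isBigO_raySum_subdominant (hn : 0 < n) {z : Fin n → ℂ} (hz : z ∈ generic n) {y y' : ℝ} (h0 : 0 < y)
    (h1 : y < n) (h : |y' - n / 2| < |y - n / 2|) :
    (fun r : ℝ => raySum z y' r * (rayMain z y r)⁻¹) =O[atTop] fun r => r⁻¹ := by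
  have h2 : |y - n / 2| < n / 2 := by rw [abs_lt]; constructor <;> linarith
  obtain ⟨h3, h4⟩ := abs_lt.1 (h.trans h2)
  have hb : (fun r : ℝ => raySum z y' r * (rayMain z y' r)⁻¹) =O[atTop] fun _ => (1 : ℝ) := by
    have e1 := (isBigO_raySum hn hz (y := y') (by linarith) (by linarith)).trans
      ((tendsto_inv_atTop_zero (𝕜 := ℝ)).isBigO_one ℝ)
    have e2 : (fun _ : ℝ => (stokesConst n : ℂ)) =O[atTop] fun _ => (1 : ℝ) :=
      isBigO_const_const _ one_ne_zero _
    simpa using e1.add e2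
  have h5 := hb.mul (isBigO_rayMain_mul_inv hn z h0 h1 h)
  refine h5.congr (fun r => ?_) fun r => one_mul _
  have := rayMain_ne_zero z y' r
  have := rayMain_ne_zero z y r
  field_simp

/-- For `1 ≤ i ≤ d` the point `y - i` is closer to `n/2` than y as soon as `2y > n + i`; so only the
term `i = 0` counts. -/
theorem isBigO_sum_raySum_direct (hn : 0 < n) {z : Fin n → ℂ} (hz : z ∈ generic n) {y : ℝ} (h0 : 0 < y)
    (h1 : y < n) {d : ℕ} (hd : d = 0 ∨ n + d < 2 * y) :
    (fun r : ℝ => (∑ i ∈ Finset.range (d + 1), (-1) ^ i * evalZ z (sSym n i) * raySum z (y - i) r) *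
      (rayMain z y r)⁻¹ - stokesConst n) =O[atTop] fun r => r⁻¹ := by
  have h2 : (fun r : ℝ => ∑ i ∈ Finset.range d, (-1) ^ (i + 1) * evalZ z (sSym n (i + 1)) *
      (raySum z (y - (i + 1 : ℕ)) r * (rayMain z y r)⁻¹)) =O[atTop] fun r => r⁻¹ := by
    refine IsBigO.fun_sum fun i hi => ?_
    have hi' : (i + 1 : ℕ) ≤ (d : ℝ) := by exact_mod_cast Finset.mem_range.1 hi
    have hd' : n + d < 2 * y := hd.resolve_left (by have := Finset.mem_range.1 hi; omega)
    have hi0 : (0 : ℝ) < (i + 1 : ℕ) := by positivity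
    refine (isBigO_raySum_subdominant hn hz h0 h1 ?_).const_mul_left _
    rw [abs_of_pos (a := y - n / 2) (by linarith), abs_lt]
    constructor <;> linarith
  refine (h2.add (isBigO_raySum hn hz h0 h1)).congr_left fun r => ?_
  rw [Finset.sum_range_succ', add_mul, Finset.sum_mul, ← add_sub_assoc]
  congr 2
  · exact Finset.sum_congr rfl fun i _ => by ring
  · simp [sSym_zero]

/-- For `y > n` the leading ray leaves the controlled range. The relation between `n + 1` rays
replaces the sum over `i ≤ d` by minus the sum over `i > d`. There `i = n` has the controlled
parameter `y - n` and dominates, and `rayMain_add_nat` matches its leading term with the one at y.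
-/
theorem isBigO_sum_raySum_wrapped (hn : 0 < n) {z : Fin n → ℂ} (hz : z ∈ generic n) {y : ℝ} (h0 : n < y)
    (h1 : y < 2 * n) {d : ℕ} (hdn : d < n) (hd : 2 * y < 2 * n + d + 1) :
    (fun r : ℝ => (∑ i ∈ Finset.range (d + 1), (-1) ^ i * evalZ z (sSym n i) * raySum z (y - i) r) *
      (rayMain z y r)⁻¹ - stokesConst n) =O[atTop] fun r => r⁻¹ := by
  set S := evalZ z (sSym n n)
  have hS : -(-1) ^ n * S ≠ 0 := by rw [← exp_two_pi_mul_kappa]; exact Complex.exp_ne_zero _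
  have hy0 : 0 < y - n := by linarith
  have hy1 : y - n < n := by linarith
  have hmain : ∀ r, rayMain z y r = -(-1) ^ n * S * rayMain z (y - n) r := fun r => by
    rw [← rayMain_add_nat hn, sub_add_cancel]
  have h2 : (fun r : ℝ => -(-(-1) ^ n * S)⁻¹ * ∑ i ∈ Finset.Ico (d + 1) n, (-1) ^ i * evalZ z (sSym n i) *
      (raySum z (y - i) r * (rayMain z (y - n) r)⁻¹)) =O[atTop] fun r => r⁻¹ := by
    refine (IsBigO.fun_sum fun i hi => ?_).const_mul_left _
    obtain ⟨hi1, hi2⟩ := Finset.mem_Ico.1 hi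
    have hi1' : (d + 1 : ℝ) ≤ i := by exact_mod_cast hi1
    have hi2' : (i : ℝ) < n := by exact_mod_cast hi2
    refine (isBigO_raySum_subdominant hn hz hy0 hy1 ?_).const_mul_left _
    rw [abs_of_neg (a := y - n - n / 2) (by linarith), abs_lt]
    constructor <;> linarith
  refine (h2.add (isBigO_raySum hn hz hy0 hy1)).congr_left fun r => ?_
  have hrel := sum_sSym_mul_raySum hn z y r
  rw [Finset.sum_range_succ, ← Finset.sum_range_add_sum_Ico _ (Nat.succ_le_of_lt hdn)] at hrel
  have hne := rayMain_ne_zero z (y - n) r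
  have hsum : ∑ i ∈ Finset.Ico (d + 1) n, (-1) ^ i * evalZ z (sSym n i) *
      (raySum z (y - i) r * (rayMain z (y - n) r)⁻¹) =
      (∑ i ∈ Finset.Ico (d + 1) n, (-1) ^ i * evalZ z (sSym n i) * raySum z (y - i) r) *
        (rayMain z (y - n) r)⁻¹ := by
    rw [Finset.sum_mul]
    exact Finset.sum_congr rfl fun i _ => by ring
  rw [hsum, hmain, ← add_sub_assoc]
  congr 1
  have e : ∑ i ∈ Finset.range (d + 1), (-1) ^ i * evalZ z (sSym n i) * raySum z (y - i) r =
      -(∑ i ∈ Finset.Ico (d + 1) n, (-1) ^ i * evalZ z (sSym n i) * raySum z (y - i) r) +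
        (-(-1) ^ n * S) * raySum z (y - n) r := by
    linear_combination hrel
  rw [e]
  generalize -(-1) ^ n * S = U at hS ⊢
  field_simp

end StokesLines
end EquivQDE
namespace EquivQDE

/-! ### From scalar asymptotics of the coordinates to the Stokes asymptotics -/

section StokesCriterion
variable {n : ℕ}

theorem isBigO_one_of_sub_one {f : ℝ → ℂ} (hf : (fun r => f r - 1) =O[atTop] fun r : ℝ => r⁻¹) :
    f =O[atTop] fun _ => (1 : ℝ) := by
  have h1 := hf.trans ((tendsto_inv_atTop_zero (𝕜 := ℝ)).isBigO_one ℝ)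
  have h2 : (fun _ : ℝ => (1 : ℂ)) =O[atTop] fun _ => (1 : ℝ) := isBigO_const_const _ one_ne_zero _
  simpa using h1.add h2

theorem isBigO_mul_sub_one {f g : ℝ → ℂ} (hf : (fun r => f r - 1) =O[atTop] fun r : ℝ => r⁻¹)
    (hg : (fun r => g r - 1) =O[atTop] fun r : ℝ => r⁻¹) :
    (fun r => f r * g r - 1) =O[atTop] fun r : ℝ => r⁻¹ := by
  refine ((hf.mul (isBigO_one_of_sub_one hg)).congr_right fun r => mul_one _).add hg |>.congr_left
    fun r => ?_
  ring

theorem isBigO_prod_sub_one {ι : Type*} (s : Finset ι) {f : ι → ℝ → ℂ}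
    (hf : ∀ a ∈ s, (fun r => f a r - 1) =O[atTop] fun r : ℝ => r⁻¹) :
    (fun r => ∏ a ∈ s, f a r - 1) =O[atTop] fun r : ℝ => r⁻¹ := by
  classical
  induction s using Finset.induction_on with
  | empty => simpa using isBigO_zero _ _
  | insert a s ha ih =>
    simp only [Finset.prod_insert ha]
    exact isBigO_mul_sub_one (hf a (Finset.mem_insert_self _ _))
      (ih fun b hb => hf b (Finset.mem_insert_of_mem hb))

theorem tendsto_one_of_sub_one {f : ℝ → ℂ} (hf : (fun r => f r - 1) =O[atTop] fun r : ℝ => r⁻¹) :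
    Tendsto f atTop (𝓝 1) := by
  have := (hf.trans_tendsto tendsto_inv_atTop_zero).add_const 1
  simpa using this

theorem kappa_raise (z : Fin n → ℂ) {m : ℕ} (hm : m ≤ n) : kappa (raise z m) = kappa z + m := by
  induction m with
  | zero => simp [raise_zero]
  | succ m ih =>
    have := ih (by omega)
    rw [kappa] at this ⊢
    rw [raise_succ z hm]
    simp only [Pi.add_apply, Finset.sum_add_distrib, Finset.sum_pi_single', Finset.mem_univ, if_true]
    push_cast
    linear_combination this

theorem rayMain_raise (z : Fin n → ℂ) {m : ℕ} (hm : m ≤ n) (y r : ℝ) :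
    rayMain (raise z m) y r = rayMain z y r * Complex.exp (logArg n y r) ^ m := by
  rw [rayMain, kappa_raise z hm, add_mul, Complex.exp_add, Complex.exp_nat_mul, rayMain]
  ring

theorem logNegOmegaS_eq (hn : 0 < n) (m : ℤ) (r φ : ℝ) :
    logNegOmegaS n m r φ = logArg n (m - n * φ) r := by
  have hn' : (n : ℂ) ≠ 0 := by exact_mod_cast hn.ne'
  rw [logNegOmegaS, logArg]
  push_cast
  field_simp
  ring

theorem omegaS_eq (hn : 0 < n) (m : ℤ) {r : ℝ} (hr : 0 < r) (φ : ℝ) :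
    omegaS n m r φ = -Complex.exp (logArg n (m - n * φ) r) := by
  have e : -Complex.exp (logArg n (m - n * φ) r) =
      Complex.exp (Real.pi * Complex.I) * Complex.exp (logArg n (m - n * φ) r) := by
    rw [Complex.exp_pi_mul_I]; ring
  have hlog : (r : ℂ) = Complex.exp (Real.log r) := by rw [← Complex.ofReal_exp, Real.exp_log hr]
  rw [e, omegaS, sPoint, ← Complex.exp_int_mul]
  conv_lhs => rw [hlog]
  rw [← Complex.exp_add, ← Complex.exp_add, ← Complex.exp_add, ← logNegOmegaS_eq hn, logNegOmegaS]
  congr 1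
  have hn' : (n : ℂ) ≠ 0 := by exact_mod_cast hn.ne'
  field_simp
  ring

theorem stokesConst_eq (n : ℕ) :
    stokesConst n = (2 * Real.pi) ^ (((n : ℝ) - 1) / 2) / √n := by
  have hπ : 0 < 2 * Real.pi := by have := Real.pi_pos; positivity
  have h : (2 * Real.pi) ^ (((n : ℝ) - 1) / 2) * √(2 * Real.pi) = √(2 * Real.pi) ^ n := by
    rw [Real.sqrt_eq_rpow, ← Real.rpow_natCast, ← Real.rpow_mul hπ.le, ← Real.rpow_add hπ]
    congr 1
    ring
  have h1 : √(2 * Real.pi) ≠ 0 := (Real.sqrt_pos.2 hπ).ne'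
  rw [stokesConst, ← h]
  field_simp

theorem stokesConst_pos (hn : 0 < n) : 0 < stokesConst n := by
  have hn' : (0 : ℝ) < n := by exact_mod_cast hn
  have := Real.pi_pos
  rw [stokesConst]
  positivity

theorem norm_exp_logArg {r : ℝ} (hr : 0 < r) (y : ℝ) : ‖Complex.exp (logArg n y r)‖ = r := by
  rw [logArg, Complex.exp_add, norm_mul, Complex.norm_exp_ofReal_mul_I, mul_one, ← Complex.ofReal_exp,
    Real.exp_log hr, Complex.norm_real, Real.norm_of_nonneg hr.le]

/-- Both the solution and the leading factor times the weight at `-S`, where `|S| = r`, have i-th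
coordinates of relative size `S^i`, so the relative errors are compared coordinate by coordinate.
Division by the weight is multiplication by `(x + S)/∏(z_a + S)`. -/
theorem hasStokesAsymptotics_of_coord (hn : 0 < n) {I : Fam n} {m : ℤ} {φ : ℝ} {z : Fin n → ℂ}
    (h : ∀ i : Fin n, (fun r : ℝ => (-1) ^ (n - 1 - i.val) * coord z (I (logP n r φ) z) i *
      (rayMain (raise z i) (m - n * φ) r)⁻¹ - stokesConst n) =O[atTop] fun r => r⁻¹) :
    HasStokesAsymptotics I m φ z := by
  set y : ℝ := m - n * φ
  set S : ℝ → ℂ := fun r => Complex.exp (logArg n y r)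
  have hS : ∀ r, S r ≠ 0 := fun r => Complex.exp_ne_zero _
  have hsc : (stokesConst n : ℂ) ≠ 0 := by exact_mod_cast (stokesConst_pos hn).ne'
  set A : Fin n → ℝ → ℂ := fun a r => 1 + z a * (S r)⁻¹
  have hSinv : (fun r => (S r)⁻¹) =O[atTop] fun r : ℝ => r⁻¹ := by
    refine IsBigO.of_bound 1 ?_
    filter_upwards [eventually_gt_atTop 0] with r hr
    rw [norm_inv, norm_exp_logArg hr, one_mul, norm_inv, Real.norm_of_nonneg hr.le]
  have hA : ∀ a, (fun r => A a r - 1) =O[atTop] fun r : ℝ => r⁻¹ := fun a => by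
    simpa [A] using hSinv.const_mul_left (z a)
  have hAS : ∀ a r, z a - -S r = S r * A a r := fun a r => by
    simp only [A]; rw [mul_add, mul_left_comm, mul_inv_cancel₀ (hS r)]; ring
  set w : Fin n → ℝ → ℂ := fun i r => (stokesConst n : ℂ)⁻¹ * ((-1) ^ (n - 1 - i.val) *
    coord z (I (logP n r φ) z) i * (rayMain (raise z i) y r)⁻¹)
  have hw : ∀ i, (fun r => w i r - 1) =O[atTop] fun r : ℝ => r⁻¹ := fun i => by
    refine ((h i).const_mul_left (stokesConst n : ℂ)⁻¹).congr_left fun r => ?_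
    simp only [w]
    field_simp
  set u : Fin n → ℝ → ℂ := fun i r => w i r - ∏ a ∈ Finset.Iio i, A a r
  have hu : ∀ i, u i =O[atTop] fun r : ℝ => r⁻¹ := fun i => by
    refine ((hw i).sub (isBigO_prod_sub_one (Finset.Iio i) fun a _ => hA a)).congr_left fun r => ?_
    simp only [u]; ring
  set B : ℝ → ℂ := fun r => ∏ a, A a r
  have hB : (fun r => B r - 1) =O[atTop] fun r : ℝ => r⁻¹ :=
    isBigO_prod_sub_one Finset.univ fun a _ => hA a
  have hB1 := tendsto_one_of_sub_one hB
  set P : ℝ → ℂ := fun r => stokesConst n * rayMain z y r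
  have hP : ∀ r, P r ≠ 0 := fun r => mul_ne_zero hsc (rayMain_ne_zero z y r)
  set v : ℝ → HT z := fun r => (P r)⁻¹ • I (logP n r φ) z - weight (-S r) z
  have hv : ∀ r i, coord z (v r) i = (-1) ^ (n - 1 - i.val) * (S r ^ i.val * u i r) := by
    intro r i
    have h1 : ((-1 : ℂ) ^ (n - 1 - i.val)) * (-1) ^ (n - 1 - i.val) = 1 := by rw [← mul_pow]; simp
    have h2 := rayMain_ne_zero z y r
    have h3 := hS r
    simp only [v, u, w]
    rw [coord_sub, coord_smul, coord_weight, weightCoord, rayMain_raise z i.2.le]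
    simp only [hAS, Finset.prod_mul_distrib, Finset.prod_const, Fin.card_Iio, P]
    rw [mul_sub, mul_sub]
    congr 1
    change _ = _ * (S r ^ i.val * (_ * (_ * _ * (_ * S r ^ i.val)⁻¹)))
    field_simp
    rw [pow_two, h1, mul_one]
  set D : ℝ → ℂ := fun r => ∏ a, (z a - -S r)
  have hD : ∀ r, D r = S r ^ n * B r := fun r => by
    simp only [D, B, hAS, Finset.prod_mul_distrib, Finset.prod_const, Finset.card_univ, Fintype.card_fin]
  -- Multiplication by `x + S` sends vectors with coordinates of size `S^i/r` to coordinates of size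
  -- `S^{j+1}/r`, and `|D|` grows like `r^n` with `j + 1 ≤ n`; hence the error is `O(1/r)`.
  refine ⟨fun r => (D r)⁻¹ • ((xi z - algebraMap ℂ (HT z) (-S r)) * v r), fun j => ?_, ?_⟩
  · have hpow : (fun r => S r ^ (j.val + 1) * (S r ^ n)⁻¹) =O[atTop] fun _ => (1 : ℝ) := by
      refine IsBigO.of_bound 1 ?_
      filter_upwards [eventually_ge_atTop 1] with r hr
      have hr0 : 0 < r := by linarith
      rw [norm_mul, norm_inv, norm_pow, norm_pow, norm_exp_logArg hr0, norm_one, one_mul,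
        mul_inv_le_iff₀ (by positivity), one_mul]
      exact pow_le_pow_right₀ hr j.2
    have hlast : (fun r => (-1) ^ (n - 1 - j.val) * (A j r * u j r) +
        if h : j.val + 1 < n then (-1) ^ (n - 1 - (j.val + 1)) * u ⟨j.val + 1, h⟩ r else 0)
        =O[atTop] fun r : ℝ => r⁻¹ := by
      refine IsBigO.add (IsBigO.const_mul_left ?_ _) ?_
      · exact ((isBigO_one_of_sub_one (hA j)).mul (hu j)).congr_right fun r => one_mul _
      · split_ifs with h
        · exact (hu _).const_mul_left _
        · exact isBigO_zero _ _
    have hBinv : (fun r => (B r)⁻¹) =O[atTop] fun _ => (1 : ℝ) := by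
      have := hB1.inv₀ one_ne_zero
      exact this.isBigO_one ℝ
    refine ((hBinv.mul hpow).mul hlast).congr (fun r => ?_) fun r => by ring
    have hSr := hS r
    rw [coord_smul, sub_mul, coord_sub, coord_xi_mul, ← Algebra.smul_def, coord_smul, hD]
    simp only [hv]
    have hz : z j = S r * A j r - S r := by rw [← hAS]; ring
    rw [hz]
    split_ifs with h
    · field_simp
      ring
    · field_simp
      ring
  · have hBne : ∀ᶠ r in atTop, B r ≠ 0 := hB1.eventually_ne one_ne_zero
    filter_upwards [eventually_gt_atTop 0, hBne] with r hr hBr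
    have hDr : D r ≠ 0 := by rw [hD]; exact mul_ne_zero (pow_ne_zero _ (hS r)) hBr
    have hpre : ((((2 * Real.pi) ^ (((n : ℝ) - 1) / 2) / Real.sqrt n : ℝ) : ℂ) *
        Complex.exp (n * omegaS n m r φ) *
        Complex.exp ((∑ a, z a + (1 - n) / 2) * logNegOmegaS n m r φ)) = P r := by
      rw [← stokesConst_eq, omegaS_eq hn m hr, logNegOmegaS_eq hn]
      simp only [P, rayMain, kappa]
      rw [mul_assoc, mul_comm (Complex.exp _)]
      congr 4
      · ring
      · ring
    rw [hpre, omegaS_eq hn m hr]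
    change _ = P r • (weight (-S r) z * (1 + (D r)⁻¹ • ((xi z - algebraMap ℂ (HT z) (-S r)) * v r)))
    have hmul : weight (-S r) z * (1 + (D r)⁻¹ • ((xi z - algebraMap ℂ (HT z) (-S r)) * v r)) =
        (P r)⁻¹ • I (logP n r φ) z := by
      have h1 := sub_mul_weight z (-S r)
      have h2 : weight (-S r) z * ((xi z - algebraMap ℂ (HT z) (-S r)) * v r) = D r • v r := by
        rw [Algebra.smul_def, ← h1]; ring
      rw [mul_add, mul_one, mul_smul_comm, h2, smul_smul, inv_mul_cancel₀ hDr, one_smul]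
      simp only [v]
      abel
    rw [hmul, smul_smul, mul_inv_cancel₀ (hP r), one_smul]

end StokesCriterion
end EquivQDE
namespace EquivQDE

/-! ### The Stokes bases -/

section StokesBases
variable {n : ℕ}

theorem exp_raise (z : Fin n → ℂ) (m : ℕ) (a : Fin n) :
    Complex.exp (2 * Real.pi * Complex.I * raise z m a) = Complex.exp (2 * Real.pi * Complex.I * z a) := by
  rw [raise]
  split_ifs
  · rw [mul_add, mul_one, Complex.exp_add, Complex.exp_two_pi_mul_I, mul_one]
  · rfl

theorem evalZ_raise (z : Fin n → ℂ) (m : ℕ) : evalZ (raise z m) = evalZ z := by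
  simp only [evalZ, exp_raise]

theorem toSolution_sum_smul {ι : Type*} (s : Finset ι) (c : ι → Laurent n) (v : ι → M n) (τ : ℂ)
    (z : Fin n → ℂ) :
    toSolution (∑ i ∈ s, c i • v i) τ z = ∑ i ∈ s, evalZ z (c i) • toSolution (v i) τ z := by
  simp only [toSolution, Finset.smul_sum, smul_smul]
  rw [Finset.sum_comm]
  refine Finset.sum_congr rfl fun j _ => ?_
  rw [← Finset.sum_smul]
  congr 1
  simp [Finset.sum_apply, map_sum, map_mul]

theorem lam_logP (hn : 0 < n) (r φ : ℝ) : lam n (logP n r φ) = n * logArg n (1 - n * φ) r := by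
  have hn' : (n : ℂ) ≠ 0 := by exact_mod_cast hn.ne'
  rw [lam, logP, logArg]
  push_cast
  field_simp
  ring

/-- The solution `Ψ^m` corresponds to `p = m - 1`, so its ray parameter is `y = m - nφ`. -/
theorem coord_toSolution_powX (hn : 0 < n) {z : Fin n → ℂ} (hz : z ∈ generic n) (p : ℤ) (r φ : ℝ)
    (i : Fin n) : coord z (toSolution (powX n p) (logP n r φ) z) i =
      (-1) ^ (n - 1 - i.val) * raySum (raise z i) (1 - n * φ + p) r := by
  rw [toSolution_eq, coord_sum, raySum_add_int hn, Finset.mul_sum]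
  refine Finset.sum_congr rfl fun J _ => ?_
  rw [coord_smul, evalX_powX, coord_PsiJ_eq hz, exp_raise, lam_logP hn]
  ring

theorem coord_toSolution_vml (hn : 0 < n) {z : Fin n → ℂ} (hz : z ∈ generic n) (k : ℤ) {m l : ℕ}
    (hl : 1 ≤ l) (hlm : l ≤ m) (hm : m ≤ n) (r φ : ℝ) (i : Fin n) :
    coord z (toSolution (vml (basisQ n k) m l) (logP n r φ) z) i = (-1) ^ (n - 1 - i.val) *
      ∑ t ∈ Finset.range (m - l + 1), (-1) ^ t * evalZ (raise z i) (sSym n t) *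
        raySum (raise z i) (k + m - n * φ - t) r := by
  rw [vml, toSolution_sum_smul, coord_sum, Finset.mul_sum]
  refine Finset.sum_congr rfl fun t ht => ?_
  have ht' : t ≤ m - l := Nat.lt_succ_iff.1 (Finset.mem_range.1 ht)
  have e : (1 - n * φ + (k + (m - t - 1 : ℕ) : ℤ) : ℝ) = k + m - n * φ - t := by
    push_cast [show 1 ≤ m - t by omega, show t ≤ m by omega]
    ring
  rw [coord_smul, nth_of_le _ (by omega) (by omega), basisQ, coord_toSolution_powX hn hz, e, evalZ_raise]
  simp only [map_mul, map_pow, map_neg, map_one]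
  ring

/-- The i-th coordinate is the same scalar sum at raised parameters. The hypothesis therefore ranges
over all generic parameters, and one scalar estimate serves all coordinates. -/
theorem hasStokesAsymptotics_vml_of_isBigO (hn : 0 < n) {z : Fin n → ℂ} (hz : z ∈ generic n) (k : ℤ)
    {m l : ℕ} (hl : 1 ≤ l) (hlm : l ≤ m) (hm : m ≤ n) {φ : ℝ}
    (h : ∀ z ∈ generic n, (fun r : ℝ => (∑ t ∈ Finset.range (m - l + 1), (-1) ^ t * evalZ z (sSym n t) *
      raySum z (k + m - n * φ - t) r) * (rayMain z (k + m - n * φ) r)⁻¹ - stokesConst n)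
        =O[atTop] fun r => r⁻¹) :
    HasStokesAsymptotics (toSolution (vml (basisQ n k) m l)) (k + m) φ z := by
  refine hasStokesAsymptotics_of_coord hn fun i => (h _ (generic_raise hz i)).congr_left fun r => ?_
  have h1 : ((-1 : ℂ) ^ (n - 1 - i.val)) * (-1) ^ (n - 1 - i.val) = 1 := by rw [← mul_pow]; simp
  rw [coord_toSolution_vml hn hz k hl hlm hm, ← mul_assoc, h1, one_mul]
  push_cast
  rfl

theorem hasStokesAsymptotics_nth (hn : 0 < n) {z : Fin n → ℂ} (hz : z ∈ generic n) (k : ℤ) {m : ℕ}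
    (hm1 : 1 ≤ m) (hm : m ≤ n) {φ : ℝ} (h1 : n * φ - k < m) (h2 : m - n < n * φ - k) :
    HasStokesAsymptotics (toSolution (nth (basisQ n k) m)) (k + m) φ z := by
  rw [← vml_self]
  refine hasStokesAsymptotics_vml_of_isBigO hn hz k hm1 le_rfl hm fun z hz => ?_
  exact isBigO_sum_raySum_direct hn hz (by linarith) (by linarith) (Or.inl (Nat.sub_self m))

theorem hasStokesAsymptotics_vml (hn : 0 < n) {z : Fin n → ℂ} (hz : z ∈ generic n) (k : ℤ) {m l : ℕ}
    (hl : 1 ≤ l) (hlm : l ≤ m) (hm : m ≤ n) {φ : ℝ} (hφ : ¬Resonant n φ)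
    (h1 : 2 * (n * φ - k) < m + l - n) (h2 : m + l - 2 * n - 1 < 2 * (n * φ - k)) :
    HasStokesAsymptotics (toSolution (vml (basisQ n k) m l)) (k + m) φ z := by
  have hn' : (0 : ℝ) < n := by exact_mod_cast hn
  have hl' : (1 : ℝ) ≤ l := by exact_mod_cast hl
  have hlm' : (l : ℝ) ≤ m := by exact_mod_cast hlm
  have hm' : (m : ℝ) ≤ n := by exact_mod_cast hm
  have hd : ((m - l : ℕ) : ℝ) = m - l := by push_cast [hlm]; ring
  refine hasStokesAsymptotics_vml_of_isBigO hn hz k hl hlm hm fun z hz => ?_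
  -- At `y = n` the ray lies on the negative axis and neither estimate applies; this happens only at
  -- resonant φ.
  have hne : (k + m - n * φ : ℝ) ≠ n := fun h => hφ ⟨k + m - n, by
    rw [eq_div_iff hn'.ne']; push_cast; linarith⟩
  rcases lt_or_gt_of_ne hne with h | h
  · exact isBigO_sum_raySum_direct hn hz (by linarith) h (Or.inr (by rw [hd]; linarith))
  · exact isBigO_sum_raySum_wrapped hn hz h (by linarith) (by omega) (by rw [hd]; linarith)

/-- The index, up to the shift by `k + 1`, of the asymptotics of a vector of `primeBasis`. -/
def primeIndex (j : Fin n) : Fin n :=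
  if Even j.val then ⟨j.val / 2, by omega⟩ else ⟨n - 1 - (j.val - 1) / 2, by omega⟩

/-- The index, up to the shift by `k + 1`, of the asymptotics of a vector of `doublePrimeBasis`. -/
def doublePrimeIndex (j : Fin n) : Fin n :=
  if Even j.val then ⟨n - 1 - j.val / 2, by omega⟩ else ⟨(j.val - 1) / 2, by omega⟩

theorem primeIndex_injective : Function.Injective (primeIndex (n := n)) := by
  intro i j h
  rw [Fin.ext_iff] at h ⊢
  simp only [primeIndex] at h
  split_ifs at h with h1 h2 h2 <;> simp only [Nat.even_iff] at h1 h2 <;> simp only at h <;> omega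

theorem doublePrimeIndex_injective : Function.Injective (doublePrimeIndex (n := n)) := by
  intro i j h
  rw [Fin.ext_iff] at h ⊢
  simp only [doublePrimeIndex] at h
  split_ifs at h with h1 h2 h2 <;> simp only [Nat.even_iff] at h1 h2 <;> simp only at h <;> omega

theorem isStokesBasis_of_index {Q : Fin n → M n} (hQ : Submodule.span (Laurent n) (Set.range Q) = ⊤)
    {k : ℤ} {a b : ℝ} {f : Fin n → Fin n} (hf : Function.Injective f)
    (h : ∀ j : Fin n, ∀ φ ∈ Set.Ioo a b, ¬Resonant n φ → ∀ z ∈ generic n,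
      HasStokesAsymptotics (toSolution (Q j)) (k + ((f j).val + 1)) φ z) :
    IsStokesBasis n k (fun j => toSolution (Q j)) a b where
  isSolutionBasis := isSolutionBasis_toSolution hQ
  asymptotics := by
    set e := Equiv.ofBijective f (Finite.injective_iff_bijective.1 hf)
    refine ⟨e.symm, fun j φ hφ hr z hz => ?_⟩
    have h1 := h (e.symm j) φ hφ hr z hz
    have h2 : f (e.symm j) = j := e.apply_symm_apply j
    rwa [h2] at h1

/-- For all vectors `v_m(l)` at even positions `m + l = n + 2`, so they impose one common condition
on φ; the `v_m` at odd positions have `m ≤ (n + 1)/2` and need no more. -/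
theorem isStokesBasis_primeBasis (hn : 0 < n) (k : ℤ) {a b : ℝ}
    (hQ : Submodule.span (Laurent n) (Set.range (primeBasis (basisQ n k))) = ⊤)
    (ha : (1 - n : ℝ) / 2 ≤ n * a - k) (hb : n * b - k ≤ 1) :
    IsStokesBasis n k (fun j => toSolution (primeBasis (basisQ n k) j)) a b := by
  have hn' : (0 : ℝ) < n := by exact_mod_cast hn
  refine isStokesBasis_of_index hQ primeIndex_injective fun j φ hφ hr z hz => ?_
  have h1 : n * φ - k < 1 := by have := mul_lt_mul_of_pos_left hφ.2 hn'; linarith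
  have h2 : (1 - n : ℝ) / 2 < n * φ - k := by have := mul_lt_mul_of_pos_left hφ.1 hn'; linarith
  have hj := j.2
  simp only [primeBasis, primeIndex]
  split_ifs with he
  · rw [Nat.even_iff] at he
    have e1 : ((j.val / 2 + 1 : ℕ) : ℝ) * 2 ≤ n + 1 := by
      exact_mod_cast (by omega : (j.val / 2 + 1) * 2 ≤ n + 1)
    have e2 : (1 : ℝ) ≤ ((j.val / 2 + 1 : ℕ) : ℝ) := by exact_mod_cast Nat.succ_le_succ (Nat.zero_le _)
    have := hasStokesAsymptotics_nth hn hz k (m := j.val / 2 + 1) (by omega) (by omega) (φ := φ)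
      (by linarith) (by linarith)
    simpa using this
  · rw [Nat.even_iff] at he
    have e1 : ((n + 1 - (j.val + 1) / 2 : ℕ) : ℝ) + ((j.val + 1) / 2 + 1 : ℕ) = n + 2 := by
      exact_mod_cast (by omega : (n + 1 - (j.val + 1) / 2) + ((j.val + 1) / 2 + 1) = n + 2)
    have := hasStokesAsymptotics_vml hn hz k (m := n + 1 - (j.val + 1) / 2) (l := (j.val + 1) / 2 + 1)
      (by omega) (by omega) (by omega) hr (by linarith) (by linarith)
    have e2 : n + 1 - (j.val + 1) / 2 = n - 1 - (j.val - 1) / 2 + 1 := by omega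
    simpa only [e2, Nat.cast_add, Nat.cast_one] using this

/-- Now `m + l = n + 1` for the vectors `v_m(l)`, which moves the interval by `1/(2n)` to the left,
and the plain `v_m` have `m ≤ n/2`. -/
theorem isStokesBasis_doublePrimeBasis (hn : 0 < n) (k : ℤ) {a b : ℝ}
    (hQ : Submodule.span (Laurent n) (Set.range (doublePrimeBasis (basisQ n k))) = ⊤)
    (ha : -(n : ℝ) / 2 ≤ n * a - k) (hb : n * b - k ≤ 1 / 2) :
    IsStokesBasis n k (fun j => toSolution (doublePrimeBasis (basisQ n k) j)) a b := by
  have hn' : (0 : ℝ) < n := by exact_mod_cast hn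
  refine isStokesBasis_of_index hQ doublePrimeIndex_injective fun j φ hφ hr z hz => ?_
  have h1 : n * φ - k < 1 / 2 := by have := mul_lt_mul_of_pos_left hφ.2 hn'; linarith
  have h2 : -(n : ℝ) / 2 < n * φ - k := by have := mul_lt_mul_of_pos_left hφ.1 hn'; linarith
  have hj := j.2
  simp only [doublePrimeBasis, doublePrimeIndex]
  split_ifs with he
  · rw [Nat.even_iff] at he
    have e1 : ((n - j.val / 2 : ℕ) : ℝ) + (j.val / 2 + 1 : ℕ) = n + 1 := by
      exact_mod_cast (by omega : (n - j.val / 2) + (j.val / 2 + 1) = n + 1)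
    have := hasStokesAsymptotics_vml hn hz k (m := n - j.val / 2) (l := j.val / 2 + 1)
      (by omega) (by omega) (by omega) hr (by linarith) (by linarith)
    have e2 : n - j.val / 2 = n - 1 - j.val / 2 + 1 := by omega
    simpa only [e2, Nat.cast_add, Nat.cast_one] using this
  · rw [Nat.even_iff] at he
    have e1 : (((j.val + 1) / 2 : ℕ) : ℝ) * 2 ≤ n := by
      exact_mod_cast (by omega : ((j.val + 1) / 2) * 2 ≤ n)
    have e2 : (1 : ℝ) ≤ (((j.val + 1) / 2 : ℕ) : ℝ) := by
      exact_mod_cast (by omega : 1 ≤ (j.val + 1) / 2)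
    have := hasStokesAsymptotics_nth hn hz k (m := (j.val + 1) / 2) (by omega) (by omega) (φ := φ)
      (by linarith) (by linarith)
    have e3 : ((((j.val - 1) / 2 : ℕ) : ℤ) + 1) = ((j.val + 1) / 2 : ℕ) := by omega
    rwa [e3]

/-- If `x / (2 * n)` with `x ∈ ℤ` is to the right of `a`, it is to the right of `(a, a + ε)`. -/
theorem IsSmall.add_le (hn : 0 < n) {a ε : ℝ} (h : IsSmall n a ε) {x : ℤ} (hx : 2 * n * a < x) :
    2 * n * (a + ε) ≤ x := by
  have hn' : (0 : ℝ) < 2 * n := by exact_mod_cast (by omega : 0 < 2 * n)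
  by_contra! hc
  exact (h x).1 ⟨by rw [lt_div_iff₀ hn']; linarith, by rw [div_lt_iff₀ hn']; linarith⟩

/-- If `x / (2 * n)` with `x ∈ ℤ` is to the left of `a - 1/2`, it is to the left of
`(a - 1/2 - ε, a - 1/2)`. -/
theorem IsSmall.le_sub (hn : 0 < n) {a ε : ℝ} (h : IsSmall n a ε) {x : ℤ}
    (hx : x < 2 * n * (a - 1 / 2)) : x ≤ 2 * n * (a - 1 / 2 - ε) := by
  have hn' : (0 : ℝ) < 2 * n := by exact_mod_cast (by omega : 0 < 2 * n)
  by_contra! hc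
  exact (h x).2 ⟨by rw [lt_div_iff₀ hn']; linarith, by rw [div_lt_iff₀ hn']; linarith⟩

end StokesBases
end EquivQDE
theorem theorem6p1 (n : ℕ) (hn : 2 ≤ n) (k : ℤ) :
    -- `basisQ n k` corresponds to `Ψ^{k+1}, …, Ψ^{k+n}`
    (∀ (j : Fin n) (τ : ℂ), ∀ z ∈ EquivQDE.generic n,
      EquivQDE.toSolution (EquivQDE.basisQ n k j) τ z = EquivQDE.Psi (k + (j.val + 1)) τ z) ∧
    -- `Q_k`, `Q_k'` and `Q_k''` are exceptional bases, `Q_k' = γ_n Q_k` and `Q_k'' = δ_{n,odd} Q_k'`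
    EquivQDE.IsExceptional (EquivQDE.basisQ n k) ∧
    EquivQDE.IsExceptional (EquivQDE.primeBasis (EquivQDE.basisQ n k)) ∧
    EquivQDE.IsExceptional (EquivQDE.doublePrimeBasis (EquivQDE.basisQ n k)) ∧
    EquivQDE.braidAct (EquivQDE.gammaWord n) (EquivQDE.basisQ n k) =
      EquivQDE.primeBasis (EquivQDE.basisQ n k) ∧
    EquivQDE.braidAct (EquivQDE.deltaOddWord n) (EquivQDE.primeBasis (EquivQDE.basisQ n k)) =
      EquivQDE.doublePrimeBasis (EquivQDE.basisQ n k) ∧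
    -- the Stokes bases
    (∀ a ε : ℝ, a ∈ Set.Ioo ((2 * k + 1 : ℝ) / (2 * n)) ((k + 1 : ℝ) / n) →
      0 < ε → EquivQDE.IsSmall n a ε →
      EquivQDE.IsStokesBasis n k
        (fun j => EquivQDE.toSolution (EquivQDE.primeBasis (EquivQDE.basisQ n k) j))
        (a - 1 / 2 - ε) (a + ε)) ∧
    (∀ a ε : ℝ, a ∈ Set.Ioo ((k : ℝ) / n) ((2 * k + 1 : ℝ) / (2 * n)) →
      0 < ε → EquivQDE.IsSmall n a ε →
      EquivQDE.IsStokesBasis n k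
        (fun j => EquivQDE.toSolution (EquivQDE.doublePrimeBasis (EquivQDE.basisQ n k) j))
        (a - 1 / 2 - ε) (a + ε)) := by
  have hn0 : 0 < n := by omega
  have hn' : (0 : ℝ) < n := by exact_mod_cast hn0
  have hQ := EquivQDE.isExceptional_basisQ (n := n) k
  have h1 := EquivQDE.braidAct_gammaWord (EquivQDE.formA_basisQ (n := n) k) (by omega)
  have h2 := EquivQDE.braidAct_deltaOddWord (EquivQDE.formA_basisQ (n := n) k)
  have hQ' : EquivQDE.IsExceptional (EquivQDE.primeBasis (EquivQDE.basisQ n k)) := by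
    rw [← h1]; exact EquivQDE.isExceptional_braidAct _ hQ
  have hQ'' : EquivQDE.IsExceptional (EquivQDE.doublePrimeBasis (EquivQDE.basisQ n k)) := by
    rw [← h2]; exact EquivQDE.isExceptional_braidAct _ hQ'
  refine ⟨fun j τ z _ => ?_, hQ, hQ', hQ'', h1, h2, fun a ε ha _ hs => ?_, fun a ε ha _ hs => ?_⟩
  · rw [EquivQDE.basisQ, EquivQDE.toSolution_powX, add_assoc]
  · obtain ⟨ha1, ha2⟩ := ha
    rw [div_lt_iff₀ (by positivity)] at ha1
    rw [lt_div_iff₀ hn'] at ha2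
    -- The grid points `(2k+2)/2n` and `(2k+1-n)/2n` lie to the right of a and to the left of `a -
    -- 1/2`; smallness of ε prevents the interval from crossing them, and they are the end points of
    -- the range of the criterion.
    have e1 := EquivQDE.IsSmall.add_le hn0 hs (x := 2 * (k + 1)) (by push_cast; linarith)
    have e2 := EquivQDE.IsSmall.le_sub hn0 hs (x := 2 * k + 1 - n) (by push_cast; linarith)
    push_cast at e1 e2
    exact EquivQDE.isStokesBasis_primeBasis hn0 k hQ'.span_eq_top (by linarith) (by linarith)
  · obtain ⟨ha1, ha2⟩ := ha
    rw [div_lt_iff₀ hn'] at ha1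
    rw [lt_div_iff₀ (by positivity)] at ha2
    -- Both barrier points are one grid step further to the left than in the first case.
    have e1 := EquivQDE.IsSmall.add_le hn0 hs (x := 2 * k + 1) (by push_cast; linarith)
    have e2 := EquivQDE.IsSmall.le_sub hn0 hs (x := 2 * k - n) (by push_cast; linarith)
    push_cast at e1 e2
    exact EquivQDE.isStokesBasis_doublePrimeBasis hn0 k hQ''.span_eq_top (by linarith) (by linarith)
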